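/- **Detecting rational angles.** Let $P$ be a polygonal billiard table: the closure of a bounded connected open set in the plane whose boundary is a finite disjoint union of simple closed polygonal curves (one such curve if $P$ is simply connected). Each edge is labelled by itself. Let ${\sf B}(P)$ be the set of bi-infinite sequences of edges hit by billiard trajectories that never meet a vertex, ${\sf B}_+(P)$ the set of one-sided sequences of edges hit by forward billiard trajectories that never meet a vertex, and $\mathcal L_P$ the set of finite subwords of elements of ${\sf B}(P)$. Closures are taken in the product topologies, the set of edges being discrete. Let $A,B$ be the two edges of $P$ at a vertex $v$, and let $\theta\in(0,2\pi)$ be the interior angle of $P$ at $v$. Let $p,q\ge 1$ be coprime integers with $p/q<2$; if $\theta=\pi$, assume also $p\le q$. *Insertions.* Take the bounce sequence of a nonsingular trajectory of slope $\pm p/q$ on the unit square billiard table, starting with a bounce off a horizontal side, and write $0$ for a horizontal and $1$ for a vertical side. For $i=1,\dots,2p$, let $\operatorname{in}_i$ be the string of $A$s and $B$s whose length is the (possibly zero) number of $1$s between the $i$-th and the $(i+1)$-st $0$, the letters being chosen such that the concatenation $\operatorname{in}_1\operatorname{in}_2\cdots\operatorname{in}_{2p}$ is the alternating word $BABA\cdots$.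 *Grazing.* A two-sided sequence of edges $E=(\dots,E_{-2},E_{-1},E_1,E_2,\dots)$, into whose middle a word can be inserted, is called grazing for $\{A,B\}$ if $E_{-1},E_1\notin\{A,B\}$ and there are $F,G\in\{A,B\}$ with $(F,E_{-1},E_{-2},\dots)\in\overline{{\sf B}_+(P)}$ and $(G,E_1,E_2,\dots)\in\overline{{\sf B}_+(P)}$. It is called aperiodic if neither of its halves $(E_{-k})_{k\ge1}$, $(E_k)_{k\ge1}$ is eventually periodic. Then, for every such square bounce sequence, $\theta=\pi p/q$ if and only if there exist aperiodic sequences $E^1,\dots,E^p$ that are grazing for $\{A,B\}$ such that $$(\dots,E^j_{-2},E^j_{-1},\operatorname{in}_{2j-1},E^j_1,E^j_2,\dots)\in\overline{{\sf B}(P)}\qquad(1\le j\le p)$$ and such that for all $n\ge 0$ and all $1\le j\le p$ the words $$E^j_{-n}\cdots E^j_{-1}\ \operatorname{in}_{2j-1}\ E^j_1\cdots E^j_n\qquad\text{and}\qquad E^j_n\cdots E^j_1\ \operatorname{in}_{2j}\ E^{j+1}_{-1}\cdots E^{j+1}_{-n}$$ (with $E^{p+1}=E^1$), $2p$ words for each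 $n$, lie in $\mathcal L_P$. -/

import Mathlib

open Set Filter Topology

/-- A polygonal billiard table with `n` edges in the plane `ℂ`.  The boundary consists of finitely
many disjoint simple closed polygonal curves (a single one for a simply connected polygon): edge `i`
runs from the vertex `vertex i` to the vertex `vertex (next i)`.  The table itself is the closure of
the bounded domain `interior`, which lies to the left of every edge. -/
structure PolygonalTable (n : ℕ) where
  vertex : Fin n → ℂ
  next : Equiv.Perm (Fin n)
  interior : Set ℂ
  next_ne : ∀ i, next i ≠ i
  vertex_injective : Function.Injective vertex
  edges_disjoint : ∀ i j, i ≠ j →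
    Disjoint (openSegment ℝ (vertex i) (vertex (next i)))
      (segment ℝ (vertex j) (vertex (next j)))
  isOpen_interior : IsOpen interior
  isConnected_interior : IsConnected interior
  isBounded_interior : Bornology.IsBounded interior
  frontier_interior : frontier interior = ⋃ i, segment ℝ (vertex i) (vertex (next i))
  interior_left : ∀ i, ∀ x ∈ openSegment ℝ (vertex i) (vertex (next i)),
    ∀ᶠ ε : ℝ in 𝓝[>] 0, x + ε * (Complex.I * (vertex (next i) - vertex i)) ∈ interior

namespace PolygonalTable

variable {n : ℕ} (P : PolygonalTable n)

/-- The edge `i` without its endpoints. -/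
def openEdge (i : Fin n) : Set ℂ := openSegment ℝ (P.vertex i) (P.vertex (P.next i))

/-- The vector along the edge `i`. -/
def edgeVec (i : Fin n) : ℂ := P.vertex (P.next i) - P.vertex i

/-- `A` and `B` are the two edges that meet at the vertex `P.vertex i`. -/
def MeetAt (A B i : Fin n) : Prop := (A = i ∧ P.next B = i) ∨ (B = i ∧ P.next A = i)

/-- The interior angle at `P.vertex i`, a number in `[0, 2π)`: the angle by which the outgoing edge
has to be turned counterclockwise (through the table) to reach the incoming edge. -/
noncomputable def interiorAngle (i : Fin n) : ℝ :=
  toIcoMod Real.two_pi_pos 0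
    (Complex.arg ((P.vertex (P.next.symm i) - P.vertex i) / P.edgeVec i))

/-- The image of the direction `v` under reflection in the edge `i`. -/
noncomputable def reflectDir (i : Fin n) (v : ℂ) : ℂ :=
  P.edgeVec i / (starRingEnd ℂ) (P.edgeVec i) * (starRingEnd ℂ) v

/-- `b` is the sequence of bounce points of a nonsingular bi-infinite billiard trajectory, which
hits the edges `e`: every bounce point is in the relative interior of its edge, the trajectory is
straight in the interior of the table between two bounces, and it is reflected optically. -/
def IsTrajectory (b : ℤ → ℂ) (e : ℤ → Fin n) : Prop :=
  ∀ k, b k ∈ P.openEdge (e k) ∧ openSegment ℝ (b k) (b (k + 1)) ⊆ P.interior ∧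
    SameRay ℝ (b (k + 2) - b (k + 1)) (P.reflectDir (e (k + 1)) (b (k + 1) - b k))

/-- `x 0` is the interior starting point, and `x 1, x 2, …` are the bounce points, of a nonsingular
forward billiard trajectory, which hits the edges `e 0, e 1, …`. -/
def IsForwardTrajectory (x : ℕ → ℂ) (e : ℕ → Fin n) : Prop :=
  x 0 ∈ P.interior ∧ ∀ k, x (k + 1) ∈ P.openEdge (e k) ∧
    openSegment ℝ (x k) (x (k + 1)) ⊆ P.interior ∧
    SameRay ℝ (x (k + 2) - x (k + 1)) (P.reflectDir (e k) (x (k + 1) - x k))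

/-- The bounce spectrum `B(P)`. -/
def bounceSpectrum : Set (ℤ → Fin n) := {e | ∃ b, P.IsTrajectory b e}

/-- The forward bounce spectrum `B₊(P)`. -/
def forwardSpectrum : Set (ℕ → Fin n) := {e | ∃ x, P.IsForwardTrajectory x e}

/-- The bounce language: all finite subwords of the sequences in the bounce spectrum. -/
def language : Set (List (Fin n)) :=
  {w | ∃ e ∈ P.bounceSpectrum, ∃ m : ℤ, w = (List.range w.length).map fun k : ℕ => e (m + k)}

end PolygonalTable

section Sequences

variable {α : Type*}

/-- A sequence `… E₋₂ E₋₁ E₁ E₂ …` with a gap in the middle, into which a word can be inserted: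
`neg k` is `E₋₍ₖ₊₁₎` and `pos k` is `Eₖ₊₁`. -/
structure GappedSeq (α : Type*) where
  neg : ℕ → α
  pos : ℕ → α

/-- The bi-infinite sequence `… E₋₂ E₋₁ w E₁ E₂ …`. -/
def GappedSeq.insert (E : GappedSeq α) (w : List α) : ℤ → α
  | Int.negSucc k => E.neg k
  | Int.ofNat k => if h : k < w.length then w[k] else E.pos (k - w.length)

/-- The word `s 0, s 1, …, s (n - 1)`. -/
def initialWord (s : ℕ → α) (n : ℕ) : List α := (List.range n).map s

/-- The word `s (n - 1), …, s 1, s 0, w, t 0, t 1, …, t (n - 1)`. -/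
def joinWord (s : ℕ → α) (w : List α) (t : ℕ → α) (n : ℕ) : List α :=
  (initialWord s n).reverse ++ w ++ initialWord t n

/-- The sequence `a, s 0, s 1, …`. -/
def consSeq (a : α) (s : ℕ → α) : ℕ → α
  | 0 => a
  | k + 1 => s k

/-- The sequence is not eventually periodic. -/
def Aperiodic (s : ℕ → α) : Prop :=
  ¬ ∃ N T : ℕ, 0 < T ∧ ∀ k ≥ N, s (k + T) = s k

end Sequences

/-- `E` is grazed by edges of the pair `{A, B}`: neither of the two edges next to the gap is `A` or
`B`, and either half, read away from the gap, has `A` or `B` as a prefix, the extended sequence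
being in the closure of the forward bounce spectrum (with the discrete topology on the edges). -/
def PolygonalTable.IsGrazing {n : ℕ} (P : PolygonalTable n) (A B : Fin n)
    (E : GappedSeq (Fin n)) : Prop :=
  Disjoint ({E.neg 0, E.pos 0} : Set (Fin n)) {A, B} ∧
  (∃ F ∈ ({A, B} : Set (Fin n)), consSeq F E.neg ∈ closure P.forwardSpectrum) ∧
  (∃ G ∈ ({A, B} : Set (Fin n)), consSeq G E.pos ∈ closure P.forwardSpectrum)

section Square

/-- The vertices of the unit square. -/
def squareVertex : Fin 4 → ℂ := ![0, 1, 1 + Complex.I, Complex.I]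

lemma square_next_ne : ∀ i : Fin 4, finRotate 4 i ≠ i := by decide

lemma squareVertex_injective : Function.Injective squareVertex := by
  intro i j h
  fin_cases i <;> fin_cases j <;> simp [squareVertex, Complex.ext_iff] at h ⊢

lemma square_edges_disjoint : ∀ i j, i ≠ j →
    Disjoint (openSegment ℝ (squareVertex i) (squareVertex (finRotate 4 i)))
      (segment ℝ (squareVertex j) (squareVertex (finRotate 4 j))) := by
  intro i j hij
  rw [Set.disjoint_left]
  rintro x ⟨a, b, ha, hb, hab, rfl⟩ ⟨c, d, hc, hd, hcd, h⟩
  fin_cases i <;> fin_cases j <;>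
    simp [squareVertex, Complex.ext_iff] at hij h <;> grind

lemma square_isConnected : IsConnected (Ioo (0 : ℝ) 1 ×ℂ Ioo (0 : ℝ) 1) := by
  refine ⟨⟨⟨1 / 2, 1 / 2⟩, ?_⟩, ?_⟩
  · norm_num [Complex.mem_reProdIm]
  · exact (((convex_Ioo (0 : ℝ) 1).linear_preimage Complex.reLm).inter
      ((convex_Ioo (0 : ℝ) 1).linear_preimage Complex.imLm)).isPreconnected

lemma square_frontier : frontier (Ioo (0 : ℝ) 1 ×ℂ Ioo (0 : ℝ) 1) =
    ⋃ i, segment ℝ (squareVertex i) (squareVertex (finRotate 4 i)) := by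
  rw [Complex.frontier_reProdIm, closure_Ioo zero_ne_one, frontier_Ioo zero_lt_one]
  ext z
  simp only [mem_union, Complex.mem_reProdIm, mem_iUnion, mem_Icc, mem_insert_iff,
    mem_singleton_iff]
  constructor
  · rintro (⟨⟨h0, h1⟩, h | h⟩ | ⟨h | h, h0, h1⟩)
    · exact ⟨0, 1 - z.re, z.re, by linarith, h0, by ring, by
        simp [squareVertex, Complex.ext_iff, h]⟩
    · exact ⟨2, z.re, 1 - z.re, h0, by linarith, by ring, by
        simp [squareVertex, Complex.ext_iff, h]⟩
    · exact ⟨3, z.im, 1 - z.im, h0, by linarith, by ring, by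
        simp [squareVertex, Complex.ext_iff, h]⟩
    · exact ⟨1, 1 - z.im, z.im, by linarith, h0, by ring, by
        simp [squareVertex, Complex.ext_iff, h]⟩
  · rintro ⟨i, a, b, ha, hb, hab, rfl⟩
    fin_cases i <;> simp [squareVertex] <;> grind

lemma square_interior_left : ∀ i,
    ∀ x ∈ openSegment ℝ (squareVertex i) (squareVertex (finRotate 4 i)), ∀ᶠ ε : ℝ in 𝓝[>] 0,
      x + ε * (Complex.I * (squareVertex (finRotate 4 i) - squareVertex i)) ∈
        Ioo (0 : ℝ) 1 ×ℂ Ioo (0 : ℝ) 1 := by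
  rintro i x ⟨a, b, ha, hb, hab, rfl⟩
  filter_upwards [Ioo_mem_nhdsGT (zero_lt_one : (0 : ℝ) < 1)] with ε hε
  obtain ⟨h0, h1⟩ := hε
  fin_cases i <;> simp [squareVertex, Complex.mem_reProdIm] <;> grind

/-- The square billiard table `[0, 1] × [0, 1]`.  Its edges are, in this order, the bottom, right,
top and left side. -/
def squareTable : PolygonalTable 4 where
  vertex := squareVertex
  next := finRotate 4
  interior := Ioo (0 : ℝ) 1 ×ℂ Ioo (0 : ℝ) 1
  next_ne := square_next_ne
  vertex_injective := squareVertex_injective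
  edges_disjoint := square_edges_disjoint
  isOpen_interior := isOpen_Ioo.reProdIm isOpen_Ioo
  isConnected_interior := square_isConnected
  isBounded_interior := (Metric.isBounded_Ioo 0 1).reProdIm (Metric.isBounded_Ioo 0 1)
  frontier_interior := square_frontier
  interior_left := square_interior_left

/-- `s` is the coding, from some bounce off a horizontal side on, of a nonsingular trajectory of
slope `± p / q` on the square table: `false` (written `0`) stands for a horizontal and `true`
(written `1`) for a vertical side. -/
def IsSquareCode (p q : ℕ) (s : ℕ → Bool) : Prop :=
  s 0 = false ∧ ∃ (b : ℤ → ℂ) (e : ℤ → Fin 4), squareTable.IsTrajectory b e ∧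
    |(b 1 - b 0).im| * q = |(b 1 - b 0).re| * p ∧
    ∀ k : ℕ, s k = true ↔ e k = 1 ∨ e k = 3

/-- The length of the `i`-th string of `1`s (counted from `i = 0`) of a sequence that starts with
`0`: the number of `1`s between the `i`-th and the next `0`. -/
noncomputable def runLength (s : ℕ → Bool) (i : ℕ) : ℕ :=
  Nat.nth (fun k => s k = false) (i + 1) - Nat.nth (fun k => s k = false) i - 1

/-- The insertion strings `in₁, in₂, …` (counted from `i = 0`): the `i`-th one has the length of the
`i`-th string of `1`s in `s`, and the concatenation of all of them is `B A B A …`. -/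
noncomputable def insertion {α : Type*} (A B : α) (s : ℕ → Bool) (i : ℕ) : List α :=
  (List.range (runLength s i)).map fun j =>
    if Even ((∑ k ∈ Finset.range i, runLength s k) + j) then B else A

end Square

/-! Unfold the corner: lay copies of the sector of angle θ side by side around the vertex. A
trajectory that passes close to the vertex becomes a straight line, which turns by π around the
vertex and crosses one copy of an edge for every bounce off `A` or `B`. The insertions of a square
trajectory form a Sturmian pattern: if κ_i is the total length of the first i insertions, then κ_i =
⌊X + i q/p⌋ for some X in (0, 1), and X + i q/p is never an integer (`IsSquareCode.exists_floor`).
If θ q = π p, this says that the ray with unfolded angle θ X + i π lies strictly inside the sector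
number κ_i.

For a rational angle, take the rays from the vertex with the angles θ X' + i π, for X' close to X
and i ≤ 2p. The ray number 2p is the ray number 0, since 2pπ = 2qθ. A line parallel to the i-th ray
and close to it comes in along this ray, bounces off the corner in the letters of one insertion, and
leaves along the next ray (`exists_orbit_of_halves`). Only countably many X' give a ray that meets a
vertex, because unfolded trajectories are straight. Only countably many give an eventually periodic
code, because a code determines its direction. So a generic X' yields all the halves
(`exists_halves`).

Conversely, by compactness the given words are read by limits T_i of orbits. Orbits with equal
futures are parallel (`dir_eq_of_future`), because a nonzero angle would drive them apart without
bound. Hence the unfolded angle Φ_i of T_i grows by exactly π between two nonempty insertions. As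
Φ_i stays within bounded distance of κ_i θ, growth rates give θ q/p = π. Empty insertions occur only
for q < p. Across one of them the angle changes by 2π in two steps if θ > π, as it should, but by 0
if θ < π. The last case has to be excluded; for θ = π the change would be ambiguous, but then p ≤ q.

The exclusion rests on a rigidity theorem: limit orbits with the same aperiodic future lie on the
same line (`off_eq_zero_of_future`). It makes the lines between consecutive insertions of length one
pass through the vertex. Such a line is constrained by `Corner.angle_nonneg`, and a maximal run of k
≥ 2 insertions of length one, between empty ones, then forces (k+1)θ = kπ (`angle_of_run`). With the
growth rate of Φ this contradicts the Sturmian bounds on κ.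

For the rigidity theorem, suppose two such orbits have positive distance. Among the pairs with equal
two-sided codes there is one of maximal distance. Two pairs of maximal distance that agree for a
long time nearly coincide, for otherwise a wider pair would exist. When they separate, the edge that
one of them meets first lies between the two orbits of the other pair, and its endpoints are
vertices that separate the orbits (`Strip.branch`). If separations occurred at both ends for
translates of one orbit, then a nearby nonsingular orbit would lie, relative to the limit line, on
alternating sides of vertices, although the height of one line over another is affine along the line
(`not_two_sign_changes`). So some orbit is periodic in one direction. Hence the aperiodic code has
arbitrarily long stretches of a fixed even period, and the ends of two such stretches lead to the
same contradiction (`no_stretches`). -/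

/-! ### Cross products, reflections and segments in the plane -/

/-- The cross product of two plane vectors. -/
def crs (z w : ℂ) : ℝ := z.re * w.im - z.im * w.re

lemma crs_self (z : ℂ) : crs z z = 0 := by simp [crs]; ring
lemma crs_anti (z w : ℂ) : crs z w = -crs w z := by simp [crs]; ring
lemma crs_add_right (z w w' : ℂ) : crs z (w + w') = crs z w + crs z w' := by
  simp [crs]; ring
lemma crs_add_left (z z' w : ℂ) : crs (z + z') w = crs z w + crs z' w := by
  simp [crs]; ring
lemma crs_sub_right (z w w' : ℂ) : crs z (w - w') = crs z w - crs z w' := by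
  simp [crs]; ring
lemma crs_sub_left (z z' w : ℂ) : crs (z - z') w = crs z w - crs z' w := by
  simp [crs]; ring
lemma crs_real_mul_right (r : ℝ) (z w : ℂ) : crs z (r * w) = r * crs z w := by
  simp [crs]; ring
lemma crs_real_mul_left (r : ℝ) (z w : ℂ) : crs (r * z) w = r * crs z w := by
  simp [crs]; ring
lemma crs_neg_right (z w : ℂ) : crs z (-w) = -crs z w := by simp [crs]; ring
lemma crs_neg_left (z w : ℂ) : crs (-z) w = -crs z w := by simp [crs]; ring
lemma crs_zero_right (z : ℂ) : crs z 0 = 0 := by simp [crs]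
lemma continuous_crs : Continuous fun x : ℂ × ℂ => crs x.1 x.2 := by
  unfold crs; fun_prop

@[fun_prop]
lemma Continuous.crs {X : Type*} [TopologicalSpace X] {f g : X → ℂ} (hf : Continuous f)
    (hg : Continuous g) : Continuous fun x => crs (f x) (g x) :=
  continuous_crs.comp (hf.prodMk hg)

lemma Filter.Tendsto.crs {X : Type*} {l : Filter X} {f g : X → ℂ} {a b : ℂ}
    (hf : Tendsto f l (𝓝 a)) (hg : Tendsto g l (𝓝 b)) :
    Tendsto (fun x => crs (f x) (g x)) l (𝓝 (crs a b)) :=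
  (continuous_crs.tendsto (a, b)).comp (hf.prodMk_nhds hg)

lemma crs_I_mul_self (z : ℂ) : crs z (Complex.I * z) = ‖z‖ ^ 2 := by
  rw [← Complex.normSq_eq_norm_sq]; simp [crs, Complex.normSq_apply]

lemma abs_crs_le (z w : ℂ) : |crs z w| ≤ ‖z‖ * ‖w‖ := by
  refine abs_le_of_sq_le_sq ?_ (by positivity)
  rw [mul_pow, ← Complex.normSq_eq_norm_sq, ← Complex.normSq_eq_norm_sq]
  simp only [crs, Complex.normSq_apply]
  nlinarith [sq_nonneg (z.re * w.re + z.im * w.im)]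

/-- Two vectors with vanishing cross product are parallel. -/
lemma eq_real_mul_of_crs_eq_zero {z w : ℂ} (hz : z ≠ 0) (h : crs z w = 0) :
    ∃ r : ℝ, w = r * z := by
  refine ⟨(w / z).re, ?_⟩
  have hn : Complex.normSq z ≠ 0 := by simpa using hz
  have him : (w / z).im = 0 := by
    rw [Complex.div_im]
    field_simp
    unfold crs at h
    linarith
  have : w / z = ((w / z).re : ℂ) := Complex.ext (by simp) (by simp [him])
  rw [← this, div_mul_cancel₀ _ hz]

/-- The decomposition of a vector with respect to two independent vectors. -/
lemma crs_decomp (a b z : ℂ) : (crs a b : ℂ) * z = (crs z b : ℂ) * a + (crs a z : ℂ) * b := by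
  apply Complex.ext <;> simp [crs] <;> ring

/-- The reflection that fixes the nonzero vector `u`. -/
noncomputable def mirror (u v : ℂ) : ℂ := u / (starRingEnd ℂ) u * (starRingEnd ℂ) v

lemma norm_mirror {u : ℂ} (hu : u ≠ 0) (v : ℂ) : ‖mirror u v‖ = ‖v‖ := by
  simp [mirror, hu]

lemma mirror_self {u : ℂ} (hu : u ≠ 0) : mirror u u = u := by
  unfold mirror
  rw [div_mul_cancel₀]
  simpa using hu

lemma mirror_mirror {u : ℂ} (hu : u ≠ 0) (v : ℂ) : mirror u (mirror u v) = v := by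
  have h : (starRingEnd ℂ) u ≠ 0 := by simpa using hu
  simp only [mirror, map_mul, map_div₀, Complex.conj_conj]
  field_simp

lemma mirror_add (u v w : ℂ) : mirror u (v + w) = mirror u v + mirror u w := by
  simp [mirror]; ring
lemma mirror_neg (u v : ℂ) : mirror u (-v) = -mirror u v := by
  simp [mirror]
lemma mirror_real_mul (u : ℂ) (r : ℝ) (v : ℂ) : mirror u (r * v) = r * mirror u v := by
  simp [mirror]; ring

lemma crs_eq_im (z w : ℂ) : crs z w = ((starRingEnd ℂ) z * w).im := by
  simp [crs]; ring

lemma crs_mirror {u : ℂ} (hu : u ≠ 0) (a b : ℂ) :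
    crs (mirror u a) (mirror u b) = -crs a b := by
  have h : (starRingEnd ℂ) u ≠ 0 := by simpa using hu
  rw [crs_eq_im, crs_eq_im]
  have : (starRingEnd ℂ) (mirror u a) * mirror u b = (starRingEnd ℂ) ((starRingEnd ℂ) a * b) := by
    simp only [mirror, map_mul, map_div₀, Complex.conj_conj]
    field_simp
  rw [this, Complex.conj_im]

lemma crs_mirror_right {u : ℂ} (hu : u ≠ 0) (a : ℂ) : crs u (mirror u a) = -crs u a := by
  have := crs_mirror hu u a
  rwa [mirror_self hu] at this

lemma mirror_eq_zero {u : ℂ} (hu : u ≠ 0) {v : ℂ} : mirror u v = 0 ↔ v = 0 := by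
  rw [← norm_eq_zero, norm_mirror hu, norm_eq_zero]

lemma mem_openSegment_iff_add {x y z : ℂ} :
    z ∈ openSegment ℝ x y ↔ ∃ t : ℝ, 0 < t ∧ t < 1 ∧ z = x + t * (y - x) := by
  rw [openSegment_eq_image']
  constructor
  · rintro ⟨t, ht, rfl⟩
    exact ⟨t, ht.1, ht.2, by simp⟩
  · rintro ⟨t, h0, h1, rfl⟩
    exact ⟨t, ⟨h0, h1⟩, by simp⟩

lemma mem_segment_iff_add {x y z : ℂ} :
    z ∈ segment ℝ x y ↔ ∃ t : ℝ, 0 ≤ t ∧ t ≤ 1 ∧ z = x + t * (y - x) := by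
  rw [segment_eq_image']
  constructor
  · rintro ⟨t, ht, rfl⟩
    exact ⟨t, ht.1, ht.2, by simp⟩
  · rintro ⟨t, h0, h1, rfl⟩
    exact ⟨t, ⟨h0, h1⟩, by simp⟩

/-! ### Edges and vertices of the table -/

namespace PolygonalTable
variable {n : ℕ} (P : PolygonalTable n)

/-- The edge `i` with its endpoints. -/
def closedEdge (i : Fin n) : Set ℂ := segment ℝ (P.vertex i) (P.vertex (P.next i))

lemma edgeVec_ne_zero (i : Fin n) : P.edgeVec i ≠ 0 :=
  sub_ne_zero.2 fun h => P.next_ne i (P.vertex_injective h)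

lemma reflectDir_eq (i : Fin n) (v : ℂ) : P.reflectDir i v = mirror (P.edgeVec i) v := rfl

lemma openEdge_subset (i : Fin n) : P.openEdge i ⊆ P.closedEdge i := openSegment_subset_segment ..

lemma isClosed_closedEdge (i : Fin n) : IsClosed (P.closedEdge i) := by
  rw [closedEdge, ← convexHull_pair]
  exact (Set.toFinite {P.vertex i, P.vertex (P.next i)}).isClosed_convexHull ℝ

lemma isCompact_closedEdge (i : Fin n) : IsCompact (P.closedEdge i) := by
  rw [closedEdge, ← convexHull_pair]
  exact (Set.toFinite {P.vertex i, P.vertex (P.next i)}).isCompact_convexHull ℝ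

lemma closedEdge_subset_frontier (i : Fin n) : P.closedEdge i ⊆ frontier P.interior := by
  rw [P.frontier_interior]; exact subset_iUnion (fun i => P.closedEdge i) i

lemma mem_frontier {z : ℂ} : z ∈ frontier P.interior ↔ ∃ i, z ∈ P.closedEdge i := by
  rw [P.frontier_interior]; simp [closedEdge]

lemma notMem_frontier_of_mem {z : ℂ} (hz : z ∈ P.interior) : z ∉ frontier P.interior := by
  rw [P.isOpen_interior.frontier_eq]; exact fun h => h.2 hz

lemma notMem_closedEdge_of_mem {z : ℂ} (hz : z ∈ P.interior) (i : Fin n) : z ∉ P.closedEdge i :=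
  fun h => P.notMem_frontier_of_mem hz (P.closedEdge_subset_frontier i h)

lemma vertex_mem_closedEdge (i : Fin n) : P.vertex i ∈ P.closedEdge i := left_mem_segment ..
lemma vertex_next_mem_closedEdge (i : Fin n) : P.vertex (P.next i) ∈ P.closedEdge i :=
  right_mem_segment ..

lemma mem_closedEdge {i : Fin n} {z : ℂ} :
    z ∈ P.closedEdge i ↔ ∃ t : ℝ, 0 ≤ t ∧ t ≤ 1 ∧ z = P.vertex i + t * P.edgeVec i :=
  mem_segment_iff_add

lemma mem_openEdge {i : Fin n} {z : ℂ} :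
    z ∈ P.openEdge i ↔ ∃ t : ℝ, 0 < t ∧ t < 1 ∧ z = P.vertex i + t * P.edgeVec i :=
  mem_openSegment_iff_add

lemma openEdge_inter_closedEdge {i j : Fin n} {z : ℂ} (hi : z ∈ P.openEdge i)
    (hj : z ∈ P.closedEdge j) : i = j := by
  by_contra h
  exact (Set.disjoint_left.1 (P.edges_disjoint i j h)) hi hj

lemma mem_closedEdge_cases {i : Fin n} {z : ℂ} (h : z ∈ P.closedEdge i) :
    z ∈ P.openEdge i ∨ z = P.vertex i ∨ z = P.vertex (P.next i) := by
  obtain ⟨t, h0, h1, rfl⟩ := P.mem_closedEdge.1 h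
  rcases h0.eq_or_lt with rfl | h0
  · right; left; simp
  rcases h1.eq_or_lt with rfl | h1
  · right; right; simp [edgeVec]
  · left; exact P.mem_openEdge.2 ⟨t, h0, h1, rfl⟩

lemma vertex_notMem_openEdge (i j : Fin n) : P.vertex i ∉ P.openEdge j := by
  intro h
  have h1 := P.openEdge_inter_closedEdge h (P.vertex_mem_closedEdge i)
  have h2 := P.openEdge_inter_closedEdge h (j := P.next.symm i) (by
    simpa using P.vertex_next_mem_closedEdge (P.next.symm i))
  apply P.next_ne i
  have : i = P.next.symm i := h1.symm.trans h2
  conv_lhs => rw [this]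
  simp

lemma vertex_mem_closedEdge_iff {i j : Fin n} :
    P.vertex i ∈ P.closedEdge j ↔ j = i ∨ P.next j = i := by
  constructor
  · intro h
    rcases P.mem_closedEdge_cases h with h | h | h
    · exact absurd h (P.vertex_notMem_openEdge i j)
    · exact Or.inl (P.vertex_injective h).symm
    · exact Or.inr (P.vertex_injective h).symm
  · rintro (rfl | rfl)
    · exact P.vertex_mem_closedEdge _
    · exact P.vertex_next_mem_closedEdge _

/-- Two different edges can only meet in a common vertex. -/
lemma exists_meetAt {i j : Fin n} (hij : i ≠ j) {z : ℂ} (hi : z ∈ P.closedEdge i)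
    (hj : z ∈ P.closedEdge j) : ∃ k, P.MeetAt i j k ∧ z = P.vertex k := by
  rcases P.mem_closedEdge_cases hi with h | h | h
  · exact absurd (P.openEdge_inter_closedEdge h hj) hij
  · subst h
    rcases P.vertex_mem_closedEdge_iff.1 hj with h | h
    · exact absurd h.symm hij
    · exact ⟨i, Or.inl ⟨rfl, h⟩, rfl⟩
  · subst h
    rcases P.vertex_mem_closedEdge_iff.1 hj with h | h
    · exact ⟨_, Or.inr ⟨h, rfl⟩, rfl⟩
    · exact absurd (P.next.injective h).symm hij

lemma crs_edgeVec_eq_zero {i : Fin n} {x y : ℂ} (hx : x ∈ P.closedEdge i)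
    (hy : y ∈ P.closedEdge i) : ∃ r : ℝ, y - x = r * P.edgeVec i := by
  obtain ⟨t, -, -, rfl⟩ := P.mem_closedEdge.1 hx
  obtain ⟨s, -, -, rfl⟩ := P.mem_closedEdge.1 hy
  exact ⟨s - t, by push_cast; ring⟩

/-! ### Winding numbers and the two sides of an edge -/

/-- The angle under which the edge `j` is seen from `z`. -/
noncomputable def visualAngle (j : Fin n) (z : ℂ) : ℝ :=
  Complex.arg ((P.vertex (P.next j) - z) / (P.vertex j - z))

/-- If the ratio were real and nonpositive, then `z` would divide the segment between the endpoints
internally, so it would lie on the edge. -/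
lemma ratio_mem_slitPlane {j : Fin n} {z : ℂ} (hz : z ∉ P.closedEdge j) :
    (P.vertex (P.next j) - z) / (P.vertex j - z) ∈ Complex.slitPlane := by
  have h0 : P.vertex j - z ≠ 0 := fun h => hz (by
    rw [← sub_eq_zero.1 h]; exact P.vertex_mem_closedEdge j)
  by_contra h
  rw [Complex.mem_slitPlane_iff, not_or, not_lt, not_not] at h
  set w := (P.vertex (P.next j) - z) / (P.vertex j - z) with hw
  have hwr : w = ((w.re : ℝ) : ℂ) := Complex.ext (by simp) (by simp [h.2])
  have h1 : P.vertex (P.next j) - z = (w.re : ℂ) * (P.vertex j - z) := by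
    rw [← hwr, hw, div_mul_cancel₀ _ h0]
  have hden : (1 - w.re) ≠ 0 := by linarith [h.1]
  have hpos : 0 < 1 - w.re := by linarith [h.1]
  apply hz
  refine ⟨-w.re / (1 - w.re), 1 / (1 - w.re), by apply div_nonneg <;> linarith [h.1],
    by positivity, by field_simp; ring, ?_⟩
  have h2 : P.vertex (P.next j) = z + (w.re : ℂ) * (P.vertex j - z) := by rw [← h1]; ring
  have hden' : (1 - (w.re : ℂ)) ≠ 0 := by exact_mod_cast hden
  rw [h2]
  simp only [Complex.real_smul]
  push_cast
  field_simp
  ring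

lemma continuousAt_visualAngle {j : Fin n} {z : ℂ} (hz : z ∉ P.closedEdge j) :
    ContinuousAt (P.visualAngle j) z := by
  have h0 : P.vertex j - z ≠ 0 := fun h => hz (by
    rw [← sub_eq_zero.1 h]; exact P.vertex_mem_closedEdge j)
  refine ContinuousAt.comp (f := fun z => (P.vertex (P.next j) - z) / (P.vertex j - z))
    (Complex.continuousAt_arg (P.ratio_mem_slitPlane hz)) ?_
  exact ContinuousAt.div (by fun_prop) (by fun_prop) h0

/-- The quotients of consecutive vectors from `z` telescope to 1 along the permutation `next`, so
their arguments add up to a multiple of 2π: the winding number of the boundary around `z`. -/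
lemma sum_visualAngle {z : ℂ} (hz : z ∈ P.interior) :
    ∃ k : ℤ, ∑ j, P.visualAngle j z = k * (2 * Real.pi) := by
  have h0 : ∀ j, P.vertex j - z ≠ 0 := fun j h => P.notMem_closedEdge_of_mem hz j (by
    rw [← sub_eq_zero.1 h]; exact P.vertex_mem_closedEdge j)
  have hprod : ∏ j, (P.vertex (P.next j) - z) / (P.vertex j - z) = 1 := by
    rw [Finset.prod_div_distrib, Equiv.prod_comp P.next (fun j => P.vertex j - z),
      div_self (Finset.prod_ne_zero_iff.2 fun j _ => h0 j)]
  have h1 : Complex.exp ((∑ j, P.visualAngle j z : ℝ) * Complex.I) = 1 := by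
    push_cast
    rw [Finset.sum_mul, Complex.exp_sum]
    have h2 : ∀ j, Complex.exp (P.visualAngle j z * Complex.I) =
        (P.vertex (P.next j) - z) / (P.vertex j - z) /
          ‖(P.vertex (P.next j) - z) / (P.vertex j - z)‖ := by
      intro j
      have hne : (P.vertex (P.next j) - z) / (P.vertex j - z) ≠ 0 := div_ne_zero (h0 _) (h0 _)
      rw [eq_div_iff (by exact_mod_cast norm_ne_zero_iff.2 hne), mul_comm]
      exact Complex.norm_mul_exp_arg_mul_I _
    rw [Finset.prod_congr rfl fun j _ => h2 j, Finset.prod_div_distrib, hprod,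
      ← Complex.ofReal_prod, ← norm_prod, hprod]
    simp
  obtain ⟨k, hk⟩ := Complex.exp_eq_one_iff.1 h1
  refine ⟨k, ?_⟩
  have := congrArg Complex.im hk
  simpa using this

/-- A continuous function on a connected set with values in 2πℤ is constant; otherwise it would take
a value of the form 2πk + π. -/
lemma sum_visualAngle_eq {z w : ℂ} (hz : z ∈ P.interior) (hw : w ∈ P.interior) :
    ∑ j, P.visualAngle j z = ∑ j, P.visualAngle j w := by
  have hcont : ContinuousOn (fun z => ∑ j, P.visualAngle j z) P.interior := by
    intro x hx
    exact (tendsto_finsetSum _ fun j _ =>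
      P.continuousAt_visualAngle (P.notMem_closedEdge_of_mem hx j)).mono_left nhdsWithin_le_nhds
  have key : ∀ z ∈ P.interior, ∀ w ∈ P.interior,
      ¬ (∑ j, P.visualAngle j z < ∑ j, P.visualAngle j w) := by
    intro z hz w hw hlt
    have hivt := P.isConnected_interior.isPreconnected.intermediate_value hz hw hcont
    obtain ⟨k, hk⟩ := P.sum_visualAngle hz
    obtain ⟨l, hl⟩ := P.sum_visualAngle hw
    have hpi := Real.pi_pos
    have hkl : k < l := by
      by_contra h
      push Not at h
      have : (l : ℝ) ≤ k := by exact_mod_cast h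
      nlinarith
    have hkl' : (k : ℝ) + 1 ≤ l := by exact_mod_cast hkl
    obtain ⟨x, hx, hxe⟩ := hivt (show (k : ℝ) * (2 * Real.pi) + Real.pi ∈ _ from
      ⟨by simp only [hk]; linarith, by simp only [hl]; nlinarith⟩)
    obtain ⟨m, hm⟩ := P.sum_visualAngle hx
    simp only [hm] at hxe
    have : (2 * (m - k) : ℝ) = 1 := by
      have h3 : Real.pi * (2 * (m - k) - 1 : ℝ) = 0 := by linarith
      rcases mul_eq_zero.1 h3 with h | h
      · exact absurd h hpi.ne'
      · linarith
    have h4 : (2 * (m - k) : ℤ) = 1 := by exact_mod_cast this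
    omega
  exact le_antisymm (not_lt.1 (key w hw z hz)) (not_lt.1 (key z hz w hw))

lemma arg_gt_of_re_neg {z : ℂ} (hre : z.re < 0) (him : 0 < z.im) : Real.pi / 2 < z.arg := by
  by_contra h
  push Not at h
  have h0 : 0 ≤ z.arg := Complex.arg_nonneg_iff.2 him.le
  have : |z.arg| ≤ Real.pi / 2 := abs_le.2 ⟨by linarith [Real.pi_pos], h⟩
  rw [Complex.abs_arg_le_pi_div_two_iff] at this
  linarith

lemma arg_lt_of_re_neg {z : ℂ} (hre : z.re < 0) (him : z.im < 0) : z.arg < -(Real.pi / 2) := by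
  by_contra h
  push Not at h
  have h0 : z.arg < 0 := Complex.arg_neg_iff.2 him
  have : |z.arg| ≤ Real.pi / 2 := abs_le.2 ⟨by linarith [Real.pi_pos], by linarith [Real.pi_pos]⟩
  rw [Complex.abs_arg_le_pi_div_two_iff] at this
  linarith

/-- By Thales, the edge is seen under an obtuse angle from inside the disc that has the edge as a
diameter, and `ε ^ 2 < t * (1 - t)` places the point in this disc. The sign of the angle tells the
side of the edge. -/
lemma visualAngle_left {i : Fin n} {t ε : ℝ} (ht0 : 0 < t) (hε : ε ^ 2 < t * (1 - t)) :
    (0 < ε → Real.pi / 2 < P.visualAngle i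
      (P.vertex i + t * P.edgeVec i + ε * (Complex.I * P.edgeVec i))) ∧
    (ε < 0 → P.visualAngle i
      (P.vertex i + t * P.edgeVec i + ε * (Complex.I * P.edgeVec i)) < -(Real.pi / 2)) := by
  have he := P.edgeVec_ne_zero i
  have hv : P.vertex (P.next i) = P.vertex i + P.edgeVec i := by simp [edgeVec]
  have hden : (t : ℂ) + ε * Complex.I ≠ 0 := by
    intro h
    have := congrArg Complex.re h
    simp at this
    exact ht0.ne' this
  have hrat : (P.vertex (P.next i) -
      (P.vertex i + t * P.edgeVec i + ε * (Complex.I * P.edgeVec i))) /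
      (P.vertex i - (P.vertex i + t * P.edgeVec i + ε * (Complex.I * P.edgeVec i))) =
      -((1 - t : ℝ) - ε * Complex.I) / (t + ε * Complex.I) := by
    rw [hv, div_eq_div_iff _ hden]
    · push_cast; ring
    · rw [show P.vertex i - (P.vertex i + t * P.edgeVec i + ε * (Complex.I * P.edgeVec i)) =
        -((t + ε * Complex.I) * P.edgeVec i) by ring]
      exact neg_ne_zero.2 (mul_ne_zero hden he)
  have hns : 0 < Complex.normSq ((t : ℂ) + ε * Complex.I) := Complex.normSq_pos.2 hden
  have hre : (-((1 - t : ℝ) - ε * Complex.I) / ((t : ℂ) + ε * Complex.I)).re < 0 := by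
    rw [Complex.div_re, ← add_div]
    apply div_neg_of_neg_of_pos _ hns
    simp
    nlinarith
  have him : (-((1 - t : ℝ) - ε * Complex.I) / ((t : ℂ) + ε * Complex.I)).im =
      ε / Complex.normSq ((t : ℂ) + ε * Complex.I) := by
    rw [Complex.div_im, ← sub_div]
    congr 1
    simp
    ring
  unfold visualAngle
  rw [hrat]
  exact ⟨fun h => arg_gt_of_re_neg hre (by rw [him]; positivity),
    fun h => arg_lt_of_re_neg hre (by rw [him]; exact div_neg_of_neg_of_pos h hns)⟩

/-- The points close to an edge and to the right of it do not belong to the domain. -/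
lemma exterior_right (i : Fin n) {x : ℂ} (hx : x ∈ P.openEdge i) :
    ∀ᶠ ε : ℝ in 𝓝[>] 0, x - ε * (Complex.I * P.edgeVec i) ∉ P.interior := by
  by_contra hcon
  have hfreq : ∃ᶠ ε : ℝ in 𝓝[>] 0, x - ε * (Complex.I * P.edgeVec i) ∈ P.interior := hcon
  obtain ⟨t, ht0, ht1, hxt⟩ := P.mem_openEdge.1 hx
  have hleft := P.interior_left i x hx
  have hsq : ∀ᶠ ε : ℝ in 𝓝[>] 0, ε ^ 2 < t * (1 - t) := by
    have : Tendsto (fun ε : ℝ => ε ^ 2) (𝓝[>] 0) (𝓝 (0 ^ 2)) :=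
      ((continuous_pow 2).tendsto 0).mono_left nhdsWithin_le_nhds
    refine this.eventually (gt_mem_nhds ?_)
    simpa using mul_pos ht0 (by linarith : 0 < 1 - t)
  -- The other edges stay away from `x`, so their visual angles have the same limit from either side
  -- (`s = 1` and `s = -1`). The angle of the edge `i` jumps by more than π, which contradicts the
  -- constancy of the sum if both sides are in the domain.
  have hG : ∀ s : ℝ, Tendsto (fun ε : ℝ => ∑ j ∈ Finset.univ.erase i,
      P.visualAngle j (x + (s * ε : ℝ) * (Complex.I * P.edgeVec i))) (𝓝[>] 0)
      (𝓝 (∑ j ∈ Finset.univ.erase i, P.visualAngle j x)) := by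
    intro s
    refine tendsto_finsetSum _ fun j hj => ?_
    have hj' : x ∉ P.closedEdge j := fun h =>
      Finset.ne_of_mem_erase hj (P.openEdge_inter_closedEdge hx h).symm
    have : Tendsto (fun ε : ℝ => x + (s * ε : ℝ) * (Complex.I * P.edgeVec i)) (𝓝[>] 0) (𝓝 x) := by
      have hc : Continuous fun ε : ℝ => x + (s * ε : ℝ) * (Complex.I * P.edgeVec i) := by fun_prop
      simpa using (hc.tendsto 0).mono_left nhdsWithin_le_nhds
    exact (P.continuousAt_visualAngle hj').tendsto.comp this
  have hdiff := ((hG 1).sub (hG (-1)))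
  rw [sub_self] at hdiff
  have hsmall := (hdiff.abs).eventually (gt_mem_nhds (show |(0 : ℝ)| < Real.pi by
    simpa using Real.pi_pos))
  obtain ⟨ε, hr, hl, hs, hq, hpos⟩ := (hfreq.and_eventually
    (hleft.and (hsmall.and (hsq.and self_mem_nhdsWithin)))).exists
  have hpos : 0 < ε := hpos
  replace hl : x + ε * (Complex.I * P.edgeVec i) ∈ P.interior := hl
  have heq := P.sum_visualAngle_eq hl hr
  rw [← Finset.add_sum_erase _ _ (Finset.mem_univ i),
    ← Finset.add_sum_erase _ (fun j => P.visualAngle j (x - _)) (Finset.mem_univ i)] at heq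
  have h1 := (P.visualAngle_left (i := i) ht0 hq).1 hpos
  have h2 := (P.visualAngle_left (i := i) (ε := -ε) ht0 (by simpa using hq)).2 (by linarith)
  rw [← hxt] at h1 h2
  simp only [one_mul, neg_mul, Complex.ofReal_neg, ← sub_eq_add_neg] at hs h2
  rw [abs_lt] at hs
  linarith [hs.1, hs.2]

end PolygonalTable

lemma convex_crs_pos (u x : ℂ) : Convex ℝ {z : ℂ | 0 < crs u (z - x)} := by
  intro y hy z hz a b ha hb hab
  simp only [mem_ofPred_eq] at *
  have : crs u (a • y + b • z - x) = a * crs u (y - x) + b * crs u (z - x) := by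
    have hb' : b = 1 - a := by linarith
    subst hb'
    simp [crs]; ring
  rw [this]
  rcases ha.eq_or_lt with rfl | ha
  · have : b = 1 := by linarith
    subst this; simpa using hz
  · nlinarith [mul_pos ha hy, mul_nonneg hb hz.le]

/-- A connected set that leaves an open set meets its frontier. -/
lemma IsPreconnected.exists_mem_frontier {X : Type*} [TopologicalSpace X] {s u : Set X}
    (hs : IsPreconnected s) (hu : IsOpen u) {x y : X} (hx : x ∈ s) (hxu : x ∈ u) (hy : y ∈ s)
    (hyu : y ∉ u) : ∃ z ∈ s, z ∈ frontier u := by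
  by_contra! h
  rw [hu.frontier_eq] at h
  have hy' : y ∉ closure u := fun hc => h y hy ⟨hc, hyu⟩
  obtain ⟨z, -, hz1, hz2⟩ := hs u (closure u)ᶜ hu isClosed_closure.isOpen_compl
    (fun z hz => by
      by_cases hzu : z ∈ u
      · exact Or.inl hzu
      · exact Or.inr fun hc => h z hz ⟨hc, hzu⟩) ⟨x, hx, hxu⟩ ⟨y, hy, hy'⟩
  exact hz2 (subset_closure hz1)

namespace PolygonalTable
variable {n : ℕ} (P : PolygonalTable n)

/-- Near an interior point of an edge, the domain is the left half of a disc. -/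
lemma exists_half_disc {i : Fin n} {x : ℂ} (hx : x ∈ P.openEdge i) :
    ∃ r > 0, ∀ z ∈ Metric.ball x r,
      (z ∈ P.interior ↔ 0 < crs (P.edgeVec i) (z - x)) ∧
      (crs (P.edgeVec i) (z - x) = 0 → z ∈ P.openEdge i) ∧
      ∀ j, z ∈ P.closedEdge j → j = i ∧ z ∈ P.openEdge i := by
  have he := P.edgeVec_ne_zero i
  obtain ⟨t, ht0, ht1, hxt⟩ := P.mem_openEdge.1 hx
  have hcl : IsClosed (⋃ j ∈ {j | j ≠ i}, P.closedEdge j) :=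
    (Set.toFinite _).isClosed_biUnion fun j _ => P.isClosed_closedEdge j
  have hxn : x ∈ (⋃ j ∈ {j | j ≠ i}, P.closedEdge j)ᶜ := by
    simp only [mem_compl_iff, mem_iUnion, not_exists]
    intro j hj hxj
    exact hj (P.openEdge_inter_closedEdge hx hxj).symm
  obtain ⟨r1, hr1, hr1'⟩ := Metric.isOpen_iff.1 hcl.isOpen_compl x hxn
  -- The radius `r1` keeps the ball off all other edges; the second bound keeps the line through the
  -- edge inside the open edge.
  set r := min r1 (min t (1 - t) * ‖P.edgeVec i‖) with hr
  have hnorm : 0 < ‖P.edgeVec i‖ := norm_pos_iff.2 he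
  have hrpos : 0 < r := lt_min hr1 (mul_pos (lt_min ht0 (by linarith)) hnorm)
  have hline : ∀ z ∈ Metric.ball x r, crs (P.edgeVec i) (z - x) = 0 → z ∈ P.openEdge i := by
    intro z hz h0
    obtain ⟨s, hs⟩ := eq_real_mul_of_crs_eq_zero he h0
    have hzs : ‖z - x‖ < min t (1 - t) * ‖P.edgeVec i‖ := by
      rw [← dist_eq_norm]; exact lt_of_lt_of_le hz (min_le_right _ _)
    rw [hs, norm_mul, Complex.norm_real, mul_lt_mul_iff_left₀ hnorm, Real.norm_eq_abs] at hzs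
    have h1 := abs_lt.1 (lt_of_lt_of_le hzs (min_le_left _ _))
    have h2 := abs_lt.1 (lt_of_lt_of_le hzs (min_le_right _ _))
    refine P.mem_openEdge.2 ⟨t + s, by linarith [h1.1], by linarith [h2.2], ?_⟩
    have : z = x + (z - x) := by ring
    rw [this, hs, hxt]; push_cast; ring
  have hother : ∀ z ∈ Metric.ball x r, ∀ j, z ∈ P.closedEdge j →
      j = i ∧ crs (P.edgeVec i) (z - x) = 0 := by
    intro z hz j hj
    have : z ∈ (⋃ j ∈ {j | j ≠ i}, P.closedEdge j)ᶜ :=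
      hr1' (Metric.ball_subset_ball (min_le_left _ _) hz)
    have hji : j = i := by
      by_contra h
      exact this (mem_biUnion (show j ∈ {j | j ≠ i} from h) hj)
    subst hji
    obtain ⟨s, hs⟩ := P.crs_edgeVec_eq_zero (P.openEdge_subset _ hx) hj
    exact ⟨rfl, by rw [hs, crs_real_mul_right, crs_self, mul_zero]⟩
  have hfr : ∀ z ∈ Metric.ball x r, crs (P.edgeVec i) (z - x) ≠ 0 → z ∉ frontier P.interior := by
    intro z hz h0 hf
    obtain ⟨j, hj⟩ := P.mem_frontier.1 hf
    exact h0 (hother z hz j hj).2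
  have htend : ∀ s : ℝ, Tendsto (fun ε : ℝ => x + (s * ε : ℝ) * (Complex.I * P.edgeVec i))
      (𝓝[>] 0) (𝓝 x) := fun s => by
    have hc : Continuous fun ε : ℝ => x + (s * ε : ℝ) * (Complex.I * P.edgeVec i) := by fun_prop
    simpa using (hc.tendsto 0).mono_left nhdsWithin_le_nhds
  -- The left half of the ball is convex and misses the frontier, so one interior point, supplied by
  -- `interior_left`, puts all of it into the domain. The right half is treated in the same way with
  -- `exterior_right`.
  have hleft : ∀ z ∈ Metric.ball x r, 0 < crs (P.edgeVec i) (z - x) → z ∈ P.interior := by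
    intro z hz h0
    obtain ⟨ε, hint, hball, hpos⟩ := ((P.interior_left i x hx).and
      (((htend 1).eventually (Metric.ball_mem_nhds x hrpos)).and self_mem_nhdsWithin)).exists
    by_contra hcon
    have hpre : IsPreconnected (Metric.ball x r ∩ {z | 0 < crs (P.edgeVec i) (z - x)}) :=
      ((convex_ball x r).inter (convex_crs_pos _ _)).isPreconnected
    obtain ⟨w, hw, hwf⟩ := hpre.exists_mem_frontier P.isOpen_interior
      (x := x + ε * (Complex.I * P.edgeVec i)) ⟨by simpa using hball, by
        simp only [mem_ofPred_eq, add_sub_cancel_left, crs_real_mul_right, crs_I_mul_self]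
        exact mul_pos hpos (by positivity)⟩ hint ⟨hz, h0⟩ hcon
    exact hfr w hw.1 hw.2.ne' hwf
  have hright : ∀ z ∈ Metric.ball x r, crs (P.edgeVec i) (z - x) < 0 → z ∉ P.interior := by
    intro z hz h0 hcon
    obtain ⟨ε, hint, hball, hpos⟩ := ((P.exterior_right i hx).and
      (((htend (-1)).eventually (Metric.ball_mem_nhds x hrpos)).and self_mem_nhdsWithin)).exists
    have hset : {z | 0 < crs (-P.edgeVec i) (z - x)} = {z | crs (P.edgeVec i) (z - x) < 0} := by
      ext z; simp [crs_neg_left]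
    have hpre : IsPreconnected (Metric.ball x r ∩ {z | crs (P.edgeVec i) (z - x) < 0}) := by
      rw [← hset]
      exact ((convex_ball x r).inter (convex_crs_pos _ _)).isPreconnected
    obtain ⟨w, hw, hwf⟩ := hpre.exists_mem_frontier P.isOpen_interior ⟨hz, h0⟩ hcon
      (y := x - ε * (Complex.I * P.edgeVec i)) ⟨by simpa [sub_eq_add_neg] using hball, by
        simp only [mem_ofPred_eq, sub_sub_cancel_left, crs_neg_right, crs_real_mul_right,
          crs_I_mul_self, neg_lt_zero]
        exact mul_pos hpos (by positivity)⟩ hint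
    exact hfr w hw.1 hw.2.ne hwf
  refine ⟨r, hrpos, fun z hz => ⟨⟨fun h => ?_, hleft z hz⟩, hline z hz, fun j hj =>
    ⟨(hother z hz j hj).1, hline z hz (hother z hz j hj).2⟩⟩⟩
  rcases lt_trichotomy (crs (P.edgeVec i) (z - x)) 0 with h0 | h0 | h0
  · exact absurd h (hright z hz h0)
  · exact absurd (P.openEdge_subset i (hline z hz h0)) (P.notMem_closedEdge_of_mem h i)
  · exact h0

/-- A segment that leaves an edge into the domain leaves it to the left. -/
lemma crs_pos_of_openSegment {i : Fin n} {x y : ℂ} (hx : x ∈ P.openEdge i)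
    (h : openSegment ℝ x y ⊆ P.interior) : 0 < crs (P.edgeVec i) (y - x) := by
  obtain ⟨r, hr, hball⟩ := P.exists_half_disc hx
  have htend : Tendsto (fun t : ℝ => x + t * (y - x)) (𝓝[>] 0) (𝓝 x) := by
    have hc : Continuous fun t : ℝ => x + t * (y - x) := by fun_prop
    simpa using (hc.tendsto 0).mono_left nhdsWithin_le_nhds
  obtain ⟨t, ht, h0, h1⟩ := ((htend.eventually (Metric.ball_mem_nhds x hr)).and
    (Ioo_mem_nhdsGT (zero_lt_one : (0 : ℝ) < 1))).exists
  have := ((hball _ ht).1).1 (h (mem_openSegment_iff_add.2 ⟨t, h0, h1, rfl⟩))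
  rw [add_sub_cancel_left, crs_real_mul_right] at this
  exact (pos_iff_pos_of_mul_pos this).1 h0

lemma ne_of_openSegment {i : Fin n} {x y : ℂ} (hx : x ∈ P.openEdge i)
    (h : openSegment ℝ x y ⊆ P.interior) : x ≠ y := by
  rintro rfl
  have := P.crs_pos_of_openSegment hx h
  simp [crs_zero_right] at this

/-- A segment through the domain does not connect an edge with itself. -/
lemma edge_ne_of_openSegment {i j : Fin n} {x y : ℂ} (hx : x ∈ P.openEdge i)
    (hy : y ∈ P.closedEdge j) (h : openSegment ℝ x y ⊆ P.interior) : i ≠ j := by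
  rintro rfl
  have h1 := P.crs_pos_of_openSegment hx h
  obtain ⟨r, hr⟩ := P.crs_edgeVec_eq_zero (P.openEdge_subset _ hx) hy
  rw [hr, crs_real_mul_right, crs_self, mul_zero] at h1
  exact h1.false

/-! ### The corner in polar coordinates -/

/-- The two edges `A`, `B` at the vertex `v`, in polar coordinates: `A` has the direction `uA`, and the
sector between them consists of the directions `uA * exp (sg * φ * I)` with `0 < φ < θ`. -/
structure Corner (A B : Fin n) (v : ℂ) (θ : ℝ) where
  uA : ℂ
  sg : ℝ
  lA : ℝ
  lB : ℝ
  norm_uA : ‖uA‖ = 1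
  sg_eq : sg = 1 ∨ sg = -1
  lA_pos : 0 < lA
  lB_pos : 0 < lB
  theta_pos : 0 < θ
  theta_lt : θ < 2 * Real.pi
  edgeVec_A : P.edgeVec A = (sg * lA : ℝ) * uA
  edgeVec_B : P.edgeVec B = (-(sg * lB) : ℝ) * (uA * Complex.exp ((sg * θ : ℝ) * Complex.I))
  mem_A : ∀ z, z ∈ P.closedEdge A ↔ ∃ ρ : ℝ, 0 ≤ ρ ∧ ρ ≤ lA ∧ z = v + ρ * uA
  mem_B : ∀ z, z ∈ P.closedEdge B ↔ ∃ ρ : ℝ, 0 ≤ ρ ∧ ρ ≤ lB ∧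
    z = v + ρ * (uA * Complex.exp ((sg * θ : ℝ) * Complex.I))
  mem_openA : ∀ z, z ∈ P.openEdge A ↔ ∃ ρ : ℝ, 0 < ρ ∧ ρ < lA ∧ z = v + ρ * uA
  mem_openB : ∀ z, z ∈ P.openEdge B ↔ ∃ ρ : ℝ, 0 < ρ ∧ ρ < lB ∧
    z = v + ρ * (uA * Complex.exp ((sg * θ : ℝ) * Complex.I))
  notMem : ∀ j, j ≠ A → j ≠ B → v ∉ P.closedEdge j
  A_ne_B : A ≠ B
  sector : ∃ r > 0, ∀ ρ φ : ℝ, 0 < ρ → ρ < r → 0 < φ → φ < θ →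
    v + ρ * (uA * Complex.exp ((sg * φ : ℝ) * Complex.I)) ∈ P.interior

end PolygonalTable

namespace PolygonalTable
variable {n : ℕ} (P : PolygonalTable n)

lemma mem_closedEdge_out {j : Fin n} {u : ℂ} {l : ℝ} (hl : 0 < l) (h : P.edgeVec j = l * u) (z : ℂ) :
    z ∈ P.closedEdge j ↔ ∃ ρ : ℝ, 0 ≤ ρ ∧ ρ ≤ l ∧ z = P.vertex j + ρ * u := by
  rw [P.mem_closedEdge, h]
  constructor
  · rintro ⟨t, h0, h1, rfl⟩
    exact ⟨t * l, by positivity, by nlinarith, by push_cast; ring⟩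
  · rintro ⟨ρ, h0, h1, rfl⟩
    refine ⟨ρ / l, by positivity, by rwa [div_le_one hl], ?_⟩
    have : (l : ℂ) ≠ 0 := by exact_mod_cast hl.ne'
    push_cast; field_simp

lemma mem_openEdge_out {j : Fin n} {u : ℂ} {l : ℝ} (hl : 0 < l) (h : P.edgeVec j = l * u) (z : ℂ) :
    z ∈ P.openEdge j ↔ ∃ ρ : ℝ, 0 < ρ ∧ ρ < l ∧ z = P.vertex j + ρ * u := by
  rw [P.mem_openEdge, h]
  constructor
  · rintro ⟨t, h0, h1, rfl⟩
    exact ⟨t * l, by positivity, by nlinarith, by push_cast; ring⟩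
  · rintro ⟨ρ, h0, h1, rfl⟩
    refine ⟨ρ / l, by positivity, by rwa [div_lt_one hl], ?_⟩
    have : (l : ℂ) ≠ 0 := by exact_mod_cast hl.ne'
    push_cast; field_simp

lemma mem_closedEdge_in {j : Fin n} {u : ℂ} {l : ℝ} (hl : 0 < l) (h : P.edgeVec j = -l * u) (z : ℂ) :
    z ∈ P.closedEdge j ↔ ∃ ρ : ℝ, 0 ≤ ρ ∧ ρ ≤ l ∧ z = P.vertex (P.next j) + ρ * u := by
  have hv : P.vertex (P.next j) = P.vertex j + -l * u := by rw [← h]; simp [edgeVec]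
  rw [P.mem_closedEdge_out hl (show P.edgeVec j = l * (-u) by rw [h]; ring)]
  constructor
  · rintro ⟨ρ, h0, h1, rfl⟩
    exact ⟨l - ρ, by linarith, by linarith, by rw [hv]; push_cast; ring⟩
  · rintro ⟨ρ, h0, h1, rfl⟩
    exact ⟨l - ρ, by linarith, by linarith, by rw [hv]; push_cast; ring⟩

lemma mem_openEdge_in {j : Fin n} {u : ℂ} {l : ℝ} (hl : 0 < l) (h : P.edgeVec j = -l * u) (z : ℂ) :
    z ∈ P.openEdge j ↔ ∃ ρ : ℝ, 0 < ρ ∧ ρ < l ∧ z = P.vertex (P.next j) + ρ * u := by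
  have hv : P.vertex (P.next j) = P.vertex j + -l * u := by rw [← h]; simp [edgeVec]
  rw [P.mem_openEdge_out hl (show P.edgeVec j = l * (-u) by rw [h]; ring)]
  constructor
  · rintro ⟨ρ, h0, h1, rfl⟩
    exact ⟨l - ρ, by linarith, by linarith, by rw [hv]; push_cast; ring⟩
  · rintro ⟨ρ, h0, h1, rfl⟩
    exact ⟨l - ρ, by linarith, by linarith, by rw [hv]; push_cast; ring⟩

/-- A thin sector between two edges at a vertex belongs to the domain if it contains points close to
one of the edges. -/
lemma exists_sector {i : Fin n} {u : ℂ} {l θ : ℝ} (hl : 0 < l) (hu : ‖u‖ = 1)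
    (hev : P.edgeVec i = l * u) (hθ0 : 0 < θ) (hθ : θ < 2 * Real.pi)
    {B : Fin n} (hB : ∀ z, z ∈ P.closedEdge B →
      ∃ ρ : ℝ, 0 ≤ ρ ∧ z = P.vertex i + ρ * (u * Complex.exp (θ * Complex.I)))
    (hother : ∀ j, j ≠ i → j ≠ B → P.vertex i ∉ P.closedEdge j) :
    ∃ r > 0, ∀ ρ φ : ℝ, 0 < ρ → ρ < r → 0 < φ → φ < θ →
      P.vertex i + ρ * (u * Complex.exp (φ * Complex.I)) ∈ P.interior := by
  set v := P.vertex i with hv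
  have hu0 : u ≠ 0 := by rintro rfl; simp at hu
  have hcl : IsClosed (⋃ j ∈ {j | j ≠ i ∧ j ≠ B}, P.closedEdge j) :=
    (Set.toFinite _).isClosed_biUnion fun j _ => P.isClosed_closedEdge j
  have hxn : v ∈ (⋃ j ∈ {j | j ≠ i ∧ j ≠ B}, P.closedEdge j)ᶜ := by
    simp only [mem_compl_iff, mem_iUnion, not_exists]
    intro j hj hxj
    exact hother j hj.1 hj.2 hxj
  obtain ⟨r, hr, hr'⟩ := Metric.isOpen_iff.1 hcl.isOpen_compl v hxn
  refine ⟨r, hr, ?_⟩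
  let f : ℝ × ℝ → ℂ := fun x => v + x.1 * (u * Complex.exp (x.2 * Complex.I))
  have hf : Continuous f := by fun_prop
  have hpre : IsPreconnected (f '' (Ioo 0 r ×ˢ Ioo 0 θ)) :=
    (((convex_Ioo 0 r).prod (convex_Ioo 0 θ)).isPreconnected).image f hf.continuousOn
  -- Polar coordinates are unique as long as the angles differ by less than 2π. Hence no point of
  -- the open sector lies on either of its two edges.
  have hpolar : ∀ ρ φ ρ' ψ : ℝ, 0 < ρ → 0 ≤ ρ' → |φ - ψ| < 2 * Real.pi →
      f (ρ, φ) = v + ρ' * (u * Complex.exp (ψ * Complex.I)) → φ = ψ := by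
    intro ρ φ ρ' ψ hρ hρ' habs h
    have h1 : (ρ : ℂ) * Complex.exp (φ * Complex.I) = ρ' * Complex.exp (ψ * Complex.I) := by
      have h0 := add_left_cancel h
      apply mul_left_cancel₀ hu0
      linear_combination h0
    have h2 : ρ = ρ' := by
      have := congrArg norm h1
      simpa [Complex.norm_exp_ofReal_mul_I, abs_of_pos hρ, abs_of_nonneg hρ'] using this
    subst h2
    have h3 := mul_left_cancel₀ (by exact_mod_cast hρ.ne') h1
    rw [Complex.exp_eq_exp_iff_exists_int] at h3
    obtain ⟨k, hk⟩ := h3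
    have h4 := congrArg Complex.im hk
    simp at h4
    have h5 : |(k : ℝ)| < 1 := by
      have : |(k : ℝ) * (2 * Real.pi)| < 2 * Real.pi := by
        rw [show (k : ℝ) * (2 * Real.pi) = φ - ψ by linarith]; exact habs
      rw [abs_mul, abs_of_pos Real.two_pi_pos] at this
      nlinarith [Real.two_pi_pos]
    have h6 : k = 0 := by
      have : |k| < 1 := by exact_mod_cast h5
      exact Int.abs_lt_one_iff.1 this
    rw [h6] at h4
    simpa using h4
  have hfr : ∀ z ∈ f '' (Ioo 0 r ×ˢ Ioo 0 θ), z ∉ frontier P.interior := by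
    rintro _ ⟨⟨ρ, φ⟩, ⟨⟨h0, h1⟩, h2, h3⟩, rfl⟩ hz
    simp only at h0 h1 h2 h3
    obtain ⟨j, hj⟩ := P.mem_frontier.1 hz
    by_cases hji : j = i
    · subst hji
      obtain ⟨ρ', h0', -, h⟩ := (P.mem_closedEdge_out hl hev _).1 hj
      have := hpolar ρ φ ρ' 0 h0 h0' (by rw [sub_zero, abs_of_pos h2]; linarith) (by rw [h]; simp [hv])
      linarith
    by_cases hjB : j = B
    · subst hjB
      obtain ⟨ρ', h0', h⟩ := hB _ hj
      have := hpolar ρ φ ρ' θ h0 h0' (by rw [abs_lt]; constructor <;> linarith) h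
      linarith
    · have hb : f (ρ, φ) ∈ Metric.ball v r := by
        simp [f, hu, Complex.norm_exp_ofReal_mul_I, abs_of_pos h0, h1]
      exact hr' hb (mem_biUnion (show j ∈ {j | j ≠ i ∧ j ≠ B} from ⟨hji, hjB⟩) hj)
  -- One point of the sector that is known to be in the domain: start on the edge at the distance
  -- `ρ0` and move slightly to the left. Its polar angle is positive and tends to 0, so it falls
  -- below θ.
  set ρ0 := min (r / 2) (l / 2) with hρ0
  have hρ0p : 0 < ρ0 := lt_min (by linarith) (by linarith)
  have hx : v + ρ0 * u ∈ P.openEdge i := (P.mem_openEdge_out hl hev _).2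
    ⟨ρ0, hρ0p, lt_of_le_of_lt (min_le_right _ _) (by linarith), rfl⟩
  have hpos : ∀ᶠ ε : ℝ in 𝓝[>] 0, 0 < ε := self_mem_nhdsWithin
  have harg : Tendsto (fun ε : ℝ => Complex.arg (ρ0 + ε * l * Complex.I)) (𝓝[>] 0) (𝓝 0) := by
    have h1 : ContinuousAt Complex.arg (ρ0 + (0 : ℝ) * l * Complex.I) :=
      Complex.continuousAt_arg (by simp [Complex.mem_slitPlane_iff, hρ0p])
    have h2 : Tendsto (fun ε : ℝ => (ρ0 + ε * l * Complex.I : ℂ)) (𝓝[>] 0)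
        (𝓝 (ρ0 + (0 : ℝ) * l * Complex.I)) := by
      have hc : Continuous fun ε : ℝ => (ρ0 + ε * l * Complex.I : ℂ) := by fun_prop
      exact (hc.tendsto 0).mono_left nhdsWithin_le_nhds
    have h3 := h1.tendsto.comp h2
    simp only [Complex.ofReal_zero, zero_mul, add_zero, Complex.arg_ofReal_of_nonneg hρ0p.le] at h3
    exact h3
  have hnorm : Tendsto (fun ε : ℝ => ‖(ρ0 + ε * l * Complex.I : ℂ)‖) (𝓝[>] 0) (𝓝 ρ0) := by
    have hc : Continuous fun ε : ℝ => ‖(ρ0 + ε * l * Complex.I : ℂ)‖ := by fun_prop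
    have := (hc.tendsto 0).mono_left (nhdsWithin_le_nhds (s := Ioi 0))
    simpa [abs_of_pos hρ0p] using this
  obtain ⟨ε, hε, hint, h1, h2⟩ := (hpos.and ((P.interior_left i _ hx).and
    ((harg.eventually (gt_mem_nhds hθ0)).and (hnorm.eventually (gt_mem_nhds
      (show ρ0 < r from lt_of_le_of_lt (min_le_left _ _) (by linarith))))))).exists
  have him : 0 < ((ρ0 + ε * l * Complex.I : ℂ)).im := by simp; positivity
  have hmem : v + ρ0 * u + ε * (Complex.I * P.edgeVec i) ∈ f '' (Ioo 0 r ×ˢ Ioo 0 θ) := by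
    refine ⟨(‖(ρ0 + ε * l * Complex.I : ℂ)‖, Complex.arg (ρ0 + ε * l * Complex.I)),
      ⟨⟨norm_pos_iff.2 fun h => by rw [h] at him; simp at him, h2⟩,
        lt_of_le_of_ne (Complex.arg_nonneg_iff.2 him.le) ?_, h1⟩, ?_⟩
    · intro h
      rw [eq_comm, Complex.arg_eq_zero_iff] at h
      exact him.ne' h.2
    · simp only [f]
      have := Complex.norm_mul_exp_arg_mul_I (ρ0 + ε * l * Complex.I)
      rw [hev]
      linear_combination u * this
  intro ρ φ h0 h1 h2 h3
  by_contra hcon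
  obtain ⟨z, hz, hzf⟩ := hpre.exists_mem_frontier P.isOpen_interior hmem hint
    ⟨(ρ, φ), ⟨⟨h0, h1⟩, h2, h3⟩, rfl⟩ hcon
  exact hfr z hz hzf

lemma exp_interiorAngle (i : Fin n) :
    Complex.exp (P.interiorAngle i * Complex.I) =
      (P.vertex (P.next.symm i) - P.vertex i) / P.edgeVec i /
        ‖(P.vertex (P.next.symm i) - P.vertex i) / P.edgeVec i‖ := by
  set w := (P.vertex (P.next.symm i) - P.vertex i) / P.edgeVec i with hw
  have hw0 : w ≠ 0 := div_ne_zero (sub_ne_zero.2 fun h => by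
    have h1 := P.vertex_injective h
    exact P.next_ne i ((Equiv.symm_apply_eq _).1 h1).symm) (P.edgeVec_ne_zero i)
  have h1 : P.interiorAngle i = w.arg - toIcoDiv Real.two_pi_pos 0 w.arg * (2 * Real.pi) := by
    rw [interiorAngle, ← hw, ← self_sub_toIcoDiv_zsmul]; simp
  have h2 : Complex.exp (P.interiorAngle i * Complex.I) = Complex.exp (w.arg * Complex.I) := by
    rw [Complex.exp_eq_exp_iff_exists_int]
    refine ⟨-toIcoDiv Real.two_pi_pos 0 w.arg, ?_⟩
    rw [h1]; push_cast; ring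
  rw [h2, eq_div_iff (by exact_mod_cast norm_ne_zero_iff.2 hw0), mul_comm]
  exact Complex.norm_mul_exp_arg_mul_I _

lemma interiorAngle_lt (i : Fin n) : P.interiorAngle i < 2 * Real.pi := by
  have := (toIcoMod_mem_Ico' Real.two_pi_pos
    (Complex.arg ((P.vertex (P.next.symm i) - P.vertex i) / P.edgeVec i))).2
  exact this

lemma prev_ne (i : Fin n) : P.next.symm i ≠ i := fun h => P.next_ne i
  ((Equiv.symm_apply_eq _).1 h).symm

lemma edgeVec_prev (i : Fin n) : P.edgeVec (P.next.symm i) =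
    -(‖P.edgeVec (P.next.symm i)‖ : ℝ) *
      (P.edgeVec i / ‖P.edgeVec i‖ * Complex.exp (P.interiorAngle i * Complex.I)) := by
  have hB : P.edgeVec (P.next.symm i) = -(P.vertex (P.next.symm i) - P.vertex i) := by
    simp [edgeVec]
  rw [P.exp_interiorAngle, hB, norm_neg, norm_div]
  have h1 := P.edgeVec_ne_zero i
  have h2 : P.vertex (P.next.symm i) - P.vertex i ≠ 0 := by
    have := P.edgeVec_ne_zero (P.next.symm i)
    rw [hB] at this
    exact neg_ne_zero.1 this
  have h1' : (‖P.edgeVec i‖ : ℂ) ≠ 0 := by exact_mod_cast norm_ne_zero_iff.2 h1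
  have h2' : (‖P.vertex (P.next.symm i) - P.vertex i‖ : ℂ) ≠ 0 := by
    exact_mod_cast norm_ne_zero_iff.2 h2
  push_cast
  field_simp

/-- With the angle 0 the two edges would leave the vertex in the same direction and have common
inner points. -/
lemma interiorAngle_pos (i : Fin n) : 0 < P.interiorAngle i := by
  have h0 : 0 ≤ P.interiorAngle i := (toIcoMod_mem_Ico' Real.two_pi_pos
    (Complex.arg ((P.vertex (P.next.symm i) - P.vertex i) / P.edgeVec i))).1
  rcases h0.eq_or_lt with h | h
  swap
  · exact h
  exfalso
  have hB := P.edgeVec_prev i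
  rw [← h] at hB
  simp only [Complex.ofReal_zero, zero_mul, Complex.exp_zero, mul_one] at hB
  have hn : 0 < ‖P.edgeVec i‖ := norm_pos_iff.2 (P.edgeVec_ne_zero i)
  have hn' : 0 < ‖P.edgeVec (P.next.symm i)‖ := norm_pos_iff.2 (P.edgeVec_ne_zero _)
  set ρ := min (‖P.edgeVec i‖ / 2) (‖P.edgeVec (P.next.symm i)‖ / 2) with hρ
  have hρ0 : 0 < ρ := lt_min (by linarith) (by linarith)
  have hA : P.edgeVec i = (‖P.edgeVec i‖ : ℝ) * (P.edgeVec i / ‖P.edgeVec i‖) := by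
    have h1' : (‖P.edgeVec i‖ : ℂ) ≠ 0 := by exact_mod_cast hn.ne'
    field_simp
  have m1 := (P.mem_openEdge_out hn hA _).2
    ⟨ρ, hρ0, lt_of_le_of_lt (min_le_left _ _) (by linarith), rfl⟩
  have m2 := (P.mem_openEdge_in hn' hB _).2
    ⟨ρ, hρ0, lt_of_le_of_lt (min_le_right _ _) (by linarith), rfl⟩
  rw [Equiv.apply_symm_apply] at m2
  exact P.prev_ne i (P.openEdge_inter_closedEdge m1 (P.openEdge_subset _ m2)).symm

/-- The corner at the vertex `i`, seen from the outgoing edge. -/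
noncomputable def cornerOut (i : Fin n) :
    P.Corner i (P.next.symm i) (P.vertex i) (P.interiorAngle i) where
  uA := P.edgeVec i / ‖P.edgeVec i‖
  sg := 1
  lA := ‖P.edgeVec i‖
  lB := ‖P.edgeVec (P.next.symm i)‖
  norm_uA := by
    have := norm_ne_zero_iff.2 (P.edgeVec_ne_zero i)
    simp [this]
  sg_eq := Or.inl rfl
  lA_pos := norm_pos_iff.2 (P.edgeVec_ne_zero i)
  lB_pos := norm_pos_iff.2 (P.edgeVec_ne_zero _)
  theta_pos := P.interiorAngle_pos i
  theta_lt := P.interiorAngle_lt i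
  edgeVec_A := by
    have h1' : (‖P.edgeVec i‖ : ℂ) ≠ 0 := by
      exact_mod_cast norm_ne_zero_iff.2 (P.edgeVec_ne_zero i)
    rw [one_mul]; field_simp
  edgeVec_B := by
    have := P.edgeVec_prev i
    rw [one_mul, one_mul]; push_cast; exact this
  mem_A := P.mem_closedEdge_out (norm_pos_iff.2 (P.edgeVec_ne_zero i)) (by
    have h1' : (‖P.edgeVec i‖ : ℂ) ≠ 0 := by
      exact_mod_cast norm_ne_zero_iff.2 (P.edgeVec_ne_zero i)
    field_simp)
  mem_openA := P.mem_openEdge_out (norm_pos_iff.2 (P.edgeVec_ne_zero i)) (by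
    have h1' : (‖P.edgeVec i‖ : ℂ) ≠ 0 := by
      exact_mod_cast norm_ne_zero_iff.2 (P.edgeVec_ne_zero i)
    field_simp)
  mem_B := by
    have := P.mem_closedEdge_in (norm_pos_iff.2 (P.edgeVec_ne_zero _)) (P.edgeVec_prev i)
    rw [Equiv.apply_symm_apply] at this
    rw [one_mul]; exact this
  mem_openB := by
    have := P.mem_openEdge_in (norm_pos_iff.2 (P.edgeVec_ne_zero _)) (P.edgeVec_prev i)
    rw [Equiv.apply_symm_apply] at this
    rw [one_mul]; exact this
  notMem := by
    intro j hA hB h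
    rcases P.vertex_mem_closedEdge_iff.1 h with h | h
    · exact hA h
    · exact hB ((Equiv.symm_apply_eq _).2 h.symm).symm
  A_ne_B := (P.prev_ne i).symm
  sector := by
    have h1' : (‖P.edgeVec i‖ : ℂ) ≠ 0 := by
      exact_mod_cast norm_ne_zero_iff.2 (P.edgeVec_ne_zero i)
    simp only [one_mul]
    refine P.exists_sector (B := P.next.symm i) (norm_pos_iff.2 (P.edgeVec_ne_zero i))
      (by simp [norm_ne_zero_iff.2 (P.edgeVec_ne_zero i)]) (by field_simp)
      (P.interiorAngle_pos i) (P.interiorAngle_lt i) ?_ ?_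
    · intro z hz
      have := P.mem_closedEdge_in (norm_pos_iff.2 (P.edgeVec_ne_zero _)) (P.edgeVec_prev i)
      rw [Equiv.apply_symm_apply] at this
      obtain ⟨ρ, h0, -, h⟩ := (this z).1 hz
      exact ⟨ρ, h0, h⟩
    · intro j hA hB h
      rcases P.vertex_mem_closedEdge_iff.1 h with h | h
      · exact hA h
      · exact hB ((Equiv.symm_apply_eq _).2 h.symm).symm

namespace Corner
variable {P} {A B : Fin n} {v : ℂ} {θ : ℝ} (C : P.Corner A B v θ)

/-- The direction at the angle `φ` from `A`. -/
noncomputable def u (φ : ℝ) : ℂ := C.uA * Complex.exp ((C.sg * φ : ℝ) * Complex.I)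

lemma u_zero : C.u 0 = C.uA := by simp [u]

lemma norm_u (φ : ℝ) : ‖C.u φ‖ = 1 := by
  rw [u, norm_mul, C.norm_uA, Complex.norm_exp_ofReal_mul_I, one_mul]

lemma u_ne_zero (φ : ℝ) : C.u φ ≠ 0 := norm_ne_zero_iff.1 (by rw [C.norm_u]; norm_num)

lemma sg_mul_sg : C.sg * C.sg = 1 := by rcases C.sg_eq with h | h <;> rw [h] <;> norm_num

lemma sg_ne_zero : C.sg ≠ 0 := by rcases C.sg_eq with h | h <;> rw [h] <;> norm_num

lemma u_add (φ ψ : ℝ) : C.u (φ + ψ) = C.u φ * Complex.exp ((C.sg * ψ : ℝ) * Complex.I) := by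
  rw [u, u, mul_assoc, ← Complex.exp_add]; congr 2; push_cast; ring

lemma u_add_pi (φ : ℝ) : C.u (φ + Real.pi) = -C.u φ := by
  rw [u_add]
  rcases C.sg_eq with h | h
  · rw [h, one_mul, Complex.exp_pi_mul_I]; ring
  · rw [h, neg_one_mul, Complex.ofReal_neg, neg_mul, Complex.exp_neg_pi_mul_I]; ring

lemma crs_u (φ ψ : ℝ) : crs (C.u φ) (C.u ψ) = C.sg * Real.sin (ψ - φ) := by
  have h1 : C.u ψ = C.u φ * Complex.exp ((C.sg * (ψ - φ) : ℝ) * Complex.I) := by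
    rw [← C.u_add]; congr 1; ring
  rw [crs_eq_im, h1, ← mul_assoc, ← Complex.normSq_eq_conj_mul_self, Complex.normSq_eq_norm_sq,
    C.norm_u, one_pow, Complex.ofReal_one, one_mul, Complex.exp_ofReal_mul_I_im]
  rcases C.sg_eq with h | h
  · rw [h, one_mul, one_mul]
  · rw [h, neg_one_mul, neg_one_mul, Real.sin_neg]

lemma exists_u {z : ℂ} (hz : ‖z‖ = 1) : ∃ φ, z = C.u φ := by
  have h0 : C.uA ≠ 0 := by rw [← C.u_zero]; exact C.u_ne_zero 0
  refine ⟨C.sg * Complex.arg (z / C.uA), ?_⟩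
  rw [u, ← mul_assoc, C.sg_mul_sg, one_mul]
  have := Complex.norm_mul_exp_arg_mul_I (z / C.uA)
  rw [norm_div, hz, C.norm_uA, div_one, Complex.ofReal_one, one_mul] at this
  rw [this, mul_div_cancel₀ _ h0]

lemma u_eq_iff {φ ψ : ℝ} : C.u φ = C.u ψ ↔ ∃ k : ℤ, φ = ψ + k * (2 * Real.pi) := by
  have h0 : C.uA ≠ 0 := by rw [← C.u_zero]; exact C.u_ne_zero 0
  rw [u, u, mul_right_inj' h0, Complex.exp_eq_exp_iff_exists_int]
  constructor
  · rintro ⟨k, hk⟩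
    have h4 := congrArg Complex.im hk
    simp at h4
    rcases C.sg_eq with h | h
    · exact ⟨k, by rw [h] at h4; linarith⟩
    · exact ⟨-k, by rw [h] at h4; push_cast; linarith⟩
  · rintro ⟨k, rfl⟩
    rcases C.sg_eq with h | h
    · exact ⟨k, by rw [h]; push_cast; ring⟩
    · exact ⟨-k, by rw [h]; push_cast; ring⟩

lemma crs_edgeVec_A (φ : ℝ) : crs (P.edgeVec A) (C.u φ) = C.lA * Real.sin φ := by
  rw [C.edgeVec_A, crs_real_mul_left, ← C.u_zero, C.crs_u, sub_zero]
  linear_combination C.lA * Real.sin φ * C.sg_mul_sg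

lemma crs_edgeVec_B (φ : ℝ) : crs (P.edgeVec B) (C.u φ) = C.lB * Real.sin (θ - φ) := by
  rw [C.edgeVec_B, crs_real_mul_left]
  change _ * crs (C.u θ) _ = _
  rw [C.crs_u, ← neg_sub θ φ, Real.sin_neg]
  linear_combination C.lB * Real.sin (θ - φ) * C.sg_mul_sg

lemma mirror_u (r : ℝ) (hr : r ≠ 0) (α φ : ℝ) : mirror (r * C.u α) (C.u φ) = C.u (2 * α - φ) := by
  have hr' : (r : ℂ) ≠ 0 := by exact_mod_cast hr
  have hα : (starRingEnd ℂ) (C.u α) ≠ 0 := by simpa using C.u_ne_zero α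
  have h1 : C.u φ = C.u α * Complex.exp ((C.sg * (φ - α) : ℝ) * Complex.I) := by
    rw [← C.u_add]; congr 1; ring
  have h2 : C.u (2 * α - φ) = C.u α * Complex.exp (-((C.sg * (φ - α) : ℝ) * Complex.I)) := by
    have := C.u_add α (α - φ)
    rw [show 2 * α - φ = α + (α - φ) by ring, this]; congr 2; push_cast; ring
  rw [mirror, map_mul, Complex.conj_ofReal, h2, h1, map_mul, ← Complex.exp_conj, map_mul,
    Complex.conj_ofReal, Complex.conj_I]
  field_simp

lemma mirror_A (φ : ℝ) : mirror (P.edgeVec A) (C.u φ) = C.u (-φ) := by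
  rw [C.edgeVec_A, ← C.u_zero, C.mirror_u _ (mul_ne_zero C.sg_ne_zero C.lA_pos.ne')]
  congr 1; ring

lemma mirror_B (φ : ℝ) : mirror (P.edgeVec B) (C.u φ) = C.u (2 * θ - φ) := by
  rw [C.edgeVec_B]
  exact C.mirror_u _ (neg_ne_zero.2 (mul_ne_zero C.sg_ne_zero C.lB_pos.ne')) _ _

lemma u_comp_sub (φ : ℝ) :
    C.uA * Complex.exp ((C.sg * θ : ℝ) * Complex.I) * Complex.exp ((-C.sg * φ : ℝ) * Complex.I) =
      C.u (θ - φ) := by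
  rw [u, mul_assoc, ← Complex.exp_add]; congr 2; push_cast; ring

/-- The same corner, seen from the other edge. -/
noncomputable def swap : P.Corner B A v θ where
  uA := C.u θ
  sg := -C.sg
  lA := C.lB
  lB := C.lA
  norm_uA := C.norm_u θ
  sg_eq := by rcases C.sg_eq with h | h <;> rw [h] <;> simp
  lA_pos := C.lB_pos
  lB_pos := C.lA_pos
  theta_pos := C.theta_pos
  theta_lt := C.theta_lt
  edgeVec_A := by rw [C.edgeVec_B, neg_mul]; rfl
  edgeVec_B := by
    rw [u, C.u_comp_sub, sub_self, C.u_zero, C.edgeVec_A]; congr 2; ring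
  mem_A := C.mem_B
  mem_B := by rw [u, C.u_comp_sub, sub_self, C.u_zero]; exact C.mem_A
  mem_openA := C.mem_openB
  mem_openB := by rw [u, C.u_comp_sub, sub_self, C.u_zero]; exact C.mem_openA
  notMem := fun j h1 h2 => C.notMem j h2 h1
  A_ne_B := C.A_ne_B.symm
  sector := by
    obtain ⟨r, hr, h⟩ := C.sector
    refine ⟨r, hr, fun ρ φ h0 h1 h2 h3 => ?_⟩
    rw [u, C.u_comp_sub]
    exact h ρ (θ - φ) h0 h1 (by linarith) (by linarith)

lemma swap_u (φ : ℝ) : C.swap.u φ = C.u (θ - φ) := C.u_comp_sub φ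

end Corner

/-- Whichever of the two edges is the outgoing one, `swap` lets the corner be seen from `A`; the
orientation is recorded in `sg`. -/
lemma MeetAt.exists_corner {A B i : Fin n} (h : P.MeetAt A B i) :
    Nonempty (P.Corner A B (P.vertex i) (P.interiorAngle i)) := by
  rcases h with ⟨rfl, h⟩ | ⟨rfl, h⟩
  · rw [← (Equiv.symm_apply_eq _).2 h.symm]
    exact ⟨P.cornerOut A⟩
  · rw [← (Equiv.symm_apply_eq _).2 h.symm]
    exact ⟨(P.cornerOut B).swap⟩

end PolygonalTable

/-! ### Orbits as sequences of states -/

/-- A sequence of states of a billiard ball: the edge it leaves, the bounce point and the direction. -/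
abbrev Orb (n : ℕ) := ℤ → Fin n × ℂ × ℂ

namespace Orb
variable {n : ℕ}

/-- The edge of the `k`-th bounce. -/
def edge (x : Orb n) (k : ℤ) : Fin n := (x k).1
/-- The point of the `k`-th bounce. -/
def pos (x : Orb n) (k : ℤ) : ℂ := (x k).2.1
/-- The direction after the `k`-th bounce. -/
def dir (x : Orb n) (k : ℤ) : ℂ := (x k).2.2
/-- The distance to the next bounce. -/
noncomputable def step (x : Orb n) (k : ℤ) : ℝ := ‖x.pos (k + 1) - x.pos k‖
/-- The orbit with shifted time. -/
def shift (m : ℤ) (x : Orb n) : Orb n := fun k => x (k + m)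
/-- The orbit with reversed time. -/
def rev (x : Orb n) : Orb n := fun k => (x.edge (-k), x.pos (-k), -x.dir (-k - 1))

@[simp] lemma edge_shift (m k : ℤ) (x : Orb n) : (x.shift m).edge k = x.edge (k + m) := rfl
@[simp] lemma pos_shift (m k : ℤ) (x : Orb n) : (x.shift m).pos k = x.pos (k + m) := rfl
@[simp] lemma dir_shift (m k : ℤ) (x : Orb n) : (x.shift m).dir k = x.dir (k + m) := rfl
@[simp] lemma edge_rev (k : ℤ) (x : Orb n) : x.rev.edge k = x.edge (-k) := rfl
@[simp] lemma pos_rev (k : ℤ) (x : Orb n) : x.rev.pos k = x.pos (-k) := rfl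
@[simp] lemma dir_rev (k : ℤ) (x : Orb n) : x.rev.dir k = -x.dir (-k - 1) := rfl
lemma step_nonneg (x : Orb n) (k : ℤ) : 0 ≤ x.step k := norm_nonneg _

lemma rev_rev (x : Orb n) : x.rev.rev = x := by
  funext k
  refine Prod.ext (by simp [rev, edge]) (Prod.ext (by simp [rev, pos]) ?_)
  simp [rev, dir]

end Orb

namespace PolygonalTable
variable {n : ℕ} (P : PolygonalTable n)

/-- The state sequences of the nonsingular bi-infinite billiard trajectories. -/
def orbits : Set (Orb n) := {x | P.IsTrajectory x.pos x.edge ∧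
  ∀ k, x.dir k = (x.pos (k + 1) - x.pos k) / ‖x.pos (k + 1) - x.pos k‖}

variable {P}

lemma IsTrajectory.ne {b : ℤ → ℂ} {e : ℤ → Fin n} (h : P.IsTrajectory b e) (k : ℤ) :
    b k ≠ b (k + 1) := P.ne_of_openSegment (h k).1 (h k).2.1

lemma IsTrajectory.exists_orbit {b : ℤ → ℂ} {e : ℤ → Fin n} (h : P.IsTrajectory b e) :
    ∃ x ∈ P.orbits, x.pos = b ∧ x.edge = e :=
  ⟨fun k => (e k, b k, (b (k + 1) - b k) / ‖b (k + 1) - b k‖), ⟨h, fun _ => rfl⟩, rfl, rfl⟩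

section
variable {x : Orb n} (hx : x ∈ P.orbits) (k : ℤ)
include hx

lemma pos_mem : x.pos k ∈ P.openEdge (x.edge k) := (hx.1 k).1
lemma pos_ne : x.pos k ≠ x.pos (k + 1) := hx.1.ne k
lemma segment_subset : openSegment ℝ (x.pos k) (x.pos (k + 1)) ⊆ P.interior := (hx.1 k).2.1
lemma step_pos : 0 < x.step k := norm_pos_iff.2 (sub_ne_zero.2 (pos_ne hx k).symm)

lemma norm_dir : ‖x.dir k‖ = 1 := by
  have := (step_pos hx k).ne'
  unfold Orb.step at this
  rw [hx.2 k]; simp [this]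

lemma pos_succ : x.pos (k + 1) = x.pos k + x.step k * x.dir k := by
  have : (x.step k : ℂ) ≠ 0 := by exact_mod_cast (step_pos hx k).ne'
  rw [hx.2 k]
  unfold Orb.step at *
  rw [mul_div_cancel₀ _ this]; ring

lemma dir_succ : x.dir (k + 1) = P.reflectDir (x.edge (k + 1)) (x.dir k) := by
  have h := (hx.1 k).2.2
  have h1 : x.pos (k + 2) - x.pos (k + 1) ≠ 0 := by
    have := pos_ne hx (k + 1)
    rw [show k + 1 + 1 = k + 2 by ring] at this
    exact sub_ne_zero.2 this.symm
  have he := P.edgeVec_ne_zero (x.edge (k + 1))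
  have h0 : x.pos (k + 1) - x.pos k ≠ 0 := sub_ne_zero.2 (pos_ne hx k).symm
  have h2 : P.reflectDir (x.edge (k + 1)) (x.pos (k + 1) - x.pos k) ≠ 0 := by
    rw [reflectDir_eq, Ne, mirror_eq_zero he]; exact h0
  have h3 := (sameRay_iff_inv_norm_smul_eq_of_ne h1 h2).1 h
  rw [hx.2, hx.2, show k + 1 + 1 = k + 2 by ring]
  rw [reflectDir_eq, norm_mirror he, Complex.real_smul, Complex.real_smul] at h3
  rw [div_eq_inv_mul, div_eq_inv_mul, reflectDir_eq, ← Complex.ofReal_inv, ← Complex.ofReal_inv,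
    mirror_real_mul, h3]

lemma crs_dir_pos : 0 < crs (P.edgeVec (x.edge k)) (x.dir k) := by
  have := P.crs_pos_of_openSegment (pos_mem hx k) (segment_subset hx k)
  rw [pos_succ hx k, add_sub_cancel_left, crs_real_mul_right] at this
  exact (pos_iff_pos_of_mul_pos this).1 (step_pos hx k)

lemma edge_ne : x.edge k ≠ x.edge (k + 1) :=
  P.edge_ne_of_openSegment (pos_mem hx k) (P.openEdge_subset _ (pos_mem hx (k + 1)))
    (segment_subset hx k)

end

lemma mirror_edgeVec_sub {i : Fin n} {a b : ℂ} (ha : a ∈ P.closedEdge i) (hb : b ∈ P.closedEdge i) :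
    mirror (P.edgeVec i) (b - a) = b - a := by
  obtain ⟨r, hr⟩ := P.crs_edgeVec_eq_zero ha hb
  rw [hr, mirror_real_mul, mirror_self (P.edgeVec_ne_zero i)]

lemma shift_mem_orbits {x : Orb n} (hx : x ∈ P.orbits) (m : ℤ) : x.shift m ∈ P.orbits := by
  refine ⟨fun k => ?_, fun k => ?_⟩
  · have := hx.1 (k + m)
    simpa only [Orb.pos_shift, Orb.edge_shift, add_right_comm k m] using this
  · have := hx.2 (k + m)
    simpa only [Orb.pos_shift, Orb.dir_shift, add_right_comm k m] using this

/-- Reflections are involutions, so the law of reflection is symmetric in time. After the reversal,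
the outgoing direction at time `k` is the negative of the direction before the bounce `-k`, whence
the index `-k - 1`. -/
lemma rev_mem_orbits {x : Orb n} (hx : x ∈ P.orbits) : x.rev ∈ P.orbits := by
  have key : ∀ k : ℤ, x.rev.pos (k + 1) - x.rev.pos k = x.step (-k - 1) * x.rev.dir k := by
    intro k
    have := pos_succ hx (-k - 1)
    rw [sub_add_cancel] at this
    simp only [Orb.pos_rev, Orb.dir_rev, this, neg_add']
    ring
  have hn : ∀ k, ‖x.rev.dir k‖ = 1 := fun k => by simp [norm_dir hx]
  refine ⟨fun k => ⟨pos_mem hx (-k), ?_, ?_⟩, fun k => ?_⟩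
  · have := segment_subset hx (-k - 1)
    rw [sub_add_cancel, openSegment_symm] at this
    simp only [Orb.pos_rev, neg_add']
    exact this
  · have h2 := key (k + 1)
    rw [show k + 1 + 1 = k + 2 by ring] at h2
    rw [h2, key k, reflectDir_eq, mirror_real_mul]
    have h3 : x.rev.dir (k + 1) = mirror (P.edgeVec (x.rev.edge (k + 1))) (x.rev.dir k) := by
      have := dir_succ hx (-(k + 1) - 1)
      rw [sub_add_cancel] at this
      simp only [Orb.dir_rev, Orb.edge_rev, mirror_neg, show -k - 1 = -(k + 1) by ring, this,
        reflectDir_eq, mirror_mirror (P.edgeVec_ne_zero _)]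
    rw [← h3]
    simp only [← Complex.real_smul]
    exact (SameRay.sameRay_pos_smul_left _ (step_pos hx _)).trans
      (SameRay.sameRay_pos_smul_right _ (step_pos hx _)) fun h => by
        have := hn (k + 1); rw [h] at this; simp at this
  · rw [key k, norm_mul, hn, mul_one, Complex.norm_real, Real.norm_of_nonneg (x.step_nonneg _)]
    have : (x.step (-k - 1) : ℂ) ≠ 0 := by exact_mod_cast (step_pos hx _).ne'
    field_simp

/-! ### Long pieces of orbits have large length -/

/-- Consecutive bounces off the two edges at a corner need a convex corner. -/
lemma Corner.lt_pi_of_consecutive {A B : Fin n} {v : ℂ} {θ : ℝ} (C : P.Corner A B v θ) {x : Orb n}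
    (hx : x ∈ P.orbits) {k : ℤ} (hA : x.edge k = A) (hB : x.edge (k + 1) = B) : θ < Real.pi := by
  have h := P.crs_pos_of_openSegment (pos_mem hx k) (segment_subset hx k)
  obtain ⟨ρ, h0, -, hρ⟩ := (C.mem_openA _).1 (hA ▸ pos_mem hx k)
  obtain ⟨ρ', h0', -, hρ'⟩ := (C.mem_openB _).1 (hB ▸ pos_mem hx (k + 1))
  have hu : C.uA * Complex.exp ((C.sg * θ : ℝ) * Complex.I) = C.u θ := rfl
  rw [hA, hρ, hρ', hu, ← C.u_zero, add_sub_add_left_eq_sub, crs_sub_right, crs_real_mul_right,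
    crs_real_mul_right, C.crs_edgeVec_A, C.crs_edgeVec_A, Real.sin_zero] at h
  have hs : 0 < Real.sin θ := by
    by_contra hcon
    push Not at hcon
    nlinarith [mul_pos h0' C.lA_pos]
  by_contra hcon
  push Not at hcon
  have := Real.sin_nonneg_of_nonneg_of_le_pi (x := θ - Real.pi) (by linarith)
    (by linarith [C.theta_lt])
  rw [Real.sin_sub_pi] at this
  linarith

/-- The number of consecutive bounces off the edges at a corner is bounded. -/
lemma Corner.not_alternating {A B : Fin n} {v : ℂ} {θ : ℝ} (C : P.Corner A B v θ) {x : Orb n}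
    (hx : x ∈ P.orbits) {k : ℤ} {K : ℕ} (hK : Real.pi / θ + 1 ≤ K)
    (h : ∀ j : ℕ, j ≤ K → x.edge (k + j) = if Even j then A else B) : False := by
  have hθ := C.theta_pos
  have hK1 : (1 : ℝ) ≤ K := by
    have : 0 < Real.pi / θ := by positivity
    linarith
  have hpi : θ < Real.pi := by
    refine C.lt_pi_of_consecutive hx (k := k) ?_ ?_
    · simpa using h 0 (Nat.zero_le _)
    · simpa using h 1 (by exact_mod_cast hK1)
  obtain ⟨ω, hω⟩ := C.exists_u (norm_dir hx k)
  -- In the unfolded corner the direction `ω` is fixed while the edge turns by θ with every bounce,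
  -- so the angle to the `j`-th edge is `ω - j * θ`.
  have hdir : ∀ j : ℕ, j ≤ K → x.dir (k + j) =
      if Even j then C.u (ω - j * θ) else C.u ((j + 1) * θ - ω) := by
    intro j
    induction j with
    | zero => intro _; simpa using hω
    | succ j ih =>
      intro hj
      have h1 := dir_succ hx (k + j)
      have h2 := h (j + 1) hj
      push_cast at h2 ⊢
      rw [← add_assoc] at h2 ⊢
      rw [h1, h2, ih (by omega), reflectDir_eq]
      by_cases hev : Even j
      · simp only [hev, Nat.even_add_one, not_true_eq_false, if_true, if_false]
        rw [C.mirror_B]; congr 1; ring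
      · simp only [hev, Nat.even_add_one, not_false_eq_true, if_true, if_false]
        rw [C.mirror_A]; congr 1; ring
  have hsin : ∀ j : ℕ, j ≤ K → 0 < Real.sin (ω - j * θ) := by
    intro j hj
    have h1 := crs_dir_pos hx (k + j)
    rw [h j hj, hdir j hj] at h1
    by_cases hev : Even j
    · simp only [hev, if_true] at h1
      rw [C.crs_edgeVec_A] at h1
      exact (pos_iff_pos_of_mul_pos h1).1 C.lA_pos
    · simp only [hev, if_false] at h1
      rw [C.crs_edgeVec_B] at h1
      have := (pos_iff_pos_of_mul_pos h1).1 C.lB_pos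
      rwa [show θ - ((j + 1) * θ - ω) = ω - j * θ by ring] at this
  -- After normalisation to [0, 2π), a positive sine at the bounce 0 gives `ω' < π`. At the bounce
  -- ⌈ω'/θ⌉ the angle lies in (-θ, 0], where the sine is not positive; this bounce is among those
  -- considered because `K ≥ π/θ + 1`.
  set ω' := toIcoMod Real.two_pi_pos 0 ω with hω'
  have hmem := toIcoMod_mem_Ico' Real.two_pi_pos ω
  rw [← hω'] at hmem
  have hsin' : ∀ j : ℕ, j ≤ K → 0 < Real.sin (ω' - j * θ) := by
    intro j hj
    have h1 : ω' = ω - toIcoDiv Real.two_pi_pos 0 ω * (2 * Real.pi) := by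
      rw [hω', ← self_sub_toIcoDiv_zsmul]; simp
    rw [h1, sub_right_comm, Real.sin_sub_int_mul_two_pi]
    exact hsin j hj
  have h0 := hsin' 0 (Nat.zero_le _)
  simp only [Nat.cast_zero, zero_mul, sub_zero] at h0
  have hlt : ω' < Real.pi := by
    by_contra hcon
    push Not at hcon
    have := Real.sin_nonneg_of_nonneg_of_le_pi (x := ω' - Real.pi) (by linarith)
      (by linarith [hmem.2])
    rw [Real.sin_sub_pi] at this
    linarith
  have hj1 : ω' / θ ≤ ⌈ω' / θ⌉₊ := Nat.le_ceil _
  have hj2 : (⌈ω' / θ⌉₊ : ℝ) < ω' / θ + 1 := Nat.ceil_lt_add_one (div_nonneg hmem.1 hθ.le)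
  have hlt' : ω' / θ < Real.pi / θ := div_lt_div_of_pos_right hlt hθ
  have hjK : ⌈ω' / θ⌉₊ ≤ K := by
    have : (⌈ω' / θ⌉₊ : ℝ) ≤ K := by linarith
    exact_mod_cast this
  have h3 := hsin' _ hjK
  rw [div_le_iff₀ hθ] at hj1
  have hj2' : (⌈ω' / θ⌉₊ : ℝ) * θ < ω' + θ := by
    have := mul_lt_mul_of_pos_right hj2 hθ
    rwa [add_mul, div_mul_cancel₀ _ hθ.ne', one_mul] at this
  have h4 := Real.sin_nonneg_of_nonneg_of_le_pi (x := -(ω' - ⌈ω' / θ⌉₊ * θ)) (by linarith)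
    (by linarith)
  rw [Real.sin_neg] at h4
  linarith

variable (P) in
/-- Sufficiently many consecutive bounces take a definite length. -/
lemma exists_length_bound : ∃ K : ℕ, 0 < K ∧ ∃ l : ℝ, 0 < l ∧ ∀ x ∈ P.orbits, ∀ k : ℤ,
    l ≤ ∑ j ∈ Finset.range K, x.step (k + j) := by
  -- A sum instead of a maximum: this `K` exceeds the bound of `Corner.not_alternating` at all
  -- vertices at once.
  set K := ∑ i, (⌈Real.pi / P.interiorAngle i + 1⌉₊ + 1) + 1 with hK
  have hKi : ∀ i, Real.pi / P.interiorAngle i + 1 ≤ K := by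
    intro i
    have h1 : ⌈Real.pi / P.interiorAngle i + 1⌉₊ + 1 ≤
        ∑ i, (⌈Real.pi / P.interiorAngle i + 1⌉₊ + 1) :=
      Finset.single_le_sum (f := fun i => ⌈Real.pi / P.interiorAngle i + 1⌉₊ + 1)
        (fun _ _ => Nat.zero_le _) (Finset.mem_univ i)
    have h2 : ⌈Real.pi / P.interiorAngle i + 1⌉₊ ≤ K := by omega
    exact (Nat.le_ceil _).trans (by exact_mod_cast h2)
  -- If the edges of a word have no common point, then the sum of the distances to them has a
  -- positive minimum on the compact first edge. There are only finitely many words, so the bound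
  -- can be made uniform.
  have hc : ∀ w : Fin (K + 1) → Fin n, ∃ c > 0, (∀ z, ∃ l, z ∉ P.closedEdge (w l)) →
      ∀ z ∈ P.closedEdge (w 0), c ≤ ∑ l, Metric.infDist z (P.closedEdge (w l)) := by
    intro w
    have hcont : Continuous fun z => ∑ l, Metric.infDist z (P.closedEdge (w l)) :=
      continuous_finsetSum _ fun l _ => Metric.continuous_infDist_pt _
    obtain ⟨z0, hz0, hmin⟩ := (P.isCompact_closedEdge (w 0)).exists_isMinOn
      ⟨_, P.vertex_mem_closedEdge _⟩ hcont.continuousOn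
    by_cases hw : ∀ z, ∃ l, z ∉ P.closedEdge (w l)
    · refine ⟨∑ l, Metric.infDist z0 (P.closedEdge (w l)), ?_, fun _ z hz => hmin hz⟩
      obtain ⟨l, hl⟩ := hw z0
      refine Finset.sum_pos' (fun _ _ => Metric.infDist_nonneg) ⟨l, Finset.mem_univ _, ?_⟩
      exact ((P.isClosed_closedEdge _).notMem_iff_infDist_pos ⟨_, P.vertex_mem_closedEdge _⟩).1 hl
    · exact ⟨1, one_pos, fun h => absurd h hw⟩
  choose c hc0 hc1 using hc
  have hne : Nonempty (Fin n) := by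
    by_contra h
    rw [not_nonempty_iff] at h
    have hfr := P.frontier_interior
    rw [iUnion_of_empty, ← isClopen_iff_frontier_eq_empty] at hfr
    rcases isClopen_iff.1 hfr with h | h
    · exact P.isConnected_interior.nonempty.ne_empty h
    · have := P.isBounded_interior
      rw [h] at this
      exact (NormedSpace.noncompactSpace ℝ ℂ).noncompact_univ
        (Metric.isCompact_of_isClosed_isBounded isClosed_univ this)
  obtain ⟨w0, hw0⟩ := Finite.exists_min c
  refine ⟨K, by omega, c w0 / (K + 1), div_pos (hc0 _) (by positivity), fun x hx k => ?_⟩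
  rw [div_le_iff₀ (by positivity)]
  set T := ∑ j ∈ Finset.range K, x.step (k + j) with hT
  have hdist : ∀ l : ℕ, l ≤ K → dist (x.pos k) (x.pos (k + l)) ≤ T := by
    intro l hl
    have h1 := dist_le_range_sum_dist (fun j : ℕ => x.pos (k + j)) l
    simp only [Nat.cast_zero, add_zero] at h1
    refine h1.trans ?_
    have h2 : ∀ j : ℕ, dist (x.pos (k + j)) (x.pos (k + (j + 1 : ℕ))) = x.step (k + j) := by
      intro j
      rw [dist_comm, dist_eq_norm, Orb.step]; push_cast; rw [add_assoc]
    simp only [h2]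
    exact Finset.sum_le_sum_of_subset_of_nonneg (Finset.range_mono hl)
      fun j _ _ => x.step_nonneg _
  set w : Fin (K + 1) → Fin n := fun l => x.edge (k + (l : ℕ)) with hw
  -- A common point of all the edges would be the common vertex of the first two. Only two edges
  -- meet there, so the word would alternate between them for too long.
  have hwz : ∀ z, ∃ l, z ∉ P.closedEdge (w l) := by
    intro z
    by_contra! hz
    have hK1 : 1 ≤ K := by omega
    have h0 : z ∈ P.closedEdge (x.edge k) := by simpa [hw] using hz 0
    have hz' : ∀ j : ℕ, j ≤ K → z ∈ P.closedEdge (x.edge (k + j)) := fun j hj =>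
      hz ⟨j, by omega⟩
    obtain ⟨i, hi, rfl⟩ := P.exists_meetAt (edge_ne hx k) h0 (by simpa using hz' 1 hK1)
    obtain ⟨C⟩ := MeetAt.exists_corner P hi
    refine C.not_alternating hx (k := k) (hKi i) fun j => ?_
    induction j with
    | zero => intro _; simp
    | succ j ih =>
      intro hj
      have h1 := ih (by omega)
      have h2 := edge_ne hx (k + j)
      have h3 := hz' (j + 1) hj
      have h4 : x.edge (k + (j + 1 : ℕ)) = x.edge k ∨ x.edge (k + (j + 1 : ℕ)) = x.edge (k + 1) := by
        by_contra! hcon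
        exact C.notMem _ hcon.1 hcon.2 h3
      push_cast at h4 ⊢
      rw [← add_assoc] at h4 ⊢
      by_cases hev : Even j
      · simp only [hev, if_true, Nat.even_add_one, not_true_eq_false, if_false] at h1 ⊢
        rcases h4 with h4 | h4
        · exact absurd (h1.trans h4.symm) h2
        · exact h4
      · simp only [hev, if_false, Nat.even_add_one, not_false_eq_true, if_true] at h1 ⊢
        rcases h4 with h4 | h4
        · exact h4
        · exact absurd (h1.trans h4.symm) h2
  have h1 := hc1 w hwz (x.pos k) (by simpa [hw] using P.openEdge_subset _ (pos_mem hx k))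
  calc c w0 ≤ c w := hw0 w
    _ ≤ ∑ l : Fin (K + 1), Metric.infDist (x.pos k) (P.closedEdge (w l)) := h1
    _ ≤ ∑ _l : Fin (K + 1), T := Finset.sum_le_sum fun l _ =>
        (Metric.infDist_le_dist_of_mem (P.openEdge_subset _ (pos_mem hx (k + (l : ℕ))))).trans
          (hdist l (by omega))
    _ = T * (K + 1) := by simp [mul_comm]

end PolygonalTable

/-! ### Limit orbits, and parallelism from equal codes -/

/-- The scalar product of two plane vectors. -/
def dotp (z w : ℂ) : ℝ := z.re * w.re + z.im * w.im

lemma dotp_self (z : ℂ) : dotp z z = ‖z‖ ^ 2 := by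
  rw [← Complex.normSq_eq_norm_sq]; simp [dotp, Complex.normSq_apply]
lemma dotp_add_right (z w w' : ℂ) : dotp z (w + w') = dotp z w + dotp z w' := by
  simp [dotp]; ring
lemma dotp_sub_right (z w w' : ℂ) : dotp z (w - w') = dotp z w - dotp z w' := by
  simp [dotp]; ring
lemma dotp_real_mul_right (r : ℝ) (z w : ℂ) : dotp z (r * w) = r * dotp z w := by
  simp [dotp]; ring
lemma dotp_eq_re (z w : ℂ) : dotp z w = ((starRingEnd ℂ) z * w).re := by simp [dotp]
lemma dotp_mirror {u : ℂ} (hu : u ≠ 0) (a b : ℂ) :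
    dotp (mirror u a) (mirror u b) = dotp a b := by
  have h : (starRingEnd ℂ) u ≠ 0 := by simpa using hu
  rw [dotp_eq_re, dotp_eq_re]
  have : (starRingEnd ℂ) (mirror u a) * mirror u b = (starRingEnd ℂ) ((starRingEnd ℂ) a * b) := by
    simp only [mirror, map_mul, map_div₀, Complex.conj_conj]
    field_simp
  rw [this, Complex.conj_re]

lemma dotp_sq_add_crs_sq (z w : ℂ) : dotp z w ^ 2 + crs z w ^ 2 = ‖z‖ ^ 2 * ‖w‖ ^ 2 := by
  rw [← Complex.normSq_eq_norm_sq, ← Complex.normSq_eq_norm_sq]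
  simp only [dotp, crs, Complex.normSq_apply]; ring

lemma abs_dotp_le (z w : ℂ) : |dotp z w| ≤ ‖z‖ * ‖w‖ := by
  refine abs_le_of_sq_le_sq ?_ (by positivity)
  rw [mul_pow, ← dotp_sq_add_crs_sq]
  nlinarith [sq_nonneg (crs z w)]

/-- The second of two unit vectors, in the basis given by the first. -/
lemma eq_dotp_add_crs {z : ℂ} (hz : ‖z‖ = 1) (w : ℂ) :
    w = dotp z w * z + crs z w * (Complex.I * z) := by
  have h : z.re * z.re + z.im * z.im = 1 := by
    have := Complex.normSq_eq_norm_sq z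
    rw [hz, Complex.normSq_apply] at this; linarith
  apply Complex.ext
  · simp [dotp, crs]; linear_combination -w.re * h
  · simp [dotp, crs]; linear_combination -w.im * h

lemma eq_of_crs_eq_zero_of_dotp_pos {z w : ℂ} (hz : ‖z‖ = 1) (hw : ‖w‖ = 1) (h : crs z w = 0)
    (hd : 0 < dotp z w) : w = z := by
  have h1 := dotp_sq_add_crs_sq z w
  rw [hz, hw, h] at h1
  have h2 : dotp z w = 1 := by nlinarith
  have h3 := eq_dotp_add_crs hz w
  rw [h, h2] at h3
  simpa using h3

namespace Orb
variable {n : ℕ}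

lemma continuous_pos (k : ℤ) : Continuous fun x : Orb n => x.pos k :=
  continuous_snd.fst.comp (continuous_apply k)
lemma continuous_dir (k : ℤ) : Continuous fun x : Orb n => x.dir k :=
  continuous_snd.snd.comp (continuous_apply k)
lemma continuous_edge (k : ℤ) : Continuous fun x : Orb n => x.edge k :=
  continuous_fst.comp (continuous_apply k)
lemma continuous_step (k : ℤ) : Continuous fun x : Orb n => x.step k :=
  ((continuous_pos (k + 1)).sub (continuous_pos k)).norm
lemma continuous_shift (m : ℤ) : Continuous (shift m : Orb n → Orb n) :=
  continuous_pi fun k => continuous_apply (k + m)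
lemma continuous_rev : Continuous (rev : Orb n → Orb n) :=
  continuous_pi fun k => (continuous_edge (-k)).prodMk
    ((continuous_pos (-k)).prodMk (continuous_dir (-k - 1)).neg)

lemma eventually_edge {ι : Type*} {l : Filter ι} {y : ι → Orb n} {x : Orb n}
    (h : Tendsto y l (𝓝 x)) (k : ℤ) : ∀ᶠ j in l, (y j).edge k = x.edge k := by
  have := ((continuous_edge k).tendsto x).comp h
  rw [nhds_discrete, tendsto_pure] at this
  exact this

/-- The length of the path from the bounce `k` to the bounce `k + m`. -/
noncomputable def len (x : Orb n) (k : ℤ) (m : ℕ) : ℝ := ∑ j ∈ Finset.range m, x.step (k + j)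

lemma len_zero (x : Orb n) (k : ℤ) : x.len k 0 = 0 := by simp [len]
lemma len_succ (x : Orb n) (k : ℤ) (m : ℕ) : x.len k (m + 1) = x.len k m + x.step (k + m) := by
  simp [len, Finset.sum_range_succ]
lemma len_nonneg (x : Orb n) (k : ℤ) (m : ℕ) : 0 ≤ x.len k m :=
  Finset.sum_nonneg fun _ _ => x.step_nonneg _
lemma len_add (x : Orb n) (k : ℤ) (m m' : ℕ) :
    x.len k (m + m') = x.len k m + x.len (k + m) m' := by
  simp only [len, Finset.sum_range_add]
  congr 1
  refine Finset.sum_congr rfl fun j _ => ?_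
  congr 1; push_cast; ring
lemma len_mono (x : Orb n) (k : ℤ) {m m' : ℕ} (h : m ≤ m') : x.len k m ≤ x.len k m' := by
  obtain ⟨d, rfl⟩ := Nat.exists_eq_add_of_le h
  rw [len_add]; linarith [x.len_nonneg (k + m) d]
lemma continuous_len (k : ℤ) (m : ℕ) : Continuous fun x : Orb n => x.len k m :=
  continuous_finsetSum _ fun _ _ => continuous_step _

end Orb

namespace PolygonalTable
variable {n : ℕ} (P : PolygonalTable n)

/-- The limits of state sequences of nonsingular billiard trajectories. -/
def limOrbits : Set (Orb n) := closure P.orbits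

/-- A bound for the distance of two points of the table. -/
lemma exists_diam : ∃ L : ℝ, 0 < L ∧ ∀ i j, ∀ x ∈ P.closedEdge i, ∀ y ∈ P.closedEdge j,
    ‖y - x‖ ≤ L := by
  have hb : Bornology.IsBounded (frontier P.interior) :=
    P.isBounded_interior.closure.subset frontier_subset_closure
  obtain ⟨L, hL⟩ := Metric.isBounded_iff.1 hb
  refine ⟨max L 1, by positivity, fun i j x hx y hy => ?_⟩
  rw [← dist_eq_norm]
  exact (hL (P.closedEdge_subset_frontier j hy) (P.closedEdge_subset_frontier i hx)).trans
    (le_max_left _ _)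

/-- The diameter bound of the table. -/
noncomputable def diam : ℝ := P.exists_diam.choose
lemma diam_pos : 0 < P.diam := P.exists_diam.choose_spec.1
lemma norm_sub_le_diam {i j : Fin n} {x y : ℂ} (hx : x ∈ P.closedEdge i) (hy : y ∈ P.closedEdge j) :
    ‖y - x‖ ≤ P.diam := P.exists_diam.choose_spec.2 i j x hx y hy

/-- Every state lies in the product of the finite set of edges, the compact boundary and the unit
circle, so Tychonoff's theorem applies. This is why states carry unit directions. -/
lemma isCompact_limOrbits : IsCompact P.limOrbits := by
  have hb : Bornology.IsBounded (frontier P.interior) :=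
    P.isBounded_interior.closure.subset frontier_subset_closure
  have hK : IsCompact (frontier P.interior) :=
    Metric.isCompact_of_isClosed_isBounded isClosed_frontier hb
  refine ((isCompact_univ_pi fun _ : ℤ => (isCompact_univ (X := Fin n)).prod
    (hK.prod (isCompact_sphere (0 : ℂ) 1)))).of_isClosed_subset isClosed_closure
    (closure_minimal ?_ (isClosed_set_pi fun _ _ => isClosed_univ.prod
      (isClosed_frontier.prod Metric.isClosed_sphere)))
  intro x hx k _
  refine ⟨trivial, P.closedEdge_subset_frontier _ (P.openEdge_subset _ (pos_mem hx k)), ?_⟩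
  exact mem_sphere_zero_iff_norm.2 (norm_dir hx k)

variable {P}

lemma orbits_subset : P.orbits ⊆ P.limOrbits := subset_closure

lemma shift_mem {x : Orb n} (hx : x ∈ P.limOrbits) (m : ℤ) : x.shift m ∈ P.limOrbits :=
  map_mem_closure (Orb.continuous_shift m) hx fun _ h => shift_mem_orbits h m

lemma rev_mem {x : Orb n} (hx : x ∈ P.limOrbits) : x.rev ∈ P.limOrbits :=
  map_mem_closure Orb.continuous_rev hx fun _ h => rev_mem_orbits h

lemma exists_seq_orbits {x : Orb n} (hx : x ∈ P.limOrbits) :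
    ∃ y : ℕ → Orb n, (∀ j, y j ∈ P.orbits) ∧ Tendsto y atTop (𝓝 x) :=
  mem_closure_iff_seq_limit.1 hx

section
variable {x : Orb n} (hx : x ∈ P.limOrbits) (k : ℤ)
include hx

/-- Edges are discrete, so approximating orbits finally have the right edge at a given time, and
closed conditions pass to the limit. A limit bounce point may be a vertex and a step may have length
0; for this reason the direction is a separate coordinate of the state. -/
lemma lim_pos_mem : x.pos k ∈ P.closedEdge (x.edge k) := by
  obtain ⟨y, hy, hlim⟩ := exists_seq_orbits hx
  refine (P.isClosed_closedEdge _).mem_of_tendsto (((Orb.continuous_pos k).tendsto x).comp hlim) ?_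
  filter_upwards [Orb.eventually_edge hlim k] with j hj
  rw [← hj]; exact P.openEdge_subset _ (pos_mem (hy j) k)

lemma lim_norm_dir : ‖x.dir k‖ = 1 := by
  obtain ⟨y, hy, hlim⟩ := exists_seq_orbits hx
  refine tendsto_nhds_unique ((((Orb.continuous_dir k).norm).tendsto x).comp hlim)
    (tendsto_const_nhds.congr fun j => (norm_dir (hy j) k).symm)

lemma lim_pos_succ : x.pos (k + 1) = x.pos k + x.step k * x.dir k := by
  obtain ⟨y, hy, hlim⟩ := exists_seq_orbits hx
  refine tendsto_nhds_unique (((Orb.continuous_pos (k + 1)).tendsto x).comp hlim)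
    (Tendsto.congr (fun j => (pos_succ (hy j) k).symm)
    ((((Orb.continuous_pos k).add ((Complex.continuous_ofReal.comp (Orb.continuous_step k)).mul
      (Orb.continuous_dir k))).tendsto x).comp hlim))

lemma lim_dir_succ : x.dir (k + 1) = mirror (P.edgeVec (x.edge (k + 1))) (x.dir k) := by
  obtain ⟨y, hy, hlim⟩ := exists_seq_orbits hx
  have hc : Continuous (mirror (P.edgeVec (x.edge (k + 1)))) := by
    unfold mirror; fun_prop
  refine tendsto_nhds_unique (((Orb.continuous_dir (k + 1)).tendsto x).comp hlim)
    (Tendsto.congr' ?_ (((hc.comp (Orb.continuous_dir k)).tendsto x).comp hlim))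
  filter_upwards [Orb.eventually_edge hlim (k + 1)] with j hj
  simp only [Function.comp]
  rw [dir_succ (hy j) k, hj, reflectDir_eq]

lemma lim_crs_nonneg : 0 ≤ crs (P.edgeVec (x.edge k)) (x.dir k) := by
  obtain ⟨y, hy, hlim⟩ := exists_seq_orbits hx
  refine ge_of_tendsto (((continuous_const.crs (Orb.continuous_dir k)).tendsto x).comp hlim) ?_
  filter_upwards [Orb.eventually_edge hlim k] with j hj
  simp only [Function.comp]
  rw [← hj]; exact (crs_dir_pos (hy j) k).le

end

variable (P) in
/-- The length of long pieces of orbits tends uniformly to infinity. -/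
lemma exists_len_ge (R : ℝ) : ∃ M : ℕ, 0 < M ∧ ∀ x ∈ P.limOrbits, ∀ k : ℤ, ∀ m ≥ M,
    R ≤ x.len k m := by
  obtain ⟨K, hK, l, hl, h⟩ := P.exists_length_bound
  have h' : ∀ x ∈ P.limOrbits, ∀ k : ℤ, l ≤ x.len k K := by
    intro x hx k
    obtain ⟨y, hy, hlim⟩ := exists_seq_orbits hx
    exact ge_of_tendsto (((Orb.continuous_len k K).tendsto x).comp hlim)
      (Eventually.of_forall fun j => h (y j) (hy j) k)
  have h2 : ∀ x ∈ P.limOrbits, ∀ a : ℕ, ∀ k : ℤ, a * l ≤ x.len k (a * K) := by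
    intro x hx a
    induction a with
    | zero => intro k; simp [Orb.len_zero]
    | succ a ih =>
      intro k
      rw [add_mul, Orb.len_add, one_mul]
      have h1 := ih k
      have h2 := h' x hx (k + (a * K : ℕ))
      push_cast at h2 ⊢
      linarith
  obtain ⟨a, ha⟩ := exists_nat_gt (R / l)
  refine ⟨(a + 1) * K, by positivity, fun x hx k m hm => ?_⟩
  rw [div_lt_iff₀ hl] at ha
  have h3 := h2 x hx (a + 1) k
  push_cast at h3
  linarith [x.len_mono k hm]

section
variable {x y : Orb n} (hx : x ∈ P.limOrbits) (hy : y ∈ P.limOrbits) {k : ℤ}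
include hx hy

lemma mirror_pos_sub (he : x.edge k = y.edge k) :
    mirror (P.edgeVec (x.edge k)) (y.pos k - x.pos k) = y.pos k - x.pos k :=
  mirror_edgeVec_sub (lim_pos_mem hx k) (he ▸ lim_pos_mem hy k)

lemma norm_pos_sub_le (j : ℤ) : ‖y.pos k - x.pos j‖ ≤ P.diam :=
  P.norm_sub_le_diam (lim_pos_mem hx j) (lim_pos_mem hy k)

/-- Both directions are reflected in the same edge at each bounce, and a reflection reverses
orientation. Hence the sign `(-1) ^ m` here and in all formulas for distances of orbits; even shifts
avoid it. -/
lemma crs_dir_dir {m : ℕ} (he : ∀ j : ℕ, 1 ≤ j → j ≤ m → x.edge (k + j) = y.edge (k + j)) :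
    crs (x.dir (k + m)) (y.dir (k + m)) = (-1) ^ m * crs (x.dir k) (y.dir k) := by
  induction m with
  | zero => simp
  | succ m ih =>
    have h1 := lim_dir_succ hx (k + m)
    have h2 := lim_dir_succ hy (k + m)
    have h3 := he (m + 1) (by omega) le_rfl
    push_cast at h3 ⊢
    rw [← add_assoc] at h3 ⊢
    rw [h1, h2, h3, crs_mirror (P.edgeVec_ne_zero _), ih fun j h0 hj => he j h0 (by omega)]
    ring

lemma dotp_dir_dir {m : ℕ} (he : ∀ j : ℕ, 1 ≤ j → j ≤ m → x.edge (k + j) = y.edge (k + j)) :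
    dotp (x.dir (k + m)) (y.dir (k + m)) = dotp (x.dir k) (y.dir k) := by
  induction m with
  | zero => simp
  | succ m ih =>
    have h1 := lim_dir_succ hx (k + m)
    have h2 := lim_dir_succ hy (k + m)
    have h3 := he (m + 1) (by omega) le_rfl
    push_cast at h3 ⊢
    rw [← add_assoc] at h3 ⊢
    rw [h1, h2, h3, dotp_mirror (P.edgeVec_ne_zero _), ih fun j h0 hj => he j h0 (by omega)]

/-- The distance of a bounce point from the line of another orbit with the same edges. -/
lemma crs_dir_pos_sub {m : ℕ} (he : ∀ j : ℕ, 1 ≤ j → j ≤ m → x.edge (k + j) = y.edge (k + j)) :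
    crs (x.dir (k + m)) (y.pos (k + m) - x.pos (k + m)) = (-1) ^ m *
      (crs (x.dir k) (y.pos k - x.pos k) + y.len k m * crs (x.dir k) (y.dir k)) := by
  induction m with
  | zero => simp [Orb.len_zero]
  | succ m ih =>
    have h1 := lim_dir_succ hx (k + m)
    have h3 := he (m + 1) (by omega) le_rfl
    have h4 := mirror_pos_sub hx hy h3
    have h5 := ih fun j h0 hj => he j h0 (by omega)
    have h6 := crs_dir_dir (k := k) (m := m) hx hy fun j h0 hj => he j h0 (by omega)
    push_cast at h3 h4 ⊢
    rw [← add_assoc] at h3 h4 ⊢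
    rw [h1, ← h4, crs_mirror (P.edgeVec_ne_zero _), lim_pos_succ hx (k + m),
      lim_pos_succ hy (k + m), Orb.len_succ]
    rw [show y.pos (k + m) + y.step (k + m) * y.dir (k + m) -
      (x.pos (k + m) + x.step (k + m) * x.dir (k + m)) = y.pos (k + m) - x.pos (k + m) +
        (y.step (k + m) * y.dir (k + m) - x.step (k + m) * x.dir (k + m)) by ring,
      crs_add_right, h5, crs_sub_right _ (_ * _), crs_real_mul_right, crs_real_mul_right, crs_self, h6]
    ring

lemma dotp_dir_pos_sub {m : ℕ} (he : ∀ j : ℕ, 1 ≤ j → j ≤ m → x.edge (k + j) = y.edge (k + j)) :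
    dotp (x.dir (k + m)) (y.pos (k + m) - x.pos (k + m)) =
      dotp (x.dir k) (y.pos k - x.pos k) + y.len k m * dotp (x.dir k) (y.dir k) - x.len k m := by
  induction m with
  | zero => simp [Orb.len_zero]
  | succ m ih =>
    have h1 := lim_dir_succ hx (k + m)
    have h3 := he (m + 1) (by omega) le_rfl
    have h4 := mirror_pos_sub hx hy h3
    have h5 := ih fun j h0 hj => he j h0 (by omega)
    have h6 := dotp_dir_dir (k := k) (m := m) hx hy fun j h0 hj => he j h0 (by omega)
    push_cast at h3 h4 ⊢
    rw [← add_assoc] at h3 h4 ⊢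
    rw [h1, ← h4, dotp_mirror (P.edgeVec_ne_zero _), lim_pos_succ hx (k + m),
      lim_pos_succ hy (k + m), Orb.len_succ, Orb.len_succ]
    rw [show y.pos (k + m) + y.step (k + m) * y.dir (k + m) -
      (x.pos (k + m) + x.step (k + m) * x.dir (k + m)) = y.pos (k + m) - x.pos (k + m) +
        (y.step (k + m) * y.dir (k + m) - x.step (k + m) * x.dir (k + m)) by ring,
      dotp_add_right, h5, dotp_sub_right _ (_ * _), dotp_real_mul_right, dotp_real_mul_right, dotp_self, h6,
      lim_norm_dir hx]
    ring

/-- The directions of orbits that hit the same edges for a long time are close to each other. -/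
lemma dir_close {m : ℕ} (he : ∀ j : ℕ, j ≤ m → x.edge (k + j) = y.edge (k + j)) :
    y.len k m * |crs (x.dir k) (y.dir k)| ≤ 2 * P.diam ∧
    (2 * P.diam < x.len k m → 0 < dotp (x.dir k) (y.dir k)) := by
  have he' : ∀ j : ℕ, 1 ≤ j → j ≤ m → x.edge (k + j) = y.edge (k + j) := fun j _ hj => he j hj
  have hb : ∀ j : ℤ, |crs (x.dir j) (y.pos j - x.pos j)| ≤ P.diam ∧
      |dotp (x.dir j) (y.pos j - x.pos j)| ≤ P.diam := by
    intro j
    have h1 := norm_pos_sub_le hx hy (k := j) j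
    exact ⟨(abs_crs_le _ _).trans (by rwa [lim_norm_dir hx, one_mul]),
      (abs_dotp_le _ _).trans (by rwa [lim_norm_dir hx, one_mul])⟩
  constructor
  · have h1 := crs_dir_pos_sub hx hy he'
    have h2 := congrArg abs h1
    rw [abs_mul, abs_pow, abs_neg, abs_one, one_pow, one_mul] at h2
    have h3 := (hb (k + m)).1
    rw [h2] at h3
    have h4 := abs_le.1 h3
    have h5 := abs_le.1 (hb k).1
    rw [← abs_of_nonneg (y.len_nonneg k m), ← abs_mul, abs_le]
    constructor <;> linarith [h4.1, h4.2, h5.1, h5.2]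
  · intro hlen
    have h1 := dotp_dir_pos_sub hx hy he'
    have h3 := abs_le.1 (hb (k + m)).2
    have h5 := abs_le.1 (hb k).2
    by_contra hcon
    push Not at hcon
    nlinarith [y.len_nonneg k m, mul_nonneg (y.len_nonneg k m) (neg_nonneg.2 hcon), h3.1, h5.2]

/-- Orbits that hit the same edges in the future are parallel. -/
lemma dir_eq_of_future (he : ∀ j, k ≤ j → x.edge j = y.edge j) : x.dir k = y.dir k := by
  have hc : crs (x.dir k) (y.dir k) = 0 := by
    by_contra hne
    have hpos := abs_pos.2 hne
    obtain ⟨M, -, hM⟩ := P.exists_len_ge (2 * P.diam / |crs (x.dir k) (y.dir k)| + 1)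
    have h1 := (dir_close hx hy (k := k) (m := M) fun j _ => he _ (by omega)).1
    have h2 := hM y hy k M le_rfl
    have h3 := (le_div_iff₀ hpos).2 h1
    linarith
  obtain ⟨M, -, hM⟩ := P.exists_len_ge (2 * P.diam + 1)
  have hd := (dir_close hx hy (k := k) (m := M) fun j _ => he _ (by omega)).2
    (by linarith [hM x hx k M le_rfl])
  exact (eq_of_crs_eq_zero_of_dotp_pos (lim_norm_dir hx k) (lim_norm_dir hy k) hc hd).symm

/-- Orbits that hit the same edges in the past are parallel. -/
lemma dir_eq_of_past (he : ∀ j, j ≤ k → x.edge j = y.edge j) : x.dir k = y.dir k := by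
  have h := dir_eq_of_future (rev_mem hx) (rev_mem hy) (k := -k) fun j hj => he _ (by omega)
  simp only [Orb.dir_rev, neg_neg, neg_inj] at h
  have h1 := lim_dir_succ hx (k - 1)
  have h2 := lim_dir_succ hy (k - 1)
  rw [sub_add_cancel] at h1 h2
  rw [h1, h2, h, he k le_rfl]

end

end PolygonalTable

/-! ### Two strips that separate -/

namespace PolygonalTable
variable {n : ℕ} (P : PolygonalTable n)

/-- Two billiard segments from the edge `e` to the edge `f` on different sides of the line
`crs D z = c`. -/
structure Strip (e f : Fin n) (D : ℂ) (c : ℝ) (p q p₁ q₁ : ℂ) : Prop where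
  hp : p ∈ P.openEdge e
  hq : q ∈ P.openEdge e
  hp₁ : p₁ ∈ P.openEdge f
  hq₁ : q₁ ∈ P.openEdge f
  segp : openSegment ℝ p p₁ ⊆ P.interior
  segq : openSegment ℝ q q₁ ⊆ P.interior
  ltp : crs D p < c
  ltp₁ : crs D p₁ < c
  ltq : c < crs D q
  ltq₁ : c < crs D q₁
  pos : 0 < crs (P.edgeVec e) D

namespace Strip
variable {P} {e f g : Fin n} {D : ℂ} {c : ℝ} {p q p₁ q₁ p' q' p₁' q₁' : ℂ}
  (S : P.Strip e f D c p q p₁ q₁)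
include S

lemma crs_e_p : 0 < crs (P.edgeVec e) (p₁ - p) := P.crs_pos_of_openSegment S.hp S.segp
lemma crs_e_q : 0 < crs (P.edgeVec e) (q₁ - q) := P.crs_pos_of_openSegment S.hq S.segq
lemma crs_f_p : crs (P.edgeVec f) (p₁ - p) < 0 := by
  have h := P.crs_pos_of_openSegment S.hp₁ (by rw [openSegment_symm]; exact S.segp)
  rw [← neg_sub, crs_neg_right] at h; linarith
lemma crs_f_q : crs (P.edgeVec f) (q₁ - q) < 0 := by
  have h := P.crs_pos_of_openSegment S.hq₁ (by rw [openSegment_symm]; exact S.segq)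
  rw [← neg_sub, crs_neg_right] at h; linarith

/-- Since the domain is to the left of every edge, the edge that is left points from the side of `q`
to the side of `p`. At the arrival edge it is the other way round, see `exists_f`. -/
lemma exists_e : ∃ κ : ℝ, κ < 0 ∧ q - p = κ * P.edgeVec e := by
  obtain ⟨κ, hκ⟩ := P.crs_edgeVec_eq_zero (P.openEdge_subset _ S.hp) (P.openEdge_subset _ S.hq)
  refine ⟨κ, ?_, hκ⟩
  have h1 : 0 < crs D (q - p) := by rw [crs_sub_right]; linarith [S.ltp, S.ltq]
  rw [hκ, crs_real_mul_right, crs_anti] at h1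
  nlinarith [S.pos]

/-- The points where the line meets the two edges. -/
lemma exists_line : ∃ α β ρ : ℝ, 0 < α ∧ α < 1 ∧ 0 < β ∧ β < 1 ∧ 0 < ρ ∧
    crs D (p + α * (q - p)) = c ∧ p₁ + β * (q₁ - p₁) = p + α * (q - p) + ρ * D := by
  have hα : 0 < crs D q - crs D p := by linarith [S.ltp, S.ltq]
  have hβ : 0 < crs D q₁ - crs D p₁ := by linarith [S.ltp₁, S.ltq₁]
  set α := (c - crs D p) / (crs D q - crs D p) with hαd
  set β := (c - crs D p₁) / (crs D q₁ - crs D p₁) with hβd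
  have h1 : α * (crs D q - crs D p) = c - crs D p := div_mul_cancel₀ _ hα.ne'
  have h2 : β * (crs D q₁ - crs D p₁) = c - crs D p₁ := div_mul_cancel₀ _ hβ.ne'
  have hz : crs D (p + α * (q - p)) = c := by
    rw [crs_add_right, crs_real_mul_right, crs_sub_right, h1]; ring
  have hz₁ : crs D (p₁ + β * (q₁ - p₁)) = c := by
    rw [crs_add_right, crs_real_mul_right, crs_sub_right, h2]; ring
  have hβ0 : 0 < β := div_pos (by linarith [S.ltp₁]) hβ
  have hβ1 : β < 1 := (div_lt_one hβ).2 (by linarith [S.ltq₁])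
  have hD : D ≠ 0 := by
    rintro rfl
    have := S.pos
    rw [crs_zero_right] at this; exact this.false
  obtain ⟨ρ, hρ⟩ := eq_real_mul_of_crs_eq_zero hD
    (w := p₁ + β * (q₁ - p₁) - (p + α * (q - p))) (by rw [crs_sub_right, hz, hz₁, sub_self])
  refine ⟨α, β, ρ, div_pos (by linarith [S.ltp]) hα, (div_lt_one hα).2 (by linarith [S.ltq]),
    hβ0, hβ1, ?_, hz, by rw [← hρ]; ring⟩
  obtain ⟨κ, -, hκ⟩ := S.exists_e
  have h3 := congrArg (crs (P.edgeVec e)) hρ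
  rw [show p₁ + β * (q₁ - p₁) - (p + α * (q - p)) =
    ((1 - β : ℝ) * (p₁ - p) + β * (q₁ - q)) + ((β - α : ℝ) * (q - p)) by push_cast; ring,
    hκ, crs_add_right, crs_add_right] at h3
  simp only [crs_real_mul_right, crs_self] at h3
  have h4 : 0 < ρ * crs (P.edgeVec e) D := by
    rw [← h3]
    nlinarith [S.crs_e_p, S.crs_e_q, mul_pos (sub_pos.2 hβ1) S.crs_e_p, mul_pos hβ0 S.crs_e_q]
  exact (pos_iff_pos_of_mul_pos h4).2 S.pos

lemma exists_f : ∃ κ : ℝ, 0 < κ ∧ q₁ - p₁ = κ * P.edgeVec f := by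
  obtain ⟨κ, hκ⟩ := P.crs_edgeVec_eq_zero (P.openEdge_subset _ S.hp₁) (P.openEdge_subset _ S.hq₁)
  refine ⟨κ, ?_, hκ⟩
  obtain ⟨α, β, ρ, h0, h1, -, -, hρ, -, hz⟩ := S.exists_line
  have h3 := congrArg (fun z => crs (P.edgeVec f) (z - (p + α * (q - p)))) hz
  simp only [add_sub_cancel_left, crs_real_mul_right] at h3
  rw [show p₁ + β * (q₁ - p₁) - (p + α * (q - p)) =
    ((1 - α : ℝ) * (p₁ - p) + α * (q₁ - q)) + ((β - α : ℝ) * (q₁ - p₁)) by push_cast; ring,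
    hκ, crs_add_right, crs_add_right] at h3
  simp only [crs_real_mul_right, crs_self] at h3
  have h4 : ρ * crs (P.edgeVec f) D < 0 := by
    rw [← h3]
    nlinarith [S.crs_f_p, S.crs_f_q, mul_pos (sub_pos.2 h1) (neg_pos.2 S.crs_f_p),
      mul_pos h0 (neg_pos.2 S.crs_f_q)]
  have h5 : 0 < crs D (P.edgeVec f) := by
    rw [crs_anti]; nlinarith
  have h6 : 0 < crs D (q₁ - p₁) := by rw [crs_sub_right]; linarith [S.ltp₁, S.ltq₁]
  rw [hκ, crs_real_mul_right] at h6
  exact (pos_iff_pos_of_mul_pos h6).2 h5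

lemma crs_p_e : 0 < crs (p₁ - p) (q - p) := by
  obtain ⟨κ, hκ, h⟩ := S.exists_e
  rw [h, crs_real_mul_right, crs_anti]; nlinarith [S.crs_e_p]
lemma crs_q_e : 0 < crs (q₁ - q) (q - p) := by
  obtain ⟨κ, hκ, h⟩ := S.exists_e
  rw [h, crs_real_mul_right, crs_anti]; nlinarith [S.crs_e_q]
lemma crs_p_f : 0 < crs (p₁ - p) (q₁ - p₁) := by
  obtain ⟨κ, hκ, h⟩ := S.exists_f
  rw [h, crs_real_mul_right, crs_anti]; nlinarith [S.crs_f_p]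
lemma crs_q_f : 0 < crs (q₁ - q) (q₁ - p₁) := by
  obtain ⟨κ, hκ, h⟩ := S.exists_f
  rw [h, crs_real_mul_right, crs_anti]; nlinarith [S.crs_f_q]

lemma openSegment_e {t : ℝ} (h0 : 0 ≤ t) (h1 : t ≤ 1) : p + t * (q - p) ∈ P.openEdge e :=
  (convex_openSegment _ _).segment_subset S.hp S.hq (mem_segment_iff_add.2 ⟨t, h0, h1, rfl⟩)
lemma openSegment_f {t : ℝ} (h0 : 0 ≤ t) (h1 : t ≤ 1) : p₁ + t * (q₁ - p₁) ∈ P.openEdge f :=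
  (convex_openSegment _ _).segment_subset S.hp₁ S.hq₁ (mem_segment_iff_add.2 ⟨t, h0, h1, rfl⟩)

lemma e_ne_f : e ≠ f := P.edge_ne_of_openSegment S.hp (P.openEdge_subset _ S.hp₁) S.segp

/-- The quadrangle between the two segments. -/
lemma edge_subset_quad {h : Fin n} (hhe : h ≠ e) (hhf : h ≠ f) {z₀ : ℂ} (hz₀ : z₀ ∈ P.closedEdge h)
    (h1 : 0 < crs (p₁ - p) (z₀ - p)) (h2 : crs (q₁ - q) (z₀ - q) < 0)
    (h3 : 0 < crs (P.edgeVec e) (z₀ - p)) (h4 : 0 < crs (P.edgeVec f) (z₀ - p₁)) {z : ℂ}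
    (hz : z ∈ P.closedEdge h) : 0 < crs (p₁ - p) (z - p) ∧ crs (q₁ - q) (z - q) < 0 ∧
      0 < crs (P.edgeVec e) (z - p) := by
  -- `U` is the open quadrangle with the corners `p`, `q`, `q₁`, `p₁`. The edge `h` is connected, so
  -- in order to leave `U` it would have to meet a side; but two sides are billiard segments and the
  -- other two are parts of the open edges `e` and `f`.
  set U : Set ℂ := {z | 0 < crs (p₁ - p) (z - p)} ∩ {z | crs (q₁ - q) (z - q) < 0} ∩
    {z | 0 < crs (P.edgeVec e) (z - p)} ∩ {z | 0 < crs (P.edgeVec f) (z - p₁)} with hU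
  have hUo : IsOpen U := by
    refine ((IsOpen.inter ?_ ?_).inter ?_).inter ?_
    · exact isOpen_lt continuous_const (by fun_prop)
    · exact isOpen_lt (by fun_prop) continuous_const
    · exact isOpen_lt continuous_const (by fun_prop)
    · exact isOpen_lt continuous_const (by fun_prop)
  by_cases hzU : z ∈ U
  · exact ⟨hzU.1.1.1, hzU.1.1.2, hzU.1.2⟩
  exfalso
  obtain ⟨y, hy, hyU⟩ := (convex_segment (𝕜 := ℝ) (P.vertex h) (P.vertex (P.next h))).isPreconnected.exists_mem_frontier
    hUo hz₀ ⟨⟨⟨h1, h2⟩, h3⟩, h4⟩ hz hzU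
  have hyn : y ∉ U := by rw [hUo.frontier_eq] at hyU; exact hyU.2
  have hcl : closure U ⊆ {z | 0 ≤ crs (p₁ - p) (z - p)} ∩ {z | crs (q₁ - q) (z - q) ≤ 0} ∩
      {z | 0 ≤ crs (P.edgeVec e) (z - p)} ∩ {z | 0 ≤ crs (P.edgeVec f) (z - p₁)} := by
    refine closure_minimal (fun z hz => ⟨⟨⟨?_, ?_⟩, ?_⟩, ?_⟩) (((IsClosed.inter ?_ ?_).inter ?_).inter ?_)
    · exact le_of_lt (α := ℝ) hz.1.1.1
    · exact le_of_lt (α := ℝ) hz.1.1.2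
    · exact le_of_lt (α := ℝ) hz.1.2
    · exact le_of_lt (α := ℝ) hz.2
    · exact isClosed_le continuous_const (by fun_prop)
    · exact isClosed_le (by fun_prop) continuous_const
    · exact isClosed_le continuous_const (by fun_prop)
    · exact isClosed_le continuous_const (by fun_prop)
  obtain ⟨⟨⟨g1, g2⟩, g3⟩, g4⟩ := hcl (frontier_subset_closure hyU)
  simp only [mem_ofPred_eq] at g1 g2 g3 g4
  have hnoe : y ∉ P.openEdge e := fun hc => hhe (P.openEdge_inter_closedEdge hc hy).symm
  have hnof : y ∉ P.openEdge f := fun hc => hhf (P.openEdge_inter_closedEdge hc hy).symm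
  have hnoi : y ∉ P.interior := fun hc => P.notMem_closedEdge_of_mem hc h hy
  have key : ∀ a b : ℂ, openSegment ℝ a b ⊆ P.interior → a ∈ P.openEdge e → b ∈ P.openEdge f →
      y ∉ segment ℝ a b := by
    intro a b hab ha hb hc
    rcases eq_or_ne a y with rfl | hay
    · exact hnoe ha
    rcases eq_or_ne b y with rfl | hby
    · exact hnof hb
    · exact hnoi (hab (mem_openSegment_of_ne_left_right hay hby hc))
  have ne_of {a b : ℂ} {x : ℂ} (h : 0 < crs x (a - b)) : a - b ≠ 0 := by
    rintro h0; rw [h0, crs_zero_right] at h; exact h.false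
  rcases g1.eq_or_lt with h | g1'
  · obtain ⟨r, hr⟩ := eq_real_mul_of_crs_eq_zero (ne_of S.crs_e_p) h.symm
    refine key p p₁ S.segp S.hp S.hp₁ (mem_segment_iff_add.2 ⟨r, ?_, ?_, by rw [← hr]; ring⟩)
    · rw [hr, crs_real_mul_right] at g3
      nlinarith [S.crs_e_p]
    · rw [show y - p₁ = (r - 1 : ℝ) * (p₁ - p) by
        rw [Complex.ofReal_sub, sub_mul, ← hr]; push_cast; ring, crs_real_mul_right] at g4
      nlinarith [S.crs_f_p]
  rcases g2.eq_or_lt with h | g2'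
  · obtain ⟨r, hr⟩ := eq_real_mul_of_crs_eq_zero (ne_of S.crs_e_q) h
    obtain ⟨κ, hκ, he⟩ := S.exists_e
    obtain ⟨κ₁, hκ₁, hf⟩ := S.exists_f
    refine key q q₁ S.segq S.hq S.hq₁ (mem_segment_iff_add.2 ⟨r, ?_, ?_, by rw [← hr]; ring⟩)
    · rw [show y - p = (y - q) + (q - p) by ring, he, hr, crs_add_right, crs_real_mul_right,
        crs_real_mul_right, crs_self] at g3
      nlinarith [S.crs_e_q]
    · rw [show y - p₁ = (r - 1 : ℝ) * (q₁ - q) + (q₁ - p₁) by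
        rw [Complex.ofReal_sub, sub_mul, ← hr]; push_cast; ring, crs_add_right, hf,
        crs_real_mul_right, crs_real_mul_right, crs_self] at g4
      nlinarith [S.crs_f_q]
  rcases g3.eq_or_lt with h | g3'
  · obtain ⟨κ, hκ, he⟩ := S.exists_e
    have h5 : crs (q - p) (y - p) = 0 := by rw [he, crs_real_mul_left, ← h, mul_zero]
    obtain ⟨r, hr⟩ := eq_real_mul_of_crs_eq_zero (ne_of S.crs_p_e) h5
    have hy : y = p + r * (q - p) := by rw [← hr]; ring
    refine hnoe (hy ▸ S.openSegment_e ?_ ?_)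
    · rw [hr, crs_real_mul_right] at g1'
      exact ((pos_iff_pos_of_mul_pos g1').2 S.crs_p_e).le
    · rw [show y - q = (r - 1 : ℝ) * (q - p) by
        rw [Complex.ofReal_sub, sub_mul, ← hr]; push_cast; ring, crs_real_mul_right] at g2'
      nlinarith [S.crs_q_e]
  rcases g4.eq_or_lt with h | g4'
  · obtain ⟨κ, hκ, hf⟩ := S.exists_f
    have h5 : crs (q₁ - p₁) (y - p₁) = 0 := by rw [hf, crs_real_mul_left, ← h, mul_zero]
    obtain ⟨r, hr⟩ := eq_real_mul_of_crs_eq_zero (ne_of S.crs_p_f) h5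
    have hy : y = p₁ + r * (q₁ - p₁) := by rw [← hr]; ring
    refine hnof (hy ▸ S.openSegment_f ?_ ?_)
    · rw [show y - p = (p₁ - p) + (y - p₁) by ring, crs_add_right, crs_self, hr,
        crs_real_mul_right, zero_add] at g1'
      exact ((pos_iff_pos_of_mul_pos g1').2 S.crs_p_f).le
    · rw [show y - q = (q₁ - q) + (r - 1 : ℝ) * (q₁ - p₁) by
        rw [Complex.ofReal_sub, sub_mul, ← hr]; push_cast; ring, crs_add_right, crs_self,
        crs_real_mul_right] at g2'
      nlinarith [S.crs_q_f]
  exact hyn ⟨⟨⟨g1', g2'⟩, g3'⟩, g4'⟩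

/-- The billiard segments end at inner points of `f`, so the endpoints of `f` lie on different sides
of each of them; the orientation of `f` tells which endpoint is on which side. -/
lemma endpoints : crs (p₁ - p) (P.vertex f - p) < 0 ∧
    0 < crs (q₁ - q) (P.vertex (P.next f) - q) := by
  obtain ⟨t, h0, h1, ht⟩ := P.mem_openEdge.1 S.hp₁
  obtain ⟨t', h0', h1', ht'⟩ := P.mem_openEdge.1 S.hq₁
  constructor
  · rw [show P.vertex f - p = (p₁ - p) - t * P.edgeVec f by rw [ht]; ring, crs_sub_right, crs_self,
      crs_real_mul_right, crs_anti]
    nlinarith [S.crs_f_p]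
  · rw [show P.vertex (P.next f) - q = (q₁ - q) + (1 - t' : ℝ) * P.edgeVec f by
      rw [ht']; simp only [edgeVec]; push_cast; ring, crs_add_right, crs_self,
      crs_real_mul_right, crs_anti]
    nlinarith [S.crs_f_q]

/-- If the line of a strip meets another edge before the end of the strip, then the edge lies
between the two segments of the strip. -/
lemma between (S' : P.Strip e g D c p' q' p₁' q₁') (hfg : f ≠ g) {α β ρ α' β' ρ' : ℝ}
    (hβ0 : 0 < β) (hβ1 : β < 1) (hρ : 0 < ρ) (hz : crs D (p + α * (q - p)) = c)
    (hz₁ : p₁ + β * (q₁ - p₁) = p + α * (q - p) + ρ * D)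
    (hα0' : 0 < α') (hα1' : α' < 1) (hβ0' : 0 < β') (hβ1' : β' < 1)
    (hz' : crs D (p' + α' * (q' - p')) = c)
    (hz₁' : p₁' + β' * (q₁' - p₁') = p' + α' * (q' - p') + ρ' * D) (hlt : ρ < ρ') :
    ∀ z ∈ P.closedEdge f, 0 < crs (p₁' - p') (z - p') ∧ crs (q₁' - q') (z - q') < 0 ∧
      0 < crs (P.edgeVec e) (z - p') := by
  obtain ⟨κ, -, hκ⟩ := S.exists_e
  obtain ⟨κ', -, hκ'⟩ := S'.exists_e
  obtain ⟨μ, -, hμ⟩ := S'.exists_f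
  -- The line crosses the common starting edge only once, so both strips start from the same point
  -- of the line.
  have hzz : p + α * (q - p) = p' + α' * (q' - p') := by
    obtain ⟨r, hr⟩ := P.crs_edgeVec_eq_zero (P.openEdge_subset _ S'.hp) (P.openEdge_subset _ S.hp)
    have h1 : p + α * (q - p) - (p' + α' * (q' - p')) =
        (r + α * κ - α' * κ' : ℝ) * P.edgeVec e := by
      rw [hκ, hκ', show p = p' + r * P.edgeVec e by rw [← hr]; ring]; push_cast; ring
    have h2 : (r + α * κ - α' * κ' : ℝ) * crs D (P.edgeVec e) = 0 := by
      rw [← crs_real_mul_right, ← h1, crs_sub_right, hz, hz', sub_self]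
    have h3 : crs D (P.edgeVec e) ≠ 0 := by rw [crs_anti]; linarith [S.pos]
    rw [(mul_eq_zero.1 h2).resolve_right h3, Complex.ofReal_zero, zero_mul] at h1
    exact sub_eq_zero.1 h1
  set z := p' + α' * (q' - p') with hzd
  have hzf : z + ρ * D ∈ P.closedEdge f := by
    rw [← hzz, ← hz₁]; exact P.openEdge_subset _ (S.openSegment_f hβ0.le hβ1.le)
  -- The line meets `f` after the fraction `τ < 1` of its way from `e` to `g`. So this point of `f`
  -- is a proper convex combination of inner points of two opposite sides of the second quadrangle,
  -- hence inside it.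
  set τ := ρ / ρ' with hτ
  have hρ' : 0 < ρ' := hρ.trans hlt
  have hτ0 : 0 < τ := div_pos hρ hρ'
  have hτ1 : τ < 1 := (div_lt_one hρ').2 hlt
  have hmix : z + ρ * D = (1 - τ : ℝ) * z + τ * (p₁' + β' * (q₁' - p₁')) := by
    rw [hz₁', hτ]
    have : (ρ' : ℂ) ≠ 0 := by exact_mod_cast hρ'.ne'
    push_cast; field_simp; ring
  have aff : ∀ a b : ℂ, crs a (z + ρ * D - b) =
      (1 - τ) * crs a (z - b) + τ * crs a (p₁' + β' * (q₁' - p₁') - b) := by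
    intro a b
    rw [hmix, show ((1 - τ : ℝ) * z + τ * (p₁' + β' * (q₁' - p₁')) - b : ℂ) =
      (1 - τ : ℝ) * (z - b) + τ * (p₁' + β' * (q₁' - p₁') - b) by push_cast; ring, crs_add_right,
      crs_real_mul_right, crs_real_mul_right]
  refine fun y hy => S'.edge_subset_quad (h := f) S.e_ne_f.symm hfg hzf ?_ ?_ ?_ ?_ hy
  · rw [aff, show z - p' = α' * (q' - p') by rw [hzd]; ring,
      show p₁' + β' * (q₁' - p₁') - p' = (p₁' - p') + β' * (q₁' - p₁') by ring, crs_add_right,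
      crs_self, crs_real_mul_right, crs_real_mul_right, zero_add]
    have := mul_pos hα0' S'.crs_p_e
    have := mul_pos hβ0' S'.crs_p_f
    have := sub_pos.2 hτ1
    positivity
  · rw [aff, show z - q' = -((1 - α' : ℝ) * (q' - p')) by rw [hzd]; push_cast; ring,
      show p₁' + β' * (q₁' - p₁') - q' = (q₁' - q') + -((1 - β' : ℝ) * (q₁' - p₁')) by
        push_cast; ring, crs_add_right,
      crs_self, crs_neg_right, crs_neg_right, crs_real_mul_right, crs_real_mul_right, zero_add]
    have := mul_pos (sub_pos.2 hτ1) (mul_pos (sub_pos.2 hα1') S'.crs_q_e)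
    have := mul_pos hτ0 (mul_pos (sub_pos.2 hβ1') S'.crs_q_f)
    linarith
  · rw [aff, show z - p' = α' * (q' - p') by rw [hzd]; ring, hκ',
      show p₁' + β' * (q₁' - p₁') - p' = (1 - β' : ℝ) * (p₁' - p') + β' * (q₁' - q') +
        β' * (q' - p') by push_cast; ring, hκ', crs_add_right, crs_add_right]
    simp only [crs_real_mul_right, crs_self]
    have := mul_pos hτ0 (mul_pos (sub_pos.2 hβ1') S'.crs_e_p)
    have := mul_pos hτ0 (mul_pos hβ0' S'.crs_e_q)
    linarith
  · rw [aff, show p₁' + β' * (q₁' - p₁') - p₁' = β' * (q₁' - p₁') by ring,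
      show z - p₁' = -((1 - α' : ℝ) * (p₁' - p') + α' * (q₁' - q')) +
        α' * (q₁' - p₁') by rw [hzd]; push_cast; ring, hμ, crs_add_right, crs_neg_right,
        crs_add_right]
    simp only [crs_real_mul_right, crs_self]
    have := mul_pos (sub_pos.2 hτ1) (mul_pos (sub_pos.2 hα1') (neg_pos.2 S'.crs_f_p))
    have := mul_pos (sub_pos.2 hτ1) (mul_pos hα0' (neg_pos.2 S'.crs_f_q))
    linarith

/-- Two strips on the same line that leave the same edge and end on different edges are separated
by vertices. -/
lemma branch (S' : P.Strip e g D c p' q' p₁' q₁') (hfg : f ≠ g) :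
    ∃ i j, 0 < crs (P.edgeVec e) (P.vertex i - p) ∧ 0 < crs (P.edgeVec e) (P.vertex j - p) ∧
      ((crs (p₁ - p) (P.vertex i - p) < 0 ∧ 0 < crs (p₁' - p') (P.vertex i - p') ∧
          0 < crs (q₁ - q) (P.vertex j - q) ∧ crs (q₁' - q') (P.vertex j - q') < 0) ∨
        (crs (p₁' - p') (P.vertex i - p') < 0 ∧ 0 < crs (p₁ - p) (P.vertex i - p) ∧
          0 < crs (q₁' - q') (P.vertex j - q') ∧ crs (q₁ - q) (P.vertex j - q) < 0)) := by
  obtain ⟨α, β, ρ, hα0, hα1, hβ0, hβ1, hρ, hz, hz₁⟩ := S.exists_line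
  obtain ⟨α', β', ρ', hα0', hα1', hβ0', hβ1', hρ', hz', hz₁'⟩ := S'.exists_line
  have hsub : ∀ y, crs (P.edgeVec e) (y - p) = crs (P.edgeVec e) (y - p') := by
    intro y
    obtain ⟨r, hr⟩ := P.crs_edgeVec_eq_zero (P.openEdge_subset _ S.hp) (P.openEdge_subset _ S'.hp)
    rw [show y - p = (y - p') + (p' - p) by ring, crs_add_right, hr, crs_real_mul_right, crs_self]
    ring
  -- The edge that the line reaches first lies in the quadrangle of the other strip, and its two
  -- endpoints are the vertices wanted. If both edges were reached at once, they would have a common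
  -- inner point.
  rcases lt_trichotomy ρ ρ' with hlt | heq | hlt
  · have h := S.between S' hfg hβ0 hβ1 hρ hz hz₁ hα0' hα1' hβ0' hβ1' hz' hz₁' hlt
    have h1 := h _ (P.vertex_mem_closedEdge f)
    have h2 := h _ (P.vertex_next_mem_closedEdge f)
    exact ⟨f, P.next f, by rw [hsub]; exact h1.2.2, by rw [hsub]; exact h2.2.2,
      Or.inl ⟨S.endpoints.1, h1.1, S.endpoints.2, h2.2.1⟩⟩
  · exfalso
    obtain ⟨κ, -, hκ⟩ := S.exists_e
    obtain ⟨κ', -, hκ'⟩ := S'.exists_e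
    obtain ⟨r, hr⟩ := P.crs_edgeVec_eq_zero (P.openEdge_subset _ S'.hp) (P.openEdge_subset _ S.hp)
    have h1 : p + α * (q - p) - (p' + α' * (q' - p')) =
        (r + α * κ - α' * κ' : ℝ) * P.edgeVec e := by
      rw [hκ, hκ', show p = p' + r * P.edgeVec e by rw [← hr]; ring]; push_cast; ring
    have h2 : (r + α * κ - α' * κ' : ℝ) * crs D (P.edgeVec e) = 0 := by
      rw [← crs_real_mul_right, ← h1, crs_sub_right, hz, hz', sub_self]
    have h3 : crs D (P.edgeVec e) ≠ 0 := by rw [crs_anti]; linarith [S.pos]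
    rw [(mul_eq_zero.1 h2).resolve_right h3, Complex.ofReal_zero, zero_mul] at h1
    have h4 : p₁ + β * (q₁ - p₁) = p₁' + β' * (q₁' - p₁') := by
      rw [hz₁, hz₁', sub_eq_zero.1 h1, heq]
    have h5 := S.openSegment_f hβ0.le hβ1.le
    rw [h4] at h5
    exact hfg (P.openEdge_inter_closedEdge h5 (P.openEdge_subset _
      (S'.openSegment_f hβ0'.le hβ1'.le)))
  · have h := S'.between S hfg.symm hβ0' hβ1' hρ' hz' hz₁' hα0 hα1 hβ0 hβ1 hz hz₁ hlt
    have h1 := h _ (P.vertex_mem_closedEdge g)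
    have h2 := h _ (P.vertex_next_mem_closedEdge g)
    exact ⟨g, P.next g, h1.2.2, h2.2.2, Or.inr ⟨S'.endpoints.1, h1.1, S'.endpoints.2, h2.2.1⟩⟩

end Strip
end PolygonalTable

/-! ### Separation of limit orbits -/

/-- Expresses heights over a line of direction `d'` by coordinates along and across `d`; it measures
how heights change when a line is turned slightly. -/
lemma crs_of_dir {d : ℂ} (hd : ‖d‖ = 1) (d' z : ℂ) :
    crs d' z = dotp d d' * crs d z - crs d d' * dotp d z := by
  have h := dotp_self d
  rw [hd] at h
  simp only [dotp, crs] at *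
  linear_combination (-(d'.re * z.im - d'.im * z.re)) * h

/-- The height of the point `z` over the oriented line in which the orbit `x` starts. -/
def Orb.side {n : ℕ} (x : Orb n) (z : ℂ) : ℝ := crs (x.dir 0) (z - x.pos 0)

namespace PolygonalTable
variable {n : ℕ} {P : PolygonalTable n}

lemma tendsto_side {y : ℕ → Orb n} {x : Orb n} (h : Tendsto y atTop (𝓝 x)) (z : ℂ) :
    Tendsto (fun k => (y k).side z) atTop (𝓝 (x.side z)) :=
  (((Orb.continuous_dir 0).crs (continuous_const.sub (Orb.continuous_pos 0))).tendsto x).comp h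

/-- Strict signs at the finitely many vertices for the approximating orbits survive in the limit as
weak signs. -/
lemma eventually_side {y : ℕ → Orb n} {x : Orb n} (h : Tendsto y atTop (𝓝 x)) (v : Fin n → ℂ) :
    ∀ᶠ k in atTop, ∀ i, ((y k).side (v i) < 0 → x.side (v i) ≤ 0) ∧
      (0 < (y k).side (v i) → 0 ≤ x.side (v i)) := by
  refine eventually_all.2 fun i => ?_
  rcases lt_trichotomy (x.side (v i)) 0 with h0 | h0 | h0
  · filter_upwards [(tendsto_side h (v i)).eventually (gt_mem_nhds h0)] with k hk
    exact ⟨fun _ => h0.le, fun hc => absurd hc hk.not_gt⟩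
  · exact Eventually.of_forall fun k => ⟨fun _ => h0.le, fun _ => h0.ge⟩
  · filter_upwards [(tendsto_side h (v i)).eventually (lt_mem_nhds h0)] with k hk
    exact ⟨fun hc => absurd hc hk.not_gt, fun _ => h0.le⟩

lemma crs_segment_eq {x : Orb n} (hx : x ∈ P.orbits) (z : ℂ) :
    crs (x.pos 1 - x.pos 0) (z - x.pos 0) = x.step 0 * x.side z := by
  have h := pos_succ hx 0
  rw [zero_add] at h
  rw [h, add_sub_cancel_left, crs_real_mul_left]; rfl

section
variable {x y : Orb n} (hx : x ∈ P.limOrbits) (hy : y ∈ P.limOrbits)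
  (he : y.edge 0 = x.edge 0)
include hx hy he

/-- A limit orbit may run along its edge. But if another bounce point on the same edge is off its
line, the line is transversal to the edge, and then the direction points inwards. -/
lemma crs_edgeVec_dir_pos (h : crs (x.dir 0) (y.pos 0 - x.pos 0) ≠ 0) :
    0 < crs (P.edgeVec (x.edge 0)) (x.dir 0) := by
  obtain ⟨r, hr⟩ := P.crs_edgeVec_eq_zero (lim_pos_mem hx 0) (he ▸ lim_pos_mem hy 0)
  rw [hr, crs_real_mul_right, crs_anti] at h
  refine (lim_crs_nonneg hx 0).lt_of_ne fun h0 => h ?_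
  rw [← h0]; simp

lemma pos_eq_of_crs_eq_zero (hpos : 0 < crs (P.edgeVec (x.edge 0)) (x.dir 0))
    (h : crs (x.dir 0) (y.pos 0 - x.pos 0) = 0) : y.pos 0 = x.pos 0 := by
  obtain ⟨r, hr⟩ := P.crs_edgeVec_eq_zero (lim_pos_mem hx 0) (he ▸ lim_pos_mem hy 0)
  rw [hr, crs_real_mul_right, crs_anti] at h
  have : r = 0 := (mul_eq_zero.1 h).resolve_right (by linarith)
  rw [this] at hr
  simpa [sub_eq_zero] using hr

/-- Both orbits are on the same line here, so a vertex that is weakly above one and weakly below the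
other lies on this line. It is ahead of the starting point because it is on the inner side of the
edge. -/
lemma exists_on_line (hpos : 0 < crs (P.edgeVec (x.edge 0)) (x.dir 0)) (hd : y.dir 0 = x.dir 0)
    (h : crs (x.dir 0) (y.pos 0 - x.pos 0) = 0) {i : Fin n}
    (hi : 0 ≤ crs (P.edgeVec (x.edge 0)) (P.vertex i - x.pos 0))
    (hs : (x.side (P.vertex i) ≤ 0 ∧ 0 ≤ y.side (P.vertex i)) ∨
      (y.side (P.vertex i) ≤ 0 ∧ 0 ≤ x.side (P.vertex i))) :
    ∃ r : ℝ, 0 ≤ r ∧ r ≤ P.diam ∧ P.vertex i = x.pos 0 + r * x.dir 0 ∧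
      P.vertex i = y.pos 0 + r * y.dir 0 := by
  have hp := pos_eq_of_crs_eq_zero hx hy he hpos h
  have hs0 : x.side (P.vertex i) = 0 := by
    have : y.side (P.vertex i) = x.side (P.vertex i) := by unfold Orb.side; rw [hd, hp]
    rw [this] at hs
    rcases hs with hs | hs <;> linarith [hs.1, hs.2]
  obtain ⟨r, hr⟩ := eq_real_mul_of_crs_eq_zero
    (norm_ne_zero_iff.1 (by rw [lim_norm_dir hx 0]; norm_num)) hs0
  have hr0 : 0 ≤ r := by
    rw [hr, crs_real_mul_right] at hi
    by_contra hc
    push Not at hc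
    nlinarith
  refine ⟨r, hr0, ?_, by rw [← hr]; ring, by rw [hp, hd, ← hr]; ring⟩
  have h1 := P.norm_sub_le_diam (lim_pos_mem hx 0) (P.vertex_mem_closedEdge i)
  rwa [hr, norm_mul, lim_norm_dir hx, mul_one, Complex.norm_real, Real.norm_of_nonneg hr0] at h1

end

section
variable {x y x' y' : Orb n} (hx : x ∈ P.limOrbits) (hy : y ∈ P.limOrbits)
  (hx' : x' ∈ P.limOrbits) (hy' : y' ∈ P.limOrbits)
  (he : y.edge 0 = x.edge 0) (he' : x'.edge 0 = x.edge 0) (he'' : y'.edge 0 = x.edge 0)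
  (hf : y.edge 1 = x.edge 1) (hg : y'.edge 1 = x'.edge 1) (hfg : x.edge 1 ≠ x'.edge 1)
  (hd : y.dir 0 = x.dir 0) (hd' : y'.dir 0 = x'.dir 0) {w : ℝ}
  (hw : crs (x.dir 0) (y.pos 0 - x.pos 0) = w) (hw' : crs (x'.dir 0) (y'.pos 0 - x'.pos 0) = w)
include hx hy hx' hy' he he' he'' hf hg hfg hd hd' hw hw'

/-- `Strip.branch` is applied to nonsingular orbits close to the four limit orbits. The strict signs
are kept for the approximations, since they detect on which side of the vertex these pass; only the
weak signs hold for the limits. -/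
lemma limit_branch_signs (h0 : 0 < w) (h1 : |crs (x.dir 0) (x'.pos 0 - x.pos 0)| < w / 4)
    (h2 : P.diam * ‖x'.dir 0 - x.dir 0‖ < w / 8) {R S R' S' : ℕ → Orb n}
    (hR : ∀ k, R k ∈ P.orbits) (hS : ∀ k, S k ∈ P.orbits) (hR' : ∀ k, R' k ∈ P.orbits)
    (hS' : ∀ k, S' k ∈ P.orbits) (tR : Tendsto R atTop (𝓝 x)) (tS : Tendsto S atTop (𝓝 y))
    (tR' : Tendsto R' atTop (𝓝 x')) (tS' : Tendsto S' atTop (𝓝 y')) :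
    ∀ᶠ k in atTop, ∃ i j, 0 ≤ crs (P.edgeVec (x.edge 0)) (P.vertex i - x.pos 0) ∧
      0 ≤ crs (P.edgeVec (x.edge 0)) (P.vertex j - y.pos 0) ∧
      (R k).side (P.vertex i) * (R' k).side (P.vertex i) < 0 ∧
      (S k).side (P.vertex j) * (S' k).side (P.vertex j) < 0 ∧
      ((x.side (P.vertex i) ≤ 0 ∧ 0 ≤ x'.side (P.vertex i) ∧
        0 ≤ y.side (P.vertex j) ∧ y'.side (P.vertex j) ≤ 0) ∨
      (x'.side (P.vertex i) ≤ 0 ∧ 0 ≤ x.side (P.vertex i) ∧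
        0 ≤ y'.side (P.vertex j) ∧ y.side (P.vertex j) ≤ 0)) := by
  set D := x.dir 0 with hD
  have hpos : 0 < crs (P.edgeVec (x.edge 0)) D :=
    crs_edgeVec_dir_pos hx hy he (by rw [hw]; exact h0.ne')
  have hnD : ‖D‖ = 1 := lim_norm_dir hx 0
  have hdia := P.diam_pos
  have hsucc : ∀ {u : Orb n}, u ∈ P.limOrbits → u.pos 1 = u.pos 0 + u.step 0 * u.dir 0 := by
    intro u hu; simpa using lim_pos_succ hu 0
  have hstep : ∀ {u : Orb n}, u ∈ P.limOrbits → u.step 0 ≤ P.diam := by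
    intro u hu
    exact P.norm_sub_le_diam (lim_pos_mem hu 0) (lim_pos_mem hu (0 + 1))
  have hcD : |crs D (x'.dir 0)| ≤ ‖x'.dir 0 - D‖ := by
    have := abs_crs_le D (x'.dir 0 - D)
    rwa [crs_sub_right, crs_self, sub_zero, hnD, one_mul] at this
  have hst : ∀ {u : Orb n}, u ∈ P.limOrbits → |u.step 0 * crs D (x'.dir 0)| < w / 8 := by
    intro u hu
    rw [abs_mul, abs_of_nonneg (u.step_nonneg 0)]
    exact lt_of_le_of_lt (mul_le_mul (hstep hu) hcD (abs_nonneg _) hdia.le) h2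
  -- The line of the strips runs halfway between `x` and `y`. The tolerances are used up exactly:
  -- `x'` is displaced by less than w/4 and turned by less than w/8, and the distance from `x'` to
  -- `y'` changes by less than w/8, measured along the old direction.
  have c0 : crs D (x.pos 0) < crs D (x.pos 0) + w / 2 := by linarith
  have c1 : crs D (x.pos 1) < crs D (x.pos 0) + w / 2 := by
    rw [hsucc hx, crs_add_right, crs_real_mul_right, ← hD, crs_self]; linarith
  have c2 : crs D (x.pos 0) + w / 2 < crs D (y.pos 0) := by
    rw [crs_sub_right] at hw; linarith
  have c3 : crs D (x.pos 0) + w / 2 < crs D (y.pos 1) := by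
    rw [hsucc hy, crs_add_right, crs_real_mul_right, hd, crs_self]; linarith
  rw [crs_sub_right] at h1
  have a1 := abs_lt.1 h1
  have c4 : crs D (x'.pos 0) < crs D (x.pos 0) + w / 2 := by linarith
  have c5 : crs D (x'.pos 1) < crs D (x.pos 0) + w / 2 := by
    rw [hsucc hx', crs_add_right, crs_real_mul_right]
    linarith [abs_lt.1 (hst hx')]
  have hyx : |crs D (y'.pos 0 - x'.pos 0) - w| < w / 8 := by
    rw [show crs D (y'.pos 0 - x'.pos 0) - w = crs (D - x'.dir 0) (y'.pos 0 - x'.pos 0) by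
      rw [crs_sub_left, hw']]
    refine (abs_crs_le _ _).trans_lt (lt_of_le_of_lt ?_ h2)
    rw [norm_sub_rev, mul_comm]
    exact mul_le_mul_of_nonneg_right (P.norm_sub_le_diam (lim_pos_mem hx' 0) (lim_pos_mem hy' 0))
      (norm_nonneg _)
  rw [crs_sub_right] at hyx
  have a2 := abs_lt.1 hyx
  have c6 : crs D (x.pos 0) + w / 2 < crs D (y'.pos 0) := by linarith
  have c7 : crs D (x.pos 0) + w / 2 < crs D (y'.pos 1) := by
    rw [hsucc hy', crs_add_right, crs_real_mul_right, hd']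
    linarith [abs_lt.1 (hst hy')]
  set c := crs D (x.pos 0) + w / 2
  have tp : ∀ {U : ℕ → Orb n} {u : Orb n}, Tendsto U atTop (𝓝 u) → ∀ m : ℤ,
      Tendsto (fun k => crs D ((U k).pos m)) atTop (𝓝 (crs D (u.pos m))) := fun hU m =>
    ((continuous_const.crs (Orb.continuous_pos m)).tendsto _).comp hU
  have tlt : ∀ {U : ℕ → Orb n} {u : Orb n}, Tendsto U atTop (𝓝 u) → ∀ {m : ℤ}, crs D (u.pos m) < c →
      ∀ᶠ k in atTop, crs D ((U k).pos m) < c := fun hU m hm =>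
    (tp hU m).eventually (gt_mem_nhds hm)
  have tgt : ∀ {U : ℕ → Orb n} {u : Orb n}, Tendsto U atTop (𝓝 u) → ∀ {m : ℤ}, c < crs D (u.pos m) →
      ∀ᶠ k in atTop, c < crs D ((U k).pos m) := fun hU m hm =>
    (tp hU m).eventually (lt_mem_nhds hm)
  have hcd : 0 < crs (P.edgeVec (x.edge 0)) D := hpos
  filter_upwards [Orb.eventually_edge tR 0, Orb.eventually_edge tS 0, Orb.eventually_edge tR' 0,
    Orb.eventually_edge tS' 0, Orb.eventually_edge tR 1, Orb.eventually_edge tS 1,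
    Orb.eventually_edge tR' 1, Orb.eventually_edge tS' 1, tlt tR c0, tlt tR c1, tgt tS c2,
    tgt tS c3, tlt tR' c4, tlt tR' c5, tgt tS' c6, tgt tS' c7, eventually_side tR P.vertex,
    eventually_side tS P.vertex, eventually_side tR' P.vertex, eventually_side tS' P.vertex]
    with k e1 e2 e3 e4 e5 e6 e7 e8 b0 b1 b2 b3 b4 b5 b6 b7 s1 s2 s3 s4
  have st1 : P.Strip (x.edge 0) (x.edge 1) D c ((R k).pos 0) ((S k).pos 0) ((R k).pos 1)
      ((S k).pos 1) :=
    ⟨e1 ▸ pos_mem (hR k) 0, he ▸ e2 ▸ pos_mem (hS k) 0, e5 ▸ pos_mem (hR k) 1,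
      hf ▸ e6 ▸ pos_mem (hS k) 1, segment_subset (hR k) 0, segment_subset (hS k) 0,
      b0, b1, b2, b3, hcd⟩
  have st2 : P.Strip (x.edge 0) (x'.edge 1) D c ((R' k).pos 0) ((S' k).pos 0) ((R' k).pos 1)
      ((S' k).pos 1) :=
    ⟨he' ▸ e3 ▸ pos_mem (hR' k) 0, he'' ▸ e4 ▸ pos_mem (hS' k) 0, e7 ▸ pos_mem (hR' k) 1,
      hg ▸ e8 ▸ pos_mem (hS' k) 1, segment_subset (hR' k) 0, segment_subset (hS' k) 0,
      b4, b5, b6, b7, hcd⟩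
  obtain ⟨i, j, hi, hj, hh⟩ := st1.branch st2 hfg
  have hE : ∀ {a b : ℂ}, a ∈ P.closedEdge (x.edge 0) → b ∈ P.closedEdge (x.edge 0) → ∀ z,
      crs (P.edgeVec (x.edge 0)) (z - a) = crs (P.edgeVec (x.edge 0)) (z - b) := by
    intro a b ha hb z
    obtain ⟨r, hr⟩ := P.crs_edgeVec_eq_zero ha hb
    rw [show z - a = (z - b) + (b - a) by ring, crs_add_right, hr, crs_real_mul_right, crs_self]
    ring
  simp only [crs_segment_eq (hR k), crs_segment_eq (hS k), crs_segment_eq (hR' k),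
    crs_segment_eq (hS' k)] at hh
  have ng : ∀ {u : Orb n}, u ∈ P.orbits → ∀ {z}, u.step 0 * u.side z < 0 → u.side z < 0 :=
    fun hu _ h => by nlinarith [step_pos hu 0]
  have ps : ∀ {u : Orb n}, u ∈ P.orbits → ∀ {z}, 0 < u.step 0 * u.side z → 0 < u.side z :=
    fun hu _ h => (pos_iff_pos_of_mul_pos h).1 (step_pos hu 0)
  have hRx := P.openEdge_subset _ st1.hp
  refine ⟨i, j, (hE hRx (lim_pos_mem hx 0) _) ▸ hi.le,
    (hE hRx (he ▸ lim_pos_mem hy 0) _) ▸ hj.le, ?_⟩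
  rcases hh with ⟨g1, g2, g3, g4⟩ | ⟨g1, g2, g3, g4⟩
  · have g1 := ng (hR k) g1
    have g2 := ps (hR' k) g2
    have g3 := ps (hS k) g3
    have g4 := ng (hS' k) g4
    exact ⟨mul_neg_of_neg_of_pos g1 g2, mul_neg_of_pos_of_neg g3 g4,
      Or.inl ⟨(s1 i).1 g1, (s3 i).2 g2, (s2 j).2 g3, (s4 j).1 g4⟩⟩
  · have g1 := ng (hR' k) g1
    have g2 := ps (hR k) g2
    have g3 := ps (hS' k) g3
    have g4 := ng (hS k) g4
    exact ⟨mul_neg_of_pos_of_neg g2 g1, mul_neg_of_neg_of_pos g4 g3,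
      Or.inr ⟨(s3 i).1 g1, (s1 i).2 g2, (s4 j).2 g3, (s2 j).1 g4⟩⟩

/-- The vertex `i` bounds the displacement from `x` to `x'` on one side, the vertex `j` bounds the
displacement from `y` to `y'` on the other. The two displacements differ only by multiples of the
sine of the angle, so both are small compared with the angle. If the angle vanishes, both pairs lie
on the same lines, with vertices on them. -/
lemma limit_branch_pos (h0 : 0 < w) (h1 : |crs (x.dir 0) (x'.pos 0 - x.pos 0)| < w / 4)
    (h2 : P.diam * ‖x'.dir 0 - x.dir 0‖ < w / 8) :
    (|crs (x'.dir 0) (x'.pos 0 - x.pos 0)| ≤ 3 * P.diam * |crs (x.dir 0) (x'.dir 0)| ∧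
     |crs (x'.dir 0) (y'.pos 0 - y.pos 0)| ≤ 3 * P.diam * |crs (x.dir 0) (x'.dir 0)|) ∧
    (crs (x.dir 0) (x'.dir 0) = 0 → x'.dir 0 = x.dir 0 ∧
      ∀ R R' : ℕ → Orb n, (∀ k, R k ∈ P.orbits) → (∀ k, R' k ∈ P.orbits) →
      (Tendsto R atTop (𝓝 x) → Tendsto R' atTop (𝓝 x') → ∀ᶠ k in atTop, ∃ r : ℝ, 0 ≤ r ∧
        r ≤ P.diam ∧ (R k).side (x.pos 0 + r * x.dir 0) * (R' k).side (x'.pos 0 + r * x'.dir 0) < 0) ∧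
      (Tendsto R atTop (𝓝 y) → Tendsto R' atTop (𝓝 y') → ∀ᶠ k in atTop, ∃ r : ℝ, 0 ≤ r ∧
        r ≤ P.diam ∧ (R k).side (y.pos 0 + r * y.dir 0) * (R' k).side (y'.pos 0 + r * y'.dir 0) < 0)) := by
  have hpos : 0 < crs (P.edgeVec (x.edge 0)) (x.dir 0) :=
    crs_edgeVec_dir_pos hx hy he (by rw [hw]; exact h0.ne')
  have hdia := P.diam_pos
  have hnd := lim_norm_dir hx 0
  have hnd' := lim_norm_dir hx' 0
  have hsig := fun R S R' S' hR hS hR' hS' => limit_branch_signs hx hy hx' hy' he he' he'' hf hg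
    hfg hd hd' hw hw' h0 h1 h2 (R := R) (S := S) (R' := R') (S' := S') hR hS hR' hS'
  obtain ⟨U, hU, tU⟩ := exists_seq_orbits hx
  obtain ⟨V, hV, tV⟩ := exists_seq_orbits hy
  obtain ⟨U', hU', tU'⟩ := exists_seq_orbits hx'
  obtain ⟨V', hV', tV'⟩ := exists_seq_orbits hy'
  have hwd : w ≤ P.diam := by
    have h3 := (le_abs_self _).trans (abs_crs_le (x.dir 0) (y.pos 0 - x.pos 0))
    rw [hw, hnd, one_mul] at h3
    exact h3.trans (P.norm_sub_le_diam (lim_pos_mem hx 0) (lim_pos_mem hy 0))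
  have hc0 : 0 < dotp (x.dir 0) (x'.dir 0) := by
    have h3 := abs_le.1 (abs_dotp_le (x.dir 0) (x'.dir 0 - x.dir 0))
    rw [dotp_sub_right, dotp_self, hnd, one_mul] at h3
    have h4 : ‖x'.dir 0 - x.dir 0‖ < 1 := by
      by_contra hc
      push Not at hc
      nlinarith
    linarith [h3.1]
  set c := dotp (x.dir 0) (x'.dir 0) with hc
  set s := crs (x.dir 0) (x'.dir 0) with hs
  have hcs : c ^ 2 + s ^ 2 = 1 := by
    have := dotp_sq_add_crs_sq (x.dir 0) (x'.dir 0)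
    rw [hnd, hnd'] at this
    simpa using this
  have hs1 : |s| ≤ 1 := abs_le_of_sq_le_sq (by nlinarith) zero_le_one
  have hc1 : c ≤ 1 := by nlinarith
  have h1c : 1 - c ≤ |s| := by
    have : s ^ 2 = |s| ^ 2 := (sq_abs s).symm
    nlinarith [abs_nonneg s]
  have rot := fun z => crs_of_dir hnd (x'.dir 0) z
  have hsd : ∀ {a z : ℂ}, ‖z - a‖ ≤ P.diam → |s * dotp (x.dir 0) (z - a)| ≤ |s| * P.diam := by
    intro a z hz
    rw [abs_mul]
    refine mul_le_mul_of_nonneg_left ((abs_dotp_le _ _).trans ?_) (abs_nonneg _)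
    rwa [hnd, one_mul]
  have hvx : ∀ {u : Orb n}, u ∈ P.limOrbits → ∀ i, ‖P.vertex i - u.pos 0‖ ≤ P.diam := fun hu i =>
    P.norm_sub_le_diam (lim_pos_mem hu 0) (P.vertex_mem_closedEdge i)
  -- The pairs have equal widths across their own directions, so the two displacements differ only
  -- by the effect of the rotation, which is at most twice `diam` times the sine.
  have hrel : crs (x'.dir 0) (y'.pos 0 - y.pos 0) = crs (x'.dir 0) (x'.pos 0 - x.pos 0) +
      ((1 - c) * w + s * dotp (x.dir 0) (y.pos 0 - x.pos 0)) := by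
    have h3 := rot (y.pos 0 - x.pos 0)
    rw [← hc, ← hs, hw] at h3
    rw [show y'.pos 0 - y.pos 0 = (y'.pos 0 - x'.pos 0) + (x'.pos 0 - x.pos 0) -
      (y.pos 0 - x.pos 0) by ring, crs_sub_right, crs_add_right, hw', h3]
    ring
  have hrel' : |(1 - c) * w + s * dotp (x.dir 0) (y.pos 0 - x.pos 0)| ≤ 2 * (|s| * P.diam) := by
    have h3 := hsd (P.norm_sub_le_diam (lim_pos_mem hx 0) (lim_pos_mem hy 0))
    have h4 : |(1 - c) * w| ≤ |s| * P.diam := by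
      rw [abs_mul, abs_of_nonneg (by linarith : 0 ≤ 1 - c), abs_of_pos h0]
      exact mul_le_mul h1c hwd h0.le (abs_nonneg _)
    exact (abs_add_le _ _).trans (by linarith)
  have hbd : |crs (x'.dir 0) (x'.pos 0 - x.pos 0)| ≤ 3 * P.diam * |s| ∧
     |crs (x'.dir 0) (y'.pos 0 - y.pos 0)| ≤ 3 * P.diam * |s| := by
    obtain ⟨k, i, j, -, -, -, -, hk⟩ := (hsig U V U' V' hU hV hU' hV' tU tV tU' tV').exists
    have e1 : x'.side (P.vertex i) = c * x.side (P.vertex i) -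
        s * dotp (x.dir 0) (P.vertex i - x.pos 0) - crs (x'.dir 0) (x'.pos 0 - x.pos 0) := by
      have := rot (P.vertex i - x.pos 0)
      unfold Orb.side
      rw [← this, ← crs_sub_right]; congr 1; ring
    have e2 : y'.side (P.vertex j) = c * y.side (P.vertex j) -
        s * dotp (x.dir 0) (P.vertex j - y.pos 0) - crs (x'.dir 0) (y'.pos 0 - y.pos 0) := by
      have := rot (P.vertex j - y.pos 0)
      unfold Orb.side
      rw [hd, ← this, hd', ← crs_sub_right]; congr 1; ring
    have e3 := abs_le.1 (hsd (hvx hx i))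
    have e4 := abs_le.1 (hsd (hvx hy j))
    have e5 := abs_le.1 hrel'
    rcases hk with ⟨g1, g2, g3, g4⟩ | ⟨g1, g2, g3, g4⟩
    · have f1 : c * x.side (P.vertex i) ≤ 0 := mul_nonpos_of_nonneg_of_nonpos hc0.le g1
      have f2 : 0 ≤ c * y.side (P.vertex j) := mul_nonneg hc0.le g3
      constructor <;> rw [abs_le] <;> constructor <;> linarith [e3.1, e3.2, e4.1, e4.2, e5.1, e5.2]
    · have f1 : 0 ≤ c * x.side (P.vertex i) := mul_nonneg hc0.le g2
      have f2 : c * y.side (P.vertex j) ≤ 0 := mul_nonpos_of_nonneg_of_nonpos hc0.le g4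
      constructor <;> rw [abs_le] <;> constructor <;> linarith [e3.1, e3.2, e4.1, e4.2, e5.1, e5.2]
  refine ⟨hbd, fun hs0 => ?_⟩
  have hdd : x'.dir 0 = x.dir 0 := eq_of_crs_eq_zero_of_dotp_pos hnd hnd' hs0 hc0
  have hx0 : crs (x.dir 0) (x'.pos 0 - x.pos 0) = 0 := by
    have := hbd.1
    rwa [hs0, abs_zero, mul_zero, abs_nonpos_iff, hdd] at this
  have hy0 : crs (y.dir 0) (y'.pos 0 - y.pos 0) = 0 := by
    have := hbd.2
    rwa [hs0, abs_zero, mul_zero, abs_nonpos_iff, hdd, ← hd] at this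
  refine ⟨hdd, fun R R' hR hR' => ⟨fun tR tR' => ?_, fun tR tR' => ?_⟩⟩
  · filter_upwards [hsig R V R' V' hR hV hR' hV' tR tV tR' tV'] with k ⟨i, j, hi, _, hp, _, hk⟩
    obtain ⟨r, hr0, hr1, hr2, hr3⟩ := exists_on_line hx hx' he' hpos hdd hx0 hi
      (hk.imp (fun h => ⟨h.1, h.2.1⟩) fun h => ⟨h.1, h.2.1⟩)
    exact ⟨r, hr0, hr1, by rw [← hr2, ← hr3]; exact hp⟩
  · filter_upwards [hsig U R U' R' hU hR hU' hR' tU tR tU' tR'] with k ⟨i, j, _, hj, _, hp, hk⟩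
    obtain ⟨r, hr0, hr1, hr2, hr3⟩ := exists_on_line hy hy' (he''.trans he.symm)
      (by rw [he, hd]; exact hpos) (hd'.trans (hdd.trans hd.symm)) hy0 (by rwa [he])
      (hk.symm.imp (fun h => ⟨h.2.2.2, h.2.2.1⟩) fun h => ⟨h.2.2.2, h.2.2.1⟩)
    exact ⟨r, hr0, hr1, by rw [← hr2, ← hr3]; exact hp⟩

/-- Two pairs of parallel limit orbits at the same distance, which are close to each other and hit
different edges next, are separated by a vertex. -/
lemma limit_branch (h0 : w ≠ 0) (h1 : |crs (x.dir 0) (x'.pos 0 - x.pos 0)| < |w| / 8)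
    (h2 : P.diam * ‖x'.dir 0 - x.dir 0‖ < |w| / 8) :
    |crs (x'.dir 0) (x'.pos 0 - x.pos 0)| ≤ 3 * P.diam * |crs (x.dir 0) (x'.dir 0)| ∧
    (crs (x.dir 0) (x'.dir 0) = 0 → x'.dir 0 = x.dir 0 ∧
      ∀ R R' : ℕ → Orb n, (∀ k, R k ∈ P.orbits) → (∀ k, R' k ∈ P.orbits) →
      Tendsto R atTop (𝓝 x) → Tendsto R' atTop (𝓝 x') → ∀ᶠ k in atTop, ∃ r : ℝ, 0 ≤ r ∧
        r ≤ P.diam ∧ (R k).side (x.pos 0 + r * x.dir 0) * (R' k).side (x'.pos 0 + r * x'.dir 0) < 0) := by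
  -- For negative `w` the roles of `x` and `y` are exchanged. The displacement from `y` to `y'` may
  -- exceed that from `x` to `x'` by |w|/8, so |w|/8 is required here where |w|/4 suffices above.
  rcases h0.lt_or_gt with hneg | hpos
  · rw [abs_of_neg hneg] at h1 h2
    have hw1 : crs (y.dir 0) (x.pos 0 - y.pos 0) = -w := by
      rw [hd, ← hw, ← crs_neg_right, neg_sub]
    have hw1' : crs (y'.dir 0) (x'.pos 0 - y'.pos 0) = -w := by
      rw [hd', ← hw', ← crs_neg_right, neg_sub]
    have h3 : |crs (x.dir 0) (y'.pos 0 - x'.pos 0) - w| < -w / 8 := by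
      rw [show crs (x.dir 0) (y'.pos 0 - x'.pos 0) - w =
        crs (x.dir 0 - x'.dir 0) (y'.pos 0 - x'.pos 0) by rw [crs_sub_left, hw']]
      refine (abs_crs_le _ _).trans_lt (lt_of_le_of_lt ?_ h2)
      rw [norm_sub_rev, mul_comm]
      exact mul_le_mul_of_nonneg_right (P.norm_sub_le_diam (lim_pos_mem hx' 0) (lim_pos_mem hy' 0))
        (norm_nonneg _)
    have h4 : |crs (y.dir 0) (y'.pos 0 - y.pos 0)| < -w / 4 := by
      rw [hd, show y'.pos 0 - y.pos 0 = (y'.pos 0 - x'.pos 0) + (x'.pos 0 - x.pos 0) -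
        (y.pos 0 - x.pos 0) by ring, crs_sub_right, crs_add_right, hw]
      have h5 := abs_lt.1 h1
      have h6 := abs_lt.1 h3
      rw [abs_lt]; constructor <;> linarith [h5.1, h5.2, h6.1, h6.2]
    have := limit_branch_pos hy hx hy' hx' he.symm (he''.trans he.symm) (he'.trans he.symm)
      hf.symm hg.symm (by rwa [hf, hg]) hd.symm hd'.symm hw1 hw1' (by linarith) h4
      (by rw [hd, hd']; exact h2)
    rw [hd, hd'] at this
    exact ⟨this.1.2, fun hs => ⟨(this.2 hs).1, fun R R' hR hR' => ((this.2 hs).2 R R' hR hR').2⟩⟩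
  · rw [abs_of_pos hpos] at h1 h2
    have := limit_branch_pos hx hy hx' hy' he he' he'' hf hg hfg hd hd' hw hw' hpos
      (by linarith) h2
    exact ⟨this.1.1, fun hs => ⟨(this.2 hs).1, fun R R' hR hR' => ((this.2 hs).2 R R' hR hR').1⟩⟩

end
end PolygonalTable

/-! ### Parallel pairs at maximal distance -/

namespace Orb
variable {n : ℕ}

lemma shift_shift (x : Orb n) (i j : ℤ) : (x.shift i).shift j = x.shift (j + i) := by
  funext k; simp only [shift, add_assoc]

/-- The oriented distance of the starting points of two orbits. -/
def off (x y : Orb n) : ℝ := crs (x.dir 0) (y.pos 0 - x.pos 0)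

lemma continuous_off : Continuous fun z : Orb n × Orb n => z.1.off z.2 :=
  ((continuous_dir 0).comp continuous_fst).crs
    (((continuous_pos 0).comp continuous_snd).sub ((continuous_pos 0).comp continuous_fst))

end Orb

/-- An affine function changes its sign only once. -/
lemma not_two_sign_changes {a κ T₁ T₂ T₃ T₄ : ℝ} (h12 : T₁ ≤ T₂) (h23 : T₂ ≤ T₃) (h34 : T₃ ≤ T₄)
    (h1 : (a + T₁ * κ) * (a + T₂ * κ) < 0) (h2 : (a + T₃ * κ) * (a + T₄ * κ) < 0) : False := by
  rcases le_total 0 κ with hκ | hκ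
  · have e1 := mul_le_mul_of_nonneg_right h12 hκ
    have e2 := mul_le_mul_of_nonneg_right h23 hκ
    have e3 := mul_le_mul_of_nonneg_right h34 hκ
    have : 0 < a + T₂ * κ := by
      by_contra hc; push Not at hc
      nlinarith [mul_nonneg_of_nonpos_of_nonpos (by linarith : a + T₁ * κ ≤ 0) hc]
    nlinarith [mul_nonneg (by linarith : 0 ≤ a + T₃ * κ) (by linarith : 0 ≤ a + T₄ * κ)]
  · have e1 := mul_le_mul_of_nonpos_right h12 hκ
    have e2 := mul_le_mul_of_nonpos_right h23 hκ
    have e3 := mul_le_mul_of_nonpos_right h34 hκ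
    have : a + T₂ * κ < 0 := by
      by_contra hc; push Not at hc
      nlinarith [mul_nonneg (by linarith : 0 ≤ a + T₁ * κ) hc]
    nlinarith [mul_nonneg_of_nonpos_of_nonpos (by linarith : a + T₃ * κ ≤ 0)
      (by linarith : a + T₄ * κ ≤ 0)]

namespace PolygonalTable
variable {n : ℕ} {P : PolygonalTable n}

section
variable {x y : Orb n} (hx : x ∈ P.limOrbits) (hy : y ∈ P.limOrbits)
include hx hy

/-- The height of points on one orbit over the line of another orbit that hits the same edges. -/
lemma side_shift {b : ℤ} {m : ℕ} (he : ∀ j : ℕ, j ≤ m → x.edge (b + j) = y.edge (b + j)) (r : ℝ) :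
    (y.shift (b + m)).side ((x.shift (b + m)).pos 0 + r * (x.shift (b + m)).dir 0) =
      (-1) ^ m * (crs (y.dir b) (x.pos b - y.pos b) +
        (x.len b m + r) * crs (y.dir b) (x.dir b)) := by
  have h1 := crs_dir_pos_sub hy hx (k := b) (m := m) fun j _ hj => (he j hj).symm
  have h2 := crs_dir_dir hy hx (k := b) (m := m) fun j _ hj => (he j hj).symm
  simp only [Orb.side, Orb.dir_shift, Orb.pos_shift, zero_add]
  rw [add_sub_right_comm, crs_add_right, crs_real_mul_right, h1, h2]
  ring

/-- Before and after the bounce the picture is the same up to the reflection in the edge. So the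
point ahead on the reversed orbit is treated as the point at `-r` on the line after the bounce, and
the signs of reflection and reversal cancel. -/
lemma side_rev {k : ℤ} (he : x.edge k = y.edge k) (r : ℝ) :
    (y.shift k).rev.side ((x.shift k).rev.pos 0 + r * (x.shift k).rev.dir 0) =
      (y.shift k).side ((x.shift k).pos 0 + (-r : ℝ) * (x.shift k).dir 0) := by
  have h1 := lim_dir_succ hx (k - 1)
  have h2 := lim_dir_succ hy (k - 1)
  rw [sub_add_cancel] at h1 h2
  have h3 := mirror_pos_sub hy hx he.symm
  simp only [Orb.side, Orb.dir_rev, Orb.pos_rev, Orb.dir_shift, Orb.pos_shift, zero_add, neg_zero,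
    zero_sub, neg_add_eq_sub]
  rw [h1, h2, he, add_sub_right_comm, add_sub_right_comm, ← h3, ← mirror_real_mul, ← mirror_add,
    crs_mirror (P.edgeVec_ne_zero _), h3, crs_neg_left]
  push_cast
  congr 3
  ring

lemma off_rev (he : x.edge 0 = y.edge 0) : x.rev.off y.rev = x.off y := by
  have h1 := lim_dir_succ hx (-1)
  rw [neg_add_cancel] at h1
  have h3 := mirror_pos_sub hx hy he
  simp only [Orb.off, Orb.dir_rev, Orb.pos_rev, neg_zero, zero_sub]
  rw [h1, ← h3, crs_mirror (P.edgeVec_ne_zero _), h3, crs_neg_left]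

/-- The distance of parallel orbits. -/
lemma off_shift {b : ℤ} {m : ℕ} (he : ∀ j : ℕ, 1 ≤ j → j ≤ m → x.edge (b + j) = y.edge (b + j))
    (hd : x.dir b = y.dir b) :
    (x.shift (b + m)).off (y.shift (b + m)) = (-1) ^ m * (x.shift b).off (y.shift b) := by
  have := crs_dir_pos_sub hx hy he
  rw [← hd, crs_self, mul_zero, add_zero] at this
  simpa [Orb.off] using this

lemma dir_eq_add {b : ℤ} {m : ℕ} (he : ∀ j : ℕ, 1 ≤ j → j ≤ m → x.edge (b + j) = y.edge (b + j))
    (hd : x.dir b = y.dir b) : x.dir (b + m) = y.dir (b + m) := by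
  induction m with
  | zero => simpa using hd
  | succ m ih =>
    have h := ih fun j h0 hj => he j h0 (by omega)
    have h1 := lim_dir_succ hx (b + m)
    have h2 := lim_dir_succ hy (b + m)
    have h3 := he (m + 1) (by omega) le_rfl
    push_cast at h3 ⊢
    rw [← add_assoc] at h3 ⊢
    rw [h1, h2, h, h3]

end

lemma off_swap {x y : Orb n} (hd : x.dir 0 = y.dir 0) : y.off x = -x.off y := by
  unfold Orb.off; rw [← hd, ← crs_neg_right, neg_sub]

variable (P) in
/-- A closed set of limit orbits that is invariant under shifts. -/
structure InvSet (S : Set (Orb n)) : Prop where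
  closed : IsClosed S
  sub : S ⊆ P.limOrbits
  shift : ∀ x ∈ S, ∀ m, x.shift m ∈ S

namespace InvSet
variable {S : Set (Orb n)} (hS : P.InvSet S)
include hS

lemma compact : IsCompact S := P.isCompact_limOrbits.of_isClosed_subset hS.closed hS.sub

lemma rev : P.InvSet (Orb.rev ⁻¹' S) where
  closed := hS.closed.preimage Orb.continuous_rev
  sub x hx := by simpa [Orb.rev_rev] using rev_mem (hS.sub hx)
  shift x hx m := by
    have : (x.shift m).rev = x.rev.shift (-m) := by
      funext k
      refine Prod.ext ?_ (Prod.ext ?_ ?_)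
      · simp [Orb.rev, Orb.edge, Orb.shift, add_comm]
      · simp [Orb.rev, Orb.pos, Orb.shift, add_comm]
      · simp only [Orb.rev, Orb.dir, Orb.shift]; congr 4; ring
    simp only [mem_preimage, this]
    exact hS.shift _ hx _

/-- A limit of pairs that hit the same edges for a longer and longer time. -/
lemma exists_limit_pair {x y : ℕ → Orb n} (hx : ∀ j, x j ∈ S) (hy : ∀ j, y j ∈ S) {w : ℝ}
    (hw : ∀ j, (x j).off (y j) = w) (he : ∀ k : ℤ, ∀ᶠ j in atTop, (x j).edge k = (y j).edge k) :
    ∃ x' ∈ S, ∃ y' ∈ S, (∀ k, x'.edge k = y'.edge k) ∧ x'.off y' = w := by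
  obtain ⟨⟨x', y'⟩, ⟨hx', hy'⟩, φ, hφ, hlim⟩ := (hS.compact.prod hS.compact).tendsto_subseq
    (x := fun j => (x j, y j)) fun j => ⟨hx j, hy j⟩
  have l1 : Tendsto (x ∘ φ) atTop (𝓝 x') := (continuous_fst.tendsto _).comp hlim
  have l2 : Tendsto (y ∘ φ) atTop (𝓝 y') := (continuous_snd.tendsto _).comp hlim
  refine ⟨x', hx', y', hy', fun k => ?_, ?_⟩
  · obtain ⟨j, h1, h2, h3⟩ := ((Orb.eventually_edge l1 k).and ((Orb.eventually_edge l2 k).and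
      (hφ.tendsto_atTop.eventually (he k)))).exists
    rw [← h1, ← h2]; exact h3
  · exact tendsto_nhds_unique ((Orb.continuous_off.tendsto _).comp hlim)
      (tendsto_const_nhds.congr fun j => (hw (φ j)).symm)

/-- Parallel orbits keep their oriented distance under even shifts. A limit of shifts by `2 * j`
turns agreement in the future into agreement at all times. -/
lemma exists_pair_of_future {x y : Orb n} (hx : x ∈ S) (hy : y ∈ S)
    (he : ∀ k, 0 ≤ k → x.edge k = y.edge k) :
    ∃ x' ∈ S, ∃ y' ∈ S, (∀ k, x'.edge k = y'.edge k) ∧ x'.off y' = x.off y := by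
  refine hS.exists_limit_pair (x := fun j => x.shift (2 * j : ℕ)) (y := fun j => y.shift (2 * j : ℕ))
    (fun j => hS.shift _ hx _) (fun j => hS.shift _ hy _) (fun j => ?_) fun k => ?_
  · have := off_shift (hS.sub hx) (hS.sub hy) (b := 0) (m := 2 * j)
      (fun i _ _ => he _ (by omega)) (dir_eq_of_future (hS.sub hx) (hS.sub hy) he)
    rw [zero_add] at this
    rw [this]; simp [Orb.off]
  · filter_upwards [eventually_ge_atTop k.natAbs] with j hj
    exact he _ (by omega)

lemma exists_pair_of_past {x y : Orb n} (hx : x ∈ S) (hy : y ∈ S)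
    (he : ∀ k, k ≤ 0 → x.edge k = y.edge k) :
    ∃ x' ∈ S, ∃ y' ∈ S, (∀ k, x'.edge k = y'.edge k) ∧ x'.off y' = x.off y := by
  refine hS.exists_limit_pair (x := fun j => x.shift (-(2 * j : ℕ)))
    (y := fun j => y.shift (-(2 * j : ℕ)))
    (fun j => hS.shift _ hx _) (fun j => hS.shift _ hy _) (fun j => ?_) fun k => ?_
  · have := off_shift (hS.sub hx) (hS.sub hy) (b := -(2 * j : ℕ)) (m := 2 * j)
      (fun i _ _ => he _ (by omega))
      (dir_eq_of_past (hS.sub hx) (hS.sub hy) fun k hk => he k (by omega))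
    rw [neg_add_cancel] at this
    rw [show (x.shift 0).off (y.shift 0) = x.off y by simp [Orb.off]] at this
    rw [this]; simp
  · filter_upwards [eventually_ge_atTop k.natAbs] with j hj
    exact he _ (by omega)

/-- A pair of orbits with the same edges and with maximal distance. -/
lemma exists_max {x₀ y₀ : Orb n} (hx₀ : x₀ ∈ S) (hy₀ : y₀ ∈ S)
    (he₀ : ∀ k, 0 ≤ k → x₀.edge k = y₀.edge k) (hne : x₀.off y₀ ≠ 0) :
    ∃ w > 0, (∃ x ∈ S, ∃ y ∈ S, (∀ k, x.edge k = y.edge k) ∧ x.off y = w) ∧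
      (∀ x ∈ S, ∀ y ∈ S, (∀ k, 0 ≤ k → x.edge k = y.edge k) → |x.off y| ≤ w) ∧
      (∀ x ∈ S, ∀ y ∈ S, (∀ k, k ≤ 0 → x.edge k = y.edge k) → |x.off y| ≤ w) := by
  -- Equality of all edges is a closed condition because the edges are discrete, so the maximum of
  -- the distance is attained.
  set K : Set (Orb n × Orb n) := (S ×ˢ S) ∩ {z | ∀ k, z.1.edge k = z.2.edge k} with hK
  have hKc : IsCompact K := (hS.compact.prod hS.compact).inter_right (by
    simp only [ofPred_forall]
    exact isClosed_iInter fun k => isClosed_eq ((Orb.continuous_edge k).comp continuous_fst)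
      ((Orb.continuous_edge k).comp continuous_snd))
  obtain ⟨x₁, hx₁, y₁, hy₁, he₁, hw₁⟩ := hS.exists_pair_of_future hx₀ hy₀ he₀
  obtain ⟨⟨x, y⟩, ⟨⟨hx, hy⟩, he⟩, hmax⟩ := hKc.exists_isMaxOn ⟨(x₁, y₁), ⟨hx₁, hy₁⟩, he₁⟩
    Orb.continuous_off.continuousOn
  have hle : ∀ x' ∈ S, ∀ y' ∈ S, (∀ k, x'.edge k = y'.edge k) → |x'.off y'| ≤ x.off y := by
    intro x' hx' y' hy' he'
    have h1 : x'.off y' ≤ x.off y := hmax (show (x', y') ∈ K from ⟨⟨hx', hy'⟩, he'⟩)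
    have h2 : y'.off x' ≤ x.off y :=
      hmax (show (y', x') ∈ K from ⟨⟨hy', hx'⟩, fun k => (he' k).symm⟩)
    rw [off_swap (dir_eq_of_future (hS.sub hx') (hS.sub hy') fun k _ => he' k)] at h2
    exact abs_le.2 ⟨by linarith, h1⟩
  refine ⟨x.off y, ?_, ⟨x, hx, y, hy, he, rfl⟩, fun x' hx' y' hy' he' => ?_,
    fun x' hx' y' hy' he' => ?_⟩
  · refine lt_of_lt_of_le (abs_pos.2 hne) ?_
    rw [← hw₁]; exact hle _ hx₁ _ hy₁ he₁
  · obtain ⟨a, ha, b, hb, hab, h⟩ := hS.exists_pair_of_future hx' hy' he'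
    rw [← h]; exact hle _ ha _ hb hab
  · obtain ⟨a, ha, b, hb, hab, h⟩ := hS.exists_pair_of_past hx' hy' he'
    rw [← h]; exact hle _ ha _ hb hab

set_option synthInstance.maxSize 1000 in
/-- Pairs with maximal distance that hit the same edges for a long time are close to each other. -/
lemma exists_close {w : ℝ} (hmax : ∀ x ∈ S, ∀ y ∈ S, (∀ k, k ≤ 0 → x.edge k = y.edge k) →
    |x.off y| ≤ w) {η : ℝ} (hη : 0 < η) : ∃ N : ℕ, ∀ x ∈ S, ∀ y ∈ S, ∀ x' ∈ S, ∀ y' ∈ S,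
      (∀ k, x.edge k = y.edge k) → (∀ k, x'.edge k = y'.edge k) → x.off y = x'.off y' →
      |x.off y| = w → (∀ k : ℤ, -N ≤ k → k ≤ 0 → x.edge k = x'.edge k) →
      |x.off x'| < η ∧ P.diam * ‖x'.dir 0 - x.dir 0‖ < η := by
  by_contra! hcon
  choose x hx y hy x' hx' y' hy' h1 h2 h3 h4 h5 h6 using hcon
  have hcomp := (hS.compact.prod hS.compact).prod (hS.compact.prod hS.compact)
  obtain ⟨⟨⟨X, Y⟩, ⟨X', Y'⟩⟩, ⟨⟨hX, hY⟩, ⟨hX', hY'⟩⟩, φ, hφ, hlim⟩ := hcomp.tendsto_subseq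
    (x := fun j => ((x j, y j), (x' j, y' j))) fun j => ⟨⟨hx j, hy j⟩, hx' j, hy' j⟩
  simp only at hX hY hX' hY'
  have lx : Tendsto (x ∘ φ) atTop (𝓝 X) := (continuous_fst.fst.tendsto _).comp hlim
  have ly : Tendsto (y ∘ φ) atTop (𝓝 Y) := (continuous_fst.snd.tendsto _).comp hlim
  have lx' : Tendsto (x' ∘ φ) atTop (𝓝 X') := (continuous_snd.fst.tendsto _).comp hlim
  have ly' : Tendsto (y' ∘ φ) atTop (𝓝 Y') := (continuous_snd.snd.tendsto _).comp hlim
  have eXY : ∀ k, X.edge k = Y.edge k := fun k => by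
    obtain ⟨j, a, b⟩ := ((Orb.eventually_edge lx k).and (Orb.eventually_edge ly k)).exists
    rw [← a, ← b]; exact h1 _ _
  have eXY' : ∀ k, X'.edge k = Y'.edge k := fun k => by
    obtain ⟨j, a, b⟩ := ((Orb.eventually_edge lx' k).and (Orb.eventually_edge ly' k)).exists
    rw [← a, ← b]; exact h2 _ _
  have eXX : ∀ k, k ≤ 0 → X.edge k = X'.edge k := fun k hk => by
    obtain ⟨j, a, b, c⟩ := ((Orb.eventually_edge lx k).and ((Orb.eventually_edge lx' k).and
      (hφ.tendsto_atTop.eventually (eventually_ge_atTop k.natAbs)))).exists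
    rw [← a, ← b]; exact h5 _ _ (by omega) hk
  have toff : ∀ {a b : ℕ → Orb n} {A B : Orb n}, Tendsto a atTop (𝓝 A) → Tendsto b atTop (𝓝 B) →
      Tendsto (fun j => (a j).off (b j)) atTop (𝓝 (A.off B)) := fun ha hb =>
    (Orb.continuous_off.tendsto _).comp (ha.prodMk_nhds hb)
  have o1 : X.off Y = X'.off Y' := tendsto_nhds_unique (toff lx ly)
    (Tendsto.congr (fun j => (h3 (φ j)).symm) (toff lx' ly'))
  have o2 : |X.off Y| = w := tendsto_nhds_unique (toff lx ly).abs
    (tendsto_const_nhds.congr fun j => (h4 (φ j)).symm)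
  have dd : X'.dir 0 = X.dir 0 :=
    (dir_eq_of_past (hS.sub hX) (hS.sub hX') eXX).symm
  have dy : Y.dir 0 = X.dir 0 :=
    (dir_eq_of_past (hS.sub hX) (hS.sub hY) fun k _ => eXY k).symm
  have m1 := hmax X hX Y' hY' fun k hk => (eXX k hk).trans (eXY' k)
  have m2 := hmax X' hX' Y hY fun k hk => (eXX k hk).symm.trans (eXY k)
  -- In the limit the two pairs are parallel and share their past. If they were displaced, then `X,
  -- Y'` or `X', Y` would be a pair with common past and a distance larger than the maximum.
  have q1 : X.off Y' = X.off X' + X.off Y := by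
    rw [o1]; simp only [Orb.off, dd, ← crs_add_right]; congr 1; ring
  have q2 : X'.off Y = X.off Y - X.off X' := by
    simp only [Orb.off, dd, ← crs_sub_right]; congr 1; ring
  have hzero : X.off X' = 0 := by
    rw [q1, ← o2] at m1
    rw [q2, ← o2] at m2
    have s1 := sq_le_sq.2 m1
    have s2 := sq_le_sq.2 m2
    nlinarith [sq_nonneg (X.off X')]
  have t1 : ∀ᶠ j in atTop, |(x (φ j)).off (x' (φ j))| < η := by
    have := (toff lx lx').abs
    rw [hzero, abs_zero] at this
    exact this.eventually (gt_mem_nhds hη)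
  have t2 : ∀ᶠ j in atTop, P.diam * ‖(x' (φ j)).dir 0 - (x (φ j)).dir 0‖ < η := by
    have := ((((Orb.continuous_dir 0).tendsto _).comp lx').sub
      (((Orb.continuous_dir 0).tendsto _).comp lx)).norm.const_mul P.diam
    rw [dd, sub_self, norm_zero, mul_zero] at this
    exact this.eventually (gt_mem_nhds hη)
  obtain ⟨j, a, b⟩ := (t1.and t2).exists
  exact absurd b (h6 _ a).not_gt

end InvSet

end PolygonalTable

namespace PolygonalTable
variable {n : ℕ} {P : PolygonalTable n}

/-- Orbits with the same edges and directions, at a distance that does not vanish, stay apart. -/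
lemma forward_switch {x y x' y' : Orb n} (hx : x ∈ P.limOrbits) (hy : y ∈ P.limOrbits)
    (hx' : x' ∈ P.limOrbits) (hy' : y' ∈ P.limOrbits) (he : ∀ k, 0 ≤ k → y.edge k = x.edge k)
    (he' : ∀ k, 0 ≤ k → y'.edge k = x'.edge k) (h0 : x.edge 0 = x'.edge 0)
    (h1 : x.edge 1 ≠ x'.edge 1)
    (hw : x.off y ≠ 0) (hw' : x'.off y' = x.off y)
    (hc : |x.off x'| < |x.off y| / 8) (hd : P.diam * ‖x'.dir 0 - x.dir 0‖ < |x.off y| / 8) :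
    |crs (x'.dir 0) (x'.pos 0 - x.pos 0)| ≤ 3 * P.diam * |crs (x.dir 0) (x'.dir 0)| ∧
    (crs (x.dir 0) (x'.dir 0) = 0 → x'.dir 0 = x.dir 0 ∧
      ∀ R R' : ℕ → Orb n, (∀ k, R k ∈ P.orbits) → (∀ k, R' k ∈ P.orbits) →
      Tendsto R atTop (𝓝 x) → Tendsto R' atTop (𝓝 x') → ∀ᶠ k in atTop, ∃ r : ℝ, 0 ≤ r ∧
        r ≤ P.diam ∧ (R k).side (x.pos 0 + r * x.dir 0) * (R' k).side (x'.pos 0 + r * x'.dir 0) < 0) :=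
  limit_branch hx hy hx' hy' (he 0 le_rfl) h0.symm ((he' 0 le_rfl).trans h0.symm)
    (he 1 zero_le_one) (he' 1 zero_le_one) h1 (dir_eq_of_future hy hx he)
    (dir_eq_of_future hy' hx' he') rfl hw' hw hc hd

namespace InvSet
variable {S : Set (Orb n)} (hS : P.InvSet S)
include hS

/-- Two pairs with maximal distance that hit the same edges for a long time, but neither always in
the future nor always in the past, are separated by vertices at both ends. -/
lemma exists_switches {w : ℝ} (hw : 0 < w)
    (hmf : ∀ x ∈ S, ∀ y ∈ S, (∀ k, 0 ≤ k → x.edge k = y.edge k) → |x.off y| ≤ w)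
    (hmp : ∀ x ∈ S, ∀ y ∈ S, (∀ k, k ≤ 0 → x.edge k = y.edge k) → |x.off y| ≤ w) :
    ∃ N : ℕ, ∀ x ∈ S, ∀ y ∈ S, ∀ x' ∈ S, ∀ y' ∈ S,
      (∀ k, x.edge k = y.edge k) → (∀ k, x'.edge k = y'.edge k) → x.off y = x'.off y' →
      |x.off y| = w → ∀ M M' : ℕ, N ≤ M → N ≤ M' →
      (∀ k : ℤ, -M' ≤ k → k ≤ M → x.edge k = x'.edge k) →
      x.edge (M + 1) ≠ x'.edge (M + 1) → x.edge (-M' - 1) ≠ x'.edge (-M' - 1) →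
      ∀ R R' : ℕ → Orb n, (∀ k, R k ∈ P.orbits) → (∀ k, R' k ∈ P.orbits) →
      Tendsto R atTop (𝓝 x) → Tendsto R' atTop (𝓝 x') →
      (∀ᶠ k in atTop, ∃ r : ℝ, 0 ≤ r ∧ ((R k).shift M).side ((x.shift M).pos 0 + r * (x.shift M).dir 0) *
        ((R' k).shift M).side ((x'.shift M).pos 0 + r * (x'.shift M).dir 0) < 0) ∧
      (∀ᶠ k in atTop, ∃ r : ℝ, 0 ≤ r ∧
        ((R k).shift (-M')).rev.side ((x.shift (-M')).rev.pos 0 + r * (x.shift (-M')).rev.dir 0) *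
        ((R' k).shift (-M')).rev.side
          ((x'.shift (-M')).rev.pos 0 + r * (x'.shift (-M')).rev.dir 0) < 0) := by
  have hdia := P.diam_pos
  obtain ⟨N₁, hN₁⟩ := hS.exists_close hmp (η := w / 8) (by positivity)
  obtain ⟨N₂, hN₂⟩ := hS.rev.exists_close (w := w) (fun x hx y hy he => by
    rw [← off_rev (hS.rev.sub hx) (hS.rev.sub hy) (he 0 le_rfl)]
    exact hmf _ hx _ hy fun k hk => he _ (by omega)) (η := w / 8) (by positivity)
  -- At each end the displacement is at most 3 `diam` times the sine of the angle, whereas it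
  -- changes by the length times the sine in between. A length of at least 8 `diam`, more than 3 +
  -- 3, forces the angle to vanish.
  obtain ⟨N₃, -, hN₃⟩ := P.exists_len_ge (8 * P.diam)
  refine ⟨max N₁ (max N₂ N₃), fun x hx y hy x' hx' y' hy' he he' ho hov M M' hM hM' hxx hb hb'
    R R' hR hR' tR tR' => ?_⟩
  have Lx := hS.sub hx
  have Ly := hS.sub hy
  have Lx' := hS.sub hx'
  have Ly' := hS.sub hy'
  have dxy : ∀ k, x.dir k = y.dir k := fun k => dir_eq_of_future Lx Ly fun j _ => he j
  have dxy' : ∀ k, x'.dir k = y'.dir k := fun k => dir_eq_of_future Lx' Ly' fun j _ => he' j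
  have hM1 : N₁ ≤ M := le_trans (le_max_left _ _) hM
  have hM2 : N₂ ≤ M' := le_trans (le_trans (le_max_left _ _) (le_max_right _ _)) hM'
  have hM3 : N₃ ≤ M := le_trans (le_trans (le_max_right _ _) (le_max_right _ _)) hM
  -- the forward end
  have oM : ∀ {a b : Orb n}, a ∈ P.limOrbits → b ∈ P.limOrbits → (∀ k, a.edge k = b.edge k) →
      (∀ k, a.dir k = b.dir k) → (a.shift M).off (b.shift M) = (-1) ^ M * a.off b := by
    intro a b ha hb hab hd
    have := off_shift ha hb (b := 0) (m := M) (fun _ _ _ => hab _) (hd 0)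
    simpa [Orb.off] using this
  have oM' : ∀ {a b : Orb n}, a ∈ P.limOrbits → b ∈ P.limOrbits → (∀ k, a.edge k = b.edge k) →
      (∀ k, a.dir k = b.dir k) → (a.shift (-M')).rev.off (b.shift (-M')).rev = (-1) ^ M' * a.off b := by
    intro a b ha hb hab hd
    rw [off_rev (shift_mem ha _) (shift_mem hb _) (hab _)]
    have := off_shift ha hb (b := -M') (m := M') (fun _ _ _ => hab _) (hd _)
    rw [neg_add_cancel] at this
    have h2 : a.off b = (a.shift 0).off (b.shift 0) := by simp [Orb.off]
    rw [h2, this, ← mul_assoc, ← mul_pow]; simp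
  have abs1 : ∀ m : ℕ, |(-1) ^ m * x.off y| = w := fun m => by
    rw [abs_mul, abs_pow, abs_neg, abs_one, one_pow, one_mul, hov]
  have hne : ∀ m : ℕ, (-1) ^ m * x.off y ≠ 0 := fun m h => by
    have := abs1 m
    rw [h, abs_zero] at this; linarith
  obtain ⟨c1, c2⟩ := hN₁ _ (hS.shift _ hx M) _ (hS.shift _ hy M) _ (hS.shift _ hx' M) _
    (hS.shift _ hy' M) (fun k => he _) (fun k => he' _)
    (by rw [oM Lx Ly he dxy, oM Lx' Ly' he' dxy', ho]) (by rw [oM Lx Ly he dxy, abs1])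
    fun k h1 h2 => hxx _ (by omega) (by omega)
  obtain ⟨f1, f2⟩ := forward_switch (shift_mem Lx M) (shift_mem Ly M) (shift_mem Lx' M)
    (shift_mem Ly' M) (fun _ _ => (he _).symm) (fun _ _ => (he' _).symm)
    (by simpa using hxx M (by omega) le_rfl) (by simpa [add_comm] using hb)
    (by rw [oM Lx Ly he dxy]; exact hne M)
    (by rw [oM Lx Ly he dxy, oM Lx' Ly' he' dxy', ho])
    (by rwa [oM Lx Ly he dxy, abs1]) (by rwa [oM Lx Ly he dxy, abs1])
  have hSr : ∀ {a : Orb n}, a ∈ S → (a.shift (-M')).rev ∈ Orb.rev ⁻¹' S := by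
    intro a ha
    simp only [mem_preimage, Orb.rev_rev]
    exact hS.shift _ ha _
  obtain ⟨d1, d2⟩ := hN₂ _ (hSr hx) _ (hSr hy) _ (hSr hx') _ (hSr hy') (fun k => he _)
    (fun k => he' _)
    (by rw [oM' Lx Ly he dxy, oM' Lx' Ly' he' dxy', ho]) (by rw [oM' Lx Ly he dxy, abs1])
    fun k h1 h2 => hxx _ (by omega) (by omega)
  obtain ⟨g1, g2⟩ := forward_switch (rev_mem (shift_mem Lx (-M'))) (rev_mem (shift_mem Ly (-M')))
    (rev_mem (shift_mem Lx' (-M')))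
    (rev_mem (shift_mem Ly' (-M'))) (fun _ _ => (he _).symm) (fun _ _ => (he' _).symm)
    (by simpa using hxx (-M') le_rfl (by omega))
    (by
      simp only [Orb.edge_rev, Orb.edge_shift]
      rw [show (-1 + -M' : ℤ) = -M' - 1 by ring]; exact hb')
    (by rw [oM' Lx Ly he dxy]; exact hne M')
    (by rw [oM' Lx Ly he dxy, oM' Lx' Ly' he' dxy', ho])
    (by rwa [oM' Lx Ly he dxy, abs1]) (by rwa [oM' Lx Ly he dxy, abs1])
  -- the directions are equal
  simp only [Orb.dir_shift, Orb.pos_shift, zero_add] at f1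
  have hm1 := lim_dir_succ Lx (-M' - 1)
  have hm2 := lim_dir_succ Lx' (-M' - 1)
  have hee := hxx (-M') le_rfl (by omega)
  rw [sub_add_cancel] at hm1 hm2
  have hmp := mirror_pos_sub Lx Lx' hee
  have hE := P.edgeVec_ne_zero (x.edge (-M'))
  rw [← hee] at hm2
  simp only [Orb.dir_shift, Orb.pos_shift, Orb.dir_rev, Orb.pos_rev, zero_add, neg_zero, zero_sub,
    neg_add_eq_sub, crs_neg_left, crs_neg_right, neg_neg, abs_neg] at g1
  have g1' : |crs (x'.dir (-M')) (x'.pos (-M') - x.pos (-M'))| ≤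
      3 * P.diam * |crs (x.dir (-M')) (x'.dir (-M'))| := by
    rw [hm1, hm2, crs_mirror hE, ← hmp, crs_mirror hE, abs_neg, abs_neg]
    exact g1
  have hag : ∀ j : ℕ, 1 ≤ j → j ≤ M' + M → x'.edge (-M' + j) = x.edge (-M' + j) := fun j _ hj =>
    (hxx _ (by omega) (by omega)).symm
  have k1 := crs_dir_pos_sub Lx' Lx hag
  have k2 := crs_dir_dir Lx' Lx hag
  have hlen := hN₃ x Lx (-M') (M' + M) (by omega)
  rw [show (-(M' : ℤ)) + ((M' + M : ℕ) : ℤ) = M by push_cast; ring] at k1 k2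
  have a2 := congrArg abs k2
  have a1 := congrArg abs k1
  rw [abs_mul, abs_pow, abs_neg, abs_one, one_pow, one_mul] at a1 a2
  rw [← neg_sub, crs_neg_right, abs_neg, ← neg_sub (x'.pos (-M')), crs_neg_right] at a1
  rw [crs_anti, abs_neg, crs_anti (x'.dir (-M')), abs_neg] at a2
  rw [crs_anti (x'.dir (-M')) (x.dir (-M'))] at a1
  rw [a1, a2] at f1
  set σ := crs (x.dir (-M')) (x'.dir (-M')) with hσ
  set h := crs (x'.dir (-M')) (x'.pos (-M') - x.pos (-M')) with hh
  have hσ0 : σ = 0 := by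
    have e1 := abs_le.1 f1
    have e2 := abs_le.1 g1'
    by_contra hne0
    have hpos := abs_pos.2 hne0
    have e3 : |x.len (-M') (M' + M) * σ| ≤ 6 * P.diam * |σ| := by
      rw [abs_le]; constructor <;> linarith [e1.1, e1.2, e2.1, e2.2]
    rw [abs_mul, abs_of_nonneg (x.len_nonneg _ _)] at e3
    have e4 := le_of_mul_le_mul_right e3 hpos
    linarith
  have z1 : crs (x.dir M) (x'.dir M) = 0 := by rw [← abs_eq_zero, a2, hσ0, abs_zero]
  have z2 : crs (x.dir (-M' - 1)) (x'.dir (-M' - 1)) = 0 := by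
    have : σ = -crs (x.dir (-M' - 1)) (x'.dir (-M' - 1)) := by rw [hσ, hm1, hm2, crs_mirror hE]
    linarith
  constructor
  · have tt : ∀ {U : ℕ → Orb n} {u : Orb n}, Tendsto U atTop (𝓝 u) →
      Tendsto (fun k => (U k).shift M) atTop (𝓝 (u.shift M)) := fun h =>
      ((Orb.continuous_shift M).tendsto _).comp h
    filter_upwards [(f2 (by simpa using z1)).2 (fun k => (R k).shift M) (fun k => (R' k).shift M)
      (fun k => shift_mem_orbits (hR k) _) (fun k => shift_mem_orbits (hR' k) _) (tt tR) (tt tR')]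
      with k ⟨r, hr, _, hk⟩
    exact ⟨r, hr, hk⟩
  · have tt : ∀ {U : ℕ → Orb n} {u : Orb n}, Tendsto U atTop (𝓝 u) →
      Tendsto (fun k => ((U k).shift (-M')).rev) atTop (𝓝 (u.shift (-M')).rev) := fun h =>
      (Orb.continuous_rev.tendsto _).comp (((Orb.continuous_shift (-M')).tendsto _).comp h)
    have z2' : crs ((x.shift (-M')).rev.dir 0) ((x'.shift (-M')).rev.dir 0) = 0 := by
      simp only [Orb.dir_rev, Orb.dir_shift, crs_neg_left, crs_neg_right, neg_neg]
      rw [show (-0 - 1 + -M' : ℤ) = -M' - 1 by ring]; exact z2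
    filter_upwards [(g2 z2').2 (fun k => ((R k).shift (-M')).rev) (fun k => ((R' k).shift (-M')).rev)
      (fun k => rev_mem_orbits (shift_mem_orbits (hR k) _))
      (fun k => rev_mem_orbits (shift_mem_orbits (hR' k) _)) (tt tR) (tt tR')] with k ⟨r, hr, _, hk⟩
    exact ⟨r, hr, hk⟩

end InvSet

end PolygonalTable

/-! ### A periodic half-orbit -/

namespace PolygonalTable
variable {n : ℕ} {P : PolygonalTable n}

namespace InvSet
variable {S : Set (Orb n)} (hS : P.InvSet S)
include hS

/-- If two orbits with the same future do not coincide, then some orbit of the same kind is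
periodic in the future or in the past. -/
lemma exists_periodic {x₀ y₀ : Orb n} (hx₀ : x₀ ∈ S) (hy₀ : y₀ ∈ S)
    (he₀ : ∀ k, 0 ≤ k → x₀.edge k = y₀.edge k) (hne : x₀.off y₀ ≠ 0) :
    ∃ x ∈ S, ∃ t : ℕ, 0 < t ∧ Even t ∧ ((∀ k : ℤ, 0 ≤ k → x.edge (k + t) = x.edge k) ∨
      (∀ k : ℤ, k ≤ 0 → x.edge (k + t) = x.edge k)) := by
  obtain ⟨w, hw, ⟨x, hx, y, hy, he, hxy⟩, hmf, hmp⟩ := hS.exists_max hx₀ hy₀ he₀ hne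
  obtain ⟨N, hN⟩ := hS.exists_switches hw hmf hmp
  have Lx := hS.sub hx
  have Ly := hS.sub hy
  have dxy : x.dir 0 = y.dir 0 := dir_eq_of_future Lx Ly fun j _ => he j
  by_contra! hcon
  -- There are finitely many words of length `2 * N + 1`, so three windows around even times have
  -- the same word. Even times keep the sign of the oriented distance of the pair.
  obtain ⟨win, hwin⟩ := Finite.exists_infinite_fiber
    (fun (a : ℕ) (j : Fin (2 * N + 1)) => x.edge (2 * a + j - N))
  have hinf : (((fun (a : ℕ) (j : Fin (2 * N + 1)) => x.edge (2 * a + j - N)) ⁻¹' {win})).Infinite :=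
    Set.infinite_coe_iff.1 hwin
  obtain ⟨a₁, ha₁, -⟩ := hinf.exists_gt 0
  obtain ⟨a₂, ha₂, h12⟩ := hinf.exists_gt a₁
  obtain ⟨a₃, ha₃, h23⟩ := hinf.exists_gt a₂
  have hsame : ∀ {a b : ℕ}, a ∈ ((fun (a : ℕ) (j : Fin (2 * N + 1)) => x.edge (2 * a + j - N)) ⁻¹' {win}) →
      b ∈ ((fun (a : ℕ) (j : Fin (2 * N + 1)) => x.edge (2 * a + j - N)) ⁻¹' {win}) →
      ∀ k : ℤ, -N ≤ k → k ≤ N → x.edge (k + (2 * a : ℕ)) = x.edge (k + (2 * b : ℕ)) := by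
    intro a b ha hb k h1 h2
    have h3 := congrFun ((show _ = win from ha).trans (show _ = win from hb).symm)
      ⟨(k + N).toNat, by omega⟩
    simp only at h3
    rw [show (2 * (a : ℤ) + ((k + N).toNat : ℕ) - N) = k + (2 * a : ℕ) by push_cast; omega,
      show (2 * (b : ℤ) + ((k + N).toNat : ℕ) - N) = k + (2 * b : ℕ) by push_cast; omega] at h3
    exact h3
  -- the codes of two windows differ in the future and in the past
  have hbr : ∀ {a b : ℕ}, a < b → (∀ k : ℤ, -N ≤ k → k ≤ N →
      x.edge (k + (2 * a : ℕ)) = x.edge (k + (2 * b : ℕ))) →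
      ∃ M M' : ℕ, N ≤ M ∧ N ≤ M' ∧
      (∀ k : ℤ, -M' ≤ k → k ≤ M → x.edge (k + (2 * a : ℕ)) = x.edge (k + (2 * b : ℕ))) ∧
      x.edge (M + 1 + (2 * a : ℕ)) ≠ x.edge (M + 1 + (2 * b : ℕ)) ∧
      x.edge (-M' - 1 + (2 * a : ℕ)) ≠ x.edge (-M' - 1 + (2 * b : ℕ)) := by
    intro a b hab hwab
    have hc := hcon (x.shift (2 * a : ℕ)) (hS.shift _ hx _) (2 * b - 2 * a) (by omega)
      ⟨b - a, by omega⟩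
    simp only [Orb.edge_shift] at hc
    have e1 : ∀ k : ℤ, k + (2 * b - 2 * a : ℕ) + (2 * a : ℕ) = k + (2 * b : ℕ) := by
      intro k; omega
    simp only [e1] at hc
    obtain ⟨⟨k₁, hk₁, hk₁'⟩, k₂, hk₂, hk₂'⟩ := hc
    have ex1 : ∃ M : ℕ, x.edge (M + 1 + (2 * a : ℕ)) ≠ x.edge (M + 1 + (2 * b : ℕ)) := by
      refine ⟨(k₁ - 1).toNat, ?_⟩
      rcases hk₁.eq_or_lt with h | h
      · rw [← h] at hk₁'
        exact absurd (hwab 0 (by omega) (by omega)) hk₁'.symm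
      · rw [show (((k₁ - 1).toNat : ℤ) + 1) = k₁ by omega]; exact hk₁'.symm
    have ex2 : ∃ M : ℕ, x.edge (-M - 1 + (2 * a : ℕ)) ≠ x.edge (-M - 1 + (2 * b : ℕ)) := by
      refine ⟨(-k₂ - 1).toNat, ?_⟩
      rcases hk₂.eq_or_lt with h | h
      · rw [h] at hk₂'
        exact absurd (hwab 0 (by omega) (by omega)) hk₂'.symm
      · rw [show (-((-k₂ - 1).toNat : ℤ) - 1) = k₂ by omega]; exact hk₂'.symm
    classical
    have m1 := Nat.find_spec ex1
    have m2 := Nat.find_spec ex2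
    refine ⟨Nat.find ex1, Nat.find ex2, ?_, ?_, fun k h1 h2 => ?_, m1, m2⟩
    · by_contra hlt
      push Not at hlt
      exact m1 (hwab _ (by omega) (by omega))
    · by_contra hlt
      push Not at hlt
      exact m2 (hwab _ (by omega) (by omega))
    · rcases lt_trichotomy k 0 with h | h | h
      · have := Nat.find_min ex2 (m := (-k - 1).toNat) (by omega)
        rw [not_not, show (-((-k - 1).toNat : ℤ) - 1) = k by omega] at this
        exact this
      · exact hwab k (by omega) (by omega)
      · have := Nat.find_min ex1 (m := (k - 1).toNat) (by omega)
        rw [not_not, show (((k - 1).toNat : ℤ) + 1) = k by omega] at this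
        exact this
  obtain ⟨R, hR, tR⟩ := exists_seq_orbits Lx
  have oE : ∀ a : ℕ, (x.shift (2 * a : ℕ)).off (y.shift (2 * a : ℕ)) = w := by
    intro a
    have := off_shift Lx Ly (b := 0) (m := 2 * a) (fun _ _ _ => he _) dxy
    rw [zero_add] at this
    rw [this, pow_mul]
    simpa [Orb.off] using hxy
  have tt : ∀ m : ℤ, Tendsto (fun k => (R k).shift m) atTop (𝓝 (x.shift m)) := fun m =>
    ((Orb.continuous_shift m).tendsto _).comp tR
  have sw := fun {a b : ℕ} (M M' : ℕ) (h1 : N ≤ M) (h2 : N ≤ M')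
    (h3 : ∀ k : ℤ, -M' ≤ k → k ≤ M → x.edge (k + (2 * a : ℕ)) = x.edge (k + (2 * b : ℕ)))
    (h4 : x.edge (M + 1 + (2 * a : ℕ)) ≠ x.edge (M + 1 + (2 * b : ℕ)))
    (h5 : x.edge (-M' - 1 + (2 * a : ℕ)) ≠ x.edge (-M' - 1 + (2 * b : ℕ))) =>
    hN _ (hS.shift _ hx (2 * a : ℕ)) _ (hS.shift _ hy (2 * a : ℕ)) _ (hS.shift _ hx (2 * b : ℕ)) _
      (hS.shift _ hy (2 * b : ℕ)) (fun _ => he _) (fun _ => he _) (by rw [oE, oE])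
      (by rw [oE, abs_of_pos hw]) M M' h1 h2 h3 h4 h5 (fun k => (R k).shift (2 * a : ℕ))
      (fun k => (R k).shift (2 * b : ℕ)) (fun k => shift_mem_orbits (hR k) _)
      (fun k => shift_mem_orbits (hR k) _) (tt _) (tt _)
  obtain ⟨M, M', g1, g2, g3, g4, g5⟩ := hbr h12 (hsame ha₁ ha₂)
  obtain ⟨L, L', f1, f2, f3, f4, f5⟩ := hbr h23 (hsame ha₂ ha₃)
  have sw1 := (sw M M' g1 g2 g3 g4 g5).2
  have sw2 := (sw L L' f1 f2 f3 f4 f5).1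
  -- The range from `b` to `b + Q` begins at the past end of the agreement of the first two windows,
  -- seen from the first, and finishes at the future end of the agreement of the last two, seen from
  -- the third. A close enough nonsingular orbit reads the same edges in this range.
  set b : ℤ := (2 * a₁ : ℕ) - M' with hb
  set Q : ℕ := 2 * a₃ - 2 * a₁ + M' + L with hQ
  have hag : ∀ᶠ k in atTop, ∀ j : Fin (Q + 1), (R k).edge (b + (j : ℕ)) = x.edge (b + (j : ℕ)) :=
    eventually_all.2 fun j => Orb.eventually_edge tR _
  obtain ⟨k, ⟨r, hr, hk1⟩, ⟨r', hr', hk2⟩, hk3⟩ := (sw1.and (sw2.and hag)).exists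
  have Lk := orbits_subset (hR k)
  have hed : ∀ m : ℕ, m ≤ Q → ∀ j : ℕ, j ≤ m → x.edge (b + j) = (R k).edge (b + j) :=
    fun m hm j hj => (hk3 ⟨j, by omega⟩).symm
  have key := fun (m : ℕ) (hm : m ≤ Q) => side_shift Lx Lk (b := b) (m := m) (hed m hm)
  simp only [Orb.shift_shift] at hk1 hk2
  have p1 : -(M' : ℤ) + (2 * a₁ : ℕ) = b + (0 : ℕ) := by omega
  have p2 : -(M' : ℤ) + (2 * a₂ : ℕ) = b + (2 * (a₂ - a₁) : ℕ) := by omega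
  have p3 : (L : ℤ) + (2 * a₂ : ℕ) = b + (2 * (a₂ - a₁) + (M' + L) : ℕ) := by omega
  have p4 : (L : ℤ) + (2 * a₃ : ℕ) = b + (2 * (a₃ - a₁) + (M' + L) : ℕ) := by omega
  rw [p1, p2, side_rev Lx Lk (hed 0 (by omega) 0 le_rfl),
    side_rev Lx Lk (hed (2 * (a₂ - a₁)) (by omega) _ le_rfl), key _ (by omega), key _ (by omega)] at hk1
  rw [p3, p4, key _ (by omega), key _ (by omega)] at hk2
  have s1 : ((-1 : ℝ)) ^ (2 * (a₂ - a₁)) = 1 := by rw [pow_mul]; simp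
  have s2 : ((-1 : ℝ)) ^ (2 * (a₃ - a₁)) = 1 := by rw [pow_mul]; simp
  have s3 : ((-1 : ℝ)) ^ (M' + L) * (-1 : ℝ) ^ (M' + L) = 1 := by rw [← mul_pow]; simp
  simp only [pow_add, s1, s2, pow_zero, one_mul] at hk1 hk2
  rw [← pow_add, mul_mul_mul_comm, s3, one_mul] at hk2
  -- Measured by arc length, the height of the line of `x` over the line of the nearby orbit is
  -- affine. It changes sign between the past ends at the first two windows and once more between
  -- the future ends at the last two; the middle window ensures that the first change comes first.
  refine not_two_sign_changes ?_ ?_ ?_ hk1 hk2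
  · have := x.len_mono b (Nat.zero_le (2 * (a₂ - a₁)))
    linarith
  · have := x.len_mono b (m := 2 * (a₂ - a₁)) (m' := 2 * (a₂ - a₁) + (M' + L)) (by omega)
    linarith
  · have := x.len_mono b (m := 2 * (a₂ - a₁) + (M' + L)) (m' := 2 * (a₃ - a₁) + (M' + L)) (by omega)
    linarith

end InvSet

/-- The change of the direction over an even number of bounces is a rotation. -/
lemma exists_rotation {x y : Orb n} (hx : x ∈ P.limOrbits) (hy : y ∈ P.limOrbits) (m : ℕ)
    (he : ∀ k : ℤ, 0 ≤ k → k ≤ 2 * m → x.edge k = y.edge k) :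
    ∃ ζ : ℂ, x.dir (2 * m) = ζ * x.dir 0 ∧ y.dir (2 * m) = ζ * y.dir 0 := by
  induction m with
  | zero => exact ⟨1, by simp, by simp⟩
  | succ m ih =>
    obtain ⟨ζ, h1, h2⟩ := ih fun k h0 hk => he k h0 (by push_cast; omega)
    have key : ∀ u v z : ℂ, mirror u (mirror v z) =
        u / (starRingEnd ℂ) u * ((starRingEnd ℂ) v / v) * z := by
      intro u v z
      simp only [mirror, map_mul, map_div₀, Complex.conj_conj]; ring
    have e1 := lim_dir_succ hx (2 * m)
    have e2 := lim_dir_succ hx (2 * m + 1)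
    have e3 := lim_dir_succ hy (2 * m)
    have e4 := lim_dir_succ hy (2 * m + 1)
    rw [he _ (by omega) (by push_cast; omega)] at e1 e2
    have hi : (2 * ((m + 1 : ℕ) : ℤ)) = 2 * m + 1 + 1 := by push_cast; ring
    rw [hi, e2, e4, e1, e3, key, key, h1, h2]
    exact ⟨_, (mul_assoc _ _ _).symm, (mul_assoc _ _ _).symm⟩

/-- If the edges are repeated with an even period for a long time, then so is the direction. -/
lemma exists_dir_periodic (m : ℕ) : ∃ L : ℕ, ∀ x ∈ P.limOrbits,
    (∀ k : ℕ, k < L → x.edge (k + 2 * m) = x.edge k) → x.dir (2 * m) = x.dir 0 := by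
  by_contra! hcon
  choose x hx he hne using hcon
  obtain ⟨y, hy, φ, hφ, hlim⟩ := P.isCompact_limOrbits.tendsto_subseq hx
  have hper : ∀ k, 0 ≤ k → (y.shift (2 * m)).edge k = y.edge k := by
    intro k hk
    obtain ⟨j, h1, h2, h3⟩ := ((Orb.eventually_edge hlim k).and
      ((Orb.eventually_edge hlim (k + 2 * m)).and
      (hφ.tendsto_atTop.eventually (eventually_ge_atTop (k.toNat + 1))))).exists
    rw [Orb.edge_shift, ← h1, ← h2]
    have := he (φ j) k.toNat (by omega)
    rwa [Int.toNat_of_nonneg hk] at this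
  have hd := dir_eq_of_future (shift_mem hy _) hy hper
  rw [Orb.dir_shift, zero_add] at hd
  have hev : ∀ᶠ j in atTop, ∀ k : Fin (2 * m + 1), (x (φ j)).edge k = y.edge k :=
    eventually_all.2 fun k => Orb.eventually_edge hlim _
  obtain ⟨j, hj⟩ := hev.exists
  -- The same edges produce the same rotation, and for the limit, which is truly periodic, this
  -- rotation is trivial.
  obtain ⟨ζ, h1, h2⟩ := exists_rotation (hx (φ j)) hy m fun k h0 hk => by
    have := hj ⟨k.toNat, by omega⟩
    simpa [Int.toNat_of_nonneg h0] using this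
  have hy0 : y.dir 0 ≠ 0 := norm_ne_zero_iff.1 (by rw [lim_norm_dir hy]; norm_num)
  rw [hd] at h2
  have hζ : ζ = 1 := (mul_eq_right₀ hy0).1 h2.symm
  rw [hζ, one_mul] at h1
  exact hne _ h1

end PolygonalTable

/-! ### Limit orbits with the same aperiodic future -/

namespace PolygonalTable
variable {n : ℕ} {P : PolygonalTable n}

/-- At the end of a long stretch with even period, two parallel orbits with the same aperiodic
future are separated from their translates by a vertex. -/
lemma exists_switch_of_stretch {c : ℕ → Fin n} (hc : Aperiodic c) {x y : Orb n}
    (hx : x ∈ P.limOrbits) (hy : y ∈ P.limOrbits) (hxc : ∀ k : ℕ, x.edge k = c k)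
    (hyc : ∀ k : ℕ, y.edge k = c k) (hw : x.off y ≠ 0) {s : ℕ} (hs : 0 < s)
    (hst : ∀ L : ℕ, ∃ a : ℕ, ∀ k < L, c (a + k + 2 * s) = c (a + k))
    {R : ℕ → Orb n} (hR : ∀ k, R k ∈ P.orbits) (tR : Tendsto R atTop (𝓝 x)) (B : ℕ) :
    ∃ i : ℕ, B ≤ i ∧ ∀ᶠ k in atTop, ∃ r : ℝ, 0 ≤ r ∧ r ≤ P.diam ∧
      ((R k).shift i).side ((x.shift i).pos 0 + r * (x.shift i).dir 0) *
      ((R k).shift (i + 2 * s : ℕ)).side ((x.shift (i + 2 * s : ℕ)).pos 0 +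
        r * (x.shift (i + 2 * s : ℕ)).dir 0) < 0 := by
  have hdia := P.diam_pos
  obtain ⟨L₀, hL₀⟩ := exists_dir_periodic (P := P) s
  -- Along `m` periods the displacements by one period add up, but the sum is at most `diam`. So a
  -- single displacement is less than an eighth of the distance of the two orbits, as
  -- `forward_switch` demands.
  obtain ⟨m, hm⟩ := exists_nat_gt (8 * P.diam / |x.off y|)
  have hwp := abs_pos.2 hw
  rw [div_lt_iff₀ hwp] at hm
  obtain ⟨a, ha⟩ := hst (L₀ + 2 * s * m + B + 1)
  -- The stretch comes to an end because `c` is not eventually periodic; the separation takes place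
  -- at the first failure of the period.
  have hex : ∃ k, c (a + k + 2 * s) ≠ c (a + k) := by
    by_contra! hcon
    refine hc ⟨a, 2 * s, by omega, fun k hk => ?_⟩
    obtain ⟨d, rfl⟩ := Nat.exists_eq_add_of_le hk
    exact hcon d
  classical
  set E := Nat.find hex with hE
  have hEs : c (a + E + 2 * s) ≠ c (a + E) := Nat.find_spec hex
  have hEm : ∀ k < E, c (a + k + 2 * s) = c (a + k) := fun k hk => not_not.1 (Nat.find_min hex hk)
  have hEL : L₀ + 2 * s * m + B + 1 ≤ E := by
    by_contra hlt
    push Not at hlt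
    exact hEs (ha _ hlt)
  obtain ⟨E', hE'⟩ : ∃ E', E = E' + 1 := ⟨E - 1, by omega⟩
  set X := x.shift a with hX
  have LX : X ∈ P.limOrbits := shift_mem hx a
  set Z := X.shift (2 * s) with hZ
  have LZ : Z ∈ P.limOrbits := shift_mem LX _
  have hXe : ∀ k : ℕ, X.edge k = c (a + k) := fun k => by
    rw [hX, Orb.edge_shift, ← hxc]; congr 1; push_cast; ring
  have hZe : ∀ k : ℕ, Z.edge k = c (a + k + 2 * s) := fun k => by
    have := hXe (k + 2 * s)
    rw [hZ, Orb.edge_shift]; push_cast at this; rw [this, add_assoc]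
  have hd0 : X.dir 0 = Z.dir 0 := by
    have := hL₀ X LX fun k hk => by
      have := hXe (k + 2 * s)
      push_cast at this
      rw [this, hXe, ← add_assoc]; exact hEm k (by omega)
    change X.dir 0 = X.dir (0 + 2 * s)
    rw [zero_add, this]
  have hag : ∀ {M : ℕ}, M < E → ∀ j : ℕ, 1 ≤ j → j ≤ M → X.edge (0 + j) = Z.edge (0 + j) :=
    fun hM j _ hj => by rw [zero_add, hXe, hZe, hEm j (by omega)]
  have hoff : ∀ {M : ℕ}, M < E → (X.shift M).off (Z.shift M) = (-1) ^ M * X.off Z := by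
    intro M hM
    have := off_shift LX LZ (hag hM) hd0
    rw [zero_add] at this
    rw [this]; simp [Orb.off]
  have hdir : ∀ {M : ℕ}, M < E → X.dir M = Z.dir M := by
    intro M hM
    have := dir_eq_add LX LZ (hag hM) hd0
    rwa [zero_add] at this
  -- the translation is small
  have hper : ∀ j : ℕ, j ≤ m → X.dir (2 * s * j : ℕ) = X.dir 0 ∧
      crs (X.dir 0) (X.pos (2 * s * j : ℕ) - X.pos 0) = j * X.off Z := by
    intro j
    induction j with
    | zero => intro _; simp [crs_zero_right]
    | succ j ih =>
      intro hj
      obtain ⟨i1, i2⟩ := ih (by omega)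
      have hlt : 2 * s * j < E := by
        have : 2 * s * j ≤ 2 * s * m := Nat.mul_le_mul_left _ (by omega)
        omega
      have h1 : X.dir (2 * s * j : ℕ) = X.dir ((2 * s * j : ℕ) + 2 * s) := hdir hlt
      have h2 := hoff hlt
      have hi : ((2 * s * (j + 1) : ℕ) : ℤ) = (2 * s * j : ℕ) + 2 * s := by push_cast; ring
      rw [← hi, i1] at h1
      refine ⟨h1.symm, ?_⟩
      simp only [Orb.off, Orb.dir_shift, Orb.pos_shift, zero_add, i1] at h2
      simp only [hZ, Orb.pos_shift, zero_add] at h2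
      rw [← hi, mul_assoc 2 s j, pow_mul, neg_one_sq, one_pow, one_mul] at h2
      rw [← sub_add_sub_cancel _ (X.pos ((2 * (s * j) : ℕ) : ℤ)), crs_add_right, h2,
        ← mul_assoc 2 s j, i2]
      simp only [Orb.off, hZ, Orb.pos_shift, zero_add]
      push_cast; ring
  have hsmall : |X.off Z| < |x.off y| / 8 := by
    have h1 := (hper m le_rfl).2
    have h2 := (abs_crs_le (X.dir 0) (X.pos (2 * s * m : ℕ) - X.pos 0))
    rw [h1, lim_norm_dir LX, one_mul, abs_mul, Nat.abs_cast] at h2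
    have h3 := h2.trans (norm_pos_sub_le LX LX 0)
    have hm0 : (0 : ℝ) < m := by
      by_contra hneg
      push Not at hneg
      nlinarith
    have h4 : (m : ℝ) * |X.off Z| < m * (|x.off y| / 8) := by linarith
    exact lt_of_mul_lt_mul_left h4 hm0.le
  have dxy : x.dir 0 = y.dir 0 := dir_eq_of_future hx hy fun k hk => by
    have h1 := hxc k.toNat
    have h2 := hyc k.toNat
    rw [Int.toNat_of_nonneg hk] at h1 h2
    rw [h1, h2]
  have oxy : ∀ i : ℕ, (x.shift i).off (y.shift i) = (-1) ^ i * x.off y := by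
    intro i
    have := off_shift hx hy (b := 0) (m := i) (fun j _ _ => by rw [zero_add, hxc, hyc]) dxy
    rw [zero_add] at this
    rw [this]; simp [Orb.off]
  set i := a + E' with hi
  have r1 : x.shift i = X.shift E' := by
    rw [hX, Orb.shift_shift, hi]; congr 1; push_cast; ring
  have r2 : x.shift (i + 2 * s : ℕ) = Z.shift E' := by
    rw [hZ, hX, Orb.shift_shift, Orb.shift_shift, hi]; congr 1; push_cast; ring
  have aux : ∀ M : ℕ, |(-1) ^ M * x.off y| = |x.off y| := fun M => by
    rw [abs_mul, abs_pow, abs_neg, abs_one, one_pow, one_mul]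
  have hfut : ∀ j : ℕ, ∀ k : ℤ, 0 ≤ k → (y.shift j).edge k = (x.shift j).edge k := by
    intro j k hk
    have h1 := hxc (k.toNat + j)
    have h2 := hyc (k.toNat + j)
    push_cast at h1 h2
    rw [Int.toNat_of_nonneg hk] at h1 h2
    rw [Orb.edge_shift, Orb.edge_shift, h1, h2]
  have hcr : (X.shift E').dir 0 = (Z.shift E').dir 0 := by
    simpa using hdir (M := E') (by omega)
  have main := (forward_switch (shift_mem hx i) (shift_mem hy i) (shift_mem hx (i + 2 * s : ℕ))
    (shift_mem hy (i + 2 * s : ℕ)) (hfut i) (hfut (i + 2 * s))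
    (by rw [r1, r2]; simp [hXe, hZe, hEm E' (by omega)])
    (by
      have h1 := hXe (E' + 1)
      have h2 := hZe (E' + 1)
      push_cast at h1 h2
      rw [r1, r2]
      simp only [Orb.edge_shift]
      rw [show (1 : ℤ) + E' = E' + 1 by ring, h1, h2, ← hE']; exact hEs.symm)
    (by rw [oxy]; exact fun h => hw (by simpa using h))
    (by rw [oxy, oxy, pow_add, pow_mul]; simp)
    (by rw [oxy, aux, r1, r2, hoff (by omega)]; rw [abs_mul, abs_pow, abs_neg, abs_one, one_pow, one_mul]; exact hsmall)
    (by rw [oxy, aux, r1, r2, hcr]; simp [hwp])).2 (by rw [r1, r2, hcr, crs_self])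
  have tt : ∀ m : ℤ, Tendsto (fun k => (R k).shift m) atTop (𝓝 (x.shift m)) := fun m =>
    ((Orb.continuous_shift m).tendsto _).comp tR
  exact ⟨i, by omega, main.2 _ _ (fun k => shift_mem_orbits (hR k) _)
    (fun k => shift_mem_orbits (hR k) _) (tt _) (tt _)⟩

/-- Each long stretch ends with a vertex that makes the height over a nearby orbit change its sign
within one period; an affine function does not change its sign twice. -/
lemma no_stretches {c : ℕ → Fin n} (hc : Aperiodic c) {x y : Orb n}
    (hx : x ∈ P.limOrbits) (hy : y ∈ P.limOrbits) (hxc : ∀ k : ℕ, x.edge k = c k)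
    (hyc : ∀ k : ℕ, y.edge k = c k) (hw : x.off y ≠ 0) {s : ℕ} (hs : 0 < s) :
    ∃ L : ℕ, ∀ a : ℕ, ∃ k < L, c (a + k + 2 * s) ≠ c (a + k) := by
  by_contra! hst
  obtain ⟨R, hR, tR⟩ := exists_seq_orbits hx
  obtain ⟨M, -, hM⟩ := P.exists_len_ge P.diam
  obtain ⟨i, -, h1⟩ := exists_switch_of_stretch hc hx hy hxc hyc hw hs hst hR tR 0
  -- The vertex of the first separation may be as far as `diam` ahead of the bounce, so the second
  -- one is looked for after a further length of `diam`.
  obtain ⟨j, hj, h2⟩ := exists_switch_of_stretch hc hx hy hxc hyc hw hs hst hR tR (i + 2 * s + M)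
  have hag : ∀ᶠ k in atTop, ∀ l : Fin (j + 2 * s + 1), (R k).edge (0 + (l : ℕ)) = x.edge (0 + (l : ℕ)) :=
    eventually_all.2 fun l => Orb.eventually_edge tR _
  obtain ⟨k, ⟨r, hr, hr1, hk1⟩, ⟨r', hr', -, hk2⟩, hk3⟩ := (h1.and (h2.and hag)).exists
  have Lk := orbits_subset (hR k)
  have key := fun (m : ℕ) (hm : m ≤ j + 2 * s) => side_shift hx Lk (b := 0) (m := m)
    fun l hl => (hk3 ⟨l, by omega⟩).symm
  simp only [zero_add] at key
  rw [key _ (by omega), key _ (by omega)] at hk1 hk2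
  have s1 : ∀ i : ℕ, (-1 : ℝ) ^ (i + 2 * s) = (-1) ^ i := fun i => by rw [pow_add, pow_mul]; simp
  have s3 : ∀ i : ℕ, ((-1 : ℝ)) ^ i * (-1 : ℝ) ^ i = 1 := fun i => by rw [← mul_pow]; simp
  rw [s1, mul_mul_mul_comm, s3, one_mul] at hk1 hk2
  refine not_two_sign_changes ?_ ?_ ?_ hk1 hk2
  · linarith [x.len_mono 0 (m := i) (m' := i + 2 * s) (by omega)]
  · have e1 := x.len_add 0 (i + 2 * s) (j - (i + 2 * s))
    rw [show i + 2 * s + (j - (i + 2 * s)) = j by omega] at e1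
    linarith [hM x hx (0 + (i + 2 * s : ℕ)) (j - (i + 2 * s)) (by omega)]
  · linarith [x.len_mono 0 (m := j) (m' := j + 2 * s) (by omega)]

/-- Limit orbits with the same aperiodic future lie on the same line. -/
theorem off_eq_zero_of_future {c : ℕ → Fin n} (hc : Aperiodic c) {x y : Orb n}
    (hx : x ∈ P.limOrbits) (hy : y ∈ P.limOrbits) (hxc : ∀ k : ℕ, x.edge k = c k)
    (hyc : ∀ k : ℕ, y.edge k = c k) : x.off y = 0 := by
  by_contra hw
  -- Limit orbits all of whose finite words occur in `c`. This set is closed, invariant under shifts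
  -- and contains all limits of forward shifts of `x` and `y`, so periodicity of an element is
  -- visible in `c`.
  set S : Set (Orb n) := P.limOrbits ∩
    {z | ∀ (m : ℤ) (L : ℕ), ∃ a : ℕ, ∀ j < L, z.edge (m + j) = c (a + j)} with hSd
  have hS : P.InvSet S := by
    refine ⟨?_, inter_subset_left, fun z hz i => ⟨shift_mem hz.1 i, fun m L => ?_⟩⟩
    · refine isClosed_of_closure_subset fun z hz => ?_
      obtain ⟨u, hu, hlim⟩ := mem_closure_iff_seq_limit.1 hz
      refine ⟨isClosed_closure.mem_of_tendsto hlim (Eventually.of_forall fun j => (hu j).1),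
        fun m L => ?_⟩
      have hev : ∀ᶠ k in atTop, ∀ l : Fin L, (u k).edge (m + (l : ℕ)) = z.edge (m + (l : ℕ)) :=
        eventually_all.2 fun l => Orb.eventually_edge hlim _
      obtain ⟨k, hk⟩ := hev.exists
      obtain ⟨a, ha⟩ := (hu k).2 m L
      exact ⟨a, fun j hj => by rw [← ha j hj]; exact (hk ⟨j, hj⟩).symm⟩
    · obtain ⟨a, ha⟩ := hz.2 (m + i) L
      refine ⟨a, fun j hj => ?_⟩
      rw [← ha j hj, Orb.edge_shift]; congr 1; ring
  have hfut : ∀ k, 0 ≤ k → x.edge k = y.edge k := fun k hk => by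
    have h1 := hxc k.toNat
    have h2 := hyc k.toNat
    rw [Int.toNat_of_nonneg hk] at h1 h2
    rw [h1, h2]
  have dxy : x.dir 0 = y.dir 0 := dir_eq_of_future hx hy hfut
  obtain ⟨⟨X, Y⟩, ⟨hX, hY⟩, φ, hφ, hlim⟩ :=
    (P.isCompact_limOrbits.prod P.isCompact_limOrbits).tendsto_subseq
    (x := fun j : ℕ => (x.shift (2 * j : ℕ), y.shift (2 * j : ℕ)))
    fun j => ⟨shift_mem hx _, shift_mem hy _⟩
  have l1 : Tendsto ((fun j : ℕ => x.shift (2 * j : ℕ)) ∘ φ) atTop (𝓝 X) :=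
    (continuous_fst.tendsto _).comp hlim
  have l2 : Tendsto ((fun j : ℕ => y.shift (2 * j : ℕ)) ∘ φ) atTop (𝓝 Y) :=
    (continuous_snd.tendsto _).comp hlim
  have hmem : ∀ {u U : Orb n}, U ∈ P.limOrbits → (∀ k : ℕ, u.edge k = c k) →
      Tendsto ((fun j : ℕ => u.shift (2 * j : ℕ)) ∘ φ) atTop (𝓝 U) → U ∈ S := by
    intro u U hU huc hl
    refine ⟨hU, fun m L => ?_⟩
    have hev : ∀ᶠ k in atTop, ∀ l : Fin L,
        (((fun j : ℕ => u.shift (2 * j : ℕ)) ∘ φ) k).edge (m + (l : ℕ)) = U.edge (m + (l : ℕ)) :=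
      eventually_all.2 fun l => Orb.eventually_edge hl _
    obtain ⟨k, hk, hk'⟩ := (hev.and (hφ.tendsto_atTop.eventually
      (eventually_ge_atTop m.natAbs))).exists
    refine ⟨(m + 2 * φ k).toNat, fun j hj => ?_⟩
    rw [← hk ⟨j, hj⟩, ← huc]
    simp only [Function.comp, Orb.edge_shift]
    congr 1; omega
  have hXY : ∀ k, X.edge k = Y.edge k := fun k => by
    obtain ⟨j, h1, h2, h3⟩ := ((Orb.eventually_edge l1 k).and ((Orb.eventually_edge l2 k).and
      (hφ.tendsto_atTop.eventually (eventually_ge_atTop k.natAbs)))).exists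
    rw [← h1, ← h2]; exact hfut _ (by push_cast; omega)
  have hoff : X.off Y = x.off y := by
    refine tendsto_nhds_unique ((Orb.continuous_off.tendsto _).comp hlim)
      (tendsto_const_nhds.congr fun j => ?_)
    have := off_shift hx hy (b := 0) (m := 2 * φ j) (fun _ _ _ => hfut _ (by omega)) dxy
    rw [zero_add] at this
    simp only [Function.comp]
    rw [this, pow_mul]; simp [Orb.off]
  obtain ⟨z, hz, t, ht, ⟨s, hs⟩, hper⟩ := hS.exists_periodic (hmem hX hxc l1) (hmem hY hyc l2)
    (fun k _ => hXY k) (by rwa [hoff])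
  obtain ⟨L, hL⟩ := no_stretches hc hx hy hxc hyc hw (s := s) (by omega)
  -- A piece of length `L + t` of the periodic half of `z` occurs in `c`, and shows there a stretch
  -- of period `t = 2 * s`.
  have hst : ∃ a : ℕ, ∀ k < L, c (a + k + 2 * s) = c (a + k) := by
    rcases hper with hper | hper
    · obtain ⟨a, ha⟩ := hz.2 0 (L + t)
      refine ⟨a, fun k hk => ?_⟩
      have h1 := ha k (by omega)
      have h2 := ha (k + t) (by omega)
      rw [zero_add] at h1 h2
      push_cast at h2
      rw [hper k (by omega), h1, ← add_assoc, hs, ← two_mul] at h2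
      exact h2.symm
    · obtain ⟨a, ha⟩ := hz.2 (-L) (L + t)
      refine ⟨a, fun k hk => ?_⟩
      have h1 := ha k (by omega)
      have h2 := ha (k + t) (by omega)
      push_cast at h2
      rw [← add_assoc, hper _ (by omega), h1, ← add_assoc, hs, ← two_mul] at h2
      exact h2.symm
  obtain ⟨a, ha⟩ := hst
  obtain ⟨k, hk, hne⟩ := hL a
  exact hne (ha k hk)

end PolygonalTable

/-! ### Square codes as Sturmian sequences -/

section Square

lemma squareTable_edgeVec : squareTable.edgeVec 0 = 1 ∧ squareTable.edgeVec 1 = Complex.I ∧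
    squareTable.edgeVec 2 = -1 ∧ squareTable.edgeVec 3 = -Complex.I := by
  simp [PolygonalTable.edgeVec, squareTable, squareVertex]

lemma squareTable_vertex : squareTable.vertex 0 = 0 ∧ squareTable.vertex 1 = 1 ∧
    squareTable.vertex 2 = 1 + Complex.I ∧ squareTable.vertex 3 = Complex.I := by
  simp [squareTable, squareVertex]

/-- The points on the sides of the square. -/
lemma squareTable_openEdge {i : Fin 4} {z : ℂ} (hz : z ∈ squareTable.openEdge i) :
    (i = 0 ∧ z.im = 0 ∧ 0 < z.re ∧ z.re < 1) ∨ (i = 2 ∧ z.im = 1 ∧ 0 < z.re ∧ z.re < 1) ∨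
    (i = 1 ∧ z.re = 1 ∧ 0 < z.im ∧ z.im < 1) ∨ (i = 3 ∧ z.re = 0 ∧ 0 < z.im ∧ z.im < 1) := by
  obtain ⟨t, h0, h1, rfl⟩ := squareTable.mem_openEdge.1 hz
  obtain ⟨e0, e1, e2, e3⟩ := squareTable_edgeVec
  obtain ⟨v0, v1, v2, v3⟩ := squareTable_vertex
  fin_cases i
  · left; simp [e0, v0, h0, h1]
  · right; right; left; simp [e1, v1, h0, h1]
  · right; left; simp [e2, v2, h0, h1]
  · right; right; right; simp [e3, v3, h0, h1]

/-- The part of a unit interval that lies behind a point moving in the direction `a`. -/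
noncomputable def behind (a x : ℝ) : ℝ := if 0 < a then x else 1 - x

lemma behind_add {a x t : ℝ} : behind a (x + t * a) = behind a x + t * |a| := by
  unfold behind
  split_ifs with h
  · rw [abs_of_pos h]
  · rw [abs_of_nonpos (not_lt.1 h)]; ring

lemma behind_pos {a x : ℝ} (h0 : 0 < x) (h1 : x < 1) : 0 < behind a x ∧ behind a x < 1 := by
  unfold behind; split_ifs <;> constructor <;> linarith

/-- In the unfolded square, arriving at a wall means that the coordinate has reached 1; after the
reflection the direction is reversed and the coordinate starts again at 0. -/
lemma behind_wall {a x y t : ℝ} (ha : a ≠ 0) (ht : 0 < t) (hy : y = x + t * a) (h0 : 0 ≤ x)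
    (h1 : x ≤ 1) (hw : y = 0 ∨ y = 1) : behind a x + t * |a| = 1 ∧ behind (-a) y = 0 := by
  have h2 := behind_add (a := a) (x := x) (t := t)
  rw [← hy] at h2
  rcases ha.lt_or_gt with h | h
  · have := mul_neg_of_pos_of_neg ht h
    have hy0 : y = 0 := by rcases hw with hw | hw <;> linarith
    rw [← h2]
    simp [behind, h, h.not_gt, hy0]
  · have := mul_pos ht h
    have hy1 : y = 1 := by rcases hw with hw | hw <;> linarith
    rw [← h2]
    simp [behind, h, h.not_gt, hy1]

/-- The runs of a bounce sequence on the square, as in a Sturmian word. -/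
lemma IsSquareCode.exists_floor {p q : ℕ} {s : ℕ → Bool} (hs : IsSquareCode p q s) (hp : 0 < p)
    (hq : 0 < q) : ∃ X : ℝ, 0 < X ∧ X < 1 ∧ (∀ i : ℕ, ∀ m : ℤ, X + i * (q / p : ℝ) ≠ m) ∧
      ∀ i : ℕ, (runLength s i : ℤ) = ⌊X + ((i + 1 : ℕ) : ℝ) * (q / p : ℝ)⌋ - ⌊X + i * (q / p : ℝ)⌋ := by
  obtain ⟨hs0, b, e, hb, hslope, hcode⟩ := hs
  obtain ⟨x, hx, rfl, rfl⟩ := hb.exists_orbit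
  have hp' : (0 : ℝ) < p := by exact_mod_cast hp
  have hq' : (0 : ℝ) < q := by exact_mod_cast hq
  obtain ⟨e0, e1, e2, e3⟩ := squareTable_edgeVec
  have hdir : ∀ k : ℕ, x.dir (k + 1) = if s (k + 1) = true then -(starRingEnd ℂ) (x.dir k) else
      (starRingEnd ℂ) (x.dir k) := by
    intro k
    rw [PolygonalTable.dir_succ hx k, PolygonalTable.reflectDir_eq, mirror]
    have h1 := hcode (k + 1)
    push_cast at h1
    simp only [h1]
    rcases squareTable_openEdge (PolygonalTable.pos_mem hx (k + 1)) with h | h | h | h <;>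
      simp [h.1, e0, e1, e2, e3]
  have hstep0 := PolygonalTable.step_pos hx
  have habs : ∀ k : ℕ, |(x.dir k).re| = |(x.dir 0).re| ∧ |(x.dir k).im| = |(x.dir 0).im| := by
    intro k
    induction k with
    | zero => simp
    | succ k ih =>
      have := hdir k
      push_cast
      rw [this]
      split_ifs <;> simpa using ih
  set α := |(x.dir 0).re| with hα
  set γ := |(x.dir 0).im| with hγ
  have hratio : γ * q = α * p := by
    have h1 := PolygonalTable.pos_succ hx 0
    rw [zero_add] at h1
    rw [h1] at hslope
    simp only [add_sub_cancel_left, Complex.im_ofReal_mul, Complex.re_ofReal_mul, abs_mul,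
      abs_of_pos (hstep0 0)] at hslope
    have := (hstep0 0).ne'
    apply mul_left_cancel₀ this
    linarith
  have hn := PolygonalTable.norm_dir hx 0
  have hα0 : 0 < α := by
    refine (abs_nonneg _).lt_of_ne fun h => ?_
    rw [← hα] at h
    rw [← h, zero_mul] at hratio
    have h2 : γ = 0 := (mul_eq_zero.1 hratio).resolve_right hq'.ne'
    have h3 : x.dir 0 = 0 := Complex.ext (abs_eq_zero.1 h.symm) (abs_eq_zero.1 h2)
    rw [h3, norm_zero] at hn
    exact zero_ne_one hn
  have hγ0 : 0 < γ := by
    have : 0 < γ * q := by rw [hratio]; positivity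
    exact (pos_iff_pos_of_mul_pos this).2 hq'
  -- `ξ` and `η` are the positions within the current cell of the unfolded square lattice. There the
  -- trajectory is a straight line with the speeds `α` and `γ`.
  set ξ : ℕ → ℝ := fun k => behind (x.dir k).re (x.pos k).re with hξ
  set η : ℕ → ℝ := fun k => behind (x.dir k).im (x.pos k).im with hη
  have hne : ∀ k : ℕ, (x.dir k).re ≠ 0 ∧ (x.dir k).im ≠ 0 := fun k =>
    ⟨abs_pos.1 ((habs k).1 ▸ hα0), abs_pos.1 ((habs k).2 ▸ hγ0)⟩
  have hbox : ∀ k : ℕ, 0 ≤ (x.pos k).re ∧ (x.pos k).re ≤ 1 ∧ 0 ≤ (x.pos k).im ∧ (x.pos k).im ≤ 1 := by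
    intro k
    rcases squareTable_openEdge (PolygonalTable.pos_mem hx k) with ⟨-, h1, h2, h3⟩ |
      ⟨-, h1, h2, h3⟩ | ⟨-, h1, h2, h3⟩ | ⟨-, h1, h2, h3⟩ <;> rw [h1] <;>
      refine ⟨?_, ?_, ?_, ?_⟩ <;> linarith
  have hsF : ∀ k : ℕ, s k = false → ((x.pos k).im = 0 ∨ (x.pos k).im = 1) ∧ 0 < (x.pos k).re ∧
      (x.pos k).re < 1 := by
    intro k hk
    have h0 : ¬ (x.edge k = 1 ∨ x.edge k = 3) := by rw [← hcode, hk]; simp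
    rcases squareTable_openEdge (PolygonalTable.pos_mem hx k) with h | h | h | h
    · exact ⟨Or.inl h.2.1, h.2.2⟩
    · exact ⟨Or.inr h.2.1, h.2.2⟩
    · exact absurd (Or.inl h.1) h0
    · exact absurd (Or.inr h.1) h0
  have hsT : ∀ k : ℕ, s k = true → ((x.pos k).re = 0 ∨ (x.pos k).re = 1) ∧ 0 < (x.pos k).im ∧
      (x.pos k).im < 1 := by
    intro k hk
    have h0 := (hcode k).1 hk
    rcases squareTable_openEdge (PolygonalTable.pos_mem hx k) with h | h | h | h
    · rw [h.1] at h0; simp at h0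
    · rw [h.1] at h0; simp at h0
    · exact ⟨Or.inr h.2.1, h.2.2⟩
    · exact ⟨Or.inl h.2.1, h.2.2⟩
  have hpos : ∀ k : ℕ, (x.pos ((k : ℤ) + 1)).re = (x.pos k).re + x.step k * (x.dir k).re ∧
      (x.pos ((k : ℤ) + 1)).im = (x.pos k).im + x.step k * (x.dir k).im := by
    intro k
    rw [PolygonalTable.pos_succ hx k]; simp
  have stepF : ∀ k : ℕ, s (k + 1) = false → ξ (k + 1) = ξ k + x.step k * α ∧
      η k + x.step k * γ = 1 ∧ η (k + 1) = 0 := by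
    intro k hk
    have h1 := hdir k
    rw [hk, if_neg (by simp)] at h1
    have h2 := hsF (k + 1) hk
    push_cast at h2
    simp only [hξ, hη]
    push_cast
    rw [h1, Complex.conj_re, Complex.conj_im, (hpos k).1, behind_add, (habs k).1]
    refine ⟨rfl, ?_⟩
    have := behind_wall (hne k).2 (hstep0 k) (hpos k).2 (hbox k).2.2.1 (hbox k).2.2.2 h2.1
    rwa [(habs k).2] at this
  have stepT : ∀ k : ℕ, s (k + 1) = true → ξ k + x.step k * α = 1 ∧ ξ (k + 1) = 0 ∧
      η (k + 1) = η k + x.step k * γ := by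
    intro k hk
    have h1 := hdir k
    rw [hk, if_pos rfl] at h1
    have h2 := hsT (k + 1) hk
    push_cast at h2
    simp only [hξ, hη]
    push_cast
    rw [h1, Complex.neg_re, Complex.neg_im, Complex.conj_re, Complex.conj_im, neg_neg, (hpos k).2,
      behind_add, (habs k).2]
    have := behind_wall (hne k).1 (hstep0 k) (hpos k).1 (hbox k).1 (hbox k).2.1 h2.1
    rw [(habs k).1] at this
    exact ⟨this.1, this.2, rfl⟩
  set c : ℕ → ℕ := Nat.count (fun k => s k = false) with hc
  have hη0 : η 0 = 0 := by
    have h1 := PolygonalTable.crs_dir_pos hx 0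
    have h0 : ¬ (x.edge (0 : ℕ) = 1 ∨ x.edge (0 : ℕ) = 3) := by rw [← hcode, hs0]; simp
    simp only [hη, behind]
    rcases squareTable_openEdge (PolygonalTable.pos_mem hx (0 : ℕ)) with h | h | h | h
    · rw [Nat.cast_zero] at *
      rw [h.1, e0] at h1
      have : 0 < (x.dir 0).im := by simpa [crs] using h1
      rw [if_pos this, h.2.1]
    · rw [Nat.cast_zero] at *
      rw [h.1, e2] at h1
      have : (x.dir 0).im < 0 := by simpa [crs] using h1
      rw [if_neg this.not_gt, h.2.1, sub_self]
    · exact absurd (Or.inl h.1) h0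
    · exact absurd (Or.inr h.1) h0
  -- `c (k + 1)` counts the horizontal bounces among the bounces 0 to `k`. The distances travelled,
  -- minus the numbers of walls crossed, give the positions in the cell; the bounce 0 is counted but
  -- not crossed, whence the `- 1`.
  have inv : ∀ k : ℕ, ξ k = ξ 0 + x.len 0 k * α - (k + 1 - c (k + 1)) ∧
      η k = x.len 0 k * γ - (c (k + 1) - 1) := by
    intro k
    induction k with
    | zero => simp [Orb.len_zero, hc, Nat.count_succ, hs0, hη0]
    | succ k ih =>
      rw [Orb.len_succ, zero_add]
      cases hk : s (k + 1) with
      | false =>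
        have hck : c (k + 1 + 1) = c (k + 1) + 1 := by simp [hc, Nat.count_succ _ (k + 1), hk]
        obtain ⟨g1, g2, g3⟩ := stepF k hk
        rw [hck, g1, g3, ih.1]
        push_cast
        exact ⟨by ring, by linarith [ih.2]⟩
      | true =>
        have hck : c (k + 1 + 1) = c (k + 1) := by simp [hc, Nat.count_succ _ (k + 1), hk]
        obtain ⟨g1, g2, g3⟩ := stepT k hk
        rw [hck, g2, g3, ih.2]
        push_cast
        exact ⟨by linarith [ih.1], by ring⟩
  -- If only vertical sides were hit from some time on, then `η` would increase by `γ / α` at each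
  -- bounce and could not stay below 1.
  have hinf : {k | s k = false}.Infinite := by
    by_contra hfin
    rw [Set.not_infinite] at hfin
    obtain ⟨N, hN⟩ := hfin.bddAbove
    have hT : ∀ k, N < k → s k = true := by
      intro k hk
      by_contra hcon
      have hk' : s k = false := by simpa using hcon
      exact absurd (hN hk') (by omega)
    have hgrow : ∀ j : ℕ, η (N + 1 + j) = η (N + 1) + j * (γ / α) := by
      intro j
      induction j with
      | zero => simp
      | succ j ih =>
        have g := stepT (N + 1 + j) (hT _ (by omega))
        have g0 : ξ (N + 1 + j) = 0 := (stepT (N + j) (hT _ (by omega))).2.1 ▸ by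
          rw [show N + 1 + j = N + j + 1 by ring]
        rw [g0, zero_add] at g
        have hst : x.step (N + 1 + j : ℕ) = 1 / α := by rw [eq_div_iff hα0.ne']; exact g.1
        rw [← add_assoc, g.2.2, ih, hst]; push_cast; ring
    obtain ⟨j, hj⟩ := exists_nat_gt (α / γ)
    rw [div_lt_iff₀ hγ0] at hj
    have h1 : (1 : ℝ) < j * (γ / α) := by rw [mul_div_assoc', lt_div_iff₀ hα0]; linarith
    have h2 := hsT _ (hT (N + 1 + j) (by omega))
    have h3 := hsT _ (hT (N + 1) (by omega))
    have h4 := (behind_pos (a := (x.dir (N + 1 + j : ℕ)).im) h2.2.1 h2.2.2).2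
    have h5 := (behind_pos (a := (x.dir (N + 1 : ℕ)).im) h3.2.1 h3.2.2).1
    have h6 := hgrow j
    simp only [hη] at h6
    linarith
  set ν : ℕ → ℕ := Nat.nth (fun k => s k = false) with hν
  have hνs : ∀ i, s (ν i) = false := fun i => Nat.nth_mem_of_infinite hinf i
  have hνc : ∀ i, c (ν i + 1) = i + 1 := fun i => by
    rw [hc, Nat.count_succ, if_pos (hνs i), Nat.count_nth_of_infinite hinf]
  have hηz : ∀ i, η (ν i) = 0 := by
    intro i
    rcases Nat.eq_zero_or_pos (ν i) with h | h
    · rw [h, hη0]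
    · obtain ⟨k, hk⟩ : ∃ k, ν i = k + 1 := ⟨ν i - 1, by omega⟩
      rw [hk]; exact (stepF k (hk ▸ hνs i)).2.2
  -- At the `i`-th horizontal bounce the height travelled is `i`, so the width travelled is `i * (q
  -- / p)`, and `ν i - i` vertical walls have been crossed. The inequalities are strict because the
  -- bounce is not at a corner.
  have hmain : ∀ i : ℕ, 0 < ξ 0 + i * (q / p : ℝ) - ((ν i : ℝ) - i) ∧
      ξ 0 + i * (q / p : ℝ) - ((ν i : ℝ) - i) < 1 := by
    intro i
    obtain ⟨g1, g2⟩ := inv (ν i)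
    rw [hηz, hνc] at g2
    rw [hνc] at g1
    push_cast at g1 g2
    have g3 : x.len 0 (ν i) * α = i * (q / p : ℝ) := by
      have h1 : x.len 0 (ν i) * γ = i := by linarith
      have h2 : x.len 0 (ν i) * α * p = i * q := by
        rw [mul_assoc, ← hratio, ← mul_assoc, h1]
      rw [mul_div_assoc', eq_div_iff hp'.ne', h2]
    rw [g3] at g1
    have g4 := behind_pos (a := (x.dir (ν i)).re) (hsF _ (hνs i)).2.1 (hsF _ (hνs i)).2.2
    have g5 : ξ (ν i) = ξ 0 + i * (q / p : ℝ) - ((ν i : ℝ) - i) := by rw [g1]; ring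
    rw [← g5]; exact g4
  have hfl : ∀ i : ℕ, ⌊ξ 0 + i * (q / p : ℝ)⌋ = (ν i : ℤ) - i := by
    intro i
    rw [Int.floor_eq_iff]
    push_cast
    constructor <;> linarith [(hmain i).1, (hmain i).2]
  have hν0 : ν 0 = 0 := Nat.nth_zero_of_zero hs0
  have h0 := hmain 0
  simp only [hν0, Nat.cast_zero, zero_mul, sub_zero, add_zero] at h0
  refine ⟨ξ 0, h0.1, h0.2, fun i m hm => ?_, fun i => ?_⟩
  · have h1 := hfl i
    have h2 := (hmain i).1
    rw [hm, Int.floor_intCast] at h1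
    rw [hm, h1] at h2
    push_cast at h2
    linarith
  · rw [hfl, hfl]
    have hlt : ν i < ν (i + 1) := Nat.nth_strictMono hinf (Nat.lt_succ_self i)
    have hr : runLength s i = ν (i + 1) - ν i - 1 := rfl
    rw [hr]; push_cast
    omega

end Square

/-! ### Lines through the vertex of a corner -/

namespace PolygonalTable
variable {n : ℕ} {P : PolygonalTable n}

namespace Corner
variable {A B : Fin n} {v : ℂ} {θ : ℝ} (C : P.Corner A B v θ)
include C

lemma exists_pos_B {z : ℂ} (hz : z ∈ P.openEdge B) :
    ∃ ρ : ℝ, 0 < ρ ∧ ρ < C.lB ∧ z = v + ρ * C.u θ := (C.mem_openB z).1 hz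

lemma sin_theta_pos (hθ : θ < Real.pi) : 0 < Real.sin θ :=
  Real.sin_pos_of_pos_of_lt_pi C.theta_pos hθ

/-- If a billiard segment from `B` ends on another edge before it reaches `A`, then there is a vertex
in the triangle which it cuts off. -/
lemma exists_vertex_of_segment (hθ : θ < Real.pi) {b c : ℂ} {h : Fin n} (hb : b ∈ P.openEdge B)
    (hc : c ∈ P.openEdge h) (hA : h ≠ A) (hB : h ≠ B) (hseg : openSegment ℝ b c ⊆ P.interior)
    {t α : ℝ} (ht : 0 < t) (hα : 0 < α) (hαl : α < C.lA) (ha : v + α * C.u 0 = b + t * (c - b)) :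
    ∃ j, 0 < C.sg * crs (P.vertex j - v) (C.u θ) ∧
      C.sg * crs (P.vertex j - v) (C.u θ) < α * Real.sin θ := by
  obtain ⟨ρ, hρ, hρl, hbρ⟩ := C.exists_pos_B hb
  have hs := C.sin_theta_pos hθ
  have hopenA : v + α * C.u 0 ∈ P.openEdge A := (C.mem_openA _).2 ⟨α, hα, hαl, by rw [C.u_zero]⟩
  have ht1 : 1 < t := by
    by_contra hcon
    push Not at hcon
    rcases hcon.eq_or_lt with rfl | hlt
    · rw [ha, Complex.ofReal_one, one_mul, add_sub_cancel] at hopenA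
      exact hA (P.openEdge_inter_closedEdge hc (P.openEdge_subset _ hopenA))
    · exact P.notMem_closedEdge_of_mem (hseg (mem_openSegment_iff_add.2 ⟨t, ht, hlt, ha⟩)) A
        (P.openEdge_subset _ hopenA)
  -- `X` and `Y` are the oblique coordinates along `A` and `B`, times the sine of θ. The function
  -- `L` below vanishes on the line of the billiard segment and is positive on the side of `v`.
  set X : ℂ → ℝ := fun z => C.sg * crs (z - v) (C.u θ) with hX
  set Y : ℂ → ℝ := fun z => C.sg * crs (C.u 0) (z - v) with hY
  have h0θ : C.sg * crs (C.u 0) (C.u θ) = Real.sin θ := by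
    rw [C.crs_u, ← mul_assoc, C.sg_mul_sg, one_mul, sub_zero]
  have hXa : ∀ x y : ℝ, X (v + x * C.u 0 + y * C.u θ) = x * Real.sin θ := by
    intro x y
    simp only [hX]
    rw [show v + x * C.u 0 + y * C.u θ - v = x * C.u 0 + y * C.u θ by ring, crs_add_left,
      crs_real_mul_left, crs_real_mul_left, crs_self, ← h0θ]; ring
  have hYa : ∀ x y : ℝ, Y (v + x * C.u 0 + y * C.u θ) = y * Real.sin θ := by
    intro x y
    simp only [hY]
    rw [show v + x * C.u 0 + y * C.u θ - v = x * C.u 0 + y * C.u θ by ring, crs_add_right,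
      crs_real_mul_right, crs_real_mul_right, crs_self, ← h0θ]; ring
  have hrep : ∀ z : ℂ, z = v + (X z / Real.sin θ : ℝ) * C.u 0 + (Y z / Real.sin θ : ℝ) * C.u θ := by
    intro z
    have h1 := crs_decomp (C.u 0) (C.u θ) (z - v)
    have h2 : (Real.sin θ : ℂ) ≠ 0 := by exact_mod_cast hs.ne'
    have h3 : (Real.sin θ : ℂ) * (z - v) = (X z : ℂ) * C.u 0 + (Y z : ℂ) * C.u θ := by
      rw [← h0θ]; simp only [hX, hY]; push_cast; rw [mul_assoc, h1]; ring
    have h4 : z - v = ((X z : ℂ) * C.u 0 + (Y z : ℂ) * C.u θ) / Real.sin θ := by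
      rw [← h3]; field_simp
    have h5 : z = v + ((X z : ℂ) * C.u 0 + (Y z : ℂ) * C.u θ) / Real.sin θ :=
      sub_eq_iff_eq_add'.1 h4
    rw [Complex.ofReal_div, Complex.ofReal_div]
    calc z = _ := h5
      _ = _ := by ring
  have hXaff : ∀ (s : ℝ) (z w : ℂ), X (z + s * (w - z)) = (1 - s) * X z + s * X w := by
    intro s z w
    simp only [hX]
    rw [show z + s * (w - z) - v = (1 - s : ℝ) * (z - v) + s * (w - v) by push_cast; ring,
      crs_add_left, crs_real_mul_left, crs_real_mul_left]; ring
  have hYaff : ∀ (s : ℝ) (z w : ℂ), Y (z + s * (w - z)) = (1 - s) * Y z + s * Y w := by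
    intro s z w
    simp only [hY]
    rw [show z + s * (w - z) - v = (1 - s : ℝ) * (z - v) + s * (w - v) by push_cast; ring,
      crs_add_right, crs_real_mul_right, crs_real_mul_right]; ring
  have hca : c = b + (1 / t : ℝ) * (v + α * C.u 0 - b) := by
    have : (t : ℂ) ≠ 0 := by exact_mod_cast ht.ne'
    rw [ha]; push_cast; field_simp; ring
  have hXA := hXa α 0
  have hYA := hYa α 0
  have hXB := hXa 0 ρ
  have hYB := hYa 0 ρ
  simp only [Complex.ofReal_zero, zero_mul, add_zero] at hXA hYA hXB hYB
  rw [← hbρ] at hXB hYB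
  have ht' : 0 < 1 / t := by positivity
  have ht1' : 1 / t < 1 := by rw [div_lt_one ht]; exact ht1
  have hXc : X c = 1 / t * (α * Real.sin θ) := by rw [hca, hXaff, hXB, hXA]; ring
  have hYc : Y c = (1 - 1 / t) * (ρ * Real.sin θ) := by rw [hca, hYaff, hYB, hYA]; ring
  have hXc0 : 0 < X c := by rw [hXc]; positivity
  have hYc0 : 0 < Y c := by rw [hYc]; have := sub_pos.2 ht1'; positivity
  set L : ℂ → ℝ := fun z => α * ρ * Real.sin θ - ρ * X z - α * Y z with hL
  have hLc : L c = 0 := by simp only [hL, hXc, hYc]; ring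
  have hLaff : ∀ (s : ℝ) (z w : ℂ), L (z + s * (w - z)) = (1 - s) * L z + s * L w := by
    intro s z w; simp only [hL, hXaff, hYaff]; ring
  have hLdiff : ∀ z w : ℂ, L w - L z = -(t * C.sg) * crs (c - b) (w - z) := by
    intro z w
    have h1 : (t : ℂ) * (c - b) = α * C.u 0 - ρ * C.u θ := by
      rw [hbρ] at ha ⊢
      linear_combination -ha
    have h2 : t * crs (c - b) (w - z) = α * crs (C.u 0) (w - z) - ρ * crs (C.u θ) (w - z) := by
      rw [← crs_real_mul_left, h1, crs_sub_left, crs_real_mul_left, crs_real_mul_left]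
    have h3 : X w - X z = -(C.sg * crs (C.u θ) (w - z)) := by
      simp only [hX]
      rw [← mul_sub, ← crs_sub_left, sub_sub_sub_cancel_right, crs_anti]; ring
    have h4 : Y w - Y z = C.sg * crs (C.u 0) (w - z) := by
      simp only [hY]
      rw [← mul_sub, ← crs_sub_right, sub_sub_sub_cancel_right]
    simp only [hL]
    linear_combination -ρ * h3 - α * h4 + C.sg * h2
  -- one of the endpoints of the edge is on the side of `v`
  have hcs := P.crs_pos_of_openSegment hc (by rw [openSegment_symm]; exact hseg)
  obtain ⟨s, hs0, hs1, hsc⟩ := P.mem_openEdge.1 hc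
  have hw : ∃ j, P.vertex j ∈ P.closedEdge h ∧ 0 < L (P.vertex j) := by
    have h1 := hLdiff c (P.vertex h)
    have h2 := hLdiff c (P.vertex (P.next h))
    rw [hLc, sub_zero, show P.vertex h - c = (-s : ℝ) * P.edgeVec h by rw [hsc]; push_cast; ring,
      crs_real_mul_right] at h1
    rw [hLc, sub_zero, show P.vertex (P.next h) - c = (1 - s : ℝ) * P.edgeVec h by
      rw [hsc]; simp only [edgeVec]; push_cast; ring, crs_real_mul_right] at h2
    have h3 : 0 < crs (c - b) (P.edgeVec h) := by
      rw [← neg_sub, crs_neg_right] at hcs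
      rw [crs_anti]; linarith
    have h4 : 0 < t * crs (c - b) (P.edgeVec h) := by positivity
    rcases C.sg_eq with hsg | hsg
    · exact ⟨h, P.vertex_mem_closedEdge h, by rw [h1, hsg]; nlinarith⟩
    · exact ⟨P.next h, P.vertex_next_mem_closedEdge h, by
        rw [h2, hsg]; nlinarith [mul_pos h4 (sub_pos.2 hs1)]⟩
  obtain ⟨j, hj, hjL⟩ := hw
  -- On the way along `h` from `c` to this endpoint, leaving the quadrant at a point with `L > 0`
  -- would mean meeting `v` or an inner point of `A` or `B`, none of which belongs to `h`.
  have hXY : 0 < X (P.vertex j) ∧ 0 < Y (P.vertex j) := by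
    by_contra hcon
    have hmin : min (X (P.vertex j)) (Y (P.vertex j)) ≤ 0 := by
      by_contra h5
      push Not at h5
      exact hcon (lt_min_iff.1 h5)
    have hcont : Continuous fun s : ℝ => min (X (c + s * (P.vertex j - c)))
        (Y (c + s * (P.vertex j - c))) := by
      simp only [hXaff, hYaff]; fun_prop
    obtain ⟨r, ⟨hr0, hr1⟩, hr⟩ := intermediate_value_Icc' (zero_le_one (α := ℝ)) hcont.continuousOn
      (show (0 : ℝ) ∈ Icc _ _ from ⟨by simpa using hmin, by simpa using ⟨hXc0.le, hYc0.le⟩⟩)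
    simp only at hr
    set z := c + r * (P.vertex j - c) with hz
    have hr0' : 0 < r := by
      refine hr0.lt_of_ne fun h5 => ?_
      rw [hz, ← h5, Complex.ofReal_zero, zero_mul, add_zero] at hr
      exact (lt_min hXc0 hYc0).ne' hr
    have hzh : z ∈ P.closedEdge h := (convex_segment _ _).segment_subset (P.openEdge_subset _ hc) hj
      (mem_segment_iff_add.2 ⟨r, hr0, hr1, rfl⟩)
    have hzL : 0 < L z := by rw [hz, hLaff, hLc]; have := mul_pos hr0' hjL; linarith
    have hzX : 0 ≤ X z := by rw [← hr]; exact min_le_left _ _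
    have hzY : 0 ≤ Y z := by rw [← hr]; exact min_le_right _ _
    have hv : z ≠ v := fun h5 => C.notMem h hA hB (h5 ▸ hzh)
    have hzr := hrep z
    simp only [hL] at hzL
    rcases min_choice (X z) (Y z) with h5 | h5
    · rw [h5] at hr
      rw [hr, zero_div, Complex.ofReal_zero, zero_mul, add_zero] at hzr
      rw [hr] at hzL
      have h6 : Y z ≠ 0 := fun h7 => hv (by rw [h7] at hzr; simpa using hzr)
      refine hB (P.openEdge_inter_closedEdge ((C.mem_openB z).2 ⟨Y z / Real.sin θ, ?_, ?_, hzr⟩)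
        hzh).symm
      · exact div_pos (hzY.lt_of_ne h6.symm) hs
      · rw [div_lt_iff₀ hs]
        have : α * Y z < α * (ρ * Real.sin θ) := by linarith
        have h8 := lt_of_mul_lt_mul_left this hα.le
        nlinarith
    · rw [h5] at hr
      rw [hr, zero_div, Complex.ofReal_zero, zero_mul, add_zero] at hzr
      rw [hr] at hzL
      have h6 : X z ≠ 0 := fun h7 => hv (by rw [h7] at hzr; simpa using hzr)
      rw [C.u_zero] at hzr
      refine hA (P.openEdge_inter_closedEdge ((C.mem_openA z).2 ⟨X z / Real.sin θ, ?_, ?_, hzr⟩)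
        hzh).symm
      · exact div_pos (hzX.lt_of_ne h6.symm) hs
      · rw [div_lt_iff₀ hs]
        have : ρ * X z < ρ * (α * Real.sin θ) := by linarith
        have h8 := lt_of_mul_lt_mul_left this hρ.le
        nlinarith
  refine ⟨j, hXY.1, ?_⟩
  have h1 : 0 < α * ρ * Real.sin θ - ρ * X (P.vertex j) - α * Y (P.vertex j) := hjL
  have h2 := mul_pos hα hXY.2
  have h3 : ρ * X (P.vertex j) < ρ * (α * Real.sin θ) := by linarith
  exact lt_of_mul_lt_mul_left h3 hρ.le

/-- A limit orbit that leaves `B` on a line through the corner does not go to the other side of `A`. -/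
lemma angle_nonneg (hθ : θ < Real.pi) {x : Orb n} (hx : x ∈ P.limOrbits) (h0 : x.edge 0 = B)
    (hA : x.edge 1 ≠ A) (hB : x.edge 1 ≠ B) {φ : ℝ} (hd : x.dir 0 = C.u φ) (hφ : θ - Real.pi ≤ φ)
    (hv : crs (x.dir 0) (v - x.pos 0) = 0) : 0 ≤ φ := by
  by_contra hneg
  push Not at hneg
  have hs := C.sin_theta_pos hθ
  have hsφ : Real.sin φ < 0 :=
    Real.sin_neg_of_neg_of_neg_pi_lt hneg (by linarith [C.theta_pos])
  obtain ⟨R, hR, tR⟩ := exists_seq_orbits hx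
  have td := ((Orb.continuous_dir 0).tendsto x).comp tR
  have tp := ((Orb.continuous_pos 0).tendsto x).comp tR
  have hlim0 : crs (C.u 0) (x.dir 0) = C.sg * Real.sin φ := by rw [hd, C.crs_u, sub_zero]
  have hne : crs (C.u 0) (x.dir 0) ≠ 0 := by
    rw [hlim0]; exact mul_ne_zero C.sg_ne_zero hsφ.ne
  -- This quotient is the distance from `v` at which the line of the approximating orbit crosses the
  -- line of `A`. It tends to 0, because the limit line passes through `v`.
  have tα : Tendsto (fun k => crs ((R k).pos 0 - v) ((R k).dir 0) / crs (C.u 0) ((R k).dir 0)) atTop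
      (𝓝 0) := by
    have h1 := ((tp.sub (tendsto_const_nhds (x := v))).crs td).div
      ((tendsto_const_nhds (x := C.u 0)).crs td) hne
    have h2 : crs (x.pos 0 - v) (x.dir 0) = 0 := by
      rw [crs_anti, ← neg_sub, crs_neg_right, hv]; simp
    rw [h2, zero_div] at h1
    exact h1
  have tneg : ∀ᶠ k in atTop, C.sg * crs (C.u 0) ((R k).dir 0) < 0 := by
    have h1 := ((tendsto_const_nhds (x := C.u 0)).crs td).const_mul C.sg
    rw [hlim0, ← mul_assoc, C.sg_mul_sg, one_mul] at h1
    exact h1.eventually (gt_mem_nhds hsφ)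
  -- There are finitely many vertices, so the thin triangle cut off near `v` contains none;
  -- `exists_vertex_of_segment` would produce one.
  have tv : ∀ᶠ k in atTop, ∀ j : Fin n, 0 < C.sg * crs (P.vertex j - v) (C.u θ) →
      crs ((R k).pos 0 - v) ((R k).dir 0) / crs (C.u 0) ((R k).dir 0) * Real.sin θ <
        C.sg * crs (P.vertex j - v) (C.u θ) := by
    refine eventually_all.2 fun j => ?_
    by_cases hj : 0 < C.sg * crs (P.vertex j - v) (C.u θ)
    · have := tα.mul_const (Real.sin θ)
      rw [zero_mul] at this
      filter_upwards [this.eventually (gt_mem_nhds hj)] with k hk _ using hk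
    · exact Eventually.of_forall fun k h => absurd h hj
  obtain ⟨k, e0, e1, hk1, hk2, hk3⟩ := ((Orb.eventually_edge tR 0).and
    ((Orb.eventually_edge tR 1).and ((tα.eventually (gt_mem_nhds C.lA_pos)).and
    (tneg.and tv)))).exists
  set d := (R k).dir 0 with hdd
  have hb := pos_mem (hR k) 0
  rw [e0, h0] at hb
  obtain ⟨ρ, hρ, -, hbρ⟩ := C.exists_pos_B hb
  have hdpos := crs_dir_pos (hR k) 0
  have hB' : P.edgeVec B = (-(C.sg * C.lB) : ℝ) * C.u θ := C.edgeVec_B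
  rw [e0, h0, hB', crs_real_mul_left] at hdpos
  have hsθ : C.sg * crs (C.u θ) d < 0 := by
    have := C.lB_pos
    by_contra hcon
    push Not at hcon
    nlinarith [mul_nonneg this.le hcon]
  set α := crs ((R k).pos 0 - v) d / crs (C.u 0) d with hα
  have hc0 : crs (C.u 0) d ≠ 0 := fun h => by rw [h, mul_zero] at hk2; exact hk2.false
  have hαe : α * crs (C.u 0) d = ρ * crs (C.u θ) d := by
    rw [hα, div_mul_cancel₀ _ hc0, hbρ, add_sub_cancel_left, crs_real_mul_left]
  have hα0 : 0 < α := by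
    have h1 : α * (C.sg * crs (C.u 0) d) = ρ * (C.sg * crs (C.u θ) d) := by
      linear_combination C.sg * hαe
    by_contra hcon
    push Not at hcon
    nlinarith [mul_neg_of_pos_of_neg hρ hsθ, mul_nonneg_of_nonpos_of_nonpos hcon hk2.le]
  have hnd := norm_dir (hR k) 0
  obtain ⟨r, hr⟩ := eq_real_mul_of_crs_eq_zero (z := d) (w := α * C.u 0 - ρ * C.u θ)
    (norm_ne_zero_iff.1 (by rw [hnd]; norm_num)) (by
      rw [crs_sub_right, crs_real_mul_right, crs_real_mul_right, crs_anti, crs_anti d (C.u θ)]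
      linarith)
  have hr0 : 0 < r := by
    have h1 := congrArg (fun z => C.sg * crs (C.u 0) z) hr
    simp only [crs_sub_right, crs_real_mul_right, crs_self, C.crs_u, sub_zero] at h1
    have h2 : -(ρ * Real.sin θ) = r * (C.sg * crs (C.u 0) d) := by
      linear_combination h1 + ρ * Real.sin θ * C.sg_mul_sg
    have := mul_pos hρ hs
    by_contra hcon
    push Not at hcon
    nlinarith [mul_nonneg_of_nonpos_of_nonpos hcon hk2.le]
  have hstep := step_pos (hR k) 0
  have hsucc := pos_succ (hR k) 0
  rw [zero_add] at hsucc
  have hst : ((R k).step 0 : ℂ) ≠ 0 := by exact_mod_cast hstep.ne'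
  obtain ⟨j, hj1, hj2⟩ := C.exists_vertex_of_segment hθ hb (pos_mem (hR k) 1) (by rwa [e1])
    (by rwa [e1]) (segment_subset (hR k) 0) (div_pos hr0 hstep) hα0 hk1 (by
      rw [hsucc, ← hdd, add_sub_cancel_left, hbρ]
      push_cast
      rw [← mul_assoc, div_mul_cancel₀ _ hst, ← hr]; ring)
  exact absurd (hk3 j hj1) hj2.not_gt

/-- A line with a direction inside the corner that meets both edges passes through the corner. -/
lemma crs_eq_zero_of_line (hθ : θ < Real.pi) {a b : ℂ} (ha : a ∈ P.closedEdge A)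
    (hb : b ∈ P.closedEdge B) {φ : ℝ} (h0 : 0 ≤ φ) (h1 : φ ≤ θ) (h : crs (C.u φ) (b - a) = 0) :
    crs (C.u φ) (v - a) = 0 ∧ crs (C.u φ) (v - b) = 0 := by
  obtain ⟨ρ, hρ, -, rfl⟩ := (C.mem_A a).1 ha
  obtain ⟨ρ', hρ', -, rfl⟩ := (C.mem_B b).1 hb
  change crs (C.u φ) (v + ρ' * C.u θ - (v + ρ * C.uA)) = 0 at h
  change crs (C.u φ) (v - (v + ρ * C.uA)) = 0 ∧ crs (C.u φ) (v - (v + ρ' * C.u θ)) = 0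
  rw [← C.u_zero] at h ⊢
  rw [add_sub_add_left_eq_sub, crs_sub_right, crs_real_mul_right, crs_real_mul_right, C.crs_u,
    C.crs_u, zero_sub, Real.sin_neg] at h
  have e1 : 0 ≤ ρ' * Real.sin (θ - φ) :=
    mul_nonneg hρ' (Real.sin_nonneg_of_nonneg_of_le_pi (by linarith) (by linarith))
  have e2 : 0 ≤ ρ * Real.sin φ :=
    mul_nonneg hρ (Real.sin_nonneg_of_nonneg_of_le_pi h0 (by linarith))
  have e3 : ρ' * Real.sin (θ - φ) + ρ * Real.sin φ = 0 := by
    have : C.sg * (ρ' * Real.sin (θ - φ) + ρ * Real.sin φ) = 0 := by linarith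
    exact (mul_eq_zero.1 this).resolve_left C.sg_ne_zero
  constructor
  · rw [sub_add_cancel_left, crs_neg_right, crs_real_mul_right, C.crs_u, zero_sub, Real.sin_neg]
    have : ρ * Real.sin φ = 0 := by linarith
    linear_combination C.sg * this
  · rw [sub_add_cancel_left, crs_neg_right, crs_real_mul_right, C.crs_u]
    have : ρ' * Real.sin (θ - φ) = 0 := by linarith
    linear_combination -C.sg * this

end Corner
end PolygonalTable

/-! ### Unfolding the passages of the corner -/

/-- The letters of the word `BABA…`. -/
def letter {α : Type*} (A B : α) (k : ℕ) : α := if Even k then B else A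

namespace PolygonalTable
variable {n : ℕ} {P : PolygonalTable n}

namespace Corner
variable {A B : Fin n} {v : ℂ} {θ : ℝ} (C : P.Corner A B v θ)

/-- The direction at the angle `Φ` in the sector that is unfolded `k` times. -/
noncomputable def fold (k : ℕ) (Φ : ℝ) : ℂ :=
  C.u (if Even k then Φ - k * θ else (k + 1) * θ - Φ)

/-- Replaces the parity of `k` by a relabelling of the corner: the edge at the far end of the sector
number `k`, at the unfolded angle `(k + 1) * θ`, plays the role of `B`. Facts about `u` then carry
over to `fold` without case distinctions. -/
lemma exists_letter_corner (k : ℕ) :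
    ∃ C' : P.Corner (letter A B (k + 1)) (letter A B k) v θ,
      (∀ Φ, C.fold k Φ = C'.u (Φ - k * θ)) ∧ ∀ Φ, C.fold (k + 1) Φ = C'.u ((k + 2) * θ - Φ) := by
  by_cases hk : Even k
  · have hk' : ¬ Even (k + 1) := by simpa [Nat.even_add_one] using hk
    rw [show letter A B k = B from if_pos hk, show letter A B (k + 1) = A from if_neg hk']
    refine ⟨C, fun Φ => by rw [fold, if_pos hk], fun Φ => ?_⟩
    rw [fold, if_neg hk']; congr 1; push_cast; ring
  · have hk' : Even (k + 1) := by simpa [Nat.even_add_one] using hk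
    rw [show letter A B k = A from if_neg hk, show letter A B (k + 1) = B from if_pos hk']
    refine ⟨C.swap, fun Φ => ?_, fun Φ => ?_⟩
    · rw [fold, if_neg hk, swap_u]; congr 1; ring
    · rw [fold, if_pos hk', swap_u]; congr 1; push_cast; ring

lemma fold_succ (k : ℕ) (Φ : ℝ) :
    mirror (P.edgeVec (letter A B k)) (C.fold k Φ) = C.fold (k + 1) Φ := by
  obtain ⟨C', h1, h2⟩ := C.exists_letter_corner k
  rw [h1, h2, C'.mirror_B]; congr 1; ring

/-- The sine of the angle between a direction and an edge. -/
lemma exists_crs_fold (k : ℕ) : ∃ l : ℝ, 0 < l ∧ ∀ Φ,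
    crs (P.edgeVec (letter A B k)) (C.fold k Φ) = -(l * Real.sin (Φ - (k + 1) * θ)) ∧
    crs (P.edgeVec (letter A B k)) (C.fold (k + 1) Φ) = l * Real.sin (Φ - (k + 1) * θ) := by
  obtain ⟨C', h1, h2⟩ := C.exists_letter_corner k
  refine ⟨C'.lB, C'.lB_pos, fun Φ => ?_⟩
  rw [h1, h2, C'.crs_edgeVec_B, C'.crs_edgeVec_B, ← mul_neg, ← Real.sin_neg]
  constructor <;> congr 2 <;> ring

lemma fold_add_pi (k : ℕ) (Φ : ℝ) : C.fold k (Φ + Real.pi) = -C.fold k Φ := by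
  obtain ⟨C', h1, -⟩ := C.exists_letter_corner k
  rw [h1, h1, ← C'.u_add_pi]; congr 1; ring

lemma fold_eq_iff {k : ℕ} {Φ Ψ : ℝ} : C.fold k Φ = C.fold k Ψ ↔ ∃ j : ℤ, Φ = Ψ + j * (2 * Real.pi) := by
  obtain ⟨C', h1, -⟩ := C.exists_letter_corner k
  rw [h1, h1, C'.u_eq_iff]
  refine exists_congr fun j => ⟨fun h => by linarith, fun h => by linarith⟩

lemma exists_fold (k : ℕ) (lo : ℝ) {z : ℂ} (hz : ‖z‖ = 1) :
    ∃ Φ, z = C.fold k Φ ∧ lo ≤ Φ ∧ Φ < lo + 2 * Real.pi := by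
  obtain ⟨C', h1, -⟩ := C.exists_letter_corner k
  obtain ⟨φ, rfl⟩ := C'.exists_u hz
  have h2 := toIcoMod_mem_Ico Real.two_pi_pos lo (φ + k * θ)
  refine ⟨toIcoMod Real.two_pi_pos lo (φ + k * θ), ?_, h2.1, h2.2⟩
  rw [h1, C'.u_eq_iff]
  refine ⟨toIcoDiv Real.two_pi_pos lo (φ + k * θ), ?_⟩
  have := toIcoMod_add_toIcoDiv_zsmul Real.two_pi_pos lo (φ + k * θ)
  rw [zsmul_eq_mul] at this
  linarith

include C in
lemma lt_pi_of_letters {x : Orb n} (hx : x ∈ P.limOrbits) {κ : ℕ} {k : ℤ}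
    (h0 : x.edge k = letter A B κ) (h1 : x.edge (k + 1) = letter A B (κ + 1)) : θ < Real.pi := by
  obtain ⟨y, hy, hlim⟩ := exists_seq_orbits hx
  obtain ⟨j, g0, g1⟩ := ((Orb.eventually_edge hlim k).and
    (Orb.eventually_edge hlim (k + 1))).exists
  obtain ⟨C', -, -⟩ := C.exists_letter_corner κ
  exact C'.swap.lt_pi_of_consecutive (hy j) (g0.trans h0) (g1.trans h1)

/-- The passage through a corner, unfolded. -/
lemma exists_passage {x : Orb n} (hx : x ∈ P.limOrbits) {κ m : ℕ} (hm : 0 < m)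
    (hxe : ∀ j < m, x.edge j = letter A B (κ + j)) :
    ∃ Φ, x.dir (-1) = -C.fold κ Φ ∧ (κ + 1) * θ - Real.pi ≤ Φ ∧ Φ ≤ (κ + 1) * θ ∧
      x.dir (m - 1) = C.fold (κ + m) (Φ + Real.pi) ∧ (κ + m) * θ ≤ Φ + Real.pi ∧ Φ ≤ (κ + m) * θ := by
  -- With this choice of the window of length 2π, the angle to the first edge is in [0, 2π), so the
  -- nonnegative sine at the first bounce confines it to [0, π].
  obtain ⟨Φ, h1, h2, h3⟩ := C.exists_fold κ ((κ + 1) * θ - Real.pi) (z := -x.dir (-1))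
    (by rw [norm_neg, lim_norm_dir hx])
  have hin : x.dir (-1) = C.fold κ (Φ + Real.pi) := by rw [C.fold_add_pi, ← h1, neg_neg]
  have hin' : x.dir (-1) = -C.fold κ Φ := by rw [← h1, neg_neg]
  have step : ∀ j : ℕ, j < m → x.dir (j - 1) = C.fold (κ + j) (Φ + Real.pi) →
      x.dir j = C.fold (κ + j + 1) (Φ + Real.pi) ∧
        0 ≤ Real.sin (Φ + Real.pi - (κ + j + 1) * θ) := by
    intro j hj hd
    have h4 := lim_dir_succ hx (j - 1)
    have h5 := lim_crs_nonneg hx j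
    obtain ⟨l, hl, hlf⟩ := C.exists_crs_fold (κ + j)
    rw [sub_add_cancel, hxe j hj, hd, C.fold_succ] at h4
    refine ⟨h4, ?_⟩
    rw [hxe j hj, h4, (hlf _).2] at h5
    push_cast at h5
    exact (mul_nonneg_iff_of_pos_left hl).1 h5
  have main : ∀ j : ℕ, j < m → x.dir j = C.fold (κ + j + 1) (Φ + Real.pi) ∧
      (κ + j + 1) * θ ≤ Φ + Real.pi ∧ Φ ≤ (κ + j + 1) * θ := by
    intro j
    induction j with
    | zero =>
      intro hj
      obtain ⟨h4, h5⟩ := step 0 hj (by simpa using hin)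
      refine ⟨h4, by simp only [Nat.cast_zero, add_zero]; linarith, ?_⟩
      simp only [Nat.cast_zero, add_zero] at h5 ⊢
      by_contra hcon
      push Not at hcon
      have := Real.sin_neg_of_neg_of_neg_pi_lt (x := Φ + Real.pi - (κ + 1) * θ - 2 * Real.pi)
        (by linarith) (by linarith)
      rw [Real.sin_sub_two_pi] at this
      linarith
    | succ j ih =>
      intro hj
      obtain ⟨g1, g2, g3⟩ := ih (by omega)
      obtain ⟨h4, h5⟩ := step (j + 1) hj (by simpa [add_assoc] using g1)
      -- Two consecutive letters need θ < π. So the angle to the next edge, which was in [0, π] for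
      -- the previous one, decreases by less than π, and a nonnegative sine keeps it nonnegative.
      have hθ : θ < Real.pi := C.lt_pi_of_letters hx (κ := κ + j) (k := j) (hxe j (by omega))
        (by have := hxe (j + 1) hj; push_cast at this; rw [this, add_assoc])
      have hθ0 := C.theta_pos
      refine ⟨h4, ?_, ?_⟩ <;> push_cast at h5 ⊢
      · by_contra hcon
        push Not at hcon
        have := Real.sin_neg_of_neg_of_neg_pi_lt (x := Φ + Real.pi - (κ + (j + 1) + 1) * θ)
          (by linarith) (by linarith)
        linarith
      · linarith
  obtain ⟨g1, g2, g3⟩ := main (m - 1) (by omega)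
  obtain ⟨-, h5⟩ := main 0 hm
  have hc : ((m - 1 : ℕ) : ℝ) = m - 1 := by rw [Nat.cast_sub hm]; simp
  have hcz : ((m - 1 : ℕ) : ℤ) = m - 1 := by rw [Nat.cast_sub hm]; simp
  have hmm : κ + (m - 1) + 1 = κ + m := by omega
  rw [hc] at g2 g3
  rw [hmm, hcz] at g1
  simp only [Nat.cast_zero, add_zero] at h5
  exact ⟨Φ, hin', by linarith, by linarith [h5.2], g1, by linarith, by linarith⟩

end Corner
end PolygonalTable

/-! ### Chains of passages and their angles -/

namespace PolygonalTable
variable {n : ℕ} {P : PolygonalTable n}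

/-- A sequence of limit orbits `T i` that read a half `h i` backwards, then `m i` letters of the word
`BABA…`, and then the half `h (i + 1)`. -/
structure CornerChain (P : PolygonalTable n) (A B : Fin n) (m : ℕ → ℕ) (h : ℕ → ℕ → Fin n)
    (T : ℕ → Orb n) : Prop where
  mem : ∀ i, T i ∈ P.limOrbits
  past : ∀ i k : ℕ, (T i).edge (-1 - k) = h i k
  mid : ∀ i, ∀ j < m i, (T i).edge j = letter A B ((∑ k ∈ Finset.range i, m k) + j)
  fut : ∀ i k : ℕ, (T i).edge (m i + k) = h (i + 1) k
  ne : ∀ i, h i 0 ≠ A ∧ h i 0 ≠ B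
  aper : ∀ i, Aperiodic (h i)

namespace CornerChain
variable {A B : Fin n} {v : ℂ} {θ : ℝ} {m : ℕ → ℕ} {h : ℕ → ℕ → Fin n} {T : ℕ → Orb n}
  (H : CornerChain P A B m h T) (C : P.Corner A B v θ)
include H

/-- The half `h (i + 1)` is the future of `T i` and the reversed past of `T (i + 1)`. Equal futures
make the orbits parallel, so `T (i + 1)` arrives along the direction opposite to the one in which `T
i` leaves. -/
lemma dir_last (i : ℕ) : (T i).dir (m i - 1) = -(T (i + 1)).dir (-1) := by
  have h1 := dir_eq_of_future (x := (T i).shift (m i)) (y := (T (i + 1)).rev.shift 1) (k := 0)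
    (shift_mem (H.mem i) _) (shift_mem (rev_mem (H.mem (i + 1))) _) (by
      intro j hj
      obtain ⟨j, rfl⟩ := Int.eq_ofNat_of_zero_le hj
      simp only [Orb.edge_shift, Orb.edge_rev]
      rw [add_comm, H.fut, ← H.past]; congr 1; ring)
  simp only [Orb.dir_shift, Orb.dir_rev, zero_add] at h1
  have h2 := lim_dir_succ (H.mem i) (m i - 1)
  have h3 := lim_dir_succ (H.mem (i + 1)) (-2)
  have h4 := H.fut i 0
  have h5 := H.past (i + 1) 0
  norm_num at h1 h2 h3 h4 h5
  rw [h4, h1] at h2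
  rw [h5, ← neg_neg ((T (i + 1)).dir (-2)), h2, mirror_neg, mirror_mirror (P.edgeVec_ne_zero _)] at h3
  rw [h3, neg_neg]

include C

/-- Collects the unfolded angles of all nonempty passages. The bounds say that each edge crossed
lies in the half-turn from `Φ i` to `Φ i + π`; for an empty insertion there is no passage and no
condition. -/
lemma exists_angles : ∃ Φ : ℕ → ℝ, ∀ i, 0 < m i →
    -(T i).dir (-1) = C.fold (∑ k ∈ Finset.range i, m k) (Φ i) ∧
    ((∑ k ∈ Finset.range i, m k : ℕ) + 1) * θ - Real.pi ≤ Φ i ∧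
    Φ i ≤ ((∑ k ∈ Finset.range i, m k : ℕ) + 1) * θ ∧
    -(T (i + 1)).dir (-1) = C.fold (∑ k ∈ Finset.range (i + 1), m k) (Φ i + Real.pi) ∧
    (∑ k ∈ Finset.range (i + 1), m k : ℕ) * θ ≤ Φ i + Real.pi ∧
    Φ i ≤ (∑ k ∈ Finset.range (i + 1), m k : ℕ) * θ := by
  have : ∀ i, ∃ Φ : ℝ, 0 < m i →
    -(T i).dir (-1) = C.fold (∑ k ∈ Finset.range i, m k) Φ ∧
    ((∑ k ∈ Finset.range i, m k : ℕ) + 1) * θ - Real.pi ≤ Φ ∧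
    Φ ≤ ((∑ k ∈ Finset.range i, m k : ℕ) + 1) * θ ∧
    -(T (i + 1)).dir (-1) = C.fold (∑ k ∈ Finset.range (i + 1), m k) (Φ + Real.pi) ∧
    (∑ k ∈ Finset.range (i + 1), m k : ℕ) * θ ≤ Φ + Real.pi ∧
    Φ ≤ (∑ k ∈ Finset.range (i + 1), m k : ℕ) * θ := by
    intro i
    by_cases hm : 0 < m i
    · obtain ⟨Φ, h1, h2, h3, h4, h5, h6⟩ := C.exists_passage (H.mem i) hm (H.mid i)
      refine ⟨Φ, fun _ => ⟨by rw [h1, neg_neg], h2, h3, ?_, ?_, ?_⟩⟩ <;>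
        rw [Finset.sum_range_succ]
      · rw [← H.dir_last, h4]
      · rw [Nat.cast_add]; exact h5
      · rw [Nat.cast_add]; exact h6
    · exact ⟨0, fun h => absurd h hm⟩
  choose Φ hΦ using this
  exact ⟨Φ, hΦ⟩

variable {Φ : ℕ → ℝ} (hΦ : ∀ i, 0 < m i →
    -(T i).dir (-1) = C.fold (∑ k ∈ Finset.range i, m k) (Φ i) ∧
    ((∑ k ∈ Finset.range i, m k : ℕ) + 1) * θ - Real.pi ≤ Φ i ∧
    Φ i ≤ ((∑ k ∈ Finset.range i, m k : ℕ) + 1) * θ ∧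
    -(T (i + 1)).dir (-1) = C.fold (∑ k ∈ Finset.range (i + 1), m k) (Φ i + Real.pi) ∧
    (∑ k ∈ Finset.range (i + 1), m k : ℕ) * θ ≤ Φ i + Real.pi ∧
    Φ i ≤ (∑ k ∈ Finset.range (i + 1), m k : ℕ) * θ)
include hΦ

omit H in
-- By `dir_last` the two angles agree modulo 2π, and the bounds leave a difference in the interval
-- [θ - 2π, θ], which contains no other multiple of 2π.
lemma angle_succ {i : ℕ} (h0 : 0 < m i) (h1 : 0 < m (i + 1)) : Φ (i + 1) = Φ i + Real.pi := by
  obtain ⟨-, -, -, a4, a5, a6⟩ := hΦ i h0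
  obtain ⟨b1, b2, b3, -⟩ := hΦ (i + 1) h1
  rw [a4, C.fold_eq_iff] at b1
  obtain ⟨j, hj⟩ := b1
  have hp := Real.pi_pos
  have l1 := C.theta_pos
  have l2 := C.theta_lt
  have j1 : (j : ℝ) < 1 := by
    by_contra hcon
    push Not at hcon
    nlinarith
  have j2 : (-1 : ℝ) < j := by
    by_contra hcon
    push Not at hcon
    nlinarith
  have : j = 0 := by
    have j1' : j < 1 := by exact_mod_cast j1
    have j2' : -1 < j := by exact_mod_cast j2
    omega
  rw [this] at hj
  simp at hj
  linarith

/-- The empty insertion only reverses the direction, so `Φ (i + 2)` and `Φ i` agree modulo 2π. By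
the bounds `Φ (i + 2) - Φ i - π` is in [θ - 2π, θ]; of its two candidates π and -π exactly one is
possible, unless θ = π. -/
lemma angle_succ_succ {i : ℕ} (h0 : 0 < m i) (h1 : m (i + 1) = 0) (h2 : 0 < m (i + 2)) :
    (Real.pi < θ → Φ (i + 2) = Φ i + 2 * Real.pi) ∧ (θ < Real.pi → Φ (i + 2) = Φ i) := by
  obtain ⟨-, -, -, a4, a5, a6⟩ := hΦ i h0
  obtain ⟨b1, b2, b3, -⟩ := hΦ (i + 2) h2
  have hd := H.dir_last (i + 1)
  have hs : ∑ k ∈ Finset.range (i + 2), m k = ∑ k ∈ Finset.range (i + 1), m k := by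
    rw [Finset.sum_range_succ, h1, add_zero]
  rw [h1, Nat.cast_zero, zero_sub] at hd
  rw [hs] at b1 b2 b3
  rw [add_assoc, one_add_one_eq_two, b1, ← neg_neg ((T (i + 1)).dir (-1)), a4, ← C.fold_add_pi,
    C.fold_eq_iff] at hd
  obtain ⟨j, hj⟩ := hd
  have hp := Real.pi_pos
  have l1 := C.theta_pos
  have l2 := C.theta_lt
  constructor
  · intro hθ
    have j1 : (j : ℝ) < 1 := by
      by_contra hcon
      push Not at hcon
      nlinarith
    have j2 : (-1 : ℝ) < j := by
      by_contra hcon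
      push Not at hcon
      nlinarith
    have : j = 0 := by
      have j1' : j < 1 := by exact_mod_cast j1
      have j2' : -1 < j := by exact_mod_cast j2
      omega
    rw [this] at hj
    simp at hj
    linarith
  · intro hθ
    have j1 : (j : ℝ) < 2 := by
      by_contra hcon
      push Not at hcon
      nlinarith
    have j2 : (0 : ℝ) < j := by
      by_contra hcon
      push Not at hcon
      nlinarith
    have : j = 1 := by
      have j1' : j < 2 := by exact_mod_cast j1
      have j2' : 0 < j := by exact_mod_cast j2
      omega
    rw [this] at hj
    simp at hj
    linarith

omit hΦ in
/-- The trajectory before and after a bounce hits the vertex on the same line. -/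
lemma crs_dir_vertex {i : ℕ} (h0 : 0 < m i)
    (hv : crs ((T i).dir 0) (v - (T i).pos 0) = 0) :
    crs (-(T i).dir (-1)) (v - (T i).pos 0) = 0 := by
  obtain ⟨C', -, -⟩ := C.exists_letter_corner (∑ k ∈ Finset.range i, m k)
  have he := H.mid i 0 h0
  have hd := lim_dir_succ (H.mem i) (-1)
  have hp := lim_pos_mem (H.mem i) 0
  norm_num at he hd
  rw [he] at hd hp
  have hm := mirror_edgeVec_sub hp ((C'.mem_B v).2 ⟨0, le_rfl, C'.lB_pos.le, by simp⟩)
  rw [hd, ← hm, crs_mirror (P.edgeVec_ne_zero _), neg_eq_zero] at hv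
  rw [crs_neg_left, hv, neg_zero]

/-- The lines between two passages of the corner, one letter each, go through the vertex. -/
lemma crs_eq_zero (hθ : θ < Real.pi) {i : ℕ} (h0 : m i = 1) (h1 : 0 < m (i + 1)) :
    crs ((T i).dir 0) (v - (T i).pos 0) = 0 ∧
      crs (-(T (i + 1)).dir (-1)) (v - (T (i + 1)).pos 0) = 0 := by
  obtain ⟨C', -, g2⟩ := C.exists_letter_corner (∑ k ∈ Finset.range i, m k)
  have hx := H.mem i
  have hy := rev_mem (H.mem (i + 1))
  have hD := H.dir_last i
  have hyD : (T (i + 1)).rev.dir 0 = -(T (i + 1)).dir (-1) := by simp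
  rw [h0, Nat.cast_one, sub_self] at hD
  have hex : ∀ k : ℕ, ((T i).shift 1).edge k = h (i + 1) k := by
    intro k
    have := H.fut i k
    rw [h0, Nat.cast_one, add_comm] at this
    simpa using this
  have hey : ∀ k : ℕ, ((T (i + 1)).rev.shift 1).edge k = h (i + 1) k := by
    intro k
    rw [← H.past (i + 1) k]
    simp only [Orb.edge_shift, Orb.edge_rev]
    congr 1; ring
  -- Here aperiodicity is used: the orbits `T i` and `T (i + 1)` reversed are not merely parallel
  -- along the half `h (i + 1)`, they are on one line.
  have hoff := off_eq_zero_of_future (H.aper (i + 1)) (shift_mem hx 1) (shift_mem hy 1) hex hey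
  simp only [Orb.off, Orb.dir_shift, Orb.pos_shift, zero_add] at hoff
  have he : (T i).edge 1 = (T (i + 1)).rev.edge 1 := by
    have a := hex 0
    have b := hey 0
    simp only [Orb.edge_shift, Nat.cast_zero, zero_add] at a b
    rw [a, b]
  have hm := mirror_pos_sub hx hy he
  have hds := lim_dir_succ hx 0
  have px := lim_pos_succ hx 0
  have py := lim_pos_succ hy 0
  simp only [zero_add] at hds px py
  rw [hds, ← hm, crs_mirror (P.edgeVec_ne_zero _), neg_eq_zero, px, py, hyD, ← hD,
    show ∀ a b d : ℂ, ∀ s t : ℝ, a + s * d - (b + t * d) = (a - b) + (s - t : ℝ) * d by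
      intros; push_cast; ring, crs_add_right, crs_real_mul_right, crs_self, mul_zero, add_zero]
    at hoff
  have hpos : (T (i + 1)).rev.pos 0 = (T (i + 1)).pos 0 := by simp
  obtain ⟨b1, -, b3, -⟩ := hΦ (i + 1) h1
  obtain ⟨-, -, -, -, a5, -⟩ := hΦ i (by omega)
  have hΦ1 := angle_succ C hΦ (by omega) h1
  have ea := H.mid (i + 1) 0 h1
  have eb := H.mid i 0 (by omega)
  rw [Finset.sum_range_succ, h0] at b1 b3 a5 ea
  simp only [Nat.cast_add, Nat.cast_one] at b3 a5
  simp only [Nat.cast_zero, add_zero] at ea eb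
  rw [hD, b1, g2, hpos, ← neg_sub ((T i).pos 0), crs_neg_right, neg_eq_zero] at hoff
  -- This line joins the last edge of one passage to the first edge of the next, which is the other
  -- edge of the corner, in a direction inside the sector; so it passes through the vertex.
  have := C'.crs_eq_zero_of_line hθ (ea ▸ lim_pos_mem (H.mem (i + 1)) 0)
    (eb ▸ lim_pos_mem (H.mem i) 0) (by linarith) (by linarith) hoff
  rw [hD, b1, g2]
  exact this.symm

/-- The orbit reversed leaves its first letter along a line through the vertex and next hits an edge
other than `A` and `B`. By `Corner.angle_nonneg` it cannot turn beyond the other edge. -/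
lemma angle_ge (hθ : θ < Real.pi) {i : ℕ} (h0 : 0 < m i)
    (hv : crs ((T i).dir 0) (v - (T i).pos 0) = 0) :
    (∑ k ∈ Finset.range i, m k : ℕ) * θ ≤ Φ i := by
  obtain ⟨C', g1, -⟩ := C.exists_letter_corner (∑ k ∈ Finset.range i, m k)
  obtain ⟨a1, a2, -⟩ := hΦ i h0
  have hE := H.mid i 0 h0
  have hp := H.past i 0
  have hne : ∀ k, h i 0 ≠ letter A B k := by
    intro k
    unfold letter
    split_ifs
    exacts [(H.ne i).2, (H.ne i).1]
  simp only [Nat.cast_zero, add_zero, sub_zero] at hE hp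
  have hv' := H.crs_dir_vertex C h0 hv
  have := C'.angle_nonneg hθ (rev_mem (H.mem i)) (φ := Φ i - (∑ k ∈ Finset.range i, m k : ℕ) * θ)
    (by simpa using hE) (by simpa [hp] using hne _) (by simpa [hp] using hne _)
    (by rw [← g1, ← a1]; simp) (by linarith) (by simpa using hv')
  linarith

/-- The counterpart of `angle_ge` at the other end, for the direction in which the orbit leaves its
only letter. -/
lemma angle_le (hθ : θ < Real.pi) {i : ℕ} (h0 : m i = 1)
    (hv : crs ((T i).dir 0) (v - (T i).pos 0) = 0) :
    Φ i + Real.pi ≤ ((∑ k ∈ Finset.range i, m k : ℕ) + 2) * θ := by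
  obtain ⟨C', -, g2⟩ := C.exists_letter_corner (∑ k ∈ Finset.range i, m k)
  obtain ⟨-, -, a3, a4, -⟩ := hΦ i (by omega)
  have hE := H.mid i 0 (by omega)
  have hp := H.fut i 0
  have hD := H.dir_last i
  rw [h0, Nat.cast_one, sub_self, a4, Finset.sum_range_succ, h0, g2] at hD
  have hne : ∀ k, h (i + 1) 0 ≠ letter A B k := by
    intro k
    unfold letter
    split_ifs
    exacts [(H.ne (i + 1)).2, (H.ne (i + 1)).1]
  simp only [Nat.cast_zero, add_zero, h0, Nat.cast_one] at hE hp
  have := C'.angle_nonneg hθ (H.mem i) hE (by rw [hp]; exact hne _) (by rw [hp]; exact hne _) hD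
    (by linarith) hv
  linarith

/-- The angle of a corner that is passed once `k` times in a row, but neither before nor after. -/
lemma angle_of_run (hθ : θ < Real.pi) {i k : ℕ} (hk : 2 ≤ k) (h0 : m i = 1) (h1 : m (i + 1) = 0)
    (hrun : ∀ j < k, m (i + 2 + j) = 1) (h2 : m (i + 2 + k) = 0) (h3 : 0 < m (i + 3 + k)) :
    k * Real.pi = (k + 1) * θ := by
  have hκ : ∀ j ≤ k, ∑ k ∈ Finset.range (i + 2 + j), m k = (∑ k ∈ Finset.range (i + 1), m k) + j := by
    intro j
    induction j with
    | zero => intro _; rw [add_zero, add_zero, Finset.sum_range_succ, h1, add_zero]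
    | succ j ih =>
      intro hj
      rw [← add_assoc, Finset.sum_range_succ, ih (by omega), hrun j (by omega), add_assoc]
  have hΦs : ∀ j < k, Φ (i + 2 + j) = Φ (i + 2) + j * Real.pi := by
    intro j
    induction j with
    | zero => intro _; simp
    | succ j ih =>
      intro hj
      rw [← add_assoc, angle_succ C hΦ (by rw [hrun j (by omega)]; omega)
        (by rw [add_assoc (i + 2), hrun (j + 1) hj]; omega), ih (by omega)]
      push_cast; ring
  -- With κ letters before the run: on the left `Φ (i + 2) = Φ i ≤ κ * θ`, and `angle_ge` gives
  -- equality. On the right the last angle plus π is likewise squeezed to `(κ + k + 1) * θ`, between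
  -- the bound at the first passage after the run and `angle_le`. In between there are k - 1 steps
  -- of π.
  obtain ⟨-, -, -, -, -, a6⟩ := hΦ i (by omega)
  have e1 := (H.angle_succ_succ C hΦ (by omega) h1 (by
    have := hrun 0 (by omega)
    rw [add_zero] at this
    omega)).2 hθ
  obtain ⟨d, rfl⟩ : ∃ d, k = d + 2 := ⟨k - 2, by omega⟩
  have e2 := (H.angle_succ_succ C hΦ (i := i + 2 + (d + 1))
    (by rw [hrun (d + 1) (by omega)]; omega) (by rw [add_assoc (i + 2)]; exact h2)
    (by rw [show i + 2 + (d + 1) + 2 = i + 3 + (d + 2) by ring]; exact h3)).2 hθ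
  obtain ⟨-, b2, -⟩ := hΦ (i + 2 + (d + 1) + 2)
    (by rw [show i + 2 + (d + 1) + 2 = i + 3 + (d + 2) by ring]; exact h3)
  rw [show i + 2 + (d + 1) + 2 = i + 2 + (d + 2) + 1 by ring, Finset.sum_range_succ, h2, add_zero,
    hκ _ le_rfl] at b2
  rw [show i + 2 + (d + 1) + 2 = i + 2 + (d + 2) + 1 by ring, hΦs _ (by omega)] at e2
  have hm1 : m (i + 2) = 1 := by have := hrun 0 (by omega); simpa using this
  have hm2 : m (i + 3) = 1 := by have := hrun 1 (by omega); simpa [add_assoc] using this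
  have g1 := H.angle_ge C hΦ hθ (i := i + 2) (by omega)
    (H.crs_eq_zero C hΦ hθ hm1 (by rw [show i + 2 + 1 = i + 3 by ring]; omega)).1
  have g1' := hκ 0 (by omega)
  rw [add_zero, add_zero] at g1'
  rw [g1'] at g1
  have g2 := H.crs_eq_zero C hΦ hθ (hrun d (by omega))
    (by rw [add_assoc (i + 2), hrun (d + 1) (by omega)]; omega)
  have hm3 := hrun (d + 1) (by omega)
  have g3 := H.angle_le C hΦ hθ hm3 (by
    have hd := lim_dir_succ (H.mem (i + 2 + (d + 1))) (-1)
    have hE := H.mid (i + 2 + (d + 1)) 0 (by omega)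
    have hp := lim_pos_mem (H.mem (i + 2 + (d + 1))) 0
    obtain ⟨C', -, -⟩ := C.exists_letter_corner (∑ k ∈ Finset.range (i + 2 + (d + 1)), m k)
    norm_num at hd hE
    rw [hE] at hd hp
    have hm := mirror_edgeVec_sub hp ((C'.mem_B v).2 ⟨0, le_rfl, C'.lB_pos.le, by simp⟩)
    have g2' := g2.2
    rw [crs_neg_left, neg_eq_zero] at g2'
    rw [hd, ← hm, crs_mirror (P.edgeVec_ne_zero _)]
    exact neg_eq_zero.2 g2')
  rw [hκ _ (by omega), hΦs _ (by omega)] at g3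
  push_cast at g3 e2 b2 g1 a6 ⊢
  linarith

end CornerChain
end PolygonalTable

/-! ### The angle is determined by the pattern of passages -/

lemma eq_zero_of_natCast_mul_le {δ K : ℝ} (h : ∀ N : ℕ, ∃ i ≥ N, i * |δ| ≤ K) : δ = 0 := by
  by_contra hne
  have hpos := abs_pos.2 hne
  obtain ⟨N, hN⟩ := exists_nat_gt (K / |δ|)
  obtain ⟨i, hi, hK⟩ := h N
  have h1 := (div_lt_iff₀ hpos).1 hN
  have h2 : (N : ℝ) ≤ i := by exact_mod_cast hi
  nlinarith

namespace PolygonalTable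
variable {n : ℕ} {P : PolygonalTable n}

namespace CornerChain
variable {A B : Fin n} {v : ℂ} {θ : ℝ} {m : ℕ → ℕ} {h : ℕ → ℕ → Fin n} {T : ℕ → Orb n}

/-- The passages of a corner with the intersection pattern of a square trajectory determine the
angle. -/
theorem angle_eq (H : CornerChain P A B m h T) (C : P.Corner A B v θ) {X r : ℝ} (hX0 : 0 < X)
    (hX1 : X < 1) (hr : 1 < 2 * r) (hflat : θ = Real.pi → 1 ≤ r)
    (hκ : ∀ i : ℕ, ((∑ k ∈ Finset.range i, m k : ℕ) : ℝ) ≤ X + i * r ∧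
      X + i * r < (∑ k ∈ Finset.range i, m k : ℕ) + 1) : θ * r = Real.pi := by
  obtain ⟨Φ, hΦ⟩ := H.exists_angles C
  set κ : ℕ → ℕ := fun i => ∑ k ∈ Finset.range i, m k with hκd
  have κs : ∀ i, κ (i + 1) = κ i + m i := fun i => Finset.sum_range_succ _ _
  have κs' : ∀ i, (κ (i + 1) : ℝ) = κ i + m i := fun i => by rw [κs]; push_cast; ring
  change ∀ i : ℕ, (κ i : ℝ) ≤ X + i * r ∧ X + i * r < κ i + 1 at hκ
  change ∀ i, 0 < m i → -(T i).dir (-1) = C.fold (κ i) (Φ i) ∧ ((κ i : ℕ) + 1) * θ - Real.pi ≤ Φ i ∧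
    Φ i ≤ ((κ i : ℕ) + 1) * θ ∧ -(T (i + 1)).dir (-1) = C.fold (κ (i + 1)) (Φ i + Real.pi) ∧
    (κ (i + 1) : ℕ) * θ ≤ Φ i + Real.pi ∧ Φ i ≤ (κ (i + 1) : ℕ) * θ at hΦ
  have hp := Real.pi_pos
  have hr0 : 0 < r := by linarith
  have hθ0 := C.theta_pos
  have hθ2 := C.theta_lt
  -- Two empty insertions in a row would keep κ constant while `X + i * r` grows by `2 * r > 1`.
  have iso : ∀ i, m i = 0 → 0 < m (i + 1) := by
    intro i h0
    by_contra hcon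
    have h1 : m (i + 1) = 0 := by omega
    have e1 := κs' i
    have e2 := κs' (i + 1)
    rw [h0] at e1
    rw [h1] at e2
    have a := (hκ i).1
    have b := (hκ (i + 1 + 1)).2
    push_cast at *
    linarith
  have hex : ∀ N, ∃ i ≥ N, 0 < m i := by
    intro N
    by_cases hN : 0 < m N
    · exact ⟨N, le_rfl, hN⟩
    · exact ⟨N + 1, by omega, iso N (by omega)⟩
  -- a linear formula for the angles determines the slope
  have slope : ∀ (c a b : ℝ), (∀ N, ∃ i ≥ N, 0 < m i ∧ Φ i = c + a * κ i + b * i) →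
      θ * r = a * r + b := by
    intro c a b hc
    have : θ * r - a * r - b = 0 := by
      refine eq_zero_of_natCast_mul_le (K := |c| + 2 * |a| + 4 * θ + Real.pi) fun N => ?_
      obtain ⟨i, hi, hm, he⟩ := hc N
      refine ⟨i, hi, ?_⟩
      obtain ⟨-, g1, g2, -⟩ := hΦ i hm
      obtain ⟨k1, k2⟩ := hκ i
      have e1 : (i : ℝ) * (θ * r - a * r - b) =
          c + a * (κ i - i * r) - (κ i - i * r) * θ - (Φ i - κ i * θ) := by rw [he]; ring
      have hi0 : (0 : ℝ) ≤ i := Nat.cast_nonneg i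
      rw [← abs_of_nonneg hi0, ← abs_mul, e1]
      have b1 : |(κ i : ℝ) - i * r| ≤ 2 := abs_le.2 ⟨by linarith, by linarith⟩
      have b2 : |a * (κ i - i * r)| ≤ 2 * |a| := by
        rw [abs_mul]; nlinarith [abs_nonneg a]
      have b3 : |(κ i - i * r) * θ| ≤ 2 * θ := by
        rw [abs_mul, abs_of_pos hθ0]; nlinarith
      have b4 : |Φ i - κ i * θ| ≤ θ + Real.pi := abs_le.2 ⟨by linarith, by linarith⟩
      have t1 := abs_sub (c + a * (κ i - i * r) - (κ i - i * r) * θ) (Φ i - κ i * θ)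
      have t2 := abs_sub (c + a * (κ i - i * r)) ((κ i - i * r) * θ)
      have t3 := abs_add_le c (a * (κ i - i * r))
      linarith
    linarith
  obtain ⟨i₀, -, hi₀⟩ := hex 0
  -- In both cases each index contributes π to the angle: an empty insertion and its neighbour
  -- together contribute 2π if θ > π.
  by_cases hcase : (∀ i, 0 < m i) ∨ Real.pi < θ
  · have main : ∀ d : ℕ, 0 < m (i₀ + d) → Φ (i₀ + d) = Φ i₀ + d * Real.pi := by
      intro d
      induction d using Nat.strong_induction_on with
      | _ d ih =>
        intro hd
        obtain _ | d := d
        · simp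
        by_cases h1 : 0 < m (i₀ + d)
        · rw [← add_assoc, angle_succ C hΦ h1 hd, ih d (by omega) h1]; push_cast; ring
        · obtain _ | d := d
          · exact absurd hi₀ h1
          have h2 : 0 < m (i₀ + d) := by
            by_contra hcon
            exact h1 (iso (i₀ + d) (by omega))
          have hθ := hcase.resolve_left fun h => h1 (h _)
          have := (H.angle_succ_succ C hΦ h2 (by rw [add_assoc]; omega) hd).1 hθ
          rw [show i₀ + (d + 1 + 1) = i₀ + d + 2 by ring, this, ih d (by omega) h2]
          push_cast; ring
    have := slope (Φ i₀ - i₀ * Real.pi) 0 Real.pi fun N => by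
      obtain ⟨i, hi, hm⟩ := hex (N + i₀)
      obtain ⟨d, rfl⟩ := Nat.exists_eq_add_of_le (show i₀ ≤ i by omega)
      exact ⟨_, by omega, hm, by rw [main d hm]; push_cast; ring⟩
    linarith
  exfalso
  push Not at hcase
  obtain ⟨⟨z, hz⟩, hθ⟩ := hcase
  have hr1 : r < 1 := by
    by_contra hcon
    have e1 := κs' z
    have a := (hκ z).1
    have b := (hκ (z + 1)).2
    rw [show m z = 0 by omega] at e1
    push_cast at *
    linarith
  -- An empty insertion forces `r < 1`, and then `hflat` excludes the straight angle.
  have hθ' : θ < Real.pi := hθ.lt_of_ne fun h => absurd (hflat h) (by linarith)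
  have hm1 : ∀ i, m i ≤ 1 := by
    intro i
    by_contra hcon
    have e1 := κs' i
    have a := (hκ i).2
    have b := (hκ (i + 1)).1
    have : (2 : ℝ) ≤ m i := by exact_mod_cast (show 2 ≤ m i by omega)
    push_cast at *
    linarith
  -- For θ < π, a step from one nonempty insertion to the next adds a letter and the angle π, while
  -- a pair consisting of a single letter and an empty insertion adds a letter and no angle. Both
  -- are covered by twice the number of letters minus the number of steps.
  have mixed : ∀ d : ℕ, 0 < m (i₀ + d) →
      Φ (i₀ + d) = Φ i₀ + Real.pi * (2 * (κ (i₀ + d) - κ i₀) - d) := by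
    intro d
    induction d using Nat.strong_induction_on with
    | _ d ih =>
      intro hd
      obtain _ | d := d
      · simp
      by_cases h1 : 0 < m (i₀ + d)
      · have e1 := κs' (i₀ + d)
        rw [show m (i₀ + d) = 1 by have := hm1 (i₀ + d); omega] at e1
        rw [← add_assoc, angle_succ C hΦ h1 hd, ih d (by omega) h1, e1]; push_cast; ring
      · obtain _ | d := d
        · exact absurd hi₀ h1
        have h2 : 0 < m (i₀ + d) := by
          by_contra hcon
          exact h1 (iso (i₀ + d) (by omega))
        have h3 : m (i₀ + d + 1) = 0 := by rw [add_assoc]; omega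
        have := (H.angle_succ_succ C hΦ h2 h3 hd).2 hθ'
        have e1 := κs' (i₀ + d)
        have e2 := κs' (i₀ + d + 1)
        rw [show m (i₀ + d) = 1 by have := hm1 (i₀ + d); omega] at e1
        rw [h3] at e2
        rw [show i₀ + (d + 1 + 1) = i₀ + d + 1 + 1 by ring, this, ih d (by omega) h2, e2, e1]
        push_cast; ring
  have hslope := slope (Φ i₀ - Real.pi * (2 * κ i₀ - i₀)) (2 * Real.pi) (-Real.pi) fun N => by
    obtain ⟨i, hi, hm⟩ := hex (N + i₀)
    obtain ⟨d, rfl⟩ := Nat.exists_eq_add_of_le (show i₀ ≤ i by omega)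
    exact ⟨_, by omega, hm, by rw [mixed d hm]; push_cast; ring⟩
  -- zeros and pairs of ones
  have hzero : ∀ N, ∃ i ≥ N, m i = 0 := by
    intro N
    by_contra hcon
    push Not at hcon
    have hsum : ∀ t : ℕ, (κ (N + t) : ℝ) = κ N + t := by
      intro t
      induction t with
      | zero => simp
      | succ t ih =>
        have := hcon (N + t) (by omega)
        rw [← add_assoc, κs', ih, show m (N + t) = 1 by have := hm1 (N + t); omega]
        push_cast; ring
    have : 1 - r = 0 := eq_zero_of_natCast_mul_le (K := 1 + N * r) fun t => ⟨t, le_rfl, by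
      have a := (hκ (N + t)).1
      rw [hsum] at a
      have hN : (0 : ℝ) ≤ κ N := Nat.cast_nonneg _
      rw [abs_of_pos (by linarith)]
      push_cast at a
      linarith⟩
    linarith
  obtain ⟨a, ha1, ha⟩ := hzero 1
  -- All lengths are at most 1 and their density `r` exceeds 1/2, so two consecutive ones occur. The
  -- first such pair after an empty insertion starts a run of length at least 2, preceded by an
  -- empty insertion and, before that, by a single letter.
  have hpair : ∃ b, a < b ∧ m b = 1 ∧ m (b + 1) = 1 := by
    by_contra hcon
    push Not at hcon
    have hsum : ∀ t : ℕ, (κ (a + 1 + 2 * t) : ℝ) ≤ κ (a + 1) + t := by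
      intro t
      induction t with
      | zero => simp
      | succ t ih =>
        have h1 := hcon (a + 1 + 2 * t) (by omega)
        have h2 := hm1 (a + 1 + 2 * t)
        have h3 := hm1 (a + 1 + 2 * t + 1)
        have h4 : m (a + 1 + 2 * t) + m (a + 1 + 2 * t + 1) ≤ 1 := by
          by_contra h5
          exact h1 (by omega) (by omega)
        have h5 : (m (a + 1 + 2 * t) : ℝ) + m (a + 1 + 2 * t + 1) ≤ 1 := by exact_mod_cast h4
        rw [show a + 1 + 2 * (t + 1) = a + 1 + 2 * t + 1 + 1 by ring, κs', κs']
        push_cast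
        linarith
    have : 2 * r - 1 = 0 := eq_zero_of_natCast_mul_le (K := 1 + κ (a + 1)) fun t => ⟨t, le_rfl, by
      have b := (hκ (a + 1 + 2 * t)).2
      have c := hsum t
      rw [abs_of_pos (by linarith)]
      have hN : (0 : ℝ) ≤ (a + 1) * r := by positivity
      push_cast at b
      linarith⟩
    linarith
  classical
  set b := Nat.find hpair with hb
  obtain ⟨hab, hb1, hb2⟩ := Nat.find_spec hpair
  rw [← hb] at hab hb1 hb2
  have hb0 : m (b - 1) = 0 := by
    by_contra hcon
    have h1 : m (b - 1) = 1 := by have := hm1 (b - 1); omega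
    have h2 : b - 1 ≠ a := fun h => by rw [h] at hcon; exact hcon ha
    exact Nat.find_min hpair (m := b - 1) (by omega)
      ⟨by omega, h1, by rw [Nat.sub_add_cancel (by omega)]; exact hb1⟩
  have hcz : ∃ k, m (b + k) = 0 := by
    obtain ⟨i, hi, h0⟩ := hzero b
    exact ⟨i - b, by rw [Nat.add_sub_cancel' hi]; exact h0⟩
  set k := Nat.find hcz with hk
  have hk0 : m (b + k) = 0 := Nat.find_spec hcz
  have hrun : ∀ j < k, m (b + j) = 1 := by
    intro j hj
    have := Nat.find_min hcz hj
    have := hm1 (b + j)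
    omega
  have hk2 : 2 ≤ k := by
    by_contra hcon
    have : k = 0 ∨ k = 1 := by omega
    rcases this with h | h <;> rw [h] at hk0
    · rw [add_zero] at hk0; omega
    · omega
  obtain ⟨i, hi⟩ : ∃ i, b = i + 2 := ⟨b - 2, by omega⟩
  rw [hi] at hb0 hrun hk0
  have hi1 : m i = 1 := by
    by_contra hcon
    have := hm1 i
    have := iso i (by omega)
    rw [show i + 2 - 1 = i + 1 by omega] at hb0
    omega
  have hfin := H.angle_of_run C hΦ hθ' hk2 hi1 hb0 hrun hk0
    (by rw [show i + 3 + k = i + 2 + k + 1 by ring]; exact iso _ hk0)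
  -- Combines `k * π = (k + 1) * θ` with the growth rate `θ * r = 2 * π * r - π`. But between index
  -- i + 1 and index i + k + 3 only k letters are read, so the bounds on κ give `(k + 2) * r < k +
  -- 1`.
  have hkr : (k + 2) * r = k + 1 := by
    have : Real.pi * ((k + 2) * r - (k + 1)) = 0 := by linear_combination -r * hfin - (k + 1) * hslope
    rcases mul_eq_zero.1 this with h | h
    · exact absurd h hp.ne'
    · linarith
  have hsum : ∀ j ≤ k, (κ (i + 2 + j) : ℝ) = κ (i + 1) + j := by
    intro j
    induction j with
    | zero =>
      intro _
      rw [show i + 2 - 1 = i + 1 by omega] at hb0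
      rw [add_zero, κs', hb0]
    | succ j ih =>
      intro hj
      rw [← add_assoc, κs', ih (by omega), hrun j (by omega)]; push_cast; ring
  have e1 := κs' (i + 2 + k)
  rw [hsum k le_rfl, hk0] at e1
  have g1 := (hκ (i + 1)).1
  have g2 := (hκ (i + 2 + k + 1)).2
  rw [e1] at g2
  push_cast at g1 g2
  linarith

end CornerChain
end PolygonalTable

/-! ### From words of the language to limit orbits -/

namespace PolygonalTable
variable {n : ℕ} {P : PolygonalTable n}

/-- Moves the origin of time to the first inserted letter, at `M + N`; the half `s` is then read
backwards at the times -1, -2, and so on. -/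
lemma joinWord_eq_iff {α : Type*} {s t : ℕ → α} {w : List α} {N : ℕ} {e : ℤ → α} {M : ℤ} :
    joinWord s w t N = (List.range (joinWord s w t N).length).map (fun k : ℕ => e (M + k)) ↔
      (∀ k < N, e (M + N + (-1 - k)) = s k) ∧ (∀ j (hj : j < w.length), e (M + N + j) = w[j]) ∧
      ∀ k < N, e (M + N + (w.length + k)) = t k := by
  have hlen : (joinWord s w t N).length = N + w.length + N := by
    simp [joinWord, initialWord, add_assoc]
  constructor
  · intro h
    have h' : ∀ k (hk : k < (joinWord s w t N).length), (joinWord s w t N)[k] = e (M + k) := by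
      intro k hk
      have : (joinWord s w t N)[k]? =
        ((List.range (joinWord s w t N).length).map (fun k : ℕ => e (M + k)))[k]? := by rw [← h]
      rw [List.getElem?_eq_getElem hk, List.getElem?_eq_getElem (by simpa using hk)] at this
      simpa using this
    refine ⟨fun k hk => ?_, fun j hj => ?_, fun k hk => ?_⟩
    · have := h' (N - 1 - k) (by omega)
      simp only [joinWord, initialWord, List.append_assoc] at this
      rw [List.getElem_append_left (by simp; omega)] at this
      simp only [List.getElem_reverse, List.getElem_map, List.getElem_range, List.length_map,
        List.length_range] at this
      rw [show N - 1 - (N - 1 - k) = k by omega] at this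
      rw [this]; congr 1; omega
    · have := h' (N + j) (by omega)
      simp only [joinWord, initialWord, List.append_assoc] at this
      rw [List.getElem_append_right (by simp), List.getElem_append_left (by simpa using hj)] at this
      simp only [List.length_reverse, List.length_map, List.length_range, Nat.add_sub_cancel_left]
        at this
      rw [this]; congr 1; push_cast; ring
    · have := h' (N + (w.length + k)) (by omega)
      simp only [joinWord, initialWord, List.append_assoc] at this
      rw [List.getElem_append_right (by simp), List.getElem_append_right (by simp)] at this
      simp only [List.length_reverse, List.length_map, List.length_range, Nat.add_sub_cancel_left,
        List.getElem_map, List.getElem_range] at this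
      rw [this]; congr 1; push_cast; ring
  · rintro ⟨h1, h2, h3⟩
    refine List.ext_getElem (by simp) fun k hk _ => ?_
    rw [List.getElem_map, List.getElem_range]
    simp only [joinWord, initialWord, List.append_assoc]
    rw [hlen] at hk
    by_cases c1 : k < N
    · rw [List.getElem_append_left (by simpa using c1)]
      simp only [List.getElem_reverse, List.getElem_map, List.getElem_range, List.length_map,
        List.length_range]
      rw [← h1 _ (by omega)]; congr 1; omega
    · rw [List.getElem_append_right (by simp; omega)]
      simp only [List.length_reverse, List.length_map, List.length_range]
      by_cases c2 : k - N < w.length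
      · rw [List.getElem_append_left c2, ← h2 _ c2]; congr 1; omega
      · rw [List.getElem_append_right (by omega)]
        simp only [List.getElem_map, List.getElem_range]
        rw [← h3 _ (by omega)]; congr 1; omega

lemma joinWord_mem_language_iff {s t : ℕ → Fin n} {w : List (Fin n)} {N : ℕ} :
    joinWord s w t N ∈ P.language ↔ ∃ x ∈ P.orbits, (∀ k < N, x.edge (-1 - k) = s k) ∧
      (∀ j (hj : j < w.length), x.edge j = w[j]) ∧ ∀ k < N, x.edge (w.length + k) = t k := by
  constructor
  · rintro ⟨e, ⟨b, hb⟩, M, h⟩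
    rw [joinWord_eq_iff] at h
    obtain ⟨x, hx, -, hxe⟩ := hb.exists_orbit
    subst hxe
    refine ⟨x.shift (M + N), shift_mem_orbits hx _, ?_⟩
    simpa only [Orb.edge_shift, add_comm _ (M + (N : ℤ))] using h
  · rintro ⟨x, hx, h⟩
    refine ⟨x.edge, ⟨x.pos, hx.1⟩, -N, ?_⟩
    rw [joinWord_eq_iff]
    simpa only [neg_add_cancel, zero_add] using h

/-- Compactness of the limit orbits: orbits that read longer and longer words around the same
insertion accumulate at one that reads all of it. -/
lemma exists_limOrbit {s t : ℕ → Fin n} {w : List (Fin n)}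
    (h : ∀ N, joinWord s w t N ∈ P.language) : ∃ x ∈ P.limOrbits,
      (∀ k : ℕ, x.edge (-1 - k) = s k) ∧ (∀ j (hj : j < w.length), x.edge j = w[j]) ∧
      ∀ k : ℕ, x.edge (w.length + k) = t k := by
  choose y hy h1 h2 h3 using fun N => joinWord_mem_language_iff.1 (h N)
  obtain ⟨x, hx, φ, hφ, hlim⟩ := P.isCompact_limOrbits.tendsto_subseq fun N => orbits_subset (hy N)
  refine ⟨x, hx, fun k => ?_, fun j hj => ?_, fun k => ?_⟩
  · obtain ⟨N, hN, hk⟩ := ((Orb.eventually_edge hlim (-1 - k)).and (eventually_gt_atTop k)).exists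
    rw [← hN]
    exact h1 _ k (hk.trans_le (hφ.id_le N))
  · obtain ⟨N, hN⟩ := (Orb.eventually_edge hlim j).exists
    rw [← hN]
    exact h2 _ j hj
  · obtain ⟨N, hN, hk⟩ := ((Orb.eventually_edge hlim (w.length + k)).and
      (eventually_gt_atTop k)).exists
    rw [← hN]
    exact h3 _ k (hk.trans_le (hφ.id_le N))

end PolygonalTable

/-- The halves of a sequence of gapped sequences, one after the other, repeated periodically. -/
def halves {α : Type*} {p : ℕ} (hp : 0 < p) (E : Fin p → GappedSeq α) (i : ℕ) : ℕ → α :=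
  if Even i then (E ⟨i / 2 % p, Nat.mod_lt _ hp⟩).neg else (E ⟨i / 2 % p, Nat.mod_lt _ hp⟩).pos

section
variable {p q : ℕ} {s : ℕ → Bool} {X : ℝ}

lemma length_insertion {α : Type*} (A B : α) (s : ℕ → Bool) (i : ℕ) :
    (insertion A B s i).length = runLength s i := by simp [insertion]

lemma getElem_insertion {α : Type*} (A B : α) (s : ℕ → Bool) (i j : ℕ)
    (hj : j < (insertion A B s i).length) :
    (insertion A B s i)[j] = letter A B ((∑ k ∈ Finset.range i, runLength s k) + j) := by
  simp [insertion, letter]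

lemma sum_runLength (h0 : 0 < X) (h1 : X < 1) (h : ∀ i : ℕ, (runLength s i : ℤ) =
    ⌊X + ((i + 1 : ℕ) : ℝ) * (q / p : ℝ)⌋ - ⌊X + i * (q / p : ℝ)⌋) (i : ℕ) :
    ((∑ k ∈ Finset.range i, runLength s k : ℕ) : ℤ) = ⌊X + i * (q / p : ℝ)⌋ := by
  induction i with
  | zero => simp [Int.floor_eq_zero_iff.2 ⟨h0.le, h1⟩]
  | succ i ih => rw [Finset.sum_range_succ, Nat.cast_add, ih, h]; ring

lemma sum_runLength_add (hp : 0 < p) (h0 : 0 < X) (h1 : X < 1) (h : ∀ i : ℕ, (runLength s i : ℤ) =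
    ⌊X + ((i + 1 : ℕ) : ℝ) * (q / p : ℝ)⌋ - ⌊X + i * (q / p : ℝ)⌋) (i : ℕ) :
    ∑ k ∈ Finset.range (i + 2 * p), runLength s k = ∑ k ∈ Finset.range i, runLength s k + 2 * q := by
  have e := sum_runLength h0 h1 h
  have hp' : (p : ℝ) ≠ 0 := by exact_mod_cast hp.ne'
  have : ((∑ k ∈ Finset.range (i + 2 * p), runLength s k : ℕ) : ℤ) =
      ((∑ k ∈ Finset.range i, runLength s k : ℕ) : ℤ) + 2 * q := by
    rw [e, e, show X + ((i + 2 * p : ℕ) : ℝ) * (q / p : ℝ) = X + i * (q / p : ℝ) + (2 * q : ℤ) by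
      push_cast; field_simp; ring, Int.floor_add_intCast]
  exact_mod_cast this

/-- One period contains the even number `2 * q` of letters, so the alternating word resumes with the
same letter. -/
lemma insertion_add {α : Type*} (A B : α) (hp : 0 < p) (h0 : 0 < X) (h1 : X < 1)
    (h : ∀ i : ℕ, (runLength s i : ℤ) =
      ⌊X + ((i + 1 : ℕ) : ℝ) * (q / p : ℝ)⌋ - ⌊X + i * (q / p : ℝ)⌋) (i : ℕ) :
    insertion A B s (i + 2 * p) = insertion A B s i := by
  have e1 := sum_runLength_add hp h0 h1 h i
  have e2 := sum_runLength_add hp h0 h1 h (i + 1)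
  rw [show i + 1 + 2 * p = i + 2 * p + 1 by ring, Finset.sum_range_succ, Finset.sum_range_succ,
    e1] at e2
  have e3 : runLength s (i + 2 * p) = runLength s i := by omega
  unfold insertion
  rw [e3, e1]
  refine List.map_congr_left fun j _ => ?_
  congr 1
  rw [eq_iff_iff, add_right_comm, Nat.even_add]
  simp

lemma insertion_mod {α : Type*} (A B : α) (hp : 0 < p) (h0 : 0 < X) (h1 : X < 1)
    (h : ∀ i : ℕ, (runLength s i : ℤ) =
      ⌊X + ((i + 1 : ℕ) : ℝ) * (q / p : ℝ)⌋ - ⌊X + i * (q / p : ℝ)⌋) (i : ℕ) :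
    insertion A B s i = insertion A B s (i % (2 * p)) := by
  conv_lhs => rw [← Nat.mod_add_div i (2 * p)]
  generalize i / (2 * p) = c
  induction c with
  | zero => simp
  | succ c ih => rw [mul_add, mul_one, ← add_assoc, insertion_add A B hp h0 h1 h, ih]

end

namespace PolygonalTable
variable {n : ℕ} {P : PolygonalTable n}

/-- The insertions determine the angle. -/
theorem angle_eq_of_language {A B i : Fin n} (hAB : P.MeetAt A B i) {p q : ℕ} (hp : 0 < p)
    (hq : 0 < q) (hlt : p < 2 * q) (hflat : P.interiorAngle i = Real.pi → p ≤ q) {s : ℕ → Bool}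
    (hs : IsSquareCode p q s) {E : Fin p → GappedSeq (Fin n)}
    (hgraz : ∀ j : Fin p, P.IsGrazing A B (E j) ∧ Aperiodic (E j).neg ∧ Aperiodic (E j).pos)
    (hlang : ∀ N : ℕ, ∀ j : Fin p,
      joinWord (E j).neg (insertion A B s (2 * j)) (E j).pos N ∈ P.language ∧
      joinWord (E j).pos (insertion A B s (2 * j + 1)) (E (finRotate p j)).neg N ∈ P.language) :
    P.interiorAngle i = Real.pi * (p / q : ℝ) := by
  obtain ⟨X, hX0, hX1, -, hrun⟩ := hs.exists_floor hp hq
  have hp' : (0 : ℝ) < p := by exact_mod_cast hp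
  have hq' : (0 : ℝ) < q := by exact_mod_cast hq
  -- The finitely many words are arranged in an infinite periodic chain of halves, where even
  -- indices are the negative halves; this allows comparing rates of growth.
  have key : ∀ i N, joinWord (halves hp E i) (insertion A B s i) (halves hp E (i + 1)) N
      ∈ P.language := by
    intro i N
    set j : Fin p := ⟨i / 2 % p, Nat.mod_lt _ hp⟩ with hj
    rw [insertion_mod A B hp hX0 hX1 hrun i]
    have hmm := Nat.mod_mul (x := i) (a := 2) (b := p)
    by_cases hi : Even i
    · have hi' : ¬ Even (i + 1) := by simpa [Nat.even_add_one] using hi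
      have h2 := Nat.even_iff.1 hi
      rw [halves, halves, if_pos hi, if_neg hi',
        show i % (2 * p) = 2 * (j : ℕ) by rw [hmm]; simp only [hj]; omega]
      have : (⟨(i + 1) / 2 % p, Nat.mod_lt _ hp⟩ : Fin p) = j := by
        rw [hj]; congr 2; omega
      rw [this]
      exact (hlang N j).1
    · have hi' : Even (i + 1) := by simpa [Nat.even_add_one] using hi
      have h2 := Nat.not_even_iff.1 hi
      rw [halves, halves, if_neg hi, if_pos hi',
        show i % (2 * p) = 2 * (j : ℕ) + 1 by rw [hmm]; simp only [hj]; omega]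
      have : (⟨(i + 1) / 2 % p, Nat.mod_lt _ hp⟩ : Fin p) = finRotate p j := by
        obtain ⟨p, rfl⟩ : ∃ p', p = p' + 1 := ⟨p - 1, by omega⟩
        rw [finRotate_apply]
        ext
        rw [Fin.val_add, hj]
        simp only [Fin.val_one', Nat.add_mod_mod, Nat.mod_add_mod]
        rw [show (i + 1) / 2 = i / 2 + 1 by omega]
      rw [this]
      exact (hlang N j).2
  choose T hT h1 h2 h3 using fun i => exists_limOrbit (key i)
  obtain ⟨C⟩ := hAB.exists_corner
  have H : CornerChain P A B (runLength s) (halves hp E) T := by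
    refine ⟨hT, h1, fun i j hj => ?_, fun i k => ?_, fun i => ?_, fun i => ?_⟩
    · rw [h2 i j (by rwa [length_insertion]), getElem_insertion]
    · rw [← h3 i k, length_insertion]
    · have hd := (hgraz ⟨i / 2 % p, Nat.mod_lt _ hp⟩).1.1
      simp only [disjoint_insert_left, disjoint_singleton_left, mem_insert_iff, mem_singleton_iff,
        not_or] at hd
      unfold halves
      split_ifs
      exacts [hd.1, hd.2]
    · obtain ⟨-, g1, g2⟩ := hgraz ⟨i / 2 % p, Nat.mod_lt _ hp⟩
      unfold halves
      split_ifs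
      exacts [g1, g2]
  have := H.angle_eq C hX0 hX1 (r := q / p)
    (by rw [mul_div_assoc', lt_div_iff₀ hp', one_mul]; exact_mod_cast hlt)
    (fun h => by rw [le_div_iff₀ hp', one_mul]; exact_mod_cast hflat h) fun i => by
      have e := sum_runLength hX0 hX1 hrun i
      rw [eq_comm, Int.floor_eq_iff] at e
      exact_mod_cast e
  field_simp at this ⊢
  linarith

end PolygonalTable

/-! ### Rays, and the countable set of singular ones -/

lemma sameRay_real_mul {s t : ℝ} (hs : 0 < s) (ht : 0 < t) {a b w : ℂ} (ha : a = s * w)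
    (hb : b = t * w) : SameRay ℝ a b := by
  rw [ha, hb, ← Complex.real_smul, ← Complex.real_smul]
  exact ((SameRay.refl w).nonneg_smul_left hs.le).nonneg_smul_right ht.le

namespace PolygonalTable
variable {n : ℕ} (P : PolygonalTable n)

/-- The first point of the boundary that is hit by the ray from `z` in the direction `d` is the point
`y`, which is not a vertex, on the edge `e`. -/
def Hits (z d : ℂ) (e : Fin n) (y : ℂ) : Prop :=
  y ∈ P.openEdge e ∧ openSegment ℝ z y ⊆ P.interior ∧ ∃ t : ℝ, 0 < t ∧ y = z + t * d

/-- The first `K` steps of a forward billiard trajectory that starts in `x 0`, in the direction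
`d 0`. -/
def IsRayTo (K : ℕ) (e : ℕ → Fin n) (x d : ℕ → ℂ) : Prop :=
  ∀ k < K, P.Hits (x k) (d k) (e k) (x (k + 1)) ∧ d (k + 1) = mirror (P.edgeVec (e k)) (d k)

/-- A forward billiard trajectory that starts in `x 0`, in the direction `d 0`. -/
def IsRay (e : ℕ → Fin n) (x d : ℕ → ℂ) : Prop := ∀ K, P.IsRayTo K e x d

variable {P}

namespace Hits
variable {z d : ℂ} {e : Fin n} {y : ℂ}

lemma unique (h : P.Hits z d e y) {e' : Fin n} {y' : ℂ} (h' : P.Hits z d e' y') :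
    e = e' ∧ y = y' := by
  have aux : ∀ {e e' : Fin n} {y y' : ℂ} {t t' : ℝ}, P.Hits z d e y → P.Hits z d e' y' → 0 < t →
      y = z + t * d → y' = z + t' * d → ¬ t < t' := by
    intro e e' y y' t t' h h' ht hy hy' hlt
    have : y ∈ openSegment ℝ z y' := by
      refine mem_openSegment_iff_add.2 ⟨t / t', div_pos ht (ht.trans hlt),
        (div_lt_one (ht.trans hlt)).2 hlt, ?_⟩
      have : (t' : ℂ) ≠ 0 := by exact_mod_cast (ht.trans hlt).ne'
      rw [hy', hy]; push_cast; field_simp; ring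
    exact P.notMem_closedEdge_of_mem (h'.2.1 this) e (P.openEdge_subset _ h.1)
  obtain ⟨t, ht, hy⟩ := h.2.2
  obtain ⟨t', ht', hy'⟩ := h'.2.2
  have htt : t = t' := le_antisymm (not_lt.1 (aux h' h ht' hy' hy)) (not_lt.1 (aux h h' ht hy hy'))
  have hyy : y = y' := by rw [hy, hy', htt]
  exact ⟨P.openEdge_inter_closedEdge h.1 (hyy ▸ P.openEdge_subset _ h'.1), hyy⟩

lemma crs_neg (h : P.Hits z d e y) : crs (P.edgeVec e) d < 0 := by
  obtain ⟨hy, hs, t, ht, rfl⟩ := h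
  rw [openSegment_symm] at hs
  have := P.crs_pos_of_openSegment hy hs
  rw [sub_add_cancel_left, crs_neg_right, crs_real_mul_right] at this
  by_contra hcon
  push Not at hcon
  nlinarith [mul_nonneg ht.le hcon]

lemma eventually_mem (h : P.Hits z d e y) :
    ∀ᶠ t : ℝ in 𝓝[>] 0, y + t * mirror (P.edgeVec e) d ∈ P.interior := by
  obtain ⟨r, hr, hball⟩ := P.exists_half_disc h.1
  have hc : Continuous fun t : ℝ => y + t * mirror (P.edgeVec e) d := by fun_prop
  have h1 : ∀ᶠ t : ℝ in 𝓝 0, y + t * mirror (P.edgeVec e) d ∈ Metric.ball y r :=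
    (hc.tendsto' 0 y (by simp)).eventually (Metric.ball_mem_nhds y hr)
  filter_upwards [h1.filter_mono nhdsWithin_le_nhds, self_mem_nhdsWithin] with t ht ht0
  rw [(hball _ ht).1, add_sub_cancel_left, crs_real_mul_right,
    crs_mirror_right (P.edgeVec_ne_zero e)]
  exact mul_pos ht0 (neg_pos.2 h.crs_neg)

/-- A ray may be started earlier on its line; this glues two pieces at a point of the domain where
no bounce takes place. -/
lemma trans {w : ℂ} {t : ℝ} (ht : 0 < t) (hw : w = z + t * d) (hwi : w ∈ P.interior)
    (hs : openSegment ℝ z w ⊆ P.interior) (h : P.Hits w d e y) : P.Hits z d e y := by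
  obtain ⟨hy, hs', t', ht', hy'⟩ := h
  refine ⟨hy, fun a ha => ?_, t + t', by positivity, by rw [hy', hw]; push_cast; ring⟩
  obtain ⟨r, hr0, hr1, rfl⟩ := mem_openSegment_iff_add.1 ha
  rw [show z + r * (y - z) = z + (r * (t + t') : ℝ) * d by rw [hy', hw]; push_cast; ring]
  set r' := r * (t + t') with hr'
  have h0 : 0 < r' := by positivity
  have h1 : r' < t + t' := by nlinarith
  have htc : (t : ℂ) ≠ 0 := by exact_mod_cast ht.ne'
  have htc' : (t' : ℂ) ≠ 0 := by exact_mod_cast ht'.ne'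
  rcases lt_trichotomy r' t with hlt | heq | hgt
  · refine hs (mem_openSegment_iff_add.2 ⟨r' / t, by positivity, (div_lt_one ht).2 hlt, ?_⟩)
    rw [hw]; push_cast; field_simp; ring
  · rw [heq, ← hw]; exact hwi
  · refine hs' (mem_openSegment_iff_add.2 ⟨(r' - t) / t', div_pos (sub_pos.2 hgt) ht',
      (div_lt_one ht').2 (by linarith), ?_⟩)
    rw [hy', hw]; push_cast; field_simp; ring

end Hits

/-- A ray hits an edge or a vertex. -/
lemma exists_hits {z d : ℂ} (hd : d ≠ 0) (hz : ∀ᶠ t : ℝ in 𝓝[>] 0, z + t * d ∈ P.interior) :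
    (∃ e y, P.Hits z d e y) ∨ ∃ j, ∃ t : ℝ, 0 < t ∧ P.vertex j = z + t * d := by
  have hc : Continuous fun t : ℝ => z + t * d := by fun_prop
  obtain ⟨δ, hδ, hδz⟩ := (nhdsGT_basis (0 : ℝ)).eventually_iff.1 hz
  -- The ray may start on the boundary, so the first exit time is searched only after `δ / 2`; up to
  -- δ the ray is known to be in the domain.
  set S : Set ℝ := {t | δ / 2 ≤ t ∧ z + t * d ∉ P.interior} with hS
  have hScl : IsClosed S := isClosed_Ici.inter ((P.isOpen_interior.isClosed_compl).preimage hc)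
  have hSb : BddBelow S := ⟨δ / 2, fun t ht => ht.1⟩
  have hSne : S.Nonempty := by
    obtain ⟨R, hR⟩ := P.isBounded_interior.subset_ball 0
    have hd' := norm_pos_iff.2 hd
    refine ⟨max (δ / 2) ((|R| + ‖z‖) / ‖d‖), le_max_left _ _, fun hmem => ?_⟩
    have h1 := hR hmem
    rw [Metric.mem_ball, dist_zero_right] at h1
    have h2 : (|R| + ‖z‖) / ‖d‖ ≤ max (δ / 2) ((|R| + ‖z‖) / ‖d‖) := le_max_right _ _
    set M := max (δ / 2) ((|R| + ‖z‖) / ‖d‖) with hM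
    have h3 := (div_le_iff₀ hd').1 h2
    have hM0 : 0 ≤ M := le_trans (by positivity) h2
    have h4 : ‖(M : ℂ) * d‖ = M * ‖d‖ := by rw [norm_mul, Complex.norm_real, Real.norm_of_nonneg hM0]
    have h5 := norm_sub_le (z + M * d) z
    rw [add_sub_cancel_left, h4] at h5
    linarith [le_abs_self R]
  set T := sInf S with hT
  obtain ⟨hT1, hT2⟩ := hScl.csInf_mem hSne hSb
  rw [← hT] at hT1 hT2
  have hT0 : 0 < T := by linarith
  have hlt : ∀ t, 0 < t → t < T → z + t * d ∈ P.interior := by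
    intro t h0 ht
    by_contra hcon
    by_cases h1 : δ / 2 ≤ t
    · exact ht.not_ge (csInf_le hSb ⟨h1, hcon⟩)
    · exact hcon (hδz ⟨h0, by linarith⟩)
  have hfr : z + T * d ∈ frontier P.interior := by
    rw [P.isOpen_interior.frontier_eq]
    refine ⟨?_, hT2⟩
    refine mem_closure_of_tendsto ((hc.tendsto T).mono_left (nhdsWithin_le_nhds (s := Iio T))) ?_
    filter_upwards [Ioo_mem_nhdsLT hT0] with t ht using hlt t ht.1 ht.2
  obtain ⟨i, hi⟩ := P.mem_frontier.1 hfr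
  rcases P.mem_closedEdge_cases hi with h | h | h
  · refine Or.inl ⟨i, _, h, fun a ha => ?_, T, hT0, rfl⟩
    obtain ⟨r, hr0, hr1, rfl⟩ := mem_openSegment_iff_add.1 ha
    rw [show z + r * (z + T * d - z) = z + (r * T : ℝ) * d by push_cast; ring]
    exact hlt _ (by positivity) (by nlinarith)
  · exact Or.inr ⟨_, T, hT0, h.symm⟩
  · exact Or.inr ⟨_, T, hT0, h.symm⟩

lemma IsRayTo.mono {K K' : ℕ} (hK : K' ≤ K) {e : ℕ → Fin n} {x d : ℕ → ℂ} (h : P.IsRayTo K e x d) :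
    P.IsRayTo K' e x d := fun k hk => h k (hk.trans_le hK)

lemma IsRayTo.unique {K : ℕ} {e e' : ℕ → Fin n} {x d x' d' : ℕ → ℂ} (h : P.IsRayTo K e x d)
    (h' : P.IsRayTo K e' x' d') (h0 : x 0 = x' 0) (hd : d 0 = d' 0) :
    ∀ k ≤ K, x k = x' k ∧ d k = d' k ∧ ∀ j < k, e j = e' j := by
  intro k
  induction k with
  | zero => exact fun _ => ⟨h0, hd, by simp⟩
  | succ k ih =>
    intro hk
    obtain ⟨g1, g2, g3⟩ := ih (by omega)
    obtain ⟨a1, a2⟩ := h k (by omega)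
    obtain ⟨b1, b2⟩ := h' k (by omega)
    rw [g1, g2] at a1
    obtain ⟨c1, c2⟩ := a1.unique b1
    refine ⟨c2, by rw [a2, b2, c1, g2], fun j hj => ?_⟩
    rcases (Nat.lt_succ_iff_lt_or_eq.1 hj) with h | rfl
    exacts [g3 j h, c1]

lemma IsRayTo.norm_dir {K : ℕ} {e : ℕ → Fin n} {x d : ℕ → ℂ} (h : P.IsRayTo K e x d) :
    ∀ k ≤ K, ‖d k‖ = ‖d 0‖ := by
  intro k
  induction k with
  | zero => simp
  | succ k ih =>
    intro hk
    rw [(h k hk).2, norm_mirror (P.edgeVec_ne_zero _), ih (by omega)]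

/-- A trajectory exists unless one gets to a vertex. -/
lemma exists_isRay {z d : ℂ} (hd : d ≠ 0) (hz : ∀ᶠ t : ℝ in 𝓝[>] 0, z + t * d ∈ P.interior)
    (hns : ∀ K e (x d' : ℕ → ℂ), P.IsRayTo K e x d' → x 0 = z → d' 0 = d →
      ∀ j, ∀ t : ℝ, 0 < t → P.vertex j ≠ x K + t * d' K) :
    ∃ e x d', P.IsRay e x d' ∧ x 0 = z ∧ d' 0 = d := by
  -- States reachable from the start by a finite nonsingular trajectory. With the reachability built
  -- into the type, `hns` applies at each step and the trajectory is obtained by recursion.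
  let R : Type := {s : ℂ × ℂ // ∃ K e, ∃ x d' : ℕ → ℂ, P.IsRayTo K e x d' ∧ x 0 = z ∧ d' 0 = d ∧
    x K = s.1 ∧ d' K = s.2 ∧ ∀ᶠ t : ℝ in 𝓝[>] 0, s.1 + t * s.2 ∈ P.interior}
  have step : ∀ s : R, ∃ (e : Fin n) (s' : R), P.Hits s.1.1 s.1.2 e s'.1.1 ∧
      s'.1.2 = mirror (P.edgeVec e) s.1.2 := by
    rintro ⟨⟨y, w⟩, K, e, x, d', hray, h0, h1, h2, h3, h4⟩
    have hw : w ≠ 0 := by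
      rw [← norm_pos_iff]
      change d' K = w at h3
      rw [← h3, hray.norm_dir K le_rfl, h1]; exact norm_pos_iff.2 hd
    rcases exists_hits hw h4 with ⟨f, y', hy'⟩ | ⟨j, t, ht, hj⟩
    · refine ⟨f, ⟨⟨y', mirror (P.edgeVec f) w⟩, K + 1, fun k => if k = K then f else e k,
        fun k => if k = K + 1 then y' else x k,
        fun k => if k = K + 1 then mirror (P.edgeVec f) w else d' k, fun k hk => ?_, by simpa using h0,
        by simpa using h1, by simp, by simp, hy'.eventually_mem⟩, hy', rfl⟩
      have hk1 : k ≠ K + 1 := by omega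
      rcases Nat.lt_succ_iff_lt_or_eq.1 hk with h | rfl
      · have e1 : k ≠ K := by omega
        simp only [hk1, e1, if_false, Nat.add_right_cancel_iff]
        exact hray k h
      · simp only [hk1, if_false, if_true]
        change x k = y at h2
        change d' k = w at h3
        rw [h2, h3]
        exact ⟨hy', rfl⟩
    · change x K = y at h2
      change d' K = w at h3
      rw [← h2, ← h3] at hj
      exact absurd hj (hns K e x d' hray h0 h1 j t ht)
  choose f g hf hg using step
  have hn : Nonempty (Fin n) := by
    rcases exists_hits hd hz with ⟨e, -⟩ | ⟨j, -⟩
    exacts [⟨e⟩, ⟨j⟩]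
  obtain ⟨e₀⟩ := hn
  let s : ℕ → R := fun k => Nat.rec ⟨(z, d), 0, fun _ => e₀, fun _ => z, fun _ => d,
    fun k hk => absurd hk (Nat.not_lt_zero k), rfl, rfl, rfl, rfl, hz⟩ (fun _ s => g s) k
  exact ⟨fun k => f (s k), fun k => (s k).1.1, fun k => (s k).1.2, fun K k _ => ⟨hf (s k), hg (s k)⟩, rfl, rfl⟩

/-- Two trajectories in opposite directions are one bi-infinite trajectory. -/
lemma exists_orbit_of_rays {e e' : ℕ → Fin n} {x d x' d' : ℕ → ℂ} (h : P.IsRay e x d)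
    (h' : P.IsRay e' x' d') (h0 : x' 0 = x 0) (hd : d' 0 = -d 0) (hn : ‖d 0‖ = 1)
    (hi : x 0 ∈ P.interior) : ∃ o ∈ P.orbits, (∀ k : ℕ, o.edge k = e k) ∧
      (∀ k : ℕ, o.edge (-1 - k) = e' k) ∧ o.dir 0 = d 1 := by
  have H := fun k => h (k + 1) k k.lt_succ_self
  have H' := fun k => h' (k + 1) k k.lt_succ_self
  -- The common starting point is not a bounce: the bounce -1 is the first hit of the backward ray,
  -- the bounce 0 that of the forward ray, and the segment between them passes through the start.
  let b : ℤ → ℂ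
    | Int.ofNat k => x (k + 1)
    | Int.negSucc k => x' (k + 1)
  let c : ℤ → Fin n
    | Int.ofNat k => e k
    | Int.negSucc k => e' k
  have hseg : openSegment ℝ (x' 1) (x 1) ⊆ P.interior := by
    obtain ⟨-, s1, t, ht, e1⟩ := (H 0).1
    obtain ⟨-, s2, t', ht', e2⟩ := (H' 0).1
    rw [openSegment_symm] at s2
    rw [h0] at s2 e2
    have hh : P.Hits (x' 1) (d 0) (e 0) (x 1) := by
      refine Hits.trans ht' (w := x 0) ?_ hi s2 (H 0).1
      rw [e2, hd]; ring
    exact hh.2.1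
  have key : P.IsTrajectory b c := by
    rintro (k | k)
    · obtain ⟨⟨m0, -, -⟩, -⟩ := H k
      obtain ⟨⟨m1, s1, t, ht, e1⟩, r1⟩ := H (k + 1)
      obtain ⟨⟨-, -, t', ht', e2⟩, -⟩ := H (k + 2)
      refine ⟨m0, s1, sameRay_real_mul (w := d (k + 2)) ht' ht ?_ ?_⟩
      · change x (k + 2 + 1) - x (k + 1 + 1) = _
        rw [e2, add_sub_cancel_left]
      · change P.reflectDir (e (k + 1)) (x (k + 1 + 1) - x (k + 1)) = _
        rw [e1, add_sub_cancel_left, reflectDir_eq, mirror_real_mul, r1]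
    obtain ⟨⟨m0, -, t₀, ht₀, e0⟩, r0⟩ := H' k
    obtain _ | _ | k := k
    · obtain ⟨⟨-, -, t, ht, e1⟩, r1⟩ := H 0
      obtain ⟨⟨-, -, t', ht', e2⟩, -⟩ := H 1
      refine ⟨m0, hseg, sameRay_real_mul (w := d 1) ht' (add_pos ht ht₀) ?_ ?_⟩
      · change x 2 - x 1 = _
        rw [e2, add_sub_cancel_left]
      · change P.reflectDir (e 0) (x 1 - x' 1) = _
        rw [reflectDir_eq, r1, ← mirror_real_mul, e1, e0, h0, hd]
        congr 1; push_cast; ring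
    · obtain ⟨⟨m1, s1, t, ht, e1⟩, r1⟩ := H 0
      obtain ⟨⟨-, -, t', ht', e2⟩, r2⟩ := H' 0
      have s0 := (H' 1).1.2.1
      rw [openSegment_symm] at s0
      refine ⟨m0, s0, sameRay_real_mul (w := d 0) (add_pos ht ht') ht₀ ?_ ?_⟩
      · change x 1 - x' 1 = _
        rw [e1, e2, h0, hd]; push_cast; ring
      · change P.reflectDir (e' 0) (x' 1 - x' 2) = _
        rw [reflectDir_eq, e0, r2, hd, mirror_neg, sub_add_cancel_left, mul_neg, neg_neg,
          mirror_real_mul, mirror_mirror (P.edgeVec_ne_zero _)]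
    · obtain ⟨⟨-, -, t, ht, e1⟩, r1⟩ := H' (k + 1)
      have s0 := (H' (k + 2)).1.2.1
      rw [openSegment_symm] at s0
      refine ⟨m0, s0, sameRay_real_mul (w := -d' (k + 1)) ht ht₀ ?_ ?_⟩
      · change x' (k + 1) - x' (k + 1 + 1) = _
        rw [e1]; ring
      · change P.reflectDir (e' (k + 1)) (x' (k + 1 + 1) - x' (k + 1 + 1 + 1)) = _
        rw [reflectDir_eq, e0, r1, sub_add_cancel_left, mirror_neg, mirror_real_mul,
          mirror_mirror (P.edgeVec_ne_zero _), mul_neg]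
  obtain ⟨o, ho, hp, he⟩ := key.exists_orbit
  refine ⟨o, ho, fun k => by rw [he], fun k => ?_, ?_⟩
  · rw [he, show (-1 - k : ℤ) = Int.negSucc k by omega]
  · obtain ⟨⟨-, -, t, ht, e1⟩, -⟩ := H 1
    have n1 := (h 1).norm_dir 1 le_rfl
    rw [ho.2 0, hp]
    change (x 2 - x 1) / ‖x 2 - x 1‖ = d 1
    rw [e1, add_sub_cancel_left, norm_mul, n1, hn, mul_one, Complex.norm_real,
      Real.norm_of_nonneg ht.le, mul_div_cancel_left₀]
    exact_mod_cast ht.ne'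

/-- The composition of the reflections in the edges of a word. -/
noncomputable def unfold (P : PolygonalTable n) (w : List (Fin n)) (z : ℂ) : ℂ :=
  w.foldl (fun z e => P.vertex e + mirror (P.edgeVec e) (z - P.vertex e)) z

lemma unfold_injective (w : List (Fin n)) : Function.Injective (P.unfold w) := by
  induction w with
  | nil => exact fun _ _ h => h
  | cons e w ih =>
    intro z z' h
    have h1 := add_left_cancel (ih h)
    have h2 := congrArg (mirror (P.edgeVec e)) h1
    rw [mirror_mirror (P.edgeVec_ne_zero e), mirror_mirror (P.edgeVec_ne_zero e)] at h2
    exact sub_left_injective h2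

/-- A trajectory, unfolded, is a straight line. -/
lemma IsRayTo.unfold_eq {K : ℕ} {e : ℕ → Fin n} {x d : ℕ → ℂ} (h : P.IsRayTo K e x d) :
    ∃ L : ℝ, 0 ≤ L ∧
      ∀ r : ℝ, P.unfold ((List.range K).map e) (x 0 + (L + r : ℝ) * d 0) = x K + r * d K := by
  induction K with
  | zero => exact ⟨0, le_rfl, fun r => by simp [unfold]⟩
  | succ K ih =>
    obtain ⟨L, hL, hLr⟩ := ih (h.mono K.le_succ)
    obtain ⟨⟨hy, -, t, ht, hx⟩, hd⟩ := h K K.lt_succ_self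
    refine ⟨L + t, by positivity, fun r => ?_⟩
    have h1 : P.unfold ((List.range (K + 1)).map e) (x 0 + (L + t + r : ℝ) * d 0) =
        P.vertex (e K) + mirror (P.edgeVec (e K))
          (P.unfold ((List.range K).map e) (x 0 + (L + t + r : ℝ) * d 0) - P.vertex (e K)) := by
      simp [unfold, List.range_succ, List.foldl_append]
    rw [h1, add_assoc L, hLr, hd, show x K + (t + r : ℝ) * d K - P.vertex (e K) =
        (x (K + 1) - P.vertex (e K)) + r * d K by rw [hx]; push_cast; ring, mirror_add,
      mirror_edgeVec_sub (P.vertex_mem_closedEdge _) (P.openEdge_subset _ hy), mirror_real_mul]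
    ring

/-- In a family of rays that are pairwise disjoint, all but countably many never meet a vertex. -/
lemma countable_setOf_singular {ι : Type*} (z w : ι → ℂ)
    (hinj : ∀ i j, ∀ r r' : ℝ, 0 < r → 0 < r' → z i + r * w i = z j + r' * w j → i = j) :
    {i | ∃ K e, ∃ x d : ℕ → ℂ, P.IsRayTo K e x d ∧ x 0 = z i ∧ d 0 = w i ∧
      ∃ j, ∃ t : ℝ, 0 < t ∧ P.vertex j = x K + t * d K}.Countable := by
  -- For a given word the unfolding is injective, so a given vertex is reached by at most one of the
  -- disjoint rays. Words and vertices together are countable.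
  have hsub : ∀ (l : List (Fin n)) (j : Fin n),
      {i | ∃ r : ℝ, 0 < r ∧ P.unfold l (z i + r * w i) = P.vertex j}.Subsingleton := by
    rintro l j i ⟨r, hr, h⟩ i' ⟨r', hr', h'⟩
    exact hinj i i' r r' hr hr' (unfold_injective l (h.trans h'.symm))
  refine (countable_iUnion fun l : List (Fin n) => countable_iUnion fun j : Fin n =>
    (hsub l j).countable).mono ?_
  rintro i ⟨K, e, x, d, hray, h0, hd, j, t, ht, hj⟩
  obtain ⟨L, hL, h⟩ := hray.unfold_eq
  refine mem_iUnion.2 ⟨(List.range K).map e, mem_iUnion.2 ⟨j, L + t, by positivity, ?_⟩⟩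
  rw [← h0, ← hd, h, hj]

end PolygonalTable

/-! ### Generic parallel lines -/

namespace PolygonalTable
variable {n : ℕ} {P : PolygonalTable n}

/-- Parallel rays that start nearby hit the same edge nearby. -/
lemma Hits.eventually {ι : Type*} {l : Filter ι} {z d : ℂ} {e : Fin n} {y : ℂ} {z' : ι → ℂ}
    (h : P.Hits z d e y) (ht : Tendsto z' l (𝓝 z))
    (hz : z ∈ P.interior ∨ ∃ f, z ∈ P.openEdge f ∧ ∀ᶠ i in l, z' i ∈ P.openEdge f) :
    ∃ y' : ι → ℂ, Tendsto y' l (𝓝 y) ∧ ∀ᶠ i in l, P.Hits (z' i) d e (y' i) := by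
  have hD := h.crs_neg
  obtain ⟨hy, hs, t, ht0, hyt⟩ := h
  -- The time at which the neighbouring ray crosses the line through the edge `e`.
  set τ : ι → ℝ := fun i => crs (P.edgeVec e) (y - z' i) / crs (P.edgeVec e) d with hτ
  have tτ : Tendsto τ l (𝓝 t) := by
    have h1 := ((tendsto_const_nhds (x := P.edgeVec e)).crs
      ((tendsto_const_nhds (x := y)).sub ht)).div_const (crs (P.edgeVec e) d)
    rwa [hyt, add_sub_cancel_left, crs_real_mul_right, mul_div_cancel_right₀ _ hD.ne, ← hyt] at h1
  have hcy : ∀ i, crs (P.edgeVec e) (z' i + τ i * d - y) = 0 := by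
    intro i
    rw [show z' i + τ i * d - y = τ i * d - (y - z' i) by ring, crs_sub_right, crs_real_mul_right,
      hτ, div_mul_cancel₀ _ hD.ne, sub_self]
  have ty : Tendsto (fun i => z' i + τ i * d) l (𝓝 y) := by
    rw [hyt]
    exact ht.add ((Complex.continuous_ofReal.tendsto t |>.comp tτ).mul_const d)
  refine ⟨_, ty, ?_⟩
  obtain ⟨ρ, hρ, hball⟩ := P.exists_half_disc hy
  obtain ⟨ρ', hρ', hstart⟩ : ∃ ρ' > 0, ∀ᶠ i in l, ∀ r : ℝ, 0 < r →
      z' i + r * d ∈ Metric.ball z ρ' → z' i + r * d ∈ P.interior := by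
    rcases hz with hz | ⟨f, hf, hf'⟩
    · obtain ⟨ρ', h0, hb⟩ := Metric.isOpen_iff.1 P.isOpen_interior z hz
      exact ⟨ρ', h0, Eventually.of_forall fun i r _ hr => hb hr⟩
    · obtain ⟨ρ', h0, hb⟩ := P.exists_half_disc hf
      refine ⟨ρ', h0, ?_⟩
      have hpos := P.crs_pos_of_openSegment hf hs
      rw [hyt, add_sub_cancel_left, crs_real_mul_right] at hpos
      have hpos' := (pos_iff_pos_of_mul_pos hpos).1 ht0
      filter_upwards [hf'] with i hi r hr hmem
      obtain ⟨c, hc⟩ := P.crs_edgeVec_eq_zero (P.openEdge_subset _ hf) (P.openEdge_subset _ hi)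
      rw [(hb _ hmem).1, show z' i + r * d - z = (z' i - z) + r * d by ring, crs_add_right, hc,
        crs_real_mul_right, crs_self, crs_real_mul_right, mul_zero, zero_add]
      exact mul_pos hr hpos'
  -- The neighbouring segment is in the domain for three reasons: near the start by the ball of
  -- radius `ρ'`, in the middle by a thickening of a compact segment, near the end by the half disc
  -- of radius `ρ`. The constant δ makes these ranges overlap.
  set M := min ρ ρ' / 2 with hM
  have hM0 : 0 < M := by have := lt_min hρ hρ'; positivity
  have hMρ : 2 * M ≤ ρ := by rw [hM]; linarith [min_le_left ρ ρ']
  have hMρ' : 2 * M ≤ ρ' := by rw [hM]; linarith [min_le_right ρ ρ']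
  set δ := M / (‖d‖ + 1) with hδ
  have hd1 : 0 < ‖d‖ + 1 := by positivity
  have hδ0 : 0 < δ := by positivity
  have hδd : δ * ‖d‖ ≤ M := by
    rw [hδ, div_mul_eq_mul_div, div_le_iff₀ hd1]; nlinarith
  have hcK : Continuous fun r : ℝ => z + r * d := by fun_prop
  have hK : IsCompact ((fun r : ℝ => z + r * d) '' Icc δ (t - δ)) := isCompact_Icc.image hcK
  obtain ⟨ε, hε, hthick⟩ := hK.exists_thickening_subset_open P.isOpen_interior (by
    rintro _ ⟨r, hr, rfl⟩
    refine hs (mem_openSegment_iff_add.2 ⟨r / t, div_pos (hδ0.trans_le hr.1) ht0,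
      (div_lt_one ht0).2 (by linarith [hr.2]), ?_⟩)
    have : (t : ℂ) ≠ 0 := by exact_mod_cast ht0.ne'
    rw [hyt]; push_cast; field_simp; ring)
  have e1 : ∀ᶠ i in l, ‖z' i - z‖ < min M ε := by
    have := ht.sub_const z |>.norm
    rw [sub_self, norm_zero] at this
    exact this.eventually (gt_mem_nhds (lt_min hM0 hε))
  filter_upwards [e1, hstart, ty.eventually (Metric.ball_mem_nhds y hρ),
    tτ.eventually (Ioo_mem_nhds (show t - min δ t < t by linarith [lt_min hδ0 ht0])
      (show t < t + δ by linarith))] with i h1 h2 h3 h4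
  have h1M := h1.trans_le (min_le_left _ _)
  have h1ε := h1.trans_le (min_le_right _ _)
  have hτ0 : 0 < τ i := by linarith [h4.1, min_le_right δ t]
  refine ⟨(hball _ h3).2.1 (hcy i), fun a ha => ?_, τ i, hτ0, rfl⟩
  obtain ⟨r', hr0, hr1, rfl⟩ := mem_openSegment_iff_add.1 ha
  rw [show z' i + r' * (z' i + τ i * d - z' i) = z' i + (r' * τ i : ℝ) * d by push_cast; ring]
  set r := r' * τ i with hr
  have hrpos : 0 < r := by positivity
  have hrτ : r < τ i := by nlinarith
  have hnorm : ∀ c : ℝ, |c| ≤ δ → ‖(c : ℂ) * d‖ ≤ M := by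
    intro c hc
    rw [norm_mul, Complex.norm_real, Real.norm_eq_abs]
    nlinarith [norm_nonneg d]
  by_cases c1 : r ≤ δ
  · refine h2 r hrpos ?_
    rw [mem_ball_iff_norm, show z' i + r * d - z = (z' i - z) + r * d by ring]
    have := norm_add_le (z' i - z) (r * d)
    have := hnorm r (by rw [abs_of_pos hrpos]; exact c1)
    linarith
  by_cases c2 : r ≤ t - δ
  · refine hthick (Metric.mem_thickening_iff.2 ⟨z + r * d, ⟨r, ⟨by linarith, c2⟩, rfl⟩, ?_⟩)
    rw [dist_eq_norm, add_sub_add_right_eq_sub]; exact h1ε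
  · rw [(hball _ ?_).1]
    · rw [show z' i + r * d - y = (z' i + τ i * d - y) + (r - τ i : ℝ) * d by push_cast; ring,
        crs_add_right, hcy, zero_add, crs_real_mul_right]
      exact mul_pos_of_neg_of_neg (by linarith) hD
    · rw [mem_ball_iff_norm, hyt, show z' i + r * d - (z + t * d) = (z' i - z) + (r - t : ℝ) * d by
        push_cast; ring]
      have := norm_add_le (z' i - z) ((r - t : ℝ) * d)
      have := hnorm (r - t) (abs_le.2 ⟨by linarith, by linarith [h4.2]⟩)
      linarith

/-- Finitely many bounces of a nonsingular ray are stable under parallel displacement; the next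
bounce point is obtained from `Hits.eventually`, starting on the edge of the previous one. -/
lemma IsRay.eventually {ι : Type*} {l : Filter ι} {e : ℕ → Fin n} {x d : ℕ → ℂ} {z' : ι → ℂ}
    (h : P.IsRay e x d) (hi : x 0 ∈ P.interior) (ht : Tendsto z' l (𝓝 (x 0))) (K : ℕ) :
    ∃ X : ℕ → ι → ℂ, X 0 = z' ∧ (∀ k ≤ K, Tendsto (X k) l (𝓝 (x k))) ∧
      ∀ᶠ i in l, P.IsRayTo K e (fun k => X k i) d := by
  induction K with
  | zero =>
    refine ⟨fun _ => z', rfl, fun k hk => ?_, Eventually.of_forall fun i k hk => absurd hk k.not_lt_zero⟩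
    rwa [Nat.le_zero.1 hk]
  | succ K ih =>
    obtain ⟨X, h0, hX, hev⟩ := ih
    obtain ⟨hh, hdd⟩ := h (K + 1) K K.lt_succ_self
    obtain ⟨y', ty, hy'⟩ := hh.eventually (hX K le_rfl) (by
      obtain _ | K := K
      · exact Or.inl hi
      · exact Or.inr ⟨e K, (h (K + 1) K K.lt_succ_self).1.1, hev.mono fun i hi =>
          (hi K K.lt_succ_self).1.1⟩)
    refine ⟨fun k => if k = K + 1 then y' else X k, by simpa using h0, fun k hk => ?_, ?_⟩
    · by_cases hkK : k = K + 1
      · simp only [hkK, if_true]; exact ty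
      · simp only [hkK, if_false]; exact hX k (by omega)
    · filter_upwards [hev, hy'] with i h1 h2 k hk
      have hk1 : k ≠ K + 1 := by omega
      rcases Nat.lt_succ_iff_lt_or_eq.1 hk with hlt | rfl
      · have hk2 : k + 1 ≠ K + 1 := by omega
        simp only [hk1, hk2, if_false]
        exact h1 k hlt
      · simp only [hk1, if_true, if_false]
        exact ⟨h2, hdd⟩

/-- In a family of parallel lines, some line extends to a trajectory. -/
lemma exists_generic {z w d : ℂ} (hd : ‖d‖ = 1) (hw : crs d w ≠ 0) {Q : ℝ → Prop}
    (hQ : ∀ᶠ s : ℝ in 𝓝[>] 0, Q s) (hz : ∀ᶠ s : ℝ in 𝓝[>] 0, z + s * w ∈ P.interior) :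
    ∃ s : ℝ, Q s ∧ z + s * w ∈ P.interior ∧
      (∃ e x d', P.IsRay e x d' ∧ x 0 = z + s * w ∧ d' 0 = d) ∧
      ∃ e x d', P.IsRay e x d' ∧ x 0 = z + s * w ∧ d' 0 = -d := by
  have hd0 : d ≠ 0 := norm_ne_zero_iff.1 (by rw [hd]; norm_num)
  -- The direction `w` is transversal to the lines, so these are pairwise disjoint and only
  -- countably many can be singular.
  have cnt : ∀ d' : ℂ, crs d' w ≠ 0 → {s : ℝ | ∃ K e, ∃ x d'' : ℕ → ℂ, P.IsRayTo K e x d'' ∧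
      x 0 = z + s * w ∧ d'' 0 = d' ∧ ∃ j, ∃ t : ℝ, 0 < t ∧ P.vertex j = x K + t * d'' K}.Countable := by
    intro d' hd'
    refine countable_setOf_singular (fun s : ℝ => z + s * w) (fun _ => d') fun s s' r r' _ _ h => ?_
    have h1 := congrArg (crs d') h
    simp only [crs_add_right, crs_real_mul_right, crs_self, mul_zero, add_zero] at h1
    exact mul_right_cancel₀ hd' (add_left_cancel h1)
  have hB := (cnt d hw).union (cnt (-d) (by rw [crs_neg_left]; exact neg_ne_zero.2 hw))
  obtain ⟨δ, hδ, hδs⟩ := (nhdsGT_basis (0 : ℝ)).eventually_iff.1 (hQ.and hz)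
  obtain ⟨s, hs, hsB⟩ := (hB.dense_compl ℝ).inter_open_nonempty _ isOpen_Ioo (nonempty_Ioo.2 hδ)
  obtain ⟨hs1, hs2⟩ := hδs hs
  have hgood : ∀ d' : ℂ, ∀ᶠ t : ℝ in 𝓝[>] 0, z + s * w + t * d' ∈ P.interior := by
    intro d'
    have hc : Continuous fun t : ℝ => z + s * w + t * d' := by fun_prop
    exact (((hc.tendsto' 0 _ (by simp)).eventually
      (P.isOpen_interior.mem_nhds hs2))).filter_mono nhdsWithin_le_nhds
  refine ⟨s, hs1, hs2, exists_isRay hd0 (hgood d) ?_, exists_isRay (neg_ne_zero.2 hd0) (hgood _) ?_⟩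
  · intro K e x d' hray h0 h1 j t ht hj
    exact hsB (Or.inl ⟨K, e, x, d', hray, h0, h1, j, t, ht, hj⟩)
  · intro K e x d' hray h0 h1 j t ht hj
    exact hsB (Or.inr ⟨K, e, x, d', hray, h0, h1, j, t, ht, hj⟩)

/-- A forward trajectory is a part of a limit of bi-infinite trajectories. -/
lemma IsRay.exists_limOrbit {e : ℕ → Fin n} {x d : ℕ → ℂ} (h : P.IsRay e x d)
    (hi : x 0 ∈ P.interior) (hd : ‖d 0‖ = 1) :
    ∃ o ∈ P.limOrbits, (∀ k : ℕ, o.edge k = e k) ∧ o.dir 0 = d 1 := by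
  have hc : Continuous fun s : ℝ => x 0 + s * (Complex.I * d 0) := by fun_prop
  have hlim : Tendsto (fun s : ℝ => x 0 + s * (Complex.I * d 0)) (𝓝[>] 0) (𝓝 (x 0)) :=
    (hc.tendsto' 0 _ (by simp)).mono_left nhdsWithin_le_nhds
  have key : ∀ K : ℕ, ∃ o ∈ P.orbits, (∀ k < K + 1, o.edge (k : ℕ) = e k) ∧ o.dir 0 = d 1 := by
    intro K
    obtain ⟨X, h0, -, hX⟩ := h.eventually hi hlim (K + 1)
    obtain ⟨s, hs, hsi, ⟨e₁, x₁, d₁, r₁, a₁, b₁⟩, ⟨e₂, x₂, d₂, r₂, a₂, b₂⟩⟩ :=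
      exists_generic (P := P) hd (w := Complex.I * d 0) (by rw [crs_I_mul_self, hd]; norm_num) hX
        (hlim.eventually (P.isOpen_interior.mem_nhds hi))
    have huniq := (r₁ (K + 1)).unique hs (by rw [a₁, h0]) b₁
    obtain ⟨o, ho, o1, -, o3⟩ := exists_orbit_of_rays r₁ r₂ (by rw [a₁, a₂]) (by rw [b₁, b₂])
      (by rw [b₁, hd]) (by rw [a₁]; exact hsi)
    refine ⟨o, ho, fun k hk => ?_, ?_⟩
    · rw [o1, (huniq (K + 1) le_rfl).2.2 k hk]
    · rw [o3, (huniq 1 (by omega)).2.1]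
  choose o ho h1 h2 using key
  obtain ⟨y, hy, φ, hφ, hlim⟩ := P.isCompact_limOrbits.tendsto_subseq fun N => orbits_subset (ho N)
  refine ⟨y, hy, fun k => ?_, ?_⟩
  · obtain ⟨N, hN, hk⟩ := ((Orb.eventually_edge hlim k).and (eventually_ge_atTop k)).exists
    rw [← hN]
    exact h1 _ k (Nat.lt_succ_of_le (hk.trans (hφ.id_le N)))
  · exact tendsto_nhds_unique (((Orb.continuous_dir 0).tendsto y).comp hlim)
      (tendsto_const_nhds.congr fun N => (h2 (φ N)).symm)

end PolygonalTable

/-! ### Lines close to the vertex -/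

namespace PolygonalTable
variable {n : ℕ} {P : PolygonalTable n}

namespace Corner
variable {A B : Fin n} {v : ℂ} {θ : ℝ} (C : P.Corner A B v θ)

lemma fold_add (k : ℕ) (Φ β : ℝ) : C.fold k (Φ + β) =
    Real.cos β * C.fold k Φ + Real.sin β * C.fold k (Φ + Real.pi / 2) := by
  obtain ⟨C', h1, -⟩ := C.exists_letter_corner k
  have h2 : ∀ β : ℝ, C.fold k (Φ + β) =
      C.fold k Φ * (Real.cos β + C'.sg * Real.sin β * Complex.I) := by
    intro β
    rw [h1, h1, show Φ + β - k * θ = Φ - k * θ + β by ring, C'.u_add, Complex.exp_mul_I,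
      ← Complex.ofReal_cos, ← Complex.ofReal_sin]
    rcases C'.sg_eq with h | h <;> simp [h]
  rw [h2 β, h2 (Real.pi / 2), Real.cos_pi_div_two, Real.sin_pi_div_two]
  push_cast; ring

lemma norm_fold (k : ℕ) (Φ : ℝ) : ‖C.fold k Φ‖ = 1 := C.norm_u _

/-- The line in the direction `Φ` at the distance `s` from the vertex, in a sector unfolded `k`
times. -/
noncomputable def line (k : ℕ) (Φ s x : ℝ) : ℂ :=
  v + x * C.fold k Φ + s * C.fold k (Φ + Real.pi / 2)

/-- The polar angle of a point on a line at the distance `s` from the vertex. -/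
noncomputable def polar (Φ s x : ℝ) : ℝ := Φ + Real.pi / 2 - Real.arctan (x / s)

lemma polar_lt_polar {Φ s x y : ℝ} (hs : 0 < s) : polar Φ s x < polar Φ s y ↔ y < x := by
  unfold polar
  rw [sub_lt_sub_iff_left, Real.arctan_lt_arctan_iff, div_lt_div_iff_of_pos_right hs]

lemma polar_mem (Φ s x : ℝ) : Φ < polar Φ s x ∧ polar Φ s x < Φ + Real.pi := by
  unfold polar
  constructor <;> linarith [Real.arctan_lt_pi_div_two (x / s), Real.neg_pi_div_two_lt_arctan (x / s)]

lemma polar_tan {Φ s α : ℝ} (hs : 0 < s) (h1 : Φ < α) (h2 : α < Φ + Real.pi) :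
    polar Φ s (s * Real.tan (Φ + Real.pi / 2 - α)) = α := by
  unfold polar
  rw [mul_div_cancel_left₀ _ hs.ne', Real.arctan_tan (by linarith) (by linarith)]; ring

/-- Converts the position `x` on a line at the distance `s` from the vertex to polar coordinates.
Going along the line, the angle runs through the half-turn from `Φ` to `Φ + π`. -/
lemma line_eq (k : ℕ) {Φ s x : ℝ} (hs : 0 < s) : ∃ ρ : ℝ, 0 < ρ ∧ ρ ≤ |x| + s ∧
    C.line k Φ s x = v + ρ * C.fold k (polar Φ s x) := by
  have h1 : 0 < 1 + (x / s) ^ 2 := by positivity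
  have h2 : (0 : ℝ) < √(1 + (x / s) ^ 2) := Real.sqrt_pos.2 h1
  refine ⟨s * √(1 + (x / s) ^ 2), by positivity, ?_, ?_⟩
  · have : s * √(1 + (x / s) ^ 2) = √(s ^ 2 + x ^ 2) := by
      rw [← Real.sqrt_sq hs.le, ← Real.sqrt_mul (by positivity), Real.sqrt_sq hs.le]
      congr 1; field_simp
    rw [this]
    refine Real.sqrt_le_iff.2 ⟨by positivity, ?_⟩
    nlinarith [sq_abs x, mul_nonneg (abs_nonneg x) hs.le]
  · have h3 : polar Φ s x = Φ + (Real.pi / 2 - Real.arctan (x / s)) := by unfold polar; ring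
    have c1 : s * √(1 + (x / s) ^ 2) * Real.cos (Real.pi / 2 - Real.arctan (x / s)) = x := by
      rw [Real.cos_pi_div_two_sub, Real.sin_arctan]; field_simp
    have c2 : s * √(1 + (x / s) ^ 2) * Real.sin (Real.pi / 2 - Real.arctan (x / s)) = s := by
      rw [Real.sin_pi_div_two_sub, Real.cos_arctan]; field_simp
    rw [h3, C.fold_add, line, mul_add, ← mul_assoc, ← mul_assoc, ← Complex.ofReal_mul,
      ← Complex.ofReal_mul, c1, c2, add_assoc]

/-- The size of a neighbourhood of the corner. -/
lemma exists_radius : ∃ R : ℝ, 0 < R ∧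
    (∀ k : ℕ, ∀ ρ Φ : ℝ, 0 < ρ → ρ < R → k * θ < Φ → Φ < (k + 1) * θ →
      v + ρ * C.fold k Φ ∈ P.interior) ∧
    ∀ k : ℕ, ∀ ρ : ℝ, 0 < ρ → ρ < R → v + ρ * C.fold k ((k + 1) * θ) ∈ P.openEdge (letter A B k) := by
  obtain ⟨r, hr, hsec⟩ := C.sector
  refine ⟨min r (min C.lA C.lB), lt_min hr (lt_min C.lA_pos C.lB_pos), ?_, ?_⟩
  · intro k ρ Φ h0 h1 h2 h3
    refine hsec ρ _ h0 (h1.trans_le (min_le_left _ _)) ?_ ?_ <;> split_ifs <;> linarith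
  · intro k ρ h0 h1
    have hA := h1.trans_le ((min_le_right _ _).trans (min_le_left _ _))
    have hB := h1.trans_le ((min_le_right _ _).trans (min_le_right _ _))
    by_cases hk : Even k
    · rw [fold, if_pos hk, show letter A B k = B from if_pos hk]
      exact (C.mem_openB _).2 ⟨ρ, h0, hB, by rw [show ((k : ℝ) + 1) * θ - k * θ = θ by ring]; rfl⟩
    · rw [fold, if_neg hk, show letter A B k = A from if_neg hk, sub_self, C.u_zero]
      exact (C.mem_openA _).2 ⟨ρ, h0, hA, rfl⟩

lemma line_sub (k : ℕ) (Φ s x y : ℝ) :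
    C.line k Φ s y = C.line k Φ s x + (x - y : ℝ) * C.fold k (Φ + Real.pi) := by
  rw [C.fold_add_pi, line, line]; push_cast; ring

section
variable {R : ℝ} (hR : ∀ k : ℕ, ∀ ρ Φ : ℝ, 0 < ρ → ρ < R → k * θ < Φ → Φ < (k + 1) * θ →
      v + ρ * C.fold k Φ ∈ P.interior)
  (hR' : ∀ k : ℕ, ∀ ρ : ℝ, 0 < ρ → ρ < R →
    v + ρ * C.fold k ((k + 1) * θ) ∈ P.openEdge (letter A B k))
include hR

/-- The polar angle is monotone along the line, so between two crossings the line stays within one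
copy of the sector, and close to the vertex this copy is in the domain. -/
lemma segment_subset_interior {k : ℕ} {Φ s x y : ℝ} (hs : 0 < s) (hx : |x| + s < R)
    (hy : |y| + s < R) (hxy : y < x) (h1 : k * θ ≤ polar Φ s x) (h2 : polar Φ s y ≤ (k + 1) * θ) :
    openSegment ℝ (C.line k Φ s x) (C.line k Φ s y) ⊆ P.interior := by
  intro a ha
  obtain ⟨r, hr0, hr1, rfl⟩ := mem_openSegment_iff_add.1 ha
  set z := x + r * (y - x) with hz
  have h3 : C.line k Φ s x + r * (C.line k Φ s y - C.line k Φ s x) = C.line k Φ s z := by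
    simp only [line, hz]; push_cast; ring
  have hzx : z < x := by nlinarith
  have hzy : y < z := by nlinarith
  rw [h3]
  obtain ⟨ρ, hρ0, hρ, he⟩ := C.line_eq k (Φ := Φ) (x := z) hs
  have hza : |z| ≤ max |x| |y| := by
    rcases abs_cases z with ⟨h, -⟩ | ⟨h, -⟩ <;> rw [h]
    · exact le_max_of_le_left (by linarith [le_abs_self x])
    · exact le_max_of_le_right (by linarith [neg_abs_le y])
  have hzR : |z| + s < R := by
    rcases max_choice |x| |y| with h | h <;> rw [h] at hza <;> linarith
  rw [he]
  exact hR k ρ _ hρ0 (by linarith) (h1.trans_lt ((polar_lt_polar hs).2 hzx))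
    (((polar_lt_polar hs).2 hzy).trans_le h2)

include hR'

/-- A line close to the vertex is a passage of the corner. -/
lemma eventually_passage {κ m : ℕ} {Φ r : ℝ} (hr : 0 < r) (hrR : r < R) (h1 : κ * θ < Φ)
    (h2 : Φ < (κ + 1) * θ) (h3 : (κ + m) * θ < Φ + Real.pi) (h4 : Φ + Real.pi < (κ + m + 1) * θ) :
    ∀ᶠ s : ℝ in 𝓝[>] 0, ∃ x d : ℕ → ℂ, P.IsRayTo m (fun j => letter A B (κ + j)) x d ∧
      x 0 = C.line κ Φ s r ∧ d 0 = C.fold κ (Φ + Real.pi) ∧ d m = C.fold (κ + m) (Φ + Real.pi) ∧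
      openSegment ℝ (x m) (C.line (κ + m) Φ s (-r)) ⊆ P.interior ∧
      C.line (κ + m) Φ s (-r) ∈ P.interior ∧
      ∃ t : ℝ, 0 < t ∧ C.line (κ + m) Φ s (-r) = x m + t * d m := by
  have hθ := C.theta_pos
  have ev1 : ∀ᶠ s : ℝ in 𝓝[>] 0, r + s < R := by
    have : Tendsto (fun s : ℝ => r + s) (𝓝 0) (𝓝 r) := by
      have hc : Continuous fun s : ℝ => r + s := by fun_prop
      exact hc.tendsto' 0 r (by simp)
    exact (this.eventually (gt_mem_nhds hrR)).filter_mono nhdsWithin_le_nhds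
  have ev2 : ∀ᶠ s : ℝ in 𝓝[>] 0, ∀ j ≤ m, |s * Real.tan (Φ + Real.pi / 2 - (κ + j) * θ)| < r := by
    refine (eventually_all_finite (finite_le_nat m)).2 fun j _ => ?_
    have hc : Continuous fun s : ℝ => |s * Real.tan (Φ + Real.pi / 2 - (κ + j) * θ)| := by fun_prop
    exact ((hc.tendsto' 0 0 (by simp)).eventually (gt_mem_nhds hr)).filter_mono nhdsWithin_le_nhds
  filter_upwards [ev1, ev2, self_mem_nhdsWithin] with s hs1 hs2 hs
  rw [mem_Ioi] at hs
  -- `X j` is the place where the line crosses the unfolded edge at the angle `(κ + j) * θ`; it is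
  -- proportional to `s`, so all crossings happen close to the vertex. The value `X 0 = r` is the
  -- starting point.
  set X : ℕ → ℝ := fun j => if j = 0 then r else s * Real.tan (Φ + Real.pi / 2 - (κ + j) * θ) with hX
  have hX0 : X 0 = r := if_pos rfl
  have hXp : ∀ j : ℕ, 0 < j → j ≤ m → polar Φ s (X j) = (κ + j) * θ := by
    intro j hj hjm
    have a1 : (1 : ℝ) ≤ j := by exact_mod_cast hj
    have a2 : (j : ℝ) ≤ m := by exact_mod_cast hjm
    simp only [hX, if_neg hj.ne']
    exact polar_tan hs (by nlinarith) (by nlinarith)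
  have hXr : ∀ j ≤ m, |X j| ≤ r ∧ -r < X j := by
    intro j hj
    by_cases h : j = 0
    · rw [h, hX0, abs_of_pos hr]; exact ⟨le_rfl, by linarith⟩
    · simp only [hX, if_neg h]; exact ⟨(hs2 j hj).le, (abs_lt.1 (hs2 j hj)).1⟩
  have hXlt : ∀ j < m, X (j + 1) < X j := by
    intro j hj
    by_cases h : j = 0
    · rw [h, hX0]
      simp only [hX, zero_add, one_ne_zero, if_false]
      exact (abs_lt.1 (hs2 1 (by omega))).2
    · rw [← polar_lt_polar (Φ := Φ) hs, hXp j (by omega) (by omega), hXp (j + 1) (by omega) hj]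
      push_cast; linarith
  have hXge : ∀ j ≤ m, ((κ + j : ℕ) : ℝ) * θ ≤ polar Φ s (X j) := by
    intro j hj
    by_cases h : j = 0
    · rw [h, add_zero]; exact (h1.trans (polar_mem Φ s _).1).le
    · rw [hXp j (by omega) hj]; push_cast; exact le_rfl
  have hXR : ∀ j ≤ m, |X j| + s < R := fun j hj => by linarith [(hXr j hj).1]
  have hmr : |(-r)| + s < R := by rw [abs_neg, abs_of_pos hr]; exact hs1
  have hend := (hXr m le_rfl).2
  have hpend : polar Φ s (-r) < (κ + m + 1) * θ := (polar_mem Φ s _).2.trans h4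
  refine ⟨fun j => C.line (κ + j) Φ s (X j), fun j => C.fold (κ + j) (Φ + Real.pi), fun j hj => ?_,
    by simp only [hX0, add_zero], rfl, rfl, ?_, ?_, X m - -r, by linarith, C.line_sub _ _ _ _ _⟩
  · obtain ⟨ρ, hρ0, hρ, hl⟩ := C.line_eq (κ + j) (Φ := Φ) (x := X (j + 1)) hs
    have hp := hXp (j + 1) (by omega) hj
    have hp' : polar Φ s (X (j + 1)) = ((κ + j : ℕ) + 1) * θ := by rw [hp]; push_cast; ring
    have hmem : C.line (κ + j) Φ s (X (j + 1)) ∈ P.openEdge (letter A B (κ + j)) := by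
      rw [hl, hp']
      exact hR' (κ + j) ρ hρ0 (hρ.trans_lt (hXR _ hj))
    -- The lines in two adjacent sectors are mirror images in the edge between them, so they agree
    -- in the point on this edge.
    have hsame : C.line (κ + (j + 1)) Φ s (X (j + 1)) = C.line (κ + j) Φ s (X (j + 1)) := by
      obtain ⟨C', g1, g2⟩ := C.exists_letter_corner (κ + j)
      have hcl := P.openEdge_subset _ hmem
      have hv := (C'.mem_B v).2 ⟨0, le_rfl, C'.lB_pos.le, by simp⟩
      have hm := mirror_edgeVec_sub hv hcl
      simp only [line] at hm ⊢
      rw [add_assoc v, add_sub_cancel_left, mirror_add, mirror_real_mul, mirror_real_mul,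
        C.fold_succ, C.fold_succ] at hm
      rw [add_assoc v, add_assoc v, ← add_assoc κ, hm]
    refine ⟨⟨?_, ?_, X j - X (j + 1), sub_pos.2 (hXlt j hj), ?_⟩, (C.fold_succ _ _).symm⟩
    · change C.line (κ + (j + 1)) Φ s (X (j + 1)) ∈ _
      rw [hsame]; exact hmem
    · change openSegment ℝ (C.line (κ + j) Φ s (X j)) (C.line (κ + (j + 1)) Φ s (X (j + 1))) ⊆ _
      rw [hsame]
      exact C.segment_subset_interior hR hs (hXR _ hj.le) (hXR _ hj) (hXlt j hj) (hXge j hj.le) hp'.le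
    · change C.line (κ + (j + 1)) Φ s (X (j + 1)) = _
      rw [hsame]; exact C.line_sub _ _ _ _ _
  · exact C.segment_subset_interior hR hs (hXR _ le_rfl) hmr hend (hXge m le_rfl)
      (by push_cast; exact hpend.le)
  · obtain ⟨ρ, hρ0, hρ, hl⟩ := C.line_eq (κ + m) (Φ := Φ) (x := -r) hs
    rw [hl]
    exact hR _ ρ _ hρ0 (by linarith) ((hXge m le_rfl).trans_lt ((polar_lt_polar hs).2 hend))
      (by push_cast; exact hpend)

end
end Corner
end PolygonalTable

/-! ### Joining two rays through the corner -/

namespace PolygonalTable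
variable {n : ℕ} {P : PolygonalTable n}

namespace Corner
variable {A B : Fin n} {v : ℂ} {θ : ℝ} (C : P.Corner A B v θ)

/-- Two rays from the vertex are connected by passages of the corner. -/
lemma exists_orbit_of_halves {R : ℝ} (hR : ∀ k : ℕ, ∀ ρ Φ : ℝ, 0 < ρ → ρ < R → k * θ < Φ →
      Φ < (k + 1) * θ → v + ρ * C.fold k Φ ∈ P.interior)
    (hR' : ∀ k : ℕ, ∀ ρ : ℝ, 0 < ρ → ρ < R →
      v + ρ * C.fold k ((k + 1) * θ) ∈ P.openEdge (letter A B k))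
    {κ m : ℕ} {Φ r : ℝ} (hr : 0 < r) (hrR : r < R) (h1 : κ * θ < Φ)
    (h2 : Φ < (κ + 1) * θ) (h3 : (κ + m : ℕ) * θ < Φ + Real.pi)
    (h4 : Φ + Real.pi < ((κ + m : ℕ) + 1) * θ)
    {e₁ e₂ : ℕ → Fin n} {x₁ d₁ x₂ d₂ : ℕ → ℂ} (H₁ : P.IsRay e₁ x₁ d₁) (H₂ : P.IsRay e₂ x₂ d₂)
    (hx₁ : x₁ 0 = v + r * C.fold κ Φ) (hd₁ : d₁ 0 = C.fold κ Φ)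
    (hx₂ : x₂ 0 = v + r * C.fold (κ + m) (Φ + Real.pi)) (hd₂ : d₂ 0 = C.fold (κ + m) (Φ + Real.pi))
    (N : ℕ) : ∃ o ∈ P.orbits, (∀ k < N, o.edge (-1 - k) = e₁ k) ∧
      (∀ j < m, o.edge j = letter A B (κ + j)) ∧ ∀ k < N, o.edge (m + k) = e₂ k := by
  have hi₁ : x₁ 0 ∈ P.interior := by rw [hx₁]; exact hR κ r Φ hr hrR h1 h2
  have hi₂ : x₂ 0 ∈ P.interior := by rw [hx₂]; exact hR (κ + m) r _ hr hrR h3 h4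
  have l₁ : Tendsto (fun s : ℝ => x₁ 0 + s * C.fold κ (Φ + Real.pi / 2)) (𝓝[>] 0) (𝓝 (x₁ 0)) := by
    have hc : Continuous fun s : ℝ => x₁ 0 + s * C.fold κ (Φ + Real.pi / 2) := by fun_prop
    exact (hc.tendsto' 0 _ (by simp)).mono_left nhdsWithin_le_nhds
  have l₂ : Tendsto (fun s : ℝ => C.line (κ + m) Φ s (-r)) (𝓝[>] 0) (𝓝 (x₂ 0)) := by
    have hc : Continuous fun s : ℝ => C.line (κ + m) Φ s (-r) := by unfold line; fun_prop
    refine (hc.tendsto' 0 _ ?_).mono_left nhdsWithin_le_nhds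
    rw [hx₂, C.fold_add_pi, line]; push_cast; ring
  obtain ⟨X₁, z₁, -, ev₁⟩ := H₁.eventually hi₁ l₁ N
  obtain ⟨X₂, z₂, -, ev₂⟩ := H₂.eventually hi₂ l₂ N
  have ev := C.eventually_passage hR hR' hr hrR h1 h2 (by exact_mod_cast h3) (by exact_mod_cast h4)
  have hcrs : crs (C.fold κ (Φ + Real.pi)) (C.fold κ (Φ + Real.pi / 2)) ≠ 0 := by
    obtain ⟨C', g1, -⟩ := C.exists_letter_corner κ
    rw [g1, g1, C'.crs_u, show Φ + Real.pi / 2 - κ * θ - (Φ + Real.pi - κ * θ) = -(Real.pi / 2) by ring,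
      Real.sin_neg, Real.sin_pi_div_two]
    exact mul_ne_zero C'.sg_ne_zero (by norm_num)
  obtain ⟨s, ⟨⟨a₁, a₂⟩, x, d, hp, p0, pd0, pdm, pseg, pint, t, ht, pt⟩, hsi, ⟨f, y, w, F, F0, Fd⟩,
    f', y', w', F', F0', Fd'⟩ := exists_generic (P := P) (C.norm_fold _ _) hcrs ((ev₁.and ev₂).and ev)
      (l₁.eventually (P.isOpen_interior.mem_nhds hi₁))
  rw [C.fold_add_pi, neg_neg] at Fd'
  obtain ⟨o, ho, o1, o2, -⟩ := exists_orbit_of_rays F F' (by rw [F0, F0'])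
    (by rw [Fd, Fd', C.fold_add_pi, neg_neg]) (by rw [Fd, C.norm_fold]) (by rw [F0]; exact hsi)
  have u₁ := (F' N).unique a₁ (by rw [F0', z₁]) (by rw [Fd', hd₁])
  have u₂ := (F m).unique hp (by rw [F0, p0, hx₁, line]) (by rw [Fd, pd0])
  obtain ⟨b1, b2, b3⟩ := u₂ m le_rfl
  -- After the last bounce at the corner, the orbit moves through the point of the line close to `x₂
  -- 0`, without a bounce there; from then on it follows the second ray.
  have hY : P.IsRayTo N e₂ (fun k => if k = 0 then x m else X₂ k s) d₂ := by
    intro k hk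
    have hk' := a₂ k hk
    by_cases h0 : k = 0
    · subst h0
      simp only [z₂, zero_add, if_true, one_ne_zero, if_false] at hk' ⊢
      refine ⟨Hits.trans ht ?_ pint pseg hk'.1, hk'.2⟩
      rw [pt, pdm, hd₂]
    · simpa only [h0, if_false, Nat.add_eq_zero_iff, one_ne_zero, and_false] using hk'
  have hF : P.IsRayTo N (fun k => f (m + k)) (fun k => y (m + k)) (fun k => w (m + k)) :=
    fun k hk => F (m + k + 1) (m + k) (by omega)
  have u₃ := hF.unique hY (by simpa using b1) (by simp only [add_zero]; rw [b2, pdm, hd₂])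
  refine ⟨o, ho, fun k hk => ?_, fun j hj => ?_, fun k hk => ?_⟩
  · rw [o2, (u₁ N le_rfl).2.2 k hk]
  · rw [o1, b3 j hj]
  · rw [← Nat.cast_add, o1, (u₃ N le_rfl).2.2 k hk]

include C in
/-- A ray from the vertex does not meet the edges of the corner again at once. -/
lemma notMem_edges {φ r : ℝ} (h0 : 0 < φ) (h1 : φ < θ) (hr : 0 < r) {e : Fin n}
    (h : v + r * C.u φ ∈ P.openEdge e) : e ≠ A ∧ e ≠ B := by
  have hθ := C.theta_lt
  have aux : ∀ ρ ψ : ℝ, 0 < ρ → |φ - ψ| < 2 * Real.pi → φ ≠ ψ →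
      v + r * C.u φ ≠ v + ρ * C.u ψ := by
    intro ρ ψ hρ hψ hne heq
    have h2 := add_left_cancel heq
    have h3 := congrArg norm h2
    rw [norm_mul, norm_mul, C.norm_u, C.norm_u, Complex.norm_real, Complex.norm_real,
      Real.norm_of_nonneg hr.le, Real.norm_of_nonneg hρ.le, mul_one, mul_one] at h3
    rw [h3] at h2
    obtain ⟨j, hj⟩ := C.u_eq_iff.1 (mul_left_cancel₀ (by exact_mod_cast hρ.ne') h2)
    rw [hj, add_sub_cancel_left, abs_mul, abs_of_pos Real.two_pi_pos] at hψ
    have h4 : |(j : ℝ)| < 1 := by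
      by_contra hcon
      push Not at hcon
      nlinarith [Real.pi_pos]
    have h5 : |j| < 1 := by exact_mod_cast h4
    rw [Int.abs_lt_one_iff.1 h5] at hj
    simp at hj
    exact hne hj
  constructor
  · rintro rfl
    obtain ⟨ρ, hρ, -, he⟩ := (C.mem_openA _).1 h
    rw [← C.u_zero] at he
    exact aux ρ 0 hρ (by rw [sub_zero, abs_of_pos h0]; linarith) h0.ne' he
  · rintro rfl
    obtain ⟨ρ, hρ, -, he⟩ := (C.mem_openB _).1 h
    exact aux ρ θ hρ (by rw [abs_sub_comm, abs_of_pos (by linarith)]; linarith) h1.ne he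

end Corner

lemma edge_mem_bounceSpectrum {o : Orb n} (ho : o ∈ P.orbits) : o.edge ∈ P.bounceSpectrum :=
  ⟨o.pos, ho.1⟩

/-- Forward trajectories start in the interior, so the midpoint of the segment before the bounce 0
serves as the starting point. -/
lemma edge_mem_forwardSpectrum {o : Orb n} (ho : o ∈ P.orbits) :
    (fun k : ℕ => o.edge k) ∈ P.forwardSpectrum := by
  have hmid : o.pos (-1) + (1 / 2 : ℝ) * (o.pos 0 - o.pos (-1)) ∈
      openSegment ℝ (o.pos (-1)) (o.pos 0) :=
    mem_openSegment_iff_add.2 ⟨1 / 2, by norm_num, by norm_num, rfl⟩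
  have hs := segment_subset ho (-1)
  rw [neg_add_cancel] at hs
  refine ⟨fun k => Nat.casesOn k (o.pos (-1) + (1 / 2 : ℝ) * (o.pos 0 - o.pos (-1)))
    fun k => o.pos k, hs hmid, fun k => ?_⟩
  obtain _ | k := k
  · refine ⟨pos_mem ho 0, fun a ha => ?_, ?_⟩
    · obtain ⟨r, hr0, hr1, rfl⟩ := mem_openSegment_iff_add.1 ha
      refine hs (mem_openSegment_iff_add.2 ⟨(1 + r) / 2, by linarith, by linarith, ?_⟩)
      change o.pos (-1) + (1 / 2 : ℝ) * (o.pos 0 - o.pos (-1)) +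
        r * (o.pos 0 - (o.pos (-1) + (1 / 2 : ℝ) * (o.pos 0 - o.pos (-1)))) = _
      push_cast; ring
    · have h := (ho.1 (-1)).2.2
      have e1 : o.pos 0 - (o.pos (-1) + (1 / 2 : ℝ) * (o.pos 0 - o.pos (-1))) =
          (1 / 2 : ℝ) * (o.pos 0 - o.pos (-1)) := by push_cast; ring
      change SameRay ℝ (o.pos (0 + 1 : ℕ) - o.pos (0 : ℕ)) (P.reflectDir (o.edge (0 : ℕ))
        (o.pos (0 : ℕ) - (o.pos (-1) + (1 / 2 : ℝ) * (o.pos 0 - o.pos (-1)))))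
      simp only [zero_add, Nat.cast_one, Nat.cast_zero]
      rw [e1, reflectDir_eq, mirror_real_mul, ← Complex.real_smul]
      norm_num at h
      rw [reflectDir_eq] at h
      exact h.nonneg_smul_right (by norm_num)
  · obtain ⟨h1, h2, h3⟩ := ho.1 k
    refine ⟨by exact_mod_cast pos_mem ho (k + 1), by exact_mod_cast h2, ?_⟩
    exact_mod_cast h3

/-- A code is in the closure if all its finite parts are read. -/
lemma mem_closure_of_forall_agree {ι α : Type*} [TopologicalSpace α] {S : Set (ι → α)} {f : ι → α}
    (rank : ι → ℕ) (h : ∀ N, ∃ g ∈ S, ∀ k, rank k < N → g k = f k) : f ∈ closure S := by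
  choose g hg hgf using h
  refine mem_closure_of_tendsto (b := atTop) (tendsto_pi_nhds.2 fun k => ?_) (Eventually.of_forall hg)
  exact tendsto_const_nhds.congr' ((eventually_gt_atTop (rank k)).mono fun N hN => (hgf N k hN).symm)

/-- An eventually periodic sequence is determined by the preperiod `N`, the period `T` and its first
`N + T` letters. -/
lemma countable_setOf_not_aperiodic : {e : ℕ → Fin n | ¬ Aperiodic e}.Countable := by
  have hsub : ∀ N T : ℕ, ∀ w : Fin (N + T) → Fin n, {e : ℕ → Fin n | (∀ k ≥ N, e (k + T) = e k) ∧
      0 < T ∧ ∀ k : Fin (N + T), e k = w k}.Subsingleton := by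
    rintro N T w e ⟨h1, hT, h2⟩ e' ⟨h1', -, h2'⟩
    funext k
    induction k using Nat.strong_induction_on with
    | _ k ih =>
      by_cases hk : k < N + T
      · exact (h2 ⟨k, hk⟩).trans (h2' ⟨k, hk⟩).symm
      · have a := h1 (k - T) (by omega)
        have b := h1' (k - T) (by omega)
        rw [Nat.sub_add_cancel (by omega)] at a b
        rw [a, b, ih _ (by omega)]
  refine (countable_iUnion fun N => countable_iUnion fun T => countable_iUnion fun w =>
    (hsub N T w).countable).mono ?_
  intro e he
  obtain ⟨N, T, hT, h⟩ := not_not.1 he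
  exact mem_iUnion.2 ⟨N, mem_iUnion.2 ⟨T, mem_iUnion.2 ⟨fun k => e k, h, hT, fun k => rfl⟩⟩⟩

end PolygonalTable

/-! ### Generic rays at a rational corner -/

namespace PolygonalTable
variable {n : ℕ} {P : PolygonalTable n}

namespace Corner
variable {A B : Fin n} {v : ℂ} {θ : ℝ} (C : P.Corner A B v θ)

lemma eq_of_fold_eq {k : ℕ} {Φ Ψ : ℝ} (h1 : k * θ < Φ) (h2 : Φ < (k + 1) * θ) (h3 : k * θ < Ψ)
    (h4 : Ψ < (k + 1) * θ) (h : C.fold k Φ = C.fold k Ψ) : Φ = Ψ := by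
  obtain ⟨j, hj⟩ := C.fold_eq_iff.1 h
  have hθ := C.theta_lt
  have h5 : |(j : ℝ)| < 1 := by
    rw [abs_lt]
    constructor <;> by_contra hcon <;> push Not at hcon <;> nlinarith [Real.pi_pos]
  have h6 : |j| < 1 := by exact_mod_cast h5
  rw [Int.abs_lt_one_iff.1 h6] at hj
  simpa using hj

include C in
/-- At a corner with a rational angle there are aperiodic rays that are connected by passages of the
corner. -/
theorem exists_halves {p q : ℕ} (hp : 0 < p) (hθ : θ * q = Real.pi * p) {X : ℝ} {m : ℕ → ℕ}
    (hκ : ∀ i : ℕ, ((∑ k ∈ Finset.range i, m k : ℕ) : ℝ) < X + i * (q / p : ℝ) ∧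
      X + i * (q / p : ℝ) < (∑ k ∈ Finset.range i, m k : ℕ) + 1)
    (hper : ∑ k ∈ Finset.range (2 * p), m k = 2 * q) :
    ∃ h : ℕ → ℕ → Fin n, h (2 * p) = h 0 ∧
      (∀ i ≤ 2 * p, Aperiodic (h i) ∧ h i 0 ≠ A ∧ h i 0 ≠ B) ∧
      ∀ i < 2 * p, ∀ N : ℕ, ∃ o ∈ P.orbits, (∀ k < N, o.edge (-1 - k) = h i k) ∧
        (∀ j < m i, o.edge j = letter A B ((∑ k ∈ Finset.range i, m k) + j)) ∧
        ∀ k < N, o.edge (m i + k) = h (i + 1) k := by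
  have hθ0 := C.theta_pos
  have hp' : (0 : ℝ) < p := by exact_mod_cast hp
  set κ : ℕ → ℕ := fun i => ∑ k ∈ Finset.range i, m k with hκd
  change ∀ i : ℕ, (κ i : ℝ) < X + i * (q / p : ℝ) ∧ X + i * (q / p : ℝ) < κ i + 1 at hκ
  change κ (2 * p) = 2 * q at hper
  have κs : ∀ i, κ (i + 1) = κ i + m i := fun i => Finset.sum_range_succ _ _
  obtain ⟨R, hR0, hR, hR'⟩ := C.exists_radius
  have hr : 0 < R / 2 := by positivity
  -- The inequalities for the finitely many indices up to `2 * p` are strict, so the intercept can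
  -- be moved in an interval; this leaves uncountably many choices.
  have hev : ∀ᶠ X' : ℝ in 𝓝 X, ∀ i ≤ 2 * p, (κ i : ℝ) < X' + i * (q / p : ℝ) ∧
      X' + i * (q / p : ℝ) < κ i + 1 := by
    refine (eventually_all_finite (finite_le_nat _)).2 fun i _ => ?_
    have hc : Continuous fun X' : ℝ => X' + i * (q / p : ℝ) := by fun_prop
    exact (hc.tendsto X).eventually (Ioo_mem_nhds (hκ i).1 (hκ i).2)
  obtain ⟨l, u, hlu, hsub⟩ := mem_nhds_iff_exists_Ioo_subset.1 hev
  -- Rationality enters here: multiplied by θ, the slope `q / p` becomes π, so consecutive rays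
  -- differ by a half-turn.
  have hang : ∀ X' ∈ Ioo l u, ∀ i ≤ 2 * p, κ i * θ < θ * X' + i * Real.pi ∧
      θ * X' + i * Real.pi < (κ i + 1) * θ := by
    intro X' hX' i hi
    obtain ⟨a, b⟩ := hsub hX' i hi
    have e : θ * (i * (q / p : ℝ)) = i * Real.pi := by
      rw [mul_div_assoc', mul_div_assoc', div_eq_iff hp'.ne']; linear_combination i * hθ
    constructor <;> nlinarith
  have hdirinj : ∀ i ≤ 2 * p, ∀ X' X'' : Ioo l u, C.fold (κ i) (θ * X' + i * Real.pi) =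
      C.fold (κ i) (θ * X'' + i * Real.pi) → X' = X'' := by
    intro i hi X' X'' h
    have := C.eq_of_fold_eq (hang _ X'.2 i hi).1 (hang _ X'.2 i hi).2 (hang _ X''.2 i hi).1
      (hang _ X''.2 i hi).2 h
    exact Subtype.ext (mul_left_cancel₀ hθ0.ne' (add_right_cancel this))
  have hint : ∀ i ≤ 2 * p, ∀ X' ∈ Ioo l u,
      v + (R / 2 : ℝ) * C.fold (κ i) (θ * X' + i * Real.pi) ∈ P.interior := fun i hi X' hX' =>
    hR _ _ _ hr (by linarith) (hang X' hX' i hi).1 (hang X' hX' i hi).2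
  have cnt1 : ∀ i ≤ 2 * p, {X' : Ioo l u | ∃ K e, ∃ x d : ℕ → ℂ, P.IsRayTo K e x d ∧
      x 0 = v + (R / 2 : ℝ) * C.fold (κ i) (θ * X' + i * Real.pi) ∧
      d 0 = C.fold (κ i) (θ * X' + i * Real.pi) ∧
      ∃ j, ∃ t : ℝ, 0 < t ∧ P.vertex j = x K + t * d K}.Countable := by
    intro i hi
    refine countable_setOf_singular (fun X' : Ioo l u => v + (R / 2 : ℝ) *
      C.fold (κ i) (θ * X' + i * Real.pi)) (fun X' => C.fold (κ i) (θ * X' + i * Real.pi))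
      fun X' X'' ρ ρ' hρ hρ' h => ?_
    simp only [add_assoc, add_right_inj, ← add_mul, ← Complex.ofReal_add] at h
    have h3 := congrArg norm h
    rw [norm_mul, norm_mul, C.norm_fold, C.norm_fold, Complex.norm_real, Complex.norm_real,
      Real.norm_of_nonneg (by positivity), Real.norm_of_nonneg (by positivity), mul_one,
      mul_one] at h3
    rw [h3] at h
    have hne : ((R / 2 + ρ' : ℝ) : ℂ) ≠ 0 := by
      exact_mod_cast (add_pos hr hρ').ne'
    exact hdirinj i hi _ _ (mul_left_cancel₀ hne h)
  -- A forward ray is part of a limit orbit, so its code determines its direction and hence `X'`.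
  -- Each of the countably many eventually periodic codes is therefore taken at most once.
  have cnt2 : ∀ i ≤ 2 * p, {X' : Ioo l u | ∃ e, ∃ x d : ℕ → ℂ, P.IsRay e x d ∧
      x 0 = v + (R / 2 : ℝ) * C.fold (κ i) (θ * X' + i * Real.pi) ∧
      d 0 = C.fold (κ i) (θ * X' + i * Real.pi) ∧ ¬ Aperiodic e}.Countable := by
    intro i hi
    refine (countable_setOf_not_aperiodic.biUnion (t := fun e _ => {X' : Ioo l u |
      ∃ x d : ℕ → ℂ, P.IsRay e x d ∧
      x 0 = v + (R / 2 : ℝ) * C.fold (κ i) (θ * X' + i * Real.pi) ∧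
      d 0 = C.fold (κ i) (θ * X' + i * Real.pi)}) fun e _ => Subsingleton.countable ?_).mono ?_
    · rintro X' ⟨x, d, H, hx, hd⟩ X'' ⟨x', d', H', hx', hd'⟩
      obtain ⟨o, ho, o1, o2⟩ := H.exists_limOrbit (by rw [hx]; exact hint i hi _ X'.2)
        (by rw [hd, C.norm_fold])
      obtain ⟨o', ho', o1', o2'⟩ := H'.exists_limOrbit (by rw [hx']; exact hint i hi _ X''.2)
        (by rw [hd', C.norm_fold])
      have h1 := dir_eq_of_future ho ho' (k := 0) fun j hj => by
        obtain ⟨j, rfl⟩ := Int.eq_ofNat_of_zero_le hj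
        rw [o1, o1']
      rw [o2, o2', (H 1 0 one_pos).2, (H' 1 0 one_pos).2, hd, hd'] at h1
      have h2 := congrArg (mirror (P.edgeVec (e 0))) h1
      rw [mirror_mirror (P.edgeVec_ne_zero _), mirror_mirror (P.edgeVec_ne_zero _)] at h2
      exact hdirinj i hi _ _ h2
    · rintro X' ⟨e, x, d, H, hx, hd, he⟩
      exact mem_biUnion he ⟨x, d, H, hx, hd⟩
  have hbad := ((finite_le_nat (2 * p)).countable.biUnion cnt1).union
    ((finite_le_nat (2 * p)).countable.biUnion cnt2)
  obtain ⟨X', hX', hgood⟩ := ((hbad.image Subtype.val).dense_compl ℝ).inter_open_nonempty _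
    isOpen_Ioo ⟨X, hlu⟩
  have hray : ∀ i, ∃ e, ∃ x d : ℕ → ℂ, i ≤ 2 * p → (P.IsRay e x d ∧
      x 0 = v + (R / 2 : ℝ) * C.fold (κ i) (θ * X' + i * Real.pi) ∧
      d 0 = C.fold (κ i) (θ * X' + i * Real.pi)) ∧ Aperiodic e := by
    intro i
    by_cases hi : i ≤ 2 * p
    · have hmem := hint i hi X' hX'
      obtain ⟨e, x, d, H, hx, hd⟩ := exists_isRay (P := P)
        (d := C.fold (κ i) (θ * X' + i * Real.pi))
        (norm_ne_zero_iff.1 (by rw [C.norm_fold]; norm_num))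
        (z := v + (R / 2 : ℝ) * C.fold (κ i) (θ * X' + i * Real.pi)) (by
          have hc : Continuous fun t : ℝ => v + (R / 2 : ℝ) * C.fold (κ i) (θ * X' + i * Real.pi) +
            t * C.fold (κ i) (θ * X' + i * Real.pi) := by fun_prop
          exact (((hc.tendsto' 0 _ (by simp)).eventually
            (P.isOpen_interior.mem_nhds hmem))).filter_mono nhdsWithin_le_nhds) (by
          intro K e x d hK hx hd j t ht hj
          exact hgood ⟨⟨X', hX'⟩, Or.inl (mem_biUnion hi ⟨K, e, x, d, hK, hx, hd, j, t, ht, hj⟩), rfl⟩)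
      refine ⟨e, x, d, fun _ => ⟨⟨H, hx, hd⟩, ?_⟩⟩
      by_contra hcon
      exact hgood ⟨⟨X', hX'⟩, Or.inr (mem_biUnion hi ⟨e, x, d, H, hx, hd, hcon⟩), rfl⟩
    · exact ⟨fun _ => A, fun _ => 0, fun _ => 0, fun h => absurd h hi⟩
  choose h x d hh using hray
  refine ⟨h, ?_, fun i hi => ⟨(hh i hi).2, ?_⟩, fun i hi N => ?_⟩
  · obtain ⟨⟨H, hx, hd⟩, -⟩ := hh (2 * p) le_rfl
    obtain ⟨⟨H', hx', hd'⟩, -⟩ := hh 0 (Nat.zero_le _)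
    -- Because `2 * p * π = 2 * q * θ` and `2 * q` sectors are passed in between, an even number,
    -- the last ray is the first one.
    have e : C.fold (κ (2 * p)) (θ * X' + (2 * p : ℕ) * Real.pi) =
        C.fold (κ 0) (θ * X' + (0 : ℕ) * Real.pi) := by
      have h0 : κ 0 = 0 := by simp [hκd]
      rw [hper, h0, fold, fold, if_pos (even_two_mul q), if_pos (show Even 0 by simp)]
      congr 1; push_cast; linear_combination -2 * hθ
    rw [e] at hx hd
    funext k
    exact ((H (k + 1)).unique (H' (k + 1)) (by rw [hx, hx']) (by rw [hd, hd']) (k + 1)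
      le_rfl).2.2 k k.lt_succ_self
  · obtain ⟨⟨H, hx, hd⟩, -⟩ := hh i hi
    obtain ⟨a, b⟩ := hang X' hX' i hi
    obtain ⟨⟨hy, -, t, ht, hy'⟩, -⟩ := H 1 0 one_pos
    rw [zero_add] at hy hy'
    rw [hy', hx, hd, add_assoc, ← add_mul, ← Complex.ofReal_add] at hy
    refine C.notMem_edges (φ := if Even (κ i) then θ * X' + i * Real.pi - κ i * θ else
      (κ i + 1) * θ - (θ * X' + i * Real.pi)) ?_ ?_ (add_pos hr ht) hy <;> split_ifs <;> linarith
  · obtain ⟨⟨H, hx, hd⟩, -⟩ := hh i hi.le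
    obtain ⟨⟨H', hx', hd'⟩, -⟩ := hh (i + 1) hi
    obtain ⟨a, b⟩ := hang X' hX' i hi.le
    obtain ⟨a', b'⟩ := hang X' hX' (i + 1) hi
    have e : θ * X' + (i + 1 : ℕ) * Real.pi = θ * X' + i * Real.pi + Real.pi := by push_cast; ring
    rw [e] at hx' hd' a' b'
    rw [κs] at hx' hd' a' b'
    exact C.exists_orbit_of_halves hR hR' hr (by linarith) a b a' b' H H' hx hd hx' hd' N

end Corner
end PolygonalTable

/-! ### The sequences at a rational corner, and the theorem -/

namespace PolygonalTable
variable {n : ℕ} {P : PolygonalTable n}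

lemma consSeq_mem_closure {F : Fin n} {t : ℕ → Fin n}
    (h : ∀ N : ℕ, ∃ o ∈ P.orbits, o.edge 0 = F ∧ ∀ k < N, o.edge (1 + k) = t k) :
    consSeq F t ∈ closure P.forwardSpectrum := by
  refine mem_closure_of_forall_agree id fun N => ?_
  obtain ⟨o, ho, h0, h1⟩ := h N
  refine ⟨_, edge_mem_forwardSpectrum ho, fun k hk => ?_⟩
  obtain _ | k := k
  · exact h0
  · rw [Nat.cast_succ, add_comm]
    exact h1 k (k.lt_succ_self.trans hk)

lemma insert_mem_closure {E : GappedSeq (Fin n)} {w : List (Fin n)}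
    (h : ∀ N : ℕ, joinWord E.neg w E.pos N ∈ P.language) :
    E.insert w ∈ closure P.bounceSpectrum := by
  refine mem_closure_of_forall_agree Int.natAbs fun N => ?_
  obtain ⟨o, ho, h1, h2, h3⟩ := joinWord_mem_language_iff.1 (h N)
  refine ⟨_, edge_mem_bounceSpectrum ho, fun k hk => ?_⟩
  obtain k | k := k
  · change k < N at hk
    change o.edge k = if h : k < w.length then w[k] else E.pos (k - w.length)
    split_ifs with hw
    · exact h2 k hw
    · rw [← h3 _ (show k - w.length < N by omega)]; congr 1; omega
  · change k + 1 < N at hk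
    change o.edge (Int.negSucc k) = E.neg k
    rw [← h1 k (by omega)]; congr 1; omega

/-- The insertions exist at a corner with a rational angle. -/
theorem exists_gappedSeq {A B i : Fin n} (hAB : P.MeetAt A B i) {p q : ℕ} (hp : 0 < p)
    (hq : 0 < q) (hlt : p < 2 * q) {s : ℕ → Bool} (hs : IsSquareCode p q s)
    (hθ : P.interiorAngle i = Real.pi * (p / q : ℝ)) :
    ∃ E : Fin p → GappedSeq (Fin n),
      (∀ j : Fin p, P.IsGrazing A B (E j) ∧ Aperiodic (E j).neg ∧ Aperiodic (E j).pos ∧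
        (E j).insert (insertion A B s (2 * j)) ∈ closure P.bounceSpectrum) ∧
      ∀ N : ℕ, ∀ j : Fin p,
        joinWord (E j).neg (insertion A B s (2 * j)) (E j).pos N ∈ P.language ∧
        joinWord (E j).pos (insertion A B s (2 * j + 1)) (E (finRotate p j)).neg N
          ∈ P.language := by
  obtain ⟨X, hX0, hX1, hne, hrun⟩ := hs.exists_floor hp hq
  obtain ⟨C⟩ := hAB.exists_corner
  have hp' : (0 : ℝ) < p := by exact_mod_cast hp
  have hq' : (0 : ℝ) < q := by exact_mod_cast hq
  have hκ : ∀ i : ℕ, ((∑ k ∈ Finset.range i, runLength s k : ℕ) : ℝ) < X + i * (q / p : ℝ) ∧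
      X + i * (q / p : ℝ) < (∑ k ∈ Finset.range i, runLength s k : ℕ) + 1 := by
    intro i
    have e := sum_runLength hX0 hX1 hrun i
    have h1 := hne i (∑ k ∈ Finset.range i, runLength s k : ℕ)
    rw [eq_comm, Int.floor_eq_iff] at e
    exact ⟨lt_of_le_of_ne (by exact_mod_cast e.1) fun h => h1 (by exact_mod_cast h.symm),
      by exact_mod_cast e.2⟩
  have hadd := sum_runLength_add hp hX0 hX1 hrun
  obtain ⟨h, hper, hap, horb⟩ := C.exists_halves hp (by rw [hθ]; field_simp) hκ
    (by have := hadd 0; simpa using this)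
  have hlang : ∀ i < 2 * p, ∀ N, joinWord (h i) (insertion A B s i) (h (i + 1)) N ∈ P.language := by
    intro i hi N
    obtain ⟨o, ho, h1, h2, h3⟩ := horb i hi N
    refine joinWord_mem_language_iff.2 ⟨o, ho, h1, fun j hj => ?_, fun k hk => ?_⟩
    · rw [getElem_insertion, h2 j (by rwa [length_insertion] at hj)]
    · rw [length_insertion, h3 k hk]
  have hlet : ∀ k, letter A B k ∈ ({A, B} : Set (Fin n)) := by
    intro k; unfold letter; split_ifs <;> simp
  have graze1 : ∀ i < 2 * p, 0 < runLength s i →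
      ∃ F ∈ ({A, B} : Set (Fin n)), consSeq F (h i) ∈ closure P.forwardSpectrum := by
    intro i hi hm
    refine ⟨letter A B ((∑ k ∈ Finset.range i, runLength s k) + 0), hlet _, consSeq_mem_closure fun N => ?_⟩
    obtain ⟨o, ho, h1, h2, -⟩ := horb i hi N
    refine ⟨o.rev, rev_mem_orbits ho, h2 0 hm, fun k hk => ?_⟩
    rw [← h1 k hk, Orb.edge_rev]; congr 1; ring
  have graze2 : ∀ i < 2 * p, 0 < runLength s i →
      ∃ F ∈ ({A, B} : Set (Fin n)), consSeq F (h (i + 1)) ∈ closure P.forwardSpectrum := by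
    intro i hi hm
    refine ⟨letter A B ((∑ k ∈ Finset.range i, runLength s k) + (runLength s i - 1)), hlet _,
      consSeq_mem_closure fun N => ?_⟩
    obtain ⟨o, ho, -, h2, h3⟩ := horb i hi N
    refine ⟨o.shift ((runLength s i - 1 : ℕ) : ℤ), shift_mem_orbits ho _, ?_, fun k hk => ?_⟩
    · rw [Orb.edge_shift, zero_add, h2 _ (by omega)]
    · rw [← h3 k hk, Orb.edge_shift]; congr 1; omega
  have iso : ∀ i, runLength s i = 0 → 0 < runLength s (i + 1) := by
    intro i h0
    by_contra hcon
    have h1 : runLength s (i + 1) = 0 := by omega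
    have a := (hκ i).1
    have b := (hκ (i + 1 + 1)).2
    rw [Finset.sum_range_succ, Finset.sum_range_succ, h0, h1, add_zero, add_zero] at b
    have c : 1 < 2 * (q / p : ℝ) := by
      rw [mul_div_assoc', lt_div_iff₀ hp', one_mul]; exact_mod_cast hlt
    push_cast at a b
    linarith
  -- A half is adjacent to two insertions, and two consecutive ones are never both empty, since `p <
  -- 2 * q`. So a letter `A` or `B` can be put in front of it from the one side or the other; for `i
  -- = 0` the preceding insertion is the one with index `2 * p - 1`.
  have graze : ∀ i < 2 * p, ∃ F ∈ ({A, B} : Set (Fin n)),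
      consSeq F (h i) ∈ closure P.forwardSpectrum := by
    intro i hi
    by_cases h0 : 0 < runLength s i
    · exact graze1 i hi h0
    obtain _ | i := i
    · have h1 : runLength s (2 * p) = runLength s 0 := by
        have e0 := hadd 0
        have e1 := hadd 1
        rw [add_comm 1, Finset.sum_range_succ, Finset.sum_range_one] at e1
        simp only [zero_add, Finset.range_zero, Finset.sum_empty] at e0
        omega
      have e : 2 * p - 1 + 1 = 2 * p := by omega
      rw [← hper, ← e]
      refine graze2 _ (by omega) ?_
      by_contra hcon
      have := iso (2 * p - 1) (by omega)
      rw [e, h1] at this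
      exact h0 this
    · refine graze2 i (by omega) ?_
      by_contra hcon
      exact h0 (iso i (by omega))
  refine ⟨fun j => ⟨h (2 * j), h (2 * j + 1)⟩, fun j => ⟨⟨?_, graze _ (by omega), graze _ (by omega)⟩,
    (hap _ (by omega)).1, (hap _ (by omega)).1, insert_mem_closure fun N => hlang _ (by omega) N⟩,
    fun N j => ⟨hlang _ (by omega) N, ?_⟩⟩
  · obtain ⟨-, a1, a2⟩ := hap (2 * j) (by omega)
    obtain ⟨-, b1, b2⟩ := hap (2 * j + 1) (by omega)
    simp only [disjoint_insert_left, disjoint_singleton_left, mem_insert_iff, mem_singleton_iff,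
      not_or]
    exact ⟨⟨a1, a2⟩, b1, b2⟩
  · have e : h (2 * (finRotate p j : ℕ)) = h (2 * j + 1 + 1) := by
      obtain ⟨p, rfl⟩ : ∃ p', p = p' + 1 := ⟨p - 1, by omega⟩
      rw [coe_finRotate]
      split_ifs with hj
      · rw [hj, Fin.val_last, mul_zero, ← hper]; congr 1
      · congr 1
    change joinWord (h (2 * j + 1)) _ (h (2 * (finRotate p j : ℕ))) N ∈ _
    rw [e]
    exact hlang _ (by omega) N

end PolygonalTable

theorem mainTheorem5 {n : ℕ} (P : PolygonalTable n) (A B i : Fin n) (hAB : P.MeetAt A B i)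
    (p q : ℕ) (hp : 0 < p) (hq : 0 < q) (hpq : Nat.Coprime p q) (hlt : p < 2 * q)
    (hflat : P.interiorAngle i = Real.pi → p ≤ q)
    (s : ℕ → Bool) (hs : IsSquareCode p q s) :
    P.interiorAngle i = Real.pi * (p / q : ℝ) ↔
      ∃ E : Fin p → GappedSeq (Fin n),
        (∀ j : Fin p, P.IsGrazing A B (E j) ∧ Aperiodic (E j).neg ∧ Aperiodic (E j).pos ∧
          (E j).insert (insertion A B s (2 * j)) ∈ closure P.bounceSpectrum) ∧
        ∀ N : ℕ, ∀ j : Fin p,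
          joinWord (E j).neg (insertion A B s (2 * j)) (E j).pos N ∈ P.language ∧
          joinWord (E j).pos (insertion A B s (2 * j + 1)) (E (finRotate p j)).neg N
            ∈ P.language := by
  refine ⟨PolygonalTable.exists_gappedSeq hAB hp hq hlt hs, ?_⟩
  rintro ⟨E, hE, hlang⟩
  exact PolygonalTable.angle_eq_of_language hAB hp hq hlt hflat hs
    (fun j => ⟨(hE j).1, (hE j).2.1, (hE j).2.2.1⟩) hlang
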